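/- For $\alpha\ge 0$ let $H^{\alpha}(\mathbb R)$ be the $L^2$-based Sobolev space of real-valued functions with norm $\|f\|_{H^\alpha}=\|\langle D\rangle^{\alpha}f\|_{L^2}$, where $D=-i\partial_x$, $\langle\xi\rangle=\sqrt{1+\xi^2}$ and $\varphi(D)$ denotes the Fourier multiplier with symbol $\varphi(\xi)$. For surface tension $\varkappa>0$ consider the system for real-valued $\eta,v$ of $x\in\mathbb R$ and $t$ $$ \partial_t\eta=-\partial_x v-i\tanh D\,(\eta v),\qquad \partial_t v=-i\tanh D\,(1+\varkappa D^2)\eta-i\tanh D\,(v^2/2). \tag{1} $$ Say that $\eta_0$ satisfies the non-cavitation condition if there are $h,H>0$ with $h-1\le\eta_0\le H$ on $\mathbb R$. By a solution of (1) on $[0,T]$ with initial data $(\eta_0,v_0)$ we mean $$ (\eta,v)\in C([0,T];H^{s+1/2}(\mathbb R)\times H^{s}(\mathbb R))\cap C^1((0,T);H^{s-1}(\mathbb R)\times H^{s-3/2}(\mathbb R)) $$ with $(\eta,v)(0)=(\eta_0,v_0)$ that satisfies (1) for all $t\in(0,T)$. **Theorem.** Let $s>3/2$. There is a function $T=T_s(\varkappa,R)>0$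 of $\varkappa>0$ and $R\ge0$, non-increasing in both $\varkappa$ and $R$ (in particular, it does not shrink as $\varkappa\to0$), such that the following holds for every $\varkappa>0$ and all initial data $(\eta_0,v_0)\in H^{s+1/2}(\mathbb R)\times H^s(\mathbb R)$ for which $\eta_0$ satisfies the non-cavitation condition. Put $T=T_s(\varkappa,\|(\eta_0,v_0)\|_{H^{s+1/2}\times H^s})$. 1. There is a solution $(\eta,v)$ of (1) on $[0,T]$ with initial data $(\eta_0,v_0)$, and it is unique: any solution with the same data on an interval $[0,\tau]$, $0<\tau\le T$, coincides with $(\eta,v)$ on $[0,\tau]$. 2. The solution depends continuously on the initial data in the $C([0,T];H^{s+1/2}\times H^s)$-norm: for every $\varepsilon>0$ there is $\delta>0$ such that for all initial data $(\eta_0',v_0')\in H^{s+1/2}\times H^s$ with $\eta_0'$ non-cavitating and $\|(\eta_0',v_0')-(\eta_0,v_0)\|_{H^{s+1/2}\times H^s}<\delta$ there is a solution $(\eta',v')$ on the same interval $[0,T]$ with these data, unique in the sense of 1, and $\sup_{t\in[0,T]}\|(\eta',v')(t)-(\eta,v)(t)\|_{H^{s+1/2}\times H^s}\le\varepsilon$.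 -/

import Mathlib

noncomputable section

open MeasureTheory
open scoped SchwartzMap ENNReal

namespace WhithamBoussinesq

/-- `Lp ℂ p` as a real subspace of the tempered distributions. -/
def distC (p : ℝ≥0∞) [Fact (1 ≤ p)] : Lp ℂ p (volume : Measure ℝ) →ₗ[ℝ] 𝓢'(ℝ, ℂ) :=
  (Lp.toTemperedDistributionCLM ℂ (volume : Measure ℝ) p).toLinearMap.restrictScalars ℝ

/-- A real valued `L^p` function regarded as a (complex) tempered distribution. -/
def toDist (p : ℝ≥0∞) [Fact (1 ≤ p)] : Lp ℝ p (volume : Measure ℝ) →ₗ[ℝ] 𝓢'(ℝ, ℂ) :=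
  distC p ∘ₗ (Complex.ofRealCLM.compLpL p (volume : Measure ℝ)).toLinearMap

/-- The Fourier multiplier `φ(D)`, `D = -i∂ₓ`, on tempered distributions. Mathlib's Fourier
transform has the kernel `exp (-2πixξ)`, so that `D` has the symbol `2πξ`. -/
def multD (φ : ℝ → ℝ) : 𝓢'(ℝ, ℂ) →L[ℂ] 𝓢'(ℝ, ℂ) :=
  TemperedDistribution.fourierMultiplierCLM ℂ (fun ξ : ℝ ↦ ((φ (2 * Real.pi * ξ) : ℝ) : ℂ))

theorem hasTemperateGrowth_symbol {φ : ℝ → ℝ} (hφ : φ.HasTemperateGrowth) :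
    (fun ξ : ℝ ↦ ((φ (2 * Real.pi * ξ) : ℝ) : ℂ)).HasTemperateGrowth := by
  have h : (fun ξ : ℝ ↦ 2 * Real.pi * ξ).HasTemperateGrowth := by fun_prop
  exact (Function.RCLike.hasTemperateGrowth_ofReal (𝕜 := ℂ)).comp (hφ.comp h)

/-- The Bessel potential `J^σ = ⟨D⟩^σ`, `⟨ξ⟩ = √(1 + ξ²)`. -/
def bessel (σ : ℝ) : 𝓢'(ℝ, ℂ) →L[ℂ] 𝓢'(ℝ, ℂ) := multD (fun ξ ↦ (1 + ξ ^ 2) ^ (σ / 2))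

/-- The operator `tanh D`. -/
def tanhD : 𝓢'(ℝ, ℂ) →L[ℂ] 𝓢'(ℝ, ℂ) := multD Real.tanh

theorem hasTemperateGrowth_bessel (σ : ℝ) :
    (fun ξ : ℝ ↦ (1 + ξ ^ 2) ^ (σ / 2)).HasTemperateGrowth := by
  simpa using Function.hasTemperateGrowth_one_add_norm_sq_rpow ℝ (σ / 2)

theorem hasTemperateGrowth_tanh : Real.tanh.HasTemperateGrowth := by
  have hd : ∀ x, HasDerivAt Real.tanh (1 - Real.tanh x ^ 2) x := by
    intro x
    have h := (Real.hasDerivAt_sinh x).div (Real.hasDerivAt_cosh x) (Real.cosh_pos x).ne'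
    have e : Real.sinh / Real.cosh = Real.tanh := by
      ext y; simp [Real.tanh_eq_sinh_div_cosh]
    rw [e] at h
    convert! h using 1
    rw [Real.tanh_eq_sinh_div_cosh]
    field_simp [(Real.cosh_pos x).ne']
  have hc : ContDiff ℝ (⊤ : ℕ∞) Real.tanh := by
    have e : Real.tanh = fun y ↦ Real.sinh y / Real.cosh y := by
      ext y; exact Real.tanh_eq_sinh_div_cosh y
    rw [e]
    exact Real.contDiff_sinh.div Real.contDiff_cosh fun x ↦ (Real.cosh_pos x).ne'
  have hp : ∀ n : ℕ, ∃ P : Polynomial ℝ, iteratedDeriv n Real.tanh =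
      fun x ↦ P.eval (Real.tanh x) := by
    intro n
    induction n with
    | zero => exact ⟨Polynomial.X, by simp⟩
    | succ n ih =>
      obtain ⟨P, hP⟩ := ih
      refine ⟨Polynomial.derivative P * (1 - Polynomial.X ^ 2), ?_⟩
      rw [iteratedDeriv_succ, hP]
      ext x
      have h := ((P.hasDerivAt (Real.tanh x)).comp x (hd x)).deriv
      simp only [Function.comp_def] at h
      rw [h]
      simp
  refine ⟨hc, fun n ↦ ?_⟩
  obtain ⟨P, hP⟩ := hp n
  obtain ⟨C, hC⟩ := (isCompact_Icc (a := (-1 : ℝ)) (b := 1)).exists_bound_of_continuousOn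
    P.continuous.continuousOn
  refine ⟨0, C, fun x ↦ ?_⟩
  rw [norm_iteratedFDeriv_eq_norm_iteratedDeriv, hP]
  simpa using hC _ ⟨(Real.neg_one_lt_tanh x).le, (Real.tanh_lt_one x).le⟩

theorem bessel_injective (σ : ℝ) : Function.Injective (bessel σ) := by
  have key : ∀ f, bessel (-σ) (bessel σ f) = f := by
    intro f
    simp only [bessel, multD]
    rw [TemperedDistribution.fourierMultiplierCLM_fourierMultiplierCLM_apply
      (hasTemperateGrowth_symbol (hasTemperateGrowth_bessel _))
      (hasTemperateGrowth_symbol (hasTemperateGrowth_bessel _))]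
    have : ((fun ξ : ℝ ↦ (((1 + (2 * Real.pi * ξ) ^ 2) ^ (σ / 2) : ℝ) : ℂ)) *
        (fun ξ : ℝ ↦ (((1 + (2 * Real.pi * ξ) ^ 2) ^ (-σ / 2) : ℝ) : ℂ))) = fun _ ↦ 1 := by
      ext ξ
      rw [Pi.mul_apply]
      norm_cast
      rw [← Real.rpow_add (by positivity)]
      ring_nf
      simp
    rw [this]
    simp
  exact Function.LeftInverse.injective key

theorem distC_injective (p : ℝ≥0∞) [Fact (1 ≤ p)] : Function.Injective (distC p) :=
  fun _ _ h ↦ LinearMap.ker_eq_bot.mp (Lp.ker_toTemperedDistributionCLM_eq_bot (F := ℂ)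
    (μ := (volume : Measure ℝ)) (p := p)) h

theorem toDist_injective (p : ℝ≥0∞) [Fact (1 ≤ p)] : Function.Injective (toDist p) := by
  refine (distC_injective p).comp fun f g h ↦ ?_
  refine Lp.ext ?_
  have hf := Complex.ofRealCLM.coeFn_compLpL (p := p) (μ := (volume : Measure ℝ)) f
  have hg := Complex.ofRealCLM.coeFn_compLpL (p := p) (μ := (volume : Measure ℝ)) g
  simp only [ContinuousLinearMap.coe_coe] at h
  rw [h] at hf
  filter_upwards [hf, hg] with x h1 h2
  rw [h1] at h2
  simpa using h2

/-- The real valued `f ∈ L²` with `J^σ f ∈ L²`. -/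
def sobolevSubmodule (σ : ℝ) : Submodule ℝ (Lp ℝ 2 (volume : Measure ℝ)) :=
  (LinearMap.range (distC 2)).comap
    ((bessel σ).toLinearMap.restrictScalars ℝ ∘ₗ toDist 2)

/-- The Sobolev space `H^σ(ℝ)` of real valued functions, for orders `σ ≥ 0`, normed by
`‖f‖ = ‖J^σ f‖_{L²}`. -/
def Sobolev (σ : ℝ) : Type := sobolevSubmodule σ

namespace Sobolev

instance (σ : ℝ) : AddCommGroup (Sobolev σ) := inferInstanceAs (AddCommGroup (sobolevSubmodule σ))

instance (σ : ℝ) : Module ℝ (Sobolev σ) := inferInstanceAs (Module ℝ (sobolevSubmodule σ))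

/-- The underlying `L²` function. -/
def toL2 (σ : ℝ) : Sobolev σ →ₗ[ℝ] Lp ℝ 2 (volume : Measure ℝ) := (sobolevSubmodule σ).subtype

/-- `J^σ f` as an element of `L²`. -/
def besselL2 (σ : ℝ) : Sobolev σ →ₗ[ℝ] Lp ℂ 2 (volume : Measure ℝ) :=
  (LinearEquiv.ofInjective (distC 2) (distC_injective 2)).symm.toLinearMap ∘ₗ
    LinearMap.codRestrict (LinearMap.range (distC 2))
      ((bessel σ).toLinearMap.restrictScalars ℝ ∘ₗ toDist 2 ∘ₗ toL2 σ) (fun f ↦ f.2)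

theorem distC_besselL2 (σ : ℝ) (f : Sobolev σ) :
    distC 2 (besselL2 σ f) = bessel σ (toDist 2 (toL2 σ f)) := by
  have h := LinearEquiv.apply_symm_apply (LinearEquiv.ofInjective (distC 2) (distC_injective 2))
    (LinearMap.codRestrict (LinearMap.range (distC 2))
      ((bessel σ).toLinearMap.restrictScalars ℝ ∘ₗ toDist 2 ∘ₗ toL2 σ) (fun f ↦ f.2) f)
  exact congrArg Subtype.val h

theorem besselL2_injective (σ : ℝ) : Function.Injective (besselL2 σ) := by
  intro f g h
  have h' : bessel σ (toDist 2 (toL2 σ f)) = bessel σ (toDist 2 (toL2 σ g)) := by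
    rw [← distC_besselL2, ← distC_besselL2, h]
  exact Subtype.ext (toDist_injective 2 (bessel_injective σ h'))

instance (σ : ℝ) : NormedAddCommGroup (Sobolev σ) :=
  NormedAddCommGroup.induced (Sobolev σ) (Lp ℂ 2 (volume : Measure ℝ)) (besselL2 σ)
    (besselL2_injective σ)

instance (σ : ℝ) : NormedSpace ℝ (Sobolev σ) :=
  NormedSpace.induced ℝ (Sobolev σ) (Lp ℂ 2 (volume : Measure ℝ)) (besselL2 σ)

theorem norm_def (σ : ℝ) (f : Sobolev σ) : ‖f‖ = ‖besselL2 σ f‖ := rfl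

end Sobolev

/-- The product of two `L²` functions, an `L¹` function. -/
def mulL2 (f g : Lp ℝ 2 (volume : Measure ℝ)) : Lp ℝ 1 (volume : Measure ℝ) := f • g

/-- The right-hand side `-∂ₓv - i tanh D (ηv)` of the first equation. -/
def rhsElevation (η v : Lp ℝ 2 (volume : Measure ℝ)) : 𝓢'(ℝ, ℂ) :=
  -TemperedDistribution.derivCLM ℂ (toDist 2 v) - Complex.I • tanhD (toDist 1 (mulL2 η v))

/-- The right-hand side `-i tanh D (1 + ϰD²) η - i tanh D (v²/2)` of the second equation. -/
def rhsVelocity (ϰ : ℝ) (η v : Lp ℝ 2 (volume : Measure ℝ)) : 𝓢'(ℝ, ℂ) :=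
  -(Complex.I • tanhD (multD (fun ξ ↦ 1 + ϰ * ξ ^ 2) (toDist 2 η)))
    - Complex.I • tanhD (toDist 1 ((1 / 2 : ℝ) • mulL2 v v))

/-- The energy space `H^{s+1/2} × H^s`. -/
abbrev Data (s : ℝ) : Type := Sobolev (s + 1 / 2) × Sobolev s

/-- The norm `(‖η‖²_{H^{s+1/2}} + ‖v‖²_{H^s})^{1/2}`. -/
def dataNorm {s : ℝ} (u : Data s) : ℝ := √(‖u.1‖ ^ 2 + ‖u.2‖ ^ 2)

/-- `h - 1 ≤ η ≤ H` almost everywhere, for some `h, H > 0`. -/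
def NonCavitation {σ : ℝ} (η : Sobolev σ) : Prop :=
  ∃ h H : ℝ, 0 < h ∧ 0 < H ∧ ∀ᵐ x : ℝ, h - 1 ≤ Sobolev.toL2 σ η x ∧ Sobolev.toL2 σ η x ≤ H

/-- `u = (η, v)` is a solution on `[0, T]` with initial data `u₀`: it is of class
`C([0, T]; H^{s+1/2} × H^s)` and of class `C¹((0, T); H^{s-1} × H^{s-3/2})` (that is, it agrees on
`(0, T)` with a `C¹` curve `w` in this space), and the system holds at every time in `(0, T)`. The
values of `u` outside `[0, T]` are irrelevant. -/
structure IsSolution (ϰ s T : ℝ) (u₀ : Data s) (u : ℝ → Data s) : Prop where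
  continuousOn : ContinuousOn u (Set.Icc 0 T)
  initial : u 0 = u₀
  equations : ∃ w : ℝ → Sobolev (s - 1) × Sobolev (s - 3 / 2),
    ContDiffOn ℝ 1 w (Set.Ioo 0 T) ∧
    ∀ t ∈ Set.Ioo 0 T,
      Sobolev.toL2 _ (w t).1 = Sobolev.toL2 _ (u t).1 ∧
      Sobolev.toL2 _ (w t).2 = Sobolev.toL2 _ (u t).2 ∧
      toDist 2 (Sobolev.toL2 _ (deriv w t).1)
        = rhsElevation (Sobolev.toL2 _ (u t).1) (Sobolev.toL2 _ (u t).2) ∧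
      toDist 2 (Sobolev.toL2 _ (deriv w t).2)
        = rhsVelocity ϰ (Sobolev.toL2 _ (u t).1) (Sobolev.toL2 _ (u t).2)

/-- `u` is a solution on `[0, T]` with data `u₀`, and every solution with these data on `[0, T]`,
or on a shorter interval `[0, τ]`, coincides with `u` there. -/
def IsUniqueSolution (ϰ s T : ℝ) (u₀ : Data s) (u : ℝ → Data s) : Prop :=
  IsSolution ϰ s T u₀ u ∧
    ∀ τ : ℝ, 0 < τ → τ ≤ T → ∀ w : ℝ → Data s, IsSolution ϰ s τ u₀ w →
      Set.EqOn w u (Set.Icc 0 τ)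

end WhithamBoussinesq

end

open WhithamBoussinesq

/-! Write k for the frequency, M = √(tanh k / k), b = √(1 + ϰk²), ρ = s - 1 and r = s - 1/2. The
unknowns on the Fourier side are P = b⟨k⟩^r η̂ and Q = M⁻¹⟨k⟩^r v̂. Since M has order exactly -1/2,
the data space is the space of pairs (P, Q) in L² that are invariant under f ↦ conj f(-·).

Because kM² = tanh k, the linear part becomes P' = -iωQ, Q' = -iωP with the same real symbol ω =
kbM, so it is skew-adjoint. The velocity nonlinearity is harmless: its factor kM has order 1/2, and
that half derivative is shared by two factors that each carry an M. The elevation nonlinearity loses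
derivatives. Up to a commutator bounded on L² it is -iAMSMQ, where A is multiplication by ω and S
corresponds to multiplication by η (`norm_commutator_le`). This term is removed by a symmetrizer: in
the energy ‖f‖² + ‖g‖² + c(‖Mf‖² + ‖Mg‖²) + Re⟨SMg, Mg⟩ the derivative of the last term produces
exactly the opposite expression (`hasDerivAt_energy`). The c-terms, with c a bound for S, make the
energy coercive whatever the sign of η. They cost only M²AMSM, which is bounded because M² gains a
whole derivative (`norm_smoothed_le`).

Every operator here is a convolution with a kernel. Each bound reduces to a pointwise kernel
inequality, followed by Young's inequality and ⟨k⟩^{-ρ} ∈ L², which is where ρ > 1/2 is needed. The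
kernel inequalities use only an upper bound ϰ ≤ c² (`bsym_add_le`), so the time of existence does
not degenerate as ϰ → 0.

The energy estimate is proved with the weight ψ_N = min(1, ⟨k⟩/N) and constants independent of N
(`weighted_estimate`). For N = 1 the weight is trivial and the estimate is an a priori bound. For
large N it controls the high frequencies of the solution by those of the data. A second estimate
compares two solutions in the weak norm with weight ⟨k⟩^{-r} (`comparison`); there the loss of
derivatives in differences is harmless because the remaining factor is measured in the strong norm.
Low frequencies are controlled by the weak norm and high ones by ψ_N, so the two estimates together
give closeness in the strong norm (`exists_close`).

The approximate problems truncate only the outer symbols to ⟨k⟩ ≤ n, and are then ordinary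
differential equations in L² (`exists_galerkin`). Truncations of this form are nested: a solution at
level m ≥ n, and equally a true solution, satisfies the level n equations after projection, with its
own untruncated arguments. Hence one comparison result, with an error of size n^{-1/2} from
truncating the arguments, shows that the approximations are Cauchy in C([0, T]; L²), that solutions
are unique, and that they depend continuously on the data.

Finally T is the reciprocal of the growth rate on a ball whose radius B is so large that e · (1 +
2c) · (squared size of the data) < B². It is explicit and monotone in ϰ and in the size R of the
data, and B is computed for data of size R + 1, so that nearby data have solutions on the same
interval. Plancherel's theorem and the convolution formula for products translate all this back to
the system for η and v. -/

noncomputable section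
open MeasureTheory
open scoped SchwartzMap ENNReal

namespace WhithamBoussinesq

/-! ### Young's inequality and Cauchy–Schwarz for nonnegative functions -/

section Young

/-- Young's inequality `‖F ⋆ G‖₂ ≤ ‖F‖₁ ‖G‖₂` for nonnegative functions. -/
theorem eLpNorm_lconv_le {F G : ℝ → ℝ≥0∞} (hF : Measurable F) (hG : Measurable G) :
    eLpNorm (fun ξ ↦ ∫⁻ ζ, F (ξ - ζ) * G ζ) 2 volume ≤ (∫⁻ ζ, F ζ) * eLpNorm G 2 volume := by
  -- Cauchy–Schwarz for the factorization F·G = F^{1/2} · (F·G²)^{1/2}; integrating in ξ afterwards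
  -- leaves only translation invariance.
  have key : ∀ ξ, (∫⁻ ζ, F (ξ - ζ) * G ζ) ^ (2 : ℝ) ≤
      (∫⁻ ζ, F ζ) * ∫⁻ ζ, F (ξ - ζ) * G ζ ^ (2 : ℝ) := by
    intro ξ
    have hF' : Measurable fun ζ ↦ F (ξ - ζ) := hF.comp (measurable_const.sub measurable_id)
    have h := ENNReal.lintegral_mul_norm_pow_le (μ := (volume : Measure ℝ)) (f := fun ζ ↦ F (ξ - ζ))
      (g := fun ζ ↦ F (ξ - ζ) * G ζ ^ (2 : ℝ)) hF'.aemeasurable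
      (hF'.mul (hG.pow_const _)).aemeasurable (p := 1 / 2) (q := 1 / 2) (by norm_num)
      (by norm_num) (by norm_num)
    have e : ∀ ζ, F (ξ - ζ) ^ (1 / 2 : ℝ) * (F (ξ - ζ) * G ζ ^ (2 : ℝ)) ^ (1 / 2 : ℝ) =
        F (ξ - ζ) * G ζ := by
      intro ζ
      rw [ENNReal.mul_rpow_of_nonneg _ _ (by norm_num), ← ENNReal.rpow_mul, ← mul_assoc,
        ← ENNReal.rpow_add_of_nonneg _ _ (by norm_num) (by norm_num)]
      norm_num
    simp only [e] at h
    have h2 := ENNReal.rpow_le_rpow h (z := 2) (by norm_num)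
    rw [ENNReal.mul_rpow_of_nonneg _ _ (by norm_num), ← ENNReal.rpow_mul, ← ENNReal.rpow_mul] at h2
    norm_num at h2
    rw [lintegral_sub_left_eq_self (fun ζ ↦ F ζ) ξ] at h2
    simpa using h2
  rw [eLpNorm_eq_lintegral_rpow_enorm_toReal (by norm_num) (by norm_num),
    eLpNorm_eq_lintegral_rpow_enorm_toReal (by norm_num) (by norm_num)]
  simp only [enorm_eq_self, ENNReal.toReal_ofNat]
  have hm : Measurable fun p : ℝ × ℝ ↦ F (p.1 - p.2) * G p.2 ^ (2 : ℝ) :=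
    (hF.comp (measurable_fst.sub measurable_snd)).mul ((hG.comp measurable_snd).pow_const _)
  have h1 : ∫⁻ ξ, (∫⁻ ζ, F (ξ - ζ) * G ζ) ^ (2 : ℝ) ≤
      (∫⁻ ζ, F ζ) ^ (2 : ℝ) * ∫⁻ ζ, G ζ ^ (2 : ℝ) := by
    calc _ ≤ ∫⁻ ξ, (∫⁻ ζ, F ζ) * ∫⁻ ζ, F (ξ - ζ) * G ζ ^ (2 : ℝ) := lintegral_mono key
      _ = (∫⁻ ζ, F ζ) * ∫⁻ ξ, ∫⁻ ζ, F (ξ - ζ) * G ζ ^ (2 : ℝ) :=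
          lintegral_const_mul _ hm.lintegral_prod_right'
      _ = (∫⁻ ζ, F ζ) * ∫⁻ ζ, ∫⁻ ξ, F (ξ - ζ) * G ζ ^ (2 : ℝ) := by
          rw [lintegral_lintegral_swap hm.aemeasurable]
      _ = (∫⁻ ζ, F ζ) * ∫⁻ ζ, (∫⁻ ξ, F ξ) * G ζ ^ (2 : ℝ) := by
          congr 1
          refine lintegral_congr fun ζ ↦ ?_
          rw [lintegral_mul_const _ (show Measurable fun ξ ↦ F (ξ - ζ) from
            hF.comp (measurable_id.sub_const ζ))]
          congr 1
          exact lintegral_sub_right_eq_self (fun x ↦ F x) ζ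
      _ = _ := by
          rw [lintegral_const_mul _ (hG.pow_const _), ← mul_assoc, ENNReal.rpow_two, sq]
  calc _ ≤ ((∫⁻ ζ, F ζ) ^ (2 : ℝ) * ∫⁻ ζ, G ζ ^ (2 : ℝ)) ^ (1 / 2 : ℝ) :=
        ENNReal.rpow_le_rpow h1 (by norm_num)
    _ = _ := by
        rw [ENNReal.mul_rpow_of_nonneg _ _ (by norm_num), ← ENNReal.rpow_mul]
        norm_num

theorem eLpNorm_lconv_le' {F G : ℝ → ℝ≥0∞} (hF : Measurable F) (hG : Measurable G) :
    eLpNorm (fun ξ ↦ ∫⁻ ζ, F (ξ - ζ) * G ζ) 2 volume ≤ eLpNorm F 2 volume * ∫⁻ ζ, G ζ := by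
  rw [mul_comm]
  refine le_trans (le_of_eq ?_) (eLpNorm_lconv_le hG hF)
  congr 1
  ext ξ
  rw [← lintegral_sub_left_eq_self (fun ζ ↦ F (ξ - ζ) * G ζ) ξ]
  refine lintegral_congr fun ζ ↦ ?_
  rw [sub_sub_cancel, mul_comm]

theorem lintegral_mul_le_eLpNorm_two {F G : ℝ → ℝ≥0∞} (hF : Measurable F) (hG : Measurable G) :
    ∫⁻ ζ, F ζ * G ζ ≤ eLpNorm F 2 volume * eLpNorm G 2 volume := by
  have h := ENNReal.lintegral_mul_le_Lp_mul_Lq (volume : Measure ℝ)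
    (Real.HolderConjugate.two_two) hF.aemeasurable hG.aemeasurable
  rw [eLpNorm_eq_lintegral_rpow_enorm_toReal (by norm_num) (by norm_num),
    eLpNorm_eq_lintegral_rpow_enorm_toReal (by norm_num) (by norm_num)]
  simpa using h

end Young

/-! ### Multiplication by bounded real symbols on L² -/

/-- The complex Hilbert space `L²(ℝ)`, on the Fourier side. -/
abbrev L2C : Type := Lp ℂ 2 (volume : Measure ℝ)

/-- Bounded measurable symbols. -/
def BddSymbol (φ : ℝ → ℝ) : Prop := Measurable φ ∧ ∃ C, ∀ x, |φ x| ≤ C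

theorem BddSymbol.memLp_mul {φ : ℝ → ℝ} (hφ : BddSymbol φ) (f : L2C) :
    MemLp (fun x ↦ (φ x : ℂ) * f x) 2 volume := by
  obtain ⟨hm, C, hC⟩ := hφ
  refine MemLp.of_le_mul (c := C) (Lp.memLp f) ?_ ?_
  · exact (Complex.measurable_ofReal.comp hm).aestronglyMeasurable.mul (Lp.aestronglyMeasurable f)
  · refine Filter.Eventually.of_forall fun x ↦ ?_
    rw [norm_mul]
    gcongr
    simpa using hC x

theorem norm_le_of_ae_le {f g : L2C} {C : ℝ} (h : ∀ᵐ x, ‖f x‖ ≤ C * ‖g x‖) :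
    ‖f‖ ≤ C * ‖g‖ := Lp.norm_le_mul_norm_of_ae_le_mul h

open Classical in
/-- Multiplication by a bounded symbol on `L²`. -/
def mulOp (φ : ℝ → ℝ) : L2C →L[ℂ] L2C :=
  -- The alternative value 0 is junk: it lets `mulOp φ` be written without a proof of boundedness,
  -- which the lemmas on it supply.
  if h : BddSymbol φ then
    LinearMap.mkContinuousOfExistsBound
      { toFun := fun f ↦ (h.memLp_mul f).toLp _
        map_add' := fun f g ↦ by
          rw [← MemLp.toLp_add]
          refine MemLp.toLp_congr _ _ ?_
          filter_upwards [Lp.coeFn_add f g] with x hx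
          simp only [Pi.add_apply] at hx ⊢
          rw [hx, mul_add]
        map_smul' := fun c f ↦ by
          rw [RingHom.id_apply, ← MemLp.toLp_const_smul]
          refine MemLp.toLp_congr _ _ ?_
          filter_upwards [Lp.coeFn_smul c f] with x hx
          simp only [Pi.smul_apply, smul_eq_mul] at hx ⊢
          rw [hx]
          ring }
      (by
        obtain ⟨C, hC⟩ := h.2
        refine ⟨C, fun f ↦ norm_le_of_ae_le ?_⟩
        filter_upwards [(h.memLp_mul f).coeFn_toLp] with x hx
        simp only [LinearMap.coe_mk, AddHom.coe_mk, hx, norm_mul]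
        gcongr
        simpa using hC x)
  else 0

theorem coeFn_mulOp {φ : ℝ → ℝ} (h : BddSymbol φ) (f : L2C) :
    mulOp φ f =ᵐ[volume] fun x ↦ (φ x : ℂ) * f x := by
  rw [mulOp, dif_pos h]
  exact (h.memLp_mul f).coeFn_toLp

theorem norm_mulOp_le {φ : ℝ → ℝ} (h : BddSymbol φ) {C : ℝ} (hC : ∀ x, |φ x| ≤ C) (f : L2C) :
    ‖mulOp φ f‖ ≤ C * ‖f‖ := by
  refine norm_le_of_ae_le ?_
  filter_upwards [coeFn_mulOp h f] with x hx
  rw [hx, norm_mul]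
  gcongr
  simpa using hC x

theorem norm_mulOp_le_norm_mulOp {φ ψ : ℝ → ℝ} (h : BddSymbol φ) (h' : BddSymbol ψ) {C : ℝ}
    (hle : ∀ x, |φ x| ≤ C * |ψ x|) (f : L2C) : ‖mulOp φ f‖ ≤ C * ‖mulOp ψ f‖ := by
  refine norm_le_of_ae_le ?_
  filter_upwards [coeFn_mulOp h f, coeFn_mulOp h' f] with x hx hx'
  rw [hx, hx', norm_mul, norm_mul, ← mul_assoc]
  gcongr
  simpa using hle x

theorem BddSymbol.mul {φ ψ : ℝ → ℝ} (h : BddSymbol φ) (h' : BddSymbol ψ) :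
    BddSymbol (fun x ↦ φ x * ψ x) := by
  obtain ⟨hm, C, hC⟩ := h
  obtain ⟨hm', C', hC'⟩ := h'
  refine ⟨hm.mul hm', C * C', fun x ↦ ?_⟩
  rw [abs_mul]
  exact mul_le_mul (hC x) (hC' x) (abs_nonneg _) ((abs_nonneg _).trans (hC 0))

theorem mulOp_mulOp {φ ψ : ℝ → ℝ} (h : BddSymbol φ) (h' : BddSymbol ψ) (f : L2C) :
    mulOp φ (mulOp ψ f) = mulOp (fun x ↦ φ x * ψ x) f := by
  refine Lp.ext ?_
  filter_upwards [coeFn_mulOp h (mulOp ψ f), coeFn_mulOp h' f, coeFn_mulOp (h.mul h') f]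
    with x h1 h2 h3
  rw [h1, h2, h3]
  push_cast
  ring

theorem mulOp_comm {φ ψ : ℝ → ℝ} (h : BddSymbol φ) (h' : BddSymbol ψ) (f : L2C) :
    mulOp φ (mulOp ψ f) = mulOp ψ (mulOp φ f) := by
  rw [mulOp_mulOp h h', mulOp_mulOp h' h]
  simp only [mul_comm]

theorem mulOp_one (f : L2C) : mulOp (fun _ ↦ 1) f = f := by
  refine Lp.ext ?_
  filter_upwards [coeFn_mulOp (φ := fun _ ↦ 1) ⟨measurable_const, 1, by simp⟩ f] with x h1
  rw [h1]
  simp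

/-- Self-adjointness because symbols are real valued. -/
theorem inner_mulOp_left {φ : ℝ → ℝ} (h : BddSymbol φ) (f g : L2C) :
    inner ℂ (mulOp φ f) g = inner ℂ f (mulOp φ g) := by
  rw [L2.inner_def, L2.inner_def]
  refine integral_congr_ae ?_
  filter_upwards [coeFn_mulOp h f, coeFn_mulOp h g] with x h1 h2
  rw [h1, h2]
  simp
  ring

/-! ### Bilinear convolution operators with a kernel -/

section Bilinear

/-- The integrand of the convolution of `f` and `g` with kernel `K`, in absolute value. -/
def absConv (K : ℝ → ℝ → ℝ) (f g : ℝ → ℂ) (ξ : ℝ) : ℝ≥0∞ :=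
  ∫⁻ ζ, ‖K (ξ - ζ) ζ‖ₑ * ‖f (ξ - ζ)‖ₑ * ‖g ζ‖ₑ

/-- `∫ K(ξ - ζ, ζ) f(ξ - ζ) g(ζ) dζ`. -/
def bilFun (K : ℝ → ℝ → ℝ) (f g : ℝ → ℂ) (ξ : ℝ) : ℂ :=
  ∫ ζ, (K (ξ - ζ) ζ : ℂ) * f (ξ - ζ) * g ζ

/-- Kernels of bounded bilinear maps `L² × L² → L²`. -/
def Admissible (K : ℝ → ℝ → ℝ) : Prop :=
  Measurable (Function.uncurry K) ∧ ∃ C : ℝ, 0 ≤ C ∧ ∀ f g : L2C,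
    eLpNorm (absConv K f g) 2 volume ≤ ENNReal.ofReal (C * ‖f‖ * ‖g‖)

theorem measurable_coeFn (f : L2C) : Measurable f := (Lp.stronglyMeasurable f).measurable

theorem measurable_integrand {K : ℝ → ℝ → ℝ} (hK : Measurable (Function.uncurry K)) (f g : L2C) :
    Measurable (fun p : ℝ × ℝ ↦ (K (p.1 - p.2) p.2 : ℂ) * f (p.1 - p.2) * g p.2) := by
  have h1 : Measurable fun p : ℝ × ℝ ↦ (p.1 - p.2, p.2) :=
    (measurable_fst.sub measurable_snd).prodMk measurable_snd
  exact ((Complex.measurable_ofReal.comp (hK.comp h1)).mul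
    ((measurable_coeFn f).comp (measurable_fst.sub measurable_snd))).mul
    ((measurable_coeFn g).comp measurable_snd)

theorem enorm_integrand (K : ℝ → ℝ → ℝ) (f g : ℝ → ℂ) (ξ ζ : ℝ) :
    ‖(K (ξ - ζ) ζ : ℂ) * f (ξ - ζ) * g ζ‖ₑ = ‖K (ξ - ζ) ζ‖ₑ * ‖f (ξ - ζ)‖ₑ * ‖g ζ‖ₑ := by
  rw [enorm_mul, enorm_mul]
  congr 2
  simp [enorm_eq_nnnorm]

theorem measurable_absConv {K : ℝ → ℝ → ℝ} (hK : Measurable (Function.uncurry K)) (f g : L2C) :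
    Measurable (absConv K f g) := by
  have := (measurable_integrand hK f g).enorm.lintegral_prod_right' (ν := volume)
  simp only [enorm_integrand] at this
  exact this

/-- A function in L² is finite almost everywhere. This gives absolute convergence of the defining
integral for almost every ξ, hence additivity of the operator in each argument. -/
theorem Admissible.ae_lt_top {K : ℝ → ℝ → ℝ} (hK : Admissible K) (f g : L2C) :
    ∀ᵐ ξ, absConv K f g ξ < ∞ := by
  obtain ⟨hm, C, hC, h⟩ := hK
  have h2 : MemLp (absConv K f g) 2 volume :=
    ⟨(measurable_absConv hm f g).aestronglyMeasurable, (h f g).trans_lt ENNReal.ofReal_lt_top⟩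
  have h3 := h2.2
  rw [eLpNorm_eq_lintegral_rpow_enorm_toReal (by norm_num) (by norm_num)] at h3
  have h4 : ∫⁻ ξ, absConv K f g ξ ^ (2 : ℝ) < ∞ := by
    simpa only [enorm_eq_self, ENNReal.toReal_ofNat, ENNReal.rpow_lt_top_iff_of_pos
      (show (0 : ℝ) < 1 / 2 by norm_num)] using h3
  filter_upwards [MeasureTheory.ae_lt_top ((measurable_absConv hm f g).pow_const _) h4.ne] with ξ hξ
  rwa [ENNReal.rpow_lt_top_iff_of_pos (by norm_num)] at hξ

theorem Admissible.ae_integrable {K : ℝ → ℝ → ℝ} (hK : Admissible K) (f g : L2C) :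
    ∀ᵐ ξ, Integrable (fun ζ ↦ (K (ξ - ζ) ζ : ℂ) * f (ξ - ζ) * g ζ) volume := by
  filter_upwards [hK.ae_lt_top f g] with ξ hξ
  refine ⟨((measurable_integrand hK.1 f g).comp measurable_prodMk_left).aestronglyMeasurable, ?_⟩
  rw [HasFiniteIntegral]
  simp only [enorm_integrand]
  exact hξ

theorem enorm_bilFun_le (K : ℝ → ℝ → ℝ) (f g : ℝ → ℂ) (ξ : ℝ) :
    ‖bilFun K f g ξ‖ₑ ≤ absConv K f g ξ := by
  refine (enorm_integral_le_lintegral_enorm _).trans (le_of_eq ?_)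
  simp only [enorm_integrand, absConv]

theorem aestronglyMeasurable_bilFun {K : ℝ → ℝ → ℝ} (hK : Measurable (Function.uncurry K))
    (f g : L2C) : AEStronglyMeasurable (bilFun K f g) volume :=
  (measurable_integrand hK f g).stronglyMeasurable.integral_prod_right'.aestronglyMeasurable

theorem Admissible.memLp {K : ℝ → ℝ → ℝ} (hK : Admissible K) (f g : L2C) :
    MemLp (bilFun K f g) 2 volume := by
  refine ⟨aestronglyMeasurable_bilFun hK.1 f g, ?_⟩
  obtain ⟨C, hC, h⟩ := hK.2
  exact (eLpNorm_mono_enorm fun ξ ↦ by simpa using enorm_bilFun_le K f g ξ).trans_lt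
    ((h f g).trans_lt ENNReal.ofReal_lt_top)

theorem norm_toLp_bilFun_le {K : ℝ → ℝ → ℝ} {f g : L2C} {C : ℝ} (hC : 0 ≤ C)
    (hm : MemLp (bilFun K f g) 2 volume)
    (h : eLpNorm (absConv K f g) 2 volume ≤ ENNReal.ofReal C) :
    ‖hm.toLp _‖ ≤ C := by
  rw [Lp.norm_toLp]
  refine ENNReal.toReal_le_of_le_ofReal hC (le_trans ?_ h)
  exact eLpNorm_mono_enorm fun ξ ↦ by simpa using enorm_bilFun_le K f g ξ

/-- The equality holds at every ξ, not just almost every one: changing the factors on null sets does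
not alter any of the integrals. -/
theorem bilFun_congr_ae {K : ℝ → ℝ → ℝ} {f f' g g' : ℝ → ℂ} (hf : f =ᵐ[volume] f')
    (hg : g =ᵐ[volume] g') : bilFun K f g = bilFun K f' g' := by
  ext ξ
  refine integral_congr_ae ?_
  have h1 : ∀ᵐ ζ : ℝ, f (ξ - ζ) = f' (ξ - ζ) :=
    (quasiMeasurePreserving_sub_left_of_right_invariant volume ξ).ae hf
  filter_upwards [h1, hg] with ζ h1 h2
  rw [h1, h2]

open Classical in
/-- The bilinear map `(f, g) ↦ ∫ K(ξ - ζ, ζ) f(ξ - ζ) g(ζ) dζ` on `L²`. -/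
def bil (K : ℝ → ℝ → ℝ) : L2C →L[ℂ] L2C →L[ℂ] L2C :=
  if h : Admissible K then
    LinearMap.mkContinuous₂
      (LinearMap.mk₂ ℂ (fun f g ↦ (h.memLp f g).toLp _)
        (fun f f' g ↦ by
          rw [← MemLp.toLp_add]
          refine MemLp.toLp_congr _ _ ?_
          rw [bilFun_congr_ae (Lp.coeFn_add f f') (Filter.EventuallyEq.refl _ _)]
          filter_upwards [h.ae_integrable f g, h.ae_integrable f' g] with ξ h1 h2
          rw [Pi.add_apply, bilFun, bilFun, bilFun, ← integral_add h1 h2]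
          congr 1; ext ζ; simp; ring)
        (fun c f g ↦ by
          rw [← MemLp.toLp_const_smul]
          refine MemLp.toLp_congr _ _ ?_
          rw [bilFun_congr_ae (Lp.coeFn_smul c f) (Filter.EventuallyEq.refl _ _)]
          refine Filter.Eventually.of_forall fun ξ ↦ ?_
          rw [Pi.smul_apply, bilFun, bilFun, smul_eq_mul, ← integral_const_mul]
          congr 1; ext ζ; simp; ring)
        (fun f g g' ↦ by
          rw [← MemLp.toLp_add]
          refine MemLp.toLp_congr _ _ ?_
          rw [bilFun_congr_ae (Filter.EventuallyEq.refl _ _) (Lp.coeFn_add g g')]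
          filter_upwards [h.ae_integrable f g, h.ae_integrable f g'] with ξ h1 h2
          rw [Pi.add_apply, bilFun, bilFun, bilFun, ← integral_add h1 h2]
          congr 1; ext ζ; simp; ring)
        (fun c f g ↦ by
          rw [← MemLp.toLp_const_smul]
          refine MemLp.toLp_congr _ _ ?_
          rw [bilFun_congr_ae (Filter.EventuallyEq.refl _ _) (Lp.coeFn_smul c g)]
          refine Filter.Eventually.of_forall fun ξ ↦ ?_
          rw [Pi.smul_apply, bilFun, bilFun, smul_eq_mul, ← integral_const_mul]
          congr 1; ext ζ; simp; ring))
      h.2.choose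
      (fun f g ↦ norm_toLp_bilFun_le (by have := h.2.choose_spec.1; positivity) (h.memLp f g)
        (h.2.choose_spec.2 f g))
  else 0

theorem coeFn_bil {K : ℝ → ℝ → ℝ} (h : Admissible K) (f g : L2C) :
    bil K f g =ᵐ[volume] bilFun K f g := by
  rw [bil, dif_pos h]
  exact (h.memLp f g).coeFn_toLp

theorem norm_bil_le_of_eLpNorm {K : ℝ → ℝ → ℝ} (hK : Admissible K) {f g : L2C} {C : ℝ} (hC : 0 ≤ C)
    (h : eLpNorm (absConv K f g) 2 volume ≤ ENNReal.ofReal C) : ‖bil K f g‖ ≤ C := by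
  rw [bil, dif_pos hK]
  exact norm_toLp_bilFun_le hC (hK.memLp f g) h

/-- The `L²` norm of a weight. -/
def weightNorm (w : ℝ → ℝ) : ℝ := (eLpNorm w 2 volume).toReal

/-- By Cauchy–Schwarz, multiplication by w maps L² to L¹. The kernel bound thus splits the integral
into (ψf) ⋆ (wg) and (wf) ⋆ (ψ'g), each an L² function convolved with an L¹ function, to which
Young's inequality applies. The weights ψ, ψ' stay visible so that tails of f and g can be tracked.
-/
theorem eLpNorm_absConv_le {w ψ ψ' : ℝ → ℝ} (hw : MemLp w 2 volume) (hwm : Measurable w)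
    (hψ : BddSymbol ψ) (hψ' : BddSymbol ψ') (K : ℝ → ℝ → ℝ) {C : ℝ} (hC : 0 ≤ C)
    (hK : ∀ τ ζ, |K τ ζ| ≤ C * (|ψ τ| * |w ζ| + |w τ| * |ψ' ζ|)) (f g : L2C) :
    eLpNorm (absConv K f g) 2 volume ≤
      ENNReal.ofReal (C * weightNorm w * (‖mulOp ψ f‖ * ‖g‖ + ‖f‖ * ‖mulOp ψ' g‖)) := by
  set a : ℝ → ℝ≥0∞ := fun x ↦ ‖ψ x‖ₑ * ‖f x‖ₑ
  set a' : ℝ → ℝ≥0∞ := fun x ↦ ‖w x‖ₑ * ‖g x‖ₑ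
  set d : ℝ → ℝ≥0∞ := fun x ↦ ‖w x‖ₑ * ‖f x‖ₑ
  set d' : ℝ → ℝ≥0∞ := fun x ↦ ‖ψ' x‖ₑ * ‖g x‖ₑ
  have ma : Measurable a := hψ.1.enorm.mul (measurable_coeFn f).enorm
  have ma' : Measurable a' := hwm.enorm.mul (measurable_coeFn g).enorm
  have md : Measurable d := hwm.enorm.mul (measurable_coeFn f).enorm
  have md' : Measurable d' := hψ'.1.enorm.mul (measurable_coeFn g).enorm
  have hpt : ∀ ξ, absConv K f g ξ ≤ ENNReal.ofReal C *
      ((∫⁻ ζ, a (ξ - ζ) * a' ζ) + ∫⁻ ζ, d (ξ - ζ) * d' ζ) := by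
    intro ξ
    have hs : Measurable fun ζ : ℝ ↦ ξ - ζ := measurable_const.sub measurable_id
    have m1 : Measurable fun ζ ↦ a (ξ - ζ) * a' ζ := (ma.comp hs).mul ma'
    have m2 : Measurable fun ζ ↦ d (ξ - ζ) * d' ζ := (md.comp hs).mul md'
    rw [← lintegral_add_left m1, ← lintegral_const_mul _ (by exact m1.add m2)]
    refine lintegral_mono fun ζ ↦ ?_
    have h1 : ‖K (ξ - ζ) ζ‖ₑ ≤ ENNReal.ofReal C * (‖ψ (ξ - ζ)‖ₑ * ‖w ζ‖ₑ +
        ‖w (ξ - ζ)‖ₑ * ‖ψ' ζ‖ₑ) := by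
      simp only [← ofReal_norm, Real.norm_eq_abs]
      rw [← ENNReal.ofReal_mul (abs_nonneg _), ← ENNReal.ofReal_mul (abs_nonneg _),
        ← ENNReal.ofReal_add (by positivity) (by positivity), ← ENNReal.ofReal_mul hC]
      exact ENNReal.ofReal_le_ofReal (hK _ _)
    calc _ ≤ ENNReal.ofReal C * (‖ψ (ξ - ζ)‖ₑ * ‖w ζ‖ₑ +
        ‖w (ξ - ζ)‖ₑ * ‖ψ' ζ‖ₑ) * ‖f (ξ - ζ)‖ₑ * ‖g ζ‖ₑ := by gcongr
      _ = _ := by simp only [a, a', d, d']; ring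
  have nf : ∀ h : L2C, eLpNorm (fun x ↦ ‖h x‖ₑ) 2 volume = ENNReal.ofReal ‖h‖ := by
    intro h
    rw [eLpNorm_enorm, Lp.norm_def, ENNReal.ofReal_toReal (Lp.eLpNorm_ne_top h)]
  have nm : ∀ {φ : ℝ → ℝ} (hφ : BddSymbol φ) (h : L2C),
      eLpNorm (fun x ↦ ‖φ x‖ₑ * ‖h x‖ₑ) 2 volume = ENNReal.ofReal ‖mulOp φ h‖ := by
    intro φ hφ h
    rw [← nf]
    refine eLpNorm_congr_ae ?_
    filter_upwards [coeFn_mulOp hφ h] with x hx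
    rw [hx, enorm_mul]
    simp [enorm_eq_nnnorm]
  have nw : ∀ h : L2C, ∫⁻ x, ‖w x‖ₑ * ‖h x‖ₑ ≤ ENNReal.ofReal (weightNorm w * ‖h‖) := by
    intro h
    refine (lintegral_mul_le_eLpNorm_two hwm.enorm (measurable_coeFn h).enorm).trans ?_
    rw [nf, eLpNorm_enorm, weightNorm, ENNReal.ofReal_mul ENNReal.toReal_nonneg,
      ENNReal.ofReal_toReal hw.2.ne]
  have hm1 : ∀ {u v : ℝ → ℝ≥0∞}, Measurable u → Measurable v →
      Measurable (fun ξ ↦ ∫⁻ ζ, u (ξ - ζ) * v ζ) := by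
    intro u v hu hv
    exact ((hu.comp (measurable_fst.sub measurable_snd)).mul
      (hv.comp measurable_snd)).lintegral_prod_right'
  have hwn : 0 ≤ weightNorm w := ENNReal.toReal_nonneg
  calc eLpNorm (absConv K f g) 2 volume
      ≤ ENNReal.ofReal C * eLpNorm ((fun ξ ↦ ∫⁻ ζ, a (ξ - ζ) * a' ζ) +
        fun ξ ↦ ∫⁻ ζ, d (ξ - ζ) * d' ζ) 2 volume := by
        rw [ENNReal.ofReal, ← smul_eq_mul, ← ENNReal.smul_def]
        refine eLpNorm_le_nnreal_smul_eLpNorm_of_ae_le_mul' (Filter.Eventually.of_forall fun ξ ↦ ?_) 2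
        simp only [enorm_eq_self, Pi.add_apply]
        exact hpt ξ
    _ ≤ ENNReal.ofReal C * (ENNReal.ofReal ‖mulOp ψ f‖ * ENNReal.ofReal (weightNorm w * ‖g‖) +
        ENNReal.ofReal (weightNorm w * ‖f‖) * ENNReal.ofReal ‖mulOp ψ' g‖) := by
        gcongr
        refine (eLpNorm_add_le (hm1 ma ma').aestronglyMeasurable
          (hm1 md md').aestronglyMeasurable (by norm_num)).trans (add_le_add ?_ ?_)
        · refine (eLpNorm_lconv_le' ma ma').trans ?_
          rw [nm hψ]
          gcongr
          exact nw g
        · refine (eLpNorm_lconv_le md md').trans ?_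
          rw [nm hψ']
          gcongr
          exact nw f
    _ = _ := by
        rw [← ENNReal.ofReal_mul (by positivity), ← ENNReal.ofReal_mul (by positivity),
          ← ENNReal.ofReal_add (by positivity) (by positivity), ← ENNReal.ofReal_mul hC]
        congr 1
        ring

theorem admissible_of_eLpNorm {K : ℝ → ℝ → ℝ} (hm : Measurable (Function.uncurry K)) {C : ℝ}
    (hC : 0 ≤ C) (h : ∀ f g : L2C,
      eLpNorm (absConv K f g) 2 volume ≤ ENNReal.ofReal (C * ‖f‖ * ‖g‖)) : Admissible K :=
  ⟨hm, C, hC, h⟩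

theorem bddSymbol_one : BddSymbol (fun _ ↦ 1) := ⟨measurable_const, 1, by simp⟩

theorem admissible_of_le_symbol {w ψ ψ' : ℝ → ℝ} (hw : MemLp w 2 volume) (hwm : Measurable w)
    (hψ : BddSymbol ψ) (hψ' : BddSymbol ψ') {K : ℝ → ℝ → ℝ}
    (hm : Measurable (Function.uncurry K)) {C : ℝ} (hC : 0 ≤ C)
    (hK : ∀ τ ζ, |K τ ζ| ≤ C * (|ψ τ| * |w ζ| + |w τ| * |ψ' ζ|)) : Admissible K := by
  obtain ⟨c, hc⟩ := hψ.2
  obtain ⟨c', hc'⟩ := hψ'.2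
  have c0 : 0 ≤ c := (abs_nonneg _).trans (hc 0)
  have c0' : 0 ≤ c' := (abs_nonneg _).trans (hc' 0)
  have hw0 : 0 ≤ weightNorm w := ENNReal.toReal_nonneg
  refine admissible_of_eLpNorm hm (C := C * weightNorm w * (c + c')) (by positivity) fun f g ↦ ?_
  refine (eLpNorm_absConv_le hw hwm hψ hψ' K hC hK f g).trans (ENNReal.ofReal_le_ofReal ?_)
  have h1 := norm_mulOp_le hψ hc f
  have h2 := norm_mulOp_le hψ' hc' g
  calc _ ≤ C * weightNorm w * (c * ‖f‖ * ‖g‖ + ‖f‖ * (c' * ‖g‖)) := by gcongr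
    _ = _ := by ring

theorem norm_bil_le_symbol {w ψ ψ' : ℝ → ℝ} (hw : MemLp w 2 volume) (hwm : Measurable w)
    (hψ : BddSymbol ψ) (hψ' : BddSymbol ψ') {K : ℝ → ℝ → ℝ}
    (hm : Measurable (Function.uncurry K)) {C : ℝ} (hC : 0 ≤ C)
    (hK : ∀ τ ζ, |K τ ζ| ≤ C * (|ψ τ| * |w ζ| + |w τ| * |ψ' ζ|)) (f g : L2C) :
    ‖bil K f g‖ ≤ C * weightNorm w * (‖mulOp ψ f‖ * ‖g‖ + ‖f‖ * ‖mulOp ψ' g‖) := by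
  have hw0 : 0 ≤ weightNorm w := ENNReal.toReal_nonneg
  exact norm_bil_le_of_eLpNorm (admissible_of_le_symbol hw hwm hψ hψ' hm hC hK) (by positivity)
    (eLpNorm_absConv_le hw hwm hψ hψ' K hC hK f g)

theorem admissible_of_le {w : ℝ → ℝ} (hw : MemLp w 2 volume) (hwm : Measurable w) {K : ℝ → ℝ → ℝ}
    (hm : Measurable (Function.uncurry K)) {C : ℝ} (hC : 0 ≤ C)
    (hK : ∀ τ ζ, |K τ ζ| ≤ C * (|w τ| + |w ζ|)) : Admissible K :=
  admissible_of_le_symbol hw hwm bddSymbol_one bddSymbol_one hm hC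
    (fun τ ζ ↦ by simpa [add_comm] using hK τ ζ)

theorem norm_bil_le {w : ℝ → ℝ} (hw : MemLp w 2 volume) (hwm : Measurable w) {K : ℝ → ℝ → ℝ}
    (hm : Measurable (Function.uncurry K)) {C : ℝ} (hC : 0 ≤ C)
    (hK : ∀ τ ζ, |K τ ζ| ≤ C * (|w τ| + |w ζ|)) (f g : L2C) :
    ‖bil K f g‖ ≤ 2 * C * weightNorm w * ‖f‖ * ‖g‖ := by
  have h := norm_bil_le_symbol hw hwm bddSymbol_one bddSymbol_one hm hC
    (fun τ ζ ↦ by simpa [add_comm] using hK τ ζ) f g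
  rw [mulOp_one, mulOp_one] at h
  linarith

theorem Admissible.of_le {K K' : ℝ → ℝ → ℝ} (hK : Admissible K)
    (hm : Measurable (Function.uncurry K')) {C : ℝ} (hC : 0 ≤ C)
    (h : ∀ τ ζ, |K' τ ζ| ≤ C * |K τ ζ|) : Admissible K' := by
  obtain ⟨hm', D, hD, hK⟩ := hK
  refine admissible_of_eLpNorm hm (C := C * D) (by positivity) fun f g ↦ ?_
  have h1 : eLpNorm (absConv K' f g) 2 volume ≤
      ENNReal.ofReal C * eLpNorm (absConv K f g) 2 volume := by
    rw [ENNReal.ofReal, ← smul_eq_mul, ← ENNReal.smul_def]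
    refine eLpNorm_le_nnreal_smul_eLpNorm_of_ae_le_mul' (Filter.Eventually.of_forall fun ξ ↦ ?_) 2
    simp only [enorm_eq_self]
    have m1 : Measurable fun ζ ↦ ‖K (ξ - ζ) ζ‖ₑ * ‖f (ξ - ζ)‖ₑ * ‖g ζ‖ₑ := by
      have := ((measurable_integrand hm' f g).comp (measurable_prodMk_left (x := ξ))).enorm
      simp only [Function.comp_def, enorm_integrand] at this
      exact this
    rw [absConv, absConv, ← lintegral_const_mul _ m1]
    refine lintegral_mono fun ζ ↦ ?_
    have h2 : ‖K' (ξ - ζ) ζ‖ₑ ≤ ENNReal.ofReal C * ‖K (ξ - ζ) ζ‖ₑ := by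
      rw [← ofReal_norm, ← ofReal_norm, ← ENNReal.ofReal_mul hC]
      exact ENNReal.ofReal_le_ofReal (h _ _)
    calc _ ≤ ENNReal.ofReal C * ‖K (ξ - ζ) ζ‖ₑ * ‖f (ξ - ζ)‖ₑ * ‖g ζ‖ₑ := by gcongr
      _ = _ := by rw [ENNReal.ofReal]; ring
  refine h1.trans ?_
  calc _ ≤ ENNReal.ofReal C * ENNReal.ofReal (D * ‖f‖ * ‖g‖) := by gcongr; exact hK f g
    _ = _ := by rw [← ENNReal.ofReal_mul hC]; congr 1; ring

theorem Admissible.mul_out {K : ℝ → ℝ → ℝ} (hK : Admissible K) {φ : ℝ → ℝ} (hφ : BddSymbol φ) :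
    Admissible (fun τ ζ ↦ φ (τ + ζ) * K τ ζ) := by
  obtain ⟨C, hC⟩ := hφ.2
  refine hK.of_le ((hφ.1.comp (measurable_fst.add measurable_snd)).mul hK.1)
    ((abs_nonneg _).trans (hC 0)) fun τ ζ ↦ ?_
  rw [abs_mul]
  gcongr
  exact hC _

theorem Admissible.mul_left {K : ℝ → ℝ → ℝ} (hK : Admissible K) {φ : ℝ → ℝ} (hφ : BddSymbol φ) :
    Admissible (fun τ ζ ↦ φ τ * K τ ζ) := by
  obtain ⟨C, hC⟩ := hφ.2
  refine hK.of_le ((hφ.1.comp measurable_fst).mul hK.1)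
    ((abs_nonneg _).trans (hC 0)) fun τ ζ ↦ ?_
  rw [abs_mul]
  gcongr
  exact hC _

theorem Admissible.mul_right {K : ℝ → ℝ → ℝ} (hK : Admissible K) {φ : ℝ → ℝ} (hφ : BddSymbol φ) :
    Admissible (fun τ ζ ↦ φ ζ * K τ ζ) := by
  obtain ⟨C, hC⟩ := hφ.2
  refine hK.of_le ((hφ.1.comp measurable_snd).mul hK.1)
    ((abs_nonneg _).trans (hC 0)) fun τ ζ ↦ ?_
  rw [abs_mul]
  gcongr
  exact hC _

/-- The output frequency is (ξ - ζ) + ζ, so a multiplier outside the bilinear map is a factor of the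
kernel evaluated at the sum; multipliers on the arguments are absorbed in the same way below. All
operator identities become identities of kernels. -/
theorem mulOp_bil {K : ℝ → ℝ → ℝ} (hK : Admissible K) {φ : ℝ → ℝ} (hφ : BddSymbol φ) (f g : L2C) :
    mulOp φ (bil K f g) = bil (fun τ ζ ↦ φ (τ + ζ) * K τ ζ) f g := by
  refine Lp.ext ?_
  filter_upwards [coeFn_mulOp hφ (bil K f g), coeFn_bil hK f g, coeFn_bil (hK.mul_out hφ) f g]
    with x h1 h2 h3
  rw [h1, h2, h3, bilFun, bilFun, ← integral_const_mul]
  congr 1; ext ζ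
  rw [sub_add_cancel]
  push_cast
  ring

theorem bil_mulOp_left {K : ℝ → ℝ → ℝ} (hK : Admissible K) {φ : ℝ → ℝ} (hφ : BddSymbol φ)
    (f g : L2C) : bil K (mulOp φ f) g = bil (fun τ ζ ↦ φ τ * K τ ζ) f g := by
  refine Lp.ext ?_
  filter_upwards [coeFn_bil hK (mulOp φ f) g, coeFn_bil (hK.mul_left hφ) f g] with x h2 h3
  rw [h2, h3, bilFun_congr_ae (coeFn_mulOp hφ f) (Filter.EventuallyEq.refl _ _), bilFun, bilFun]
  congr 1; ext ζ
  push_cast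
  ring

theorem bil_mulOp_right {K : ℝ → ℝ → ℝ} (hK : Admissible K) {φ : ℝ → ℝ} (hφ : BddSymbol φ)
    (f g : L2C) : bil K f (mulOp φ g) = bil (fun τ ζ ↦ φ ζ * K τ ζ) f g := by
  refine Lp.ext ?_
  filter_upwards [coeFn_bil hK f (mulOp φ g), coeFn_bil (hK.mul_right hφ) f g] with x h2 h3
  rw [h2, h3, bilFun_congr_ae (Filter.EventuallyEq.refl _ _) (coeFn_mulOp hφ g), bilFun, bilFun]
  congr 1; ext ζ
  push_cast
  ring

/-- The difference is given its own kernel L because in a commutator L satisfies much better bounds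
than K and K' separately. -/
theorem bil_sub_bil {K K' L : ℝ → ℝ → ℝ} (hK : Admissible K) (hK' : Admissible K')
    (hL : Admissible L) (h : ∀ τ ζ, L τ ζ = K τ ζ - K' τ ζ) (f g : L2C) :
    bil K f g - bil K' f g = bil L f g := by
  refine Lp.ext ?_
  filter_upwards [coeFn_bil hK f g, coeFn_bil hK' f g, coeFn_bil hL f g,
    Lp.coeFn_sub (bil K f g) (bil K' f g), hK.ae_integrable f g, hK'.ae_integrable f g]
    with x h1 h2 h3 h4 h5 h6
  rw [h4, Pi.sub_apply, h1, h2, h3, bilFun, bilFun, bilFun, ← integral_sub h5 h6]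
  congr 1; ext ζ
  rw [h]
  push_cast
  ring

end Bilinear

/-! ### The reflection whose fixed points are transforms of real functions -/

section Reflection

/-- The conjugate-linear involution `f ↦ conj (f (-x))`, whose fixed points are the Fourier
transforms of real valued functions. -/
def reflect : L2C →L[ℝ] L2C :=
  (Complex.conjCLE.toContinuousLinearMap.compLpL 2 (volume : Measure ℝ)) ∘L
    (Lp.compMeasurePreservingₗᵢ ℝ (fun x : ℝ ↦ -x)
      (Measure.measurePreserving_neg (volume : Measure ℝ))).toContinuousLinearMap

theorem coeFn_reflect (f : L2C) : reflect f =ᵐ[volume] fun x ↦ (starRingEnd ℂ) (f (-x)) := by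
  have h1 := Complex.conjCLE.toContinuousLinearMap.coeFn_compLpL (p := 2)
    (μ := (volume : Measure ℝ)) (Lp.compMeasurePreservingₗᵢ ℝ (fun x : ℝ ↦ -x)
      (Measure.measurePreserving_neg (volume : Measure ℝ)) f)
  have h2 := Lp.coeFn_compMeasurePreserving f (Measure.measurePreserving_neg (volume : Measure ℝ))
  filter_upwards [h1, h2] with x h1 h2
  refine h1.trans ?_
  change (starRingEnd ℂ) ((Lp.compMeasurePreserving (fun x : ℝ ↦ -x) _ f : L2C) x) = _
  rw [h2]
  rfl

theorem reflect_I_smul (f : L2C) : reflect (Complex.I • f) = -(Complex.I • reflect f) := by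
  refine Lp.ext ?_
  have h2 : ∀ᵐ x : ℝ, (Complex.I • f : L2C) (-x) = (Complex.I • (f : ℝ → ℂ)) (-x) :=
    (Measure.measurePreserving_neg (volume : Measure ℝ)).quasiMeasurePreserving.ae
      (Lp.coeFn_smul Complex.I f)
  filter_upwards [coeFn_reflect (Complex.I • f), h2, Lp.coeFn_neg (Complex.I • reflect f),
    Lp.coeFn_smul Complex.I (reflect f), coeFn_reflect f] with x h1 h2 h3 h4 h5
  rw [h1, h2, h3, Pi.neg_apply, h4, Pi.smul_apply, Pi.smul_apply, h5]
  simp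

theorem reflect_mulOp {φ : ℝ → ℝ} (hφ : BddSymbol φ) (he : ∀ x, φ (-x) = φ x) (f : L2C) :
    reflect (mulOp φ f) = mulOp φ (reflect f) := by
  refine Lp.ext ?_
  have h2 := (Measure.measurePreserving_neg (volume : Measure ℝ)).quasiMeasurePreserving.ae
      (coeFn_mulOp hφ f)
  filter_upwards [coeFn_reflect (mulOp φ f), h2, coeFn_mulOp hφ (reflect f), coeFn_reflect f]
    with x h1 h2 h3 h4
  rw [h1, h2, h3, h4, he]
  simp

/-- The sign is compensated by the factor i in front of every odd symbol of the system, since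
`reflect` is conjugate linear; this is how the equations preserve reality. -/
theorem reflect_mulOp_odd {φ : ℝ → ℝ} (hφ : BddSymbol φ) (he : ∀ x, φ (-x) = -φ x) (f : L2C) :
    reflect (mulOp φ f) = -mulOp φ (reflect f) := by
  refine Lp.ext ?_
  have h2 := (Measure.measurePreserving_neg (volume : Measure ℝ)).quasiMeasurePreserving.ae
      (coeFn_mulOp hφ f)
  filter_upwards [coeFn_reflect (mulOp φ f), h2, coeFn_mulOp hφ (reflect f), coeFn_reflect f,
    Lp.coeFn_neg (mulOp φ (reflect f))]
    with x h1 h2 h3 h4 h5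
  rw [h1, h2, h5, Pi.neg_apply, h3, h4, he]
  simp

theorem reflect_bil_odd {K : ℝ → ℝ → ℝ} (hK : Admissible K) (he : ∀ τ ζ, K (-τ) (-ζ) = -K τ ζ)
    (f g : L2C) : reflect (bil K f g) = -bil K (reflect f) (reflect g) := by
  refine Lp.ext ?_
  have h2 := (Measure.measurePreserving_neg (volume : Measure ℝ)).quasiMeasurePreserving.ae
      (coeFn_bil hK f g)
  filter_upwards [coeFn_reflect (bil K f g), h2, coeFn_bil hK (reflect f) (reflect g),
    Lp.coeFn_neg (bil K (reflect f) (reflect g))] with x h1 h2 h3 h4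
  rw [h1, h2, h4, Pi.neg_apply, h3, bilFun_congr_ae (coeFn_reflect f) (coeFn_reflect g), bilFun,
    bilFun, ← integral_conj, ← integral_neg_eq_self, ← integral_neg]
  congr 1; ext ζ
  have e1 : -x - -ζ = -(x - ζ) := by ring
  rw [e1, he]
  simp

/-- Multiplication by a real function is symmetric: for f fixed by the reflection and σ even, the
integral kernel σ(ξ - ζ) f(ξ - ζ) is Hermitian. The rest is Fubini, justified by the absolute L²
bound on the convolution. -/
theorem inner_bil_symm {σ : ℝ → ℝ} (hK : Admissible (fun τ _ ↦ σ τ)) (he : ∀ x, σ (-x) = σ x)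
    {f : L2C} (hf : reflect f = f) (g h : L2C) :
    inner ℂ h (bil (fun τ _ ↦ σ τ) f g) = inner ℂ (bil (fun τ _ ↦ σ τ) f h) g := by
  have hf' : ∀ᵐ x : ℝ, f (-x) = (starRingEnd ℂ) (f x) := by
    have := coeFn_reflect f
    rw [hf] at this
    filter_upwards [this] with x hx
    rw [hx]; simp
  rw [L2.inner_def, L2.inner_def]
  have e1 : ∀ᵐ ξ, inner ℂ (h ξ) (bil (fun τ _ ↦ σ τ) f g ξ) =
      ∫ ζ, (starRingEnd ℂ) (h ξ) * ((σ (ξ - ζ) : ℂ) * f (ξ - ζ) * g ζ) := by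
    filter_upwards [coeFn_bil hK f g] with ξ h1
    rw [h1, bilFun, integral_const_mul]
    simp [mul_comm]
  have e2 : ∀ᵐ ζ, inner ℂ (bil (fun τ _ ↦ σ τ) f h ζ) (g ζ) =
      ∫ ξ, (starRingEnd ℂ) (h ξ) * ((σ (ξ - ζ) : ℂ) * f (ξ - ζ) * g ζ) := by
    filter_upwards [coeFn_bil hK f h] with ζ h1
    rw [h1, bilFun]
    simp only [RCLike.inner_apply]
    rw [← integral_conj, ← integral_const_mul]
    refine integral_congr_ae ?_
    have h3 : ∀ᵐ ξ : ℝ, f (-(ζ - ξ)) = (starRingEnd ℂ) (f (ζ - ξ)) :=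
      (quasiMeasurePreserving_sub_left_of_right_invariant volume ζ).ae hf'
    filter_upwards [h3] with ξ h3
    rw [neg_sub] at h3
    rw [h3, ← he (ξ - ζ), neg_sub]
    simp
    ring
  rw [integral_congr_ae e1, integral_congr_ae e2]
  rw [integral_integral_swap]
  have hm : Measurable (Function.uncurry fun ξ ζ : ℝ ↦
      (starRingEnd ℂ) (h ξ) * ((σ (ξ - ζ) : ℂ) * f (ξ - ζ) * g ζ)) :=
    (Complex.continuous_conj.measurable.comp ((measurable_coeFn h).comp measurable_fst)).mul
      (measurable_integrand hK.1 f g)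
  refine ⟨hm.aestronglyMeasurable, ?_⟩
  rw [HasFiniteIntegral, lintegral_prod _ hm.enorm.aemeasurable]
  have e3 : ∀ ξ, ∫⁻ ζ, ‖Function.uncurry (fun ξ ζ : ℝ ↦
      (starRingEnd ℂ) (h ξ) * ((σ (ξ - ζ) : ℂ) * f (ξ - ζ) * g ζ)) (ξ, ζ)‖ₑ =
      ‖h ξ‖ₑ * absConv (fun τ _ ↦ σ τ) f g ξ := by
    intro ξ
    have m1 : Measurable fun ζ ↦ ‖σ (ξ - ζ)‖ₑ * ‖f (ξ - ζ)‖ₑ * ‖g ζ‖ₑ := by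
      have := ((measurable_integrand hK.1 f g).comp (measurable_prodMk_left (x := ξ))).enorm
      simp only [Function.comp_def, enorm_integrand (fun τ _ ↦ σ τ)] at this
      exact this
    rw [absConv, ← lintegral_const_mul _ m1]
    refine lintegral_congr fun ζ ↦ ?_
    rw [Function.uncurry_apply_pair, enorm_mul, enorm_integrand (fun τ _ ↦ σ τ), RCLike.enorm_conj]
  simp only [e3]
  obtain ⟨C, hC, hb⟩ := hK.2
  refine (lintegral_mul_le_eLpNorm_two (measurable_coeFn h).enorm
    (measurable_absConv hK.1 f g)).trans_lt (ENNReal.mul_lt_top ?_ ?_)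
  · rw [eLpNorm_enorm]; exact Lp.eLpNorm_lt_top h
  · exact (hb f g).trans_lt ENNReal.ofReal_lt_top

end Reflection

end WhithamBoussinesq
end

noncomputable section
open MeasureTheory
open scoped SchwartzMap ENNReal

namespace WhithamBoussinesq

/-! ### The symbols ⟨k⟩, M, b and tanh k -/

section Symbols

/-- `⟨D⟩` on the Fourier side, `√(1 + (2πξ)²)`. -/
def jap (ξ : ℝ) : ℝ := √(1 + (2 * Real.pi * ξ) ^ 2)

/-- The symbol `√(tanh k / k)`, `k = 2πξ`. -/
def msym (ξ : ℝ) : ℝ :=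
  if ξ = 0 then 1 else √(Real.tanh (2 * Real.pi * ξ) / (2 * Real.pi * ξ))

/-- The symbol `√(1 + ϰk²)`. -/
def bsym (ϰ ξ : ℝ) : ℝ := √(1 + ϰ * (2 * Real.pi * ξ) ^ 2)

/-- The symbol `tanh k`. -/
def thsym (ξ : ℝ) : ℝ := Real.tanh (2 * Real.pi * ξ)

/-- The square integrable weight `⟨k⟩^{-ρ}`, `ρ > 1/2`. -/
def lam (ρ ξ : ℝ) : ℝ := jap ξ ^ (-ρ)

theorem one_le_jap (ξ : ℝ) : 1 ≤ jap ξ := by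
  rw [jap, Real.one_le_sqrt]
  nlinarith [sq_nonneg (2 * Real.pi * ξ)]

theorem jap_pos (ξ : ℝ) : 0 < jap ξ := one_pos.trans_le (one_le_jap ξ)

theorem jap_neg (ξ : ℝ) : jap (-ξ) = jap ξ := by simp [jap]

theorem jap_sq (ξ : ℝ) : jap ξ ^ 2 = 1 + (2 * Real.pi * ξ) ^ 2 := Real.sq_sqrt (by positivity)

theorem abs_freq_le_jap (ξ : ℝ) : |2 * Real.pi * ξ| ≤ jap ξ :=
  abs_le_of_sq_le_sq (by rw [jap_sq]; linarith) (jap_pos ξ).le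

theorem continuous_jap : Continuous jap := by unfold jap; fun_prop

/-- The triangle inequality in the plane for (1, √c x) + (0, √c y). -/
theorem sqrt_one_add_sq_add_le {c x y : ℝ} (hc : 0 ≤ c) :
    √(1 + c * (x + y) ^ 2) ≤ √(1 + c * x ^ 2) + √c * |y| := by
  have h1 : 0 ≤ √(1 + c * x ^ 2) + √c * |y| := by positivity
  rw [Real.sqrt_le_left h1]
  have h2 : √c * |x| ≤ √(1 + c * x ^ 2) := by
    rw [Real.le_sqrt (by positivity) (by positivity), mul_pow, Real.sq_sqrt hc, sq_abs]
    linarith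
  have h3 : (√c * |y|) ^ 2 = c * y ^ 2 := by rw [mul_pow, Real.sq_sqrt hc, sq_abs]
  have h4 : √(1 + c * x ^ 2) ^ 2 = 1 + c * x ^ 2 := Real.sq_sqrt (by positivity)
  have h5 : c * (x * y) ≤ (√c * |x|) * (√c * |y|) := by
    have : (√c * |x|) * (√c * |y|) = c * |x * y| := by
      rw [abs_mul]; linear_combination (|x| * |y|) * Real.mul_self_sqrt hc
    rw [this]
    gcongr
    exact le_abs_self _
  have h6 : (√c * |x|) * (√c * |y|) ≤ √(1 + c * x ^ 2) * (√c * |y|) := by gcongr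
  nlinarith

theorem jap_add_le_freq (τ ζ : ℝ) : jap (τ + ζ) ≤ jap τ + |2 * Real.pi * ζ| := by
  have h := sqrt_one_add_sq_add_le (c := 1) (x := 2 * Real.pi * τ) (y := 2 * Real.pi * ζ) (by norm_num)
  simp only [one_mul, Real.sqrt_one, ← mul_add] at h
  exact h

theorem jap_add_le (τ ζ : ℝ) : jap (τ + ζ) ≤ jap τ + jap ζ :=
  (jap_add_le_freq τ ζ).trans (by gcongr; exact abs_freq_le_jap ζ)

theorem abs_jap_add_sub_le (τ ζ : ℝ) : |jap (τ + ζ) - jap ζ| ≤ jap τ := by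
  have h1 := jap_add_le τ ζ
  have h2 := jap_add_le (-τ) (τ + ζ)
  rw [jap_neg, neg_add_cancel_left] at h2
  rw [abs_le]
  constructor <;> linarith

theorem jap_add_le_mul (τ ζ : ℝ) : jap (τ + ζ) ≤ 2 * (jap τ * jap ζ) := by
  have := jap_add_le τ ζ
  nlinarith [one_le_jap τ, one_le_jap ζ]

theorem jap_right_le_mul (τ ζ : ℝ) : jap ζ ≤ 2 * (jap (τ + ζ) * jap τ) := by
  have := jap_add_le_mul (τ + ζ) (-τ)
  rwa [jap_neg, add_neg_cancel_comm] at this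

theorem tanh_le_self {x : ℝ} (hx : 0 ≤ x) : Real.tanh x ≤ x := by
  have h : MonotoneOn (fun y ↦ y * Real.cosh y - Real.sinh y) (Set.Ici 0) := by
    refine monotoneOn_of_hasDerivWithinAt_nonneg (convex_Ici 0) (by fun_prop)
      (f' := fun y ↦ y * Real.sinh y) (fun y _ ↦ ?_) (fun y hy ↦ ?_)
    · have := ((hasDerivAt_id y).mul (Real.hasDerivAt_cosh y)).sub (Real.hasDerivAt_sinh y)
      convert! this.hasDerivWithinAt using 1
      simp
    · simp only [interior_Ici, Set.mem_Ioi] at hy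
      have := Real.sinh_pos_iff.mpr hy
      positivity
  have h1 := h (Set.mem_Ici.mpr le_rfl) (Set.mem_Ici.mpr hx) hx
  simp only [Real.sinh_zero, zero_mul, sub_zero] at h1
  rw [Real.tanh_eq_sinh_div_cosh, div_le_iff₀ (Real.cosh_pos x)]
  linarith

/-- After clearing denominators this is x(cosh x - sinh x) = x e^{-x} ≤ x ≤ sinh x. -/
theorem div_one_add_le_tanh {x : ℝ} (hx : 0 ≤ x) : x / (1 + x) ≤ Real.tanh x := by
  rw [Real.tanh_eq_sinh_div_cosh, div_le_div_iff₀ (by positivity) (Real.cosh_pos x)]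
  have h1 : x ≤ Real.sinh x := Real.self_le_sinh_iff.mpr hx
  have h2 : Real.cosh x - Real.sinh x = Real.exp (-x) := Real.cosh_sub_sinh x
  have h3 : Real.exp (-x) ≤ 1 := Real.exp_le_one_iff.mpr (by linarith)
  nlinarith

theorem tanh_div_self_neg (x : ℝ) : Real.tanh (-x) / (-x) = Real.tanh x / x := by
  rw [Real.tanh_neg, neg_div_neg_eq]

theorem tanh_div_eq_abs (x : ℝ) : Real.tanh x / x = Real.tanh |x| / |x| := by
  rcases abs_choice x with h | h <;> rw [h]
  rw [tanh_div_self_neg]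

theorem tanh_div_nonneg (x : ℝ) : 0 ≤ Real.tanh x / x := by
  rw [tanh_div_eq_abs]
  have := div_one_add_le_tanh (abs_nonneg x)
  have : 0 ≤ Real.tanh |x| := le_trans (by positivity) this
  positivity

theorem msym_neg (ξ : ℝ) : msym (-ξ) = msym ξ := by
  simp only [msym, neg_eq_zero, mul_neg, tanh_div_self_neg]

theorem msym_sq_of_ne {ξ : ℝ} (h : ξ ≠ 0) :
    msym ξ ^ 2 = Real.tanh (2 * Real.pi * ξ) / (2 * Real.pi * ξ) := by
  rw [msym, if_neg h, Real.sq_sqrt (tanh_div_nonneg _)]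

/-- The identity that splits tanh k symmetrically between the two equations and gives both the same
dispersion symbol. -/
theorem freq_mul_msym_sq (ξ : ℝ) : 2 * Real.pi * ξ * msym ξ ^ 2 = thsym ξ := by
  by_cases h : ξ = 0
  · simp [h, thsym]
  · rw [msym_sq_of_ne h, thsym, mul_div_cancel₀]
    have := Real.pi_pos
    positivity

theorem msym_nonneg (ξ : ℝ) : 0 ≤ msym ξ := by
  unfold msym; split_ifs <;> positivity

theorem abs_thsym_le_one (ξ : ℝ) : |thsym ξ| ≤ 1 :=
  abs_le.mpr ⟨(Real.neg_one_lt_tanh _).le, (Real.tanh_lt_one _).le⟩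

theorem msym_le_one (ξ : ℝ) : msym ξ ≤ 1 := by
  unfold msym
  split_ifs with h
  · rfl
  · rw [Real.sqrt_le_left zero_le_one, one_pow, tanh_div_eq_abs]
    exact div_le_one_of_le₀ (tanh_le_self (abs_nonneg _)) (abs_nonneg _)

/-- With `one_le_msym_sq_mul_jap` this says that M has order exactly -1/2. The upper bound comes
from M² ≤ 1 and |k|M² = |tanh k| ≤ 1, used for the two parts of ⟨k⟩ ≤ 1 + |k|. -/
theorem msym_sq_mul_jap_le (ξ : ℝ) : msym ξ ^ 2 * jap ξ ≤ 2 := by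
  have h1 : jap ξ ≤ 1 + |2 * Real.pi * ξ| := by
    have := jap_add_le_freq 0 ξ
    simpa [jap] using this
  have h2 : msym ξ ^ 2 * |2 * Real.pi * ξ| ≤ 1 := by
    have h3 := abs_thsym_le_one ξ
    rw [← freq_mul_msym_sq, abs_mul, abs_of_nonneg (sq_nonneg (msym ξ))] at h3
    linarith
  have h4 : msym ξ ^ 2 ≤ 1 := pow_le_one₀ (msym_nonneg ξ) (msym_le_one ξ)
  nlinarith [sq_nonneg (msym ξ)]

theorem one_le_msym_sq_mul_jap (ξ : ℝ) : 1 ≤ 2 * (msym ξ ^ 2 * jap ξ) := by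
  by_cases h : ξ = 0
  · simp [h, msym, jap]
  · rw [msym_sq_of_ne h, tanh_div_eq_abs]
    set x := |2 * Real.pi * ξ| with hx
    have hx0 : 0 < x := by have := Real.pi_pos; positivity
    have h1 := div_one_add_le_tanh hx0.le
    have h2 : 1 + x ≤ 2 * jap ξ := by linarith [one_le_jap ξ, abs_freq_le_jap ξ]
    have h3 : 1 / (1 + x) ≤ Real.tanh x / x := by
      rw [le_div_iff₀ hx0]
      calc 1 / (1 + x) * x = x / (1 + x) := by ring
        _ ≤ _ := h1
    calc (1 : ℝ) = 1 / (1 + x) * (1 + x) := by field_simp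
      _ ≤ (Real.tanh x / x) * (2 * jap ξ) := by
          have := tanh_div_nonneg x
          gcongr
      _ = _ := by ring

theorem msym_pos (ξ : ℝ) : 0 < msym ξ := by
  refine (msym_nonneg ξ).lt_of_ne fun h ↦ ?_
  have := one_le_msym_sq_mul_jap ξ
  rw [← h] at this
  norm_num at this

theorem msym_mul_sqrt_jap_le (ξ : ℝ) : msym ξ * √(jap ξ) ≤ 2 := by
  have h : (msym ξ * √(jap ξ)) ^ 2 ≤ 2 := by
    rw [mul_pow, Real.sq_sqrt (jap_pos ξ).le]
    exact msym_sq_mul_jap_le ξ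
  nlinarith

theorem abs_freq_mul_msym_le (ξ : ℝ) : |2 * Real.pi * ξ| * msym ξ ≤ √(jap ξ) := by
  refine Real.le_sqrt_of_sq_le ?_
  have h3 := abs_thsym_le_one ξ
  rw [← freq_mul_msym_sq, abs_mul, abs_of_nonneg (sq_nonneg (msym ξ))] at h3
  nlinarith [abs_freq_le_jap ξ, abs_nonneg (2 * Real.pi * ξ)]

theorem one_le_bsym {ϰ : ℝ} (h : 0 < ϰ) (ξ : ℝ) : 1 ≤ bsym ϰ ξ := by
  rw [bsym, Real.one_le_sqrt]
  nlinarith [mul_nonneg h.le (sq_nonneg (2 * Real.pi * ξ))]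

theorem bsym_pos {ϰ : ℝ} (h : 0 < ϰ) (ξ : ℝ) : 0 < bsym ϰ ξ := one_pos.trans_le (one_le_bsym h ξ)

theorem bsym_neg (ϰ ξ : ℝ) : bsym ϰ (-ξ) = bsym ϰ ξ := by simp [bsym]

/-- Only the upper bound ϰ ≤ c² is used. No lower bound on ϰ enters the constant, which keeps the
energy estimates uniform as ϰ → 0. -/
theorem sqrt_mul_jap_le_bsym {ϰ c : ℝ} (h : 0 < ϰ) (hc : 1 ≤ c) (hϰ : ϰ ≤ c ^ 2) (ξ : ℝ) :
    √ϰ * jap ξ ≤ c * bsym ϰ ξ := by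
  have h0 : 0 ≤ c * bsym ϰ ξ := by have := bsym_pos h ξ; positivity
  refine le_of_sq_le_sq ?_ h0
  rw [mul_pow, mul_pow, jap_sq, Real.sq_sqrt h.le, bsym, Real.sq_sqrt (by positivity)]
  have : 1 ≤ c ^ 2 := one_le_pow₀ hc
  nlinarith [mul_nonneg h.le (sq_nonneg (2 * Real.pi * ξ))]

/-- The order one weights of neighbouring frequencies are comparable. -/
theorem bsym_add_le {ϰ c : ℝ} (h : 0 < ϰ) (hc : 1 ≤ c) (hϰ : ϰ ≤ c ^ 2) (τ ζ : ℝ) :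
    bsym ϰ (τ + ζ) ≤ bsym ϰ τ * (1 + c * (jap ζ / jap τ)) := by
  have h1 := sqrt_one_add_sq_add_le (c := ϰ) (x := 2 * Real.pi * τ) (y := 2 * Real.pi * ζ) h.le
  rw [← mul_add] at h1
  have h2 := sqrt_mul_jap_le_bsym h hc hϰ τ
  have h3 := abs_freq_le_jap ζ
  have hj := jap_pos τ
  calc bsym ϰ (τ + ζ) ≤ bsym ϰ τ + √ϰ * |2 * Real.pi * ζ| := h1
    _ ≤ bsym ϰ τ + √ϰ * jap ζ := by gcongr
    _ = bsym ϰ τ + (√ϰ * jap τ) * (jap ζ / jap τ) := by field_simp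
    _ ≤ bsym ϰ τ + (c * bsym ϰ τ) * (jap ζ / jap τ) := by
        have := jap_pos ζ
        gcongr
    _ = _ := by ring

theorem lam_pos (ρ ξ : ℝ) : 0 < lam ρ ξ := Real.rpow_pos_of_pos (jap_pos ξ) _

theorem lam_neg (ρ ξ : ℝ) : lam ρ (-ξ) = lam ρ ξ := by rw [lam, lam, jap_neg]

theorem lam_le_one {ρ : ℝ} (hρ : 0 ≤ ρ) (ξ : ℝ) : lam ρ ξ ≤ 1 :=
  Real.rpow_le_one_of_one_le_of_nonpos (one_le_jap ξ) (by linarith)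

theorem lam_le_inv_sqrt {ρ : ℝ} (hρ : 1 / 2 ≤ ρ) (ξ : ℝ) : lam ρ ξ ≤ (√(jap ξ))⁻¹ := by
  rw [lam, Real.sqrt_eq_rpow, ← Real.rpow_neg (jap_pos ξ).le]
  exact Real.rpow_le_rpow_of_exponent_le (one_le_jap ξ) (by linarith)

theorem inv_lam (ρ ξ : ℝ) : (lam ρ ξ)⁻¹ = jap ξ ^ ρ := by
  rw [lam, Real.rpow_neg (jap_pos ξ).le, inv_inv]

theorem measurable_lam (ρ : ℝ) : Measurable (lam ρ) :=
  continuous_jap.measurable.pow_const _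

/-- Here s > 3/2 enters: ρ = s - 1 > 1/2 makes ⟨k⟩^{-ρ} square integrable, so one factor of it turns
L² into L¹. -/
theorem memLp_lam {ρ : ℝ} (hρ : 1 / 2 < ρ) : MemLp (lam ρ) 2 volume := by
  rw [memLp_two_iff_integrable_sq (measurable_lam ρ).aestronglyMeasurable]
  have h := integrable_rpow_neg_one_add_norm_sq (E := ℝ) (μ := volume) (r := 2 * ρ)
    (by simp; linarith)
  have h2 := h.comp_mul_left' (R := 2 * Real.pi) (by positivity)
  refine h2.congr (Filter.Eventually.of_forall fun ξ ↦ ?_)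
  simp only [lam, jap, Real.norm_eq_abs, sq_abs]
  rw [← Real.rpow_mul_natCast (Real.sqrt_nonneg _), Real.sqrt_eq_rpow,
    ← Real.rpow_mul (by positivity)]
  congr 1
  push_cast
  ring

/-- The larger of ⟨τ⟩ and ⟨ζ⟩ is at least half of ⟨τ + ζ⟩. -/
theorem inv_lam_add_le {ρ : ℝ} (hρ : 0 ≤ ρ) (τ ζ : ℝ) :
    (lam ρ (τ + ζ))⁻¹ ≤ 2 ^ ρ * ((lam ρ τ)⁻¹ + (lam ρ ζ)⁻¹) := by
  simp only [inv_lam]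
  have key : ∀ {a b : ℝ}, 1 ≤ a → a ≤ b → ∀ x, 0 ≤ x → x ≤ a + b →
      x ^ ρ ≤ 2 ^ ρ * (a ^ ρ + b ^ ρ) := by
    intro a b ha hab x hx hxab
    calc x ^ ρ ≤ (2 * b) ^ ρ := Real.rpow_le_rpow hx (by linarith) hρ
      _ = 2 ^ ρ * b ^ ρ := Real.mul_rpow (by norm_num) (by linarith)
      _ ≤ _ := by
        have : 0 ≤ a ^ ρ := Real.rpow_nonneg (by linarith) _
        gcongr
        linarith
  rcases le_total (jap τ) (jap ζ) with h | h
  · exact key (one_le_jap τ) h _ (jap_pos _).le (jap_add_le τ ζ)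
  · rw [add_comm (jap τ ^ ρ)]
    exact key (one_le_jap ζ) h _ (jap_pos _).le (by rw [add_comm (jap ζ)]; exact jap_add_le τ ζ)

end Symbols

/-! ### High frequency weights and their increments -/

section Weights

/-- The weight `min(1, ⟨k⟩/N)`. -/
def psi (N ξ : ℝ) : ℝ := min 1 (jap ξ / N)

/-- `⟨k⟩^{ρ + 1/2} min(1, ⟨k⟩/N)`. -/
def phi (ρ N ξ : ℝ) : ℝ := psi N ξ * (√(jap ξ) * (lam ρ ξ)⁻¹)

/-- `phi` as a function of `⟨k⟩`. -/
def phiRadial (ρ N x : ℝ) : ℝ := min 1 (x / N) * (√x * x ^ ρ)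

theorem phi_eq (ρ N ξ : ℝ) : phi ρ N ξ = phiRadial ρ N (jap ξ) := by
  rw [phi, phiRadial, psi, inv_lam]

theorem phiRadial_nonneg {ρ N x : ℝ} (hN : 1 ≤ N) (hx : 0 ≤ x) : 0 ≤ phiRadial ρ N x := by
  unfold phiRadial; positivity

theorem phiRadial_mono {ρ N x y : ℝ} (hρ : 0 ≤ ρ) (hN : 1 ≤ N) (hx : 0 ≤ x) (h : x ≤ y) :
    phiRadial ρ N x ≤ phiRadial ρ N y := by
  have hy : 0 ≤ y := hx.trans h
  unfold phiRadial
  gcongr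

/-- Of the q ≥ ρ + 2 powers of c, one pays for the minimum, one for the square root and ρ for the
power; the bound is independent of N. -/
theorem phiRadial_mul_le {ρ N x c : ℝ} {q : ℕ} (hq : ρ + 2 ≤ q) (hN : 1 ≤ N) (hx : 0 ≤ x)
    (hc : 1 ≤ c) : phiRadial ρ N (c * x) ≤ c ^ q * phiRadial ρ N x := by
  have hc0 : 0 ≤ c := by linarith
  have h1 : min 1 (c * x / N) ≤ c * min 1 (x / N) := by
    rw [mul_min_of_nonneg _ _ hc0, mul_one, mul_div_assoc]
    exact min_le_min_right _ hc
  have h2 : √(c * x) ≤ c * √x := by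
    rw [Real.sqrt_mul hc0]
    gcongr
    rw [Real.sqrt_le_left hc0]
    nlinarith
  have h3 : (c * x) ^ ρ = c ^ ρ * x ^ ρ := Real.mul_rpow hc0 hx
  have h4 : c * c * c ^ ρ ≤ c ^ q := by
    rw [← Real.rpow_natCast, ← sq, ← Real.rpow_natCast c 2, ← Real.rpow_add (by linarith)]
    exact Real.rpow_le_rpow_of_exponent_le hc (by push_cast; linarith)
  unfold phiRadial
  rw [h3]
  calc min 1 (c * x / N) * (√(c * x) * (c ^ ρ * x ^ ρ))
      ≤ c * min 1 (x / N) * (c * √x * (c ^ ρ * x ^ ρ)) := by gcongr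
    _ = (c * c * c ^ ρ) * (min 1 (x / N) * (√x * x ^ ρ)) := by ring
    _ ≤ _ := by gcongr

/-- A substitute for a derivative bound that avoids the kink of the minimum: the function is
increasing and grows at most like the q-th power, so the relative increment is controlled by (x/y)^q
- 1 or 1 - (x/y)^q, and Bernoulli's inequality makes these linear in d/y. -/
theorem abs_phiRadial_sub_le {ρ N x y d : ℝ} {q : ℕ} (hρ : 0 ≤ ρ) (hq : ρ + 2 ≤ q) (hN : 1 ≤ N)
    (hx : 0 < x) (hy : 0 < y) (hd : d ≤ y) (h : |x - y| ≤ d) :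
    |phiRadial ρ N x - phiRadial ρ N y| ≤ q * 2 ^ q * (d / y) * phiRadial ρ N y := by
  have hy0 : 0 ≤ phiRadial ρ N y := phiRadial_nonneg hN hy.le
  have hd0 : 0 ≤ d := (abs_nonneg _).trans h
  have hab := abs_le.mp h
  rcases le_total y x with hxy | hxy
  · have hm := phiRadial_mono hρ hN hy.le hxy
    rw [abs_of_nonneg (by linarith)]
    have hc : 1 ≤ x / y := (one_le_div hy).mpr hxy
    have hc2 : x / y ≤ 2 := by rw [div_le_iff₀ hy]; linarith
    have h1 : phiRadial ρ N x ≤ (x / y) ^ q * phiRadial ρ N y := by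
      have := phiRadial_mul_le hq hN hy.le hc
      rwa [div_mul_cancel₀ _ hy.ne'] at this
    have h2 : (x / y) ^ q - 1 ≤ q * 2 ^ q * (d / y) := by
      -- Bernoulli bounds a power from below, so it is applied to the reciprocal y/x in order to
      -- bound (x/y)^q from above.
      have hb := one_add_mul_le_pow (a := y / x - 1) (by
        have : 0 < y / x := by positivity
        linarith) q
      rw [add_sub_cancel] at hb
      have hp : (0 : ℝ) < (x / y) ^ q := by positivity
      have e : (x / y) ^ q * (y / x) ^ q = 1 := by
        rw [← mul_pow, div_mul_div_comm, mul_comm y x, div_self (by positivity), one_pow]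
      have h3 : (x / y) ^ q - 1 ≤ (x / y) ^ q * (q * (1 - y / x)) := by nlinarith
      have h4 : 1 - y / x ≤ d / y := by
        have : 1 - y / x = (x - y) / x := by field_simp
        rw [this]
        exact div_le_div₀ hd0 (by linarith) hy hxy
      have h5 : 0 ≤ 1 - y / x := by
        rw [sub_nonneg, div_le_one hx]; exact hxy
      calc _ ≤ (x / y) ^ q * (q * (1 - y / x)) := h3
        _ ≤ 2 ^ q * (q * (d / y)) := by gcongr
        _ = _ := by ring
    nlinarith
  · have hm := phiRadial_mono hρ hN hx.le hxy
    rw [abs_of_nonpos (by linarith)]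
    have hc : 1 ≤ y / x := (one_le_div hx).mpr hxy
    have h1 : phiRadial ρ N y ≤ (y / x) ^ q * phiRadial ρ N x := by
      have := phiRadial_mul_le hq hN hx.le hc
      rwa [div_mul_cancel₀ _ hx.ne'] at this
    have h2 : (x / y) ^ q * phiRadial ρ N y ≤ phiRadial ρ N x := by
      calc _ ≤ (x / y) ^ q * ((y / x) ^ q * phiRadial ρ N x) := by gcongr
        _ = _ := by
          rw [← mul_assoc, ← mul_pow, div_mul_div_comm, mul_comm y x, div_self (by positivity),
            one_pow, one_mul]
    have hb := one_add_mul_le_pow (a := x / y - 1) (by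
        have : 0 < x / y := by positivity
        linarith) q
    rw [add_sub_cancel] at hb
    have h4 : 1 - x / y ≤ d / y := by
      have : 1 - x / y = (y - x) / y := by field_simp
      rw [this]
      gcongr
      linarith
    have h5 : (1 : ℝ) ≤ 2 ^ q := one_le_pow₀ (by norm_num)
    have h6 : 0 ≤ d / y := by positivity
    have h7 : 1 - (x / y) ^ q ≤ q * 2 ^ q * (d / y) := by
      calc 1 - (x / y) ^ q ≤ q * (1 - x / y) := by linarith
        _ ≤ q * (d / y) := by gcongr
        _ = q * 1 * (d / y) := by ring
        _ ≤ _ := by gcongr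
    nlinarith

theorem phi_nonneg {ρ N : ℝ} (hN : 1 ≤ N) (ξ : ℝ) : 0 ≤ phi ρ N ξ := by
  rw [phi_eq]; exact phiRadial_nonneg hN (jap_pos ξ).le

theorem phi_add_le_of_le {ρ N : ℝ} {q : ℕ} (hρ : 0 ≤ ρ) (hq : ρ + 2 ≤ q) (hN : 1 ≤ N) {τ ζ : ℝ}
    (h : jap ζ ≤ jap τ) : phi ρ N (τ + ζ) ≤ 2 ^ q * phi ρ N τ := by
  rw [phi_eq, phi_eq]
  refine (phiRadial_mono hρ hN (jap_pos _).le (y := 2 * jap τ) ?_).trans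
    (phiRadial_mul_le hq hN (jap_pos _).le (by norm_num))
  linarith [jap_add_le τ ζ]

theorem phi_add_le {ρ N : ℝ} {q : ℕ} (hρ : 0 ≤ ρ) (hq : ρ + 2 ≤ q) (hN : 1 ≤ N) (τ ζ : ℝ) :
    phi ρ N (τ + ζ) ≤ 2 ^ q * (phi ρ N τ + phi ρ N ζ) := by
  have h1 := phi_nonneg (ρ := ρ) hN τ
  have h2 := phi_nonneg (ρ := ρ) hN ζ
  have h5 : (0 : ℝ) ≤ 2 ^ q := by positivity
  rcases le_total (jap ζ) (jap τ) with h | h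
  · nlinarith [phi_add_le_of_le hρ hq hN h]
  · have := phi_add_le_of_le hρ hq hN h
    rw [add_comm] at this
    nlinarith

/-- Commutators with the weight gain a derivative from the low frequency factor. -/
theorem abs_phi_add_sub_le {ρ N : ℝ} {q : ℕ} (hρ : 0 ≤ ρ) (hq : ρ + 2 ≤ q) (hN : 1 ≤ N)
    {τ ζ : ℝ} (h : jap τ ≤ jap ζ) :
    |phi ρ N (τ + ζ) - phi ρ N ζ| ≤ q * 2 ^ q * (jap τ / jap ζ) * phi ρ N ζ := by
  simp only [phi_eq]
  exact abs_phiRadial_sub_le hρ hq hN (jap_pos _) (jap_pos _) h (abs_jap_add_sub_le τ ζ)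

/-- When τ is the high frequency there is nothing to gain from the difference; both terms are
dominated by the weight at τ, and the weight moves onto that factor. -/
theorem abs_phi_add_sub_le' {ρ N : ℝ} {q : ℕ} (hρ : 0 ≤ ρ) (hq : ρ + 2 ≤ q) (hN : 1 ≤ N)
    {τ ζ : ℝ} (h : jap ζ ≤ jap τ) :
    |phi ρ N (τ + ζ) - phi ρ N ζ| ≤ 2 ^ q * phi ρ N τ := by
  have h1 := phi_add_le_of_le hρ hq hN h
  have h2 : phi ρ N ζ ≤ phi ρ N τ := by
    rw [phi_eq, phi_eq]; exact phiRadial_mono hρ hN (jap_pos _).le h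
  have h3 := phi_nonneg (ρ := ρ) hN τ
  have h4 := phi_nonneg (ρ := ρ) hN ζ
  have h6 := phi_nonneg (ρ := ρ) hN (τ + ζ)
  have h5 : (1 : ℝ) ≤ 2 ^ q := one_le_pow₀ (by norm_num)
  rw [abs_le]
  constructor <;> nlinarith

end Weights

end WhithamBoussinesq
end

noncomputable section
open MeasureTheory
open scoped SchwartzMap ENNReal

namespace WhithamBoussinesq

/-! ### Pointwise kernel inequalities -/

section Kernels

/-- The kernel `A(τ + ζ) B(τ) C(ζ)`. -/
def tri (A B C : ℝ → ℝ) (τ ζ : ℝ) : ℝ := A (τ + ζ) * B τ * C ζ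

theorem measurable_tri {A B C : ℝ → ℝ} (hA : Measurable A) (hB : Measurable B)
    (hC : Measurable C) : Measurable (Function.uncurry (tri A B C)) :=
  ((hA.comp (measurable_fst.add measurable_snd)).mul (hB.comp measurable_fst)).mul
    (hC.comp measurable_snd)

theorem mulOp_bil_tri {A B C φ : ℝ → ℝ} (h : Admissible (tri A B C)) (hφ : BddSymbol φ)
    (f g : L2C) : mulOp φ (bil (tri A B C) f g) = bil (tri (fun x ↦ φ x * A x) B C) f g := by
  rw [mulOp_bil h hφ]
  congr 3; ext τ ζ; simp only [tri]; ring

theorem bil_tri_mulOp_left {A B C φ : ℝ → ℝ} (h : Admissible (tri A B C)) (hφ : BddSymbol φ)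
    (f g : L2C) : bil (tri A B C) (mulOp φ f) g = bil (tri A (fun x ↦ φ x * B x) C) f g := by
  rw [bil_mulOp_left h hφ]
  congr 3; ext τ ζ; simp only [tri]; ring

theorem bil_tri_mulOp_right {A B C φ : ℝ → ℝ} (h : Admissible (tri A B C)) (hφ : BddSymbol φ)
    (f g : L2C) : bil (tri A B C) f (mulOp φ g) = bil (tri A B (fun x ↦ φ x * C x)) f g := by
  rw [bil_mulOp_right h hφ]
  congr 3; ext τ ζ; simp only [tri]; ring

/-- The frequency `k = 2πξ`. -/
def freq (ξ : ℝ) : ℝ := 2 * Real.pi * ξ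

/-- The symbol `⟨k⟩^{-r}`, `r = ρ + 1/2`. -/
def lowSym (ρ ξ : ℝ) : ℝ := lam ρ ξ * (√(jap ξ))⁻¹

/-- The symbol `⟨k⟩^{r}`, `r = ρ + 1/2`. -/
def highSym (ρ ξ : ℝ) : ℝ := √(jap ξ) * (lam ρ ξ)⁻¹

/-- The symbol that takes the unknown `P` to the elevation `η`. -/
def etaSym (ϰ ρ ξ : ℝ) : ℝ := (bsym ϰ ξ)⁻¹ * lowSym ρ ξ

/-- The symbol that takes the unknown `Q` to the velocity `v`. -/
def velSym (ρ ξ : ℝ) : ℝ := msym ξ * lowSym ρ ξ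

/-- Frequency cutoffs. -/
structure IsCutoff (χ : ℝ → ℝ) : Prop where
  measurable : Measurable χ
  abs_le_one : ∀ ξ, |χ ξ| ≤ 1
  even : ∀ ξ, χ (-ξ) = χ ξ

theorem measurable_jap : Measurable jap := continuous_jap.measurable

theorem measurable_msym : Measurable msym := by
  have h1 : Measurable fun ξ : ℝ ↦ 2 * Real.pi * ξ := by fun_prop
  have h2 : Continuous Real.tanh := hasTemperateGrowth_tanh.1.continuous
  exact Measurable.ite (measurableSet_singleton 0) measurable_const
    ((h2.measurable.comp h1).div h1).sqrt

theorem measurable_bsym (ϰ : ℝ) : Measurable (bsym ϰ) := by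
  have : Continuous (bsym ϰ) := by unfold bsym; fun_prop
  exact this.measurable

theorem measurable_freq : Measurable freq := by unfold freq; fun_prop

theorem measurable_thsym : Measurable thsym :=
  hasTemperateGrowth_tanh.1.continuous.measurable.comp measurable_freq

theorem measurable_lowSym (ρ : ℝ) : Measurable (lowSym ρ) :=
  (measurable_lam ρ).mul measurable_jap.sqrt.inv

theorem measurable_etaSym (ϰ ρ : ℝ) : Measurable (etaSym ϰ ρ) :=
  (measurable_bsym ϰ).inv.mul (measurable_lowSym ρ)

theorem measurable_velSym (ρ : ℝ) : Measurable (velSym ρ) :=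
  measurable_msym.mul (measurable_lowSym ρ)

theorem measurable_psi (N : ℝ) : Measurable (psi N) :=
  measurable_const.min (measurable_jap.div_const N)

theorem sqrt_jap_pos (ξ : ℝ) : 0 < √(jap ξ) := Real.sqrt_pos.mpr (jap_pos ξ)

theorem one_le_sqrt_jap (ξ : ℝ) : 1 ≤ √(jap ξ) := Real.one_le_sqrt.mpr (one_le_jap ξ)

theorem lowSym_pos (ρ ξ : ℝ) : 0 < lowSym ρ ξ :=
  mul_pos (lam_pos ρ ξ) (inv_pos.mpr (sqrt_jap_pos ξ))

theorem lowSym_mul_highSym (ρ ξ : ℝ) : lowSym ρ ξ * highSym ρ ξ = 1 := by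
  have h1 := (sqrt_jap_pos ξ).ne'
  have h2 := (lam_pos ρ ξ).ne'
  unfold lowSym highSym
  field_simp

theorem lowSym_le_lam (ρ ξ : ℝ) : lowSym ρ ξ ≤ lam ρ ξ :=
  mul_le_of_le_one_right (lam_pos ρ ξ).le (inv_le_one_of_one_le₀ (one_le_sqrt_jap ξ))

theorem lowSym_le_one {ρ : ℝ} (hρ : 0 ≤ ρ) (ξ : ℝ) : lowSym ρ ξ ≤ 1 :=
  (lowSym_le_lam ρ ξ).trans (lam_le_one hρ ξ)

theorem etaSym_pos {ϰ : ℝ} (h : 0 < ϰ) (ρ ξ : ℝ) : 0 < etaSym ϰ ρ ξ :=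
  mul_pos (inv_pos.mpr (bsym_pos h ξ)) (lowSym_pos ρ ξ)

theorem velSym_pos (ρ ξ : ℝ) : 0 < velSym ρ ξ := mul_pos (msym_pos ξ) (lowSym_pos ρ ξ)

theorem etaSym_le_low {ϰ : ℝ} (h : 0 < ϰ) (ρ ξ : ℝ) : etaSym ϰ ρ ξ ≤ lowSym ρ ξ :=
  mul_le_of_le_one_left (lowSym_pos ρ ξ).le (inv_le_one_of_one_le₀ (one_le_bsym h ξ))

theorem etaSym_le_lam {ϰ : ℝ} (h : 0 < ϰ) (ρ ξ : ℝ) : etaSym ϰ ρ ξ ≤ lam ρ ξ :=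
  (etaSym_le_low h ρ ξ).trans (lowSym_le_lam ρ ξ)

theorem velSym_le_low (ρ ξ : ℝ) : velSym ρ ξ ≤ lowSym ρ ξ :=
  mul_le_of_le_one_left (lowSym_pos ρ ξ).le (msym_le_one ξ)

theorem velSym_le_lam (ρ ξ : ℝ) : velSym ρ ξ ≤ lam ρ ξ :=
  (velSym_le_low ρ ξ).trans (lowSym_le_lam ρ ξ)

theorem msym_le_inv_sqrt (ξ : ℝ) : msym ξ ≤ 2 * (√(jap ξ))⁻¹ := by
  rw [← div_eq_mul_inv, le_div_iff₀ (sqrt_jap_pos ξ)]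
  exact msym_mul_sqrt_jap_le ξ

theorem velSym_le (ρ ξ : ℝ) : velSym ρ ξ ≤ 2 * (lam ρ ξ * (jap ξ)⁻¹) := by
  have h1 : (√(jap ξ))⁻¹ * (√(jap ξ))⁻¹ = (jap ξ)⁻¹ := by
    rw [← mul_inv, Real.mul_self_sqrt (jap_pos ξ).le]
  calc velSym ρ ξ ≤ 2 * (√(jap ξ))⁻¹ * lowSym ρ ξ := by
        have := lowSym_pos ρ ξ
        unfold velSym
        gcongr
        exact msym_le_inv_sqrt ξ
    _ = 2 * (lam ρ ξ * ((√(jap ξ))⁻¹ * (√(jap ξ))⁻¹)) := by unfold lowSym; ring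
    _ = _ := by rw [h1]

/-- The order one symbol b at the output frequency falls on the elevation, whose symbol carries b⁻¹.
What remains is only the frequency ratio, to be paid by a commutator or by M². -/
theorem bsym_mul_etaSym_le {ϰ c ρ : ℝ} (h : 0 < ϰ) (hc : 1 ≤ c) (hϰ : ϰ ≤ c ^ 2) (τ ζ : ℝ) :
    bsym ϰ (τ + ζ) * etaSym ϰ ρ τ ≤ (1 + c * (jap ζ / jap τ)) * lowSym ρ τ := by
  have h1 := bsym_add_le h hc hϰ τ ζ
  have h2 := bsym_pos h τ
  have h3 := lowSym_pos ρ τ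
  calc _ ≤ bsym ϰ τ * (1 + c * (jap ζ / jap τ)) * etaSym ϰ ρ τ := by
        have := etaSym_pos h ρ τ
        gcongr
    _ = _ := by unfold etaSym; field_simp

theorem psi_nonneg {N : ℝ} (hN : 1 ≤ N) (ξ : ℝ) : 0 ≤ psi N ξ := by
  have := jap_pos ξ
  unfold psi
  positivity

theorem psi_le_one (N ξ : ℝ) : psi N ξ ≤ 1 := min_le_left _ _

theorem phi_mul_lowSym (ρ N ξ : ℝ) : phi ρ N ξ * lowSym ρ ξ = psi N ξ := by
  have : phi ρ N ξ = psi N ξ * highSym ρ ξ := rfl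
  rw [this, mul_assoc, mul_comm (highSym ρ ξ), lowSym_mul_highSym, mul_one]

theorem abs_mul_le_of_abs_le_one {a x : ℝ} (ha : |a| ≤ 1) : |a * x| ≤ |x| := by
  rw [abs_mul]
  exact mul_le_of_le_one_left (abs_nonneg x) ha

/-- The kernel of the commutator of the weight with multiplication by the elevation. -/
theorem abs_commutator_kernel_le {ϰ c ρ N : ℝ} {q : ℕ} (h : 0 < ϰ) (hc : 1 ≤ c) (hϰ : ϰ ≤ c ^ 2)
    (hρ : 0 ≤ ρ) (hq : ρ + 2 ≤ q) (hN : 1 ≤ N) {a : ℝ} (ha : |a| ≤ 1) (τ ζ : ℝ) :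
    |a * (bsym ϰ (τ + ζ) * etaSym ϰ ρ τ * ((phi ρ N (τ + ζ) - phi ρ N ζ) * velSym ρ ζ))| ≤
      2 * c * ((q + 1) * 2 ^ q) * (psi N τ * lam ρ ζ + lam ρ τ * psi N ζ) := by
  refine (abs_mul_le_of_abs_le_one ha).trans ?_
  have h1 := bsym_mul_etaSym_le (ρ := ρ) h hc hϰ τ ζ
  have e1 := etaSym_pos h ρ τ
  have b1 := bsym_pos h (τ + ζ)
  have l1 := lowSym_pos ρ τ
  have l2 := lowSym_pos ρ ζ
  have la1 := lam_pos ρ τ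
  have la2 := lam_pos ρ ζ
  have j1 := jap_pos τ
  have j2 := jap_pos ζ
  have p1 := psi_nonneg hN τ
  have p2 := psi_nonneg hN ζ
  have v1 := velSym_pos ρ ζ
  have f1 := phi_nonneg (ρ := ρ) hN τ
  have f2 := phi_nonneg (ρ := ρ) hN ζ
  rw [abs_mul, abs_of_pos (mul_pos b1 e1), abs_mul, abs_of_pos v1]
  -- If τ is low, the loss ⟨ζ⟩/⟨τ⟩ from b is cancelled exactly by the gain ⟨τ⟩/⟨ζ⟩ of the
  -- commutator. If τ is high, the ratio is at most 1 and the whole weight goes onto the elevation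
  -- factor.
  rcases le_total (jap τ) (jap ζ) with hj | hj
  · have h2 := abs_phi_add_sub_le hρ hq hN hj
    have h3 : 1 + c * (jap ζ / jap τ) ≤ 2 * c * (jap ζ / jap τ) := by
      have : 1 ≤ jap ζ / jap τ := (one_le_div j1).mpr hj
      nlinarith
    have h4 : phi ρ N ζ * velSym ρ ζ ≤ psi N ζ := by
      calc _ ≤ phi ρ N ζ * lowSym ρ ζ := by gcongr; exact velSym_le_low ρ ζ
        _ = _ := phi_mul_lowSym ρ N ζ
    calc _ ≤ (2 * c * (jap ζ / jap τ) * lowSym ρ τ) *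
          (q * 2 ^ q * (jap τ / jap ζ) * phi ρ N ζ * velSym ρ ζ) := by
          refine mul_le_mul (h1.trans ?_) ?_ (by positivity) (by positivity) <;> gcongr
      _ = 2 * c * (q * 2 ^ q) * (lowSym ρ τ * (phi ρ N ζ * velSym ρ ζ)) := by field_simp
      _ ≤ 2 * c * ((q + 1) * 2 ^ q) * (lam ρ τ * psi N ζ) := by
          gcongr
          · linarith
          · exact lowSym_le_lam ρ τ
      _ ≤ _ := by
          gcongr
          have : 0 ≤ psi N τ * lam ρ ζ := by positivity
          linarith
  · have h2 := abs_phi_add_sub_le' hρ hq hN hj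
    have h3 : 1 + c * (jap ζ / jap τ) ≤ 2 * c := by
      have : jap ζ / jap τ ≤ 1 := (div_le_one j1).mpr hj
      nlinarith
    calc _ ≤ (2 * c * lowSym ρ τ) * (2 ^ q * phi ρ N τ * velSym ρ ζ) := by
          refine mul_le_mul (h1.trans ?_) ?_ (by positivity) (by positivity) <;> gcongr
      _ = 2 * c * (1 * 2 ^ q) * ((phi ρ N τ * lowSym ρ τ) * velSym ρ ζ) := by ring
      _ ≤ 2 * c * ((q + 1) * 2 ^ q) * (psi N τ * lam ρ ζ) := by
          rw [phi_mul_lowSym]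
          gcongr
          · linarith [(Nat.cast_nonneg q : (0 : ℝ) ≤ q)]
          · exact velSym_le_lam ρ ζ
      _ ≤ _ := by
          gcongr
          have : 0 ≤ lam ρ τ * psi N ζ := by positivity
          linarith

theorem sqrt_jap_add_le (τ ζ : ℝ) : √(jap (τ + ζ)) ≤ 2 * (√(jap τ) * √(jap ζ)) := by
  rw [Real.sqrt_le_left (by positivity), mul_pow, mul_pow, Real.sq_sqrt (jap_pos _).le,
    Real.sq_sqrt (jap_pos _).le]
  have := jap_add_le_mul τ ζ
  nlinarith [mul_pos (jap_pos τ) (jap_pos ζ)]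

/-- The symbol kM has order 1/2, and √⟨·⟩ is submultiplicative up to a constant, so the half
derivative is distributed over both factors. -/
theorem abs_freq_mul_msym_add_le (τ ζ : ℝ) :
    |freq (τ + ζ) * msym (τ + ζ)| ≤ 2 * (√(jap τ) * √(jap ζ)) := by
  rw [abs_mul, abs_of_nonneg (msym_nonneg _)]
  exact (abs_freq_mul_msym_le (τ + ζ)).trans (sqrt_jap_add_le τ ζ)

theorem sqrt_jap_mul_velSym_le (ρ ξ : ℝ) : √(jap ξ) * velSym ρ ξ ≤ 2 * lowSym ρ ξ := by
  have := msym_mul_sqrt_jap_le ξ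
  have h := lowSym_pos ρ ξ
  calc _ = (msym ξ * √(jap ξ)) * lowSym ρ ξ := by unfold velSym; ring
    _ ≤ _ := by gcongr

/-- The kernel of the nonlinear term in the velocity equation. -/
theorem abs_velocity_kernel_le {ρ : ℝ} {a : ℝ} (ha : |a| ≤ 1) (τ ζ : ℝ) :
    |1 / 2 * a * (freq (τ + ζ) * msym (τ + ζ)) * velSym ρ τ * velSym ρ ζ| ≤
      4 * (lowSym ρ τ * lowSym ρ ζ) := by
  have h1 := abs_freq_mul_msym_add_le τ ζ
  have h2 := sqrt_jap_mul_velSym_le ρ τ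
  have h3 := sqrt_jap_mul_velSym_le ρ ζ
  have v1 := velSym_pos ρ τ
  have v2 := velSym_pos ρ ζ
  have l1 := lowSym_pos ρ τ
  have h4 : |1 / 2 * a| ≤ 1 / 2 := by
    rw [abs_mul, abs_of_pos (by norm_num : (0 : ℝ) < 1 / 2)]; linarith
  rw [abs_mul, abs_mul, abs_mul, abs_of_pos v1, abs_of_pos v2]
  calc _ ≤ 1 / 2 * (2 * (√(jap τ) * √(jap ζ))) * velSym ρ τ * velSym ρ ζ := by gcongr
    _ = (√(jap τ) * velSym ρ τ) * (√(jap ζ) * velSym ρ ζ) := by ring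
    _ ≤ (2 * lowSym ρ τ) * (2 * lowSym ρ ζ) := by gcongr
    _ = _ := by ring

theorem abs_weighted_velocity_kernel_le {ρ N : ℝ} {q : ℕ} (hρ : 0 ≤ ρ) (hq : ρ + 2 ≤ q)
    (hN : 1 ≤ N) {a : ℝ} (ha : |a| ≤ 1) (τ ζ : ℝ) :
    |phi ρ N (τ + ζ) * (1 / 2 * a * (freq (τ + ζ) * msym (τ + ζ)) * velSym ρ τ * velSym ρ ζ)| ≤
      4 * 2 ^ q * (psi N τ * lam ρ ζ + lam ρ τ * psi N ζ) := by
  have h1 := abs_velocity_kernel_le (ρ := ρ) ha τ ζ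
  have h2 := phi_add_le hρ hq hN τ ζ
  have f0 := phi_nonneg (ρ := ρ) hN (τ + ζ)
  have f1 := phi_nonneg (ρ := ρ) hN τ
  have f2 := phi_nonneg (ρ := ρ) hN ζ
  have l1 := lowSym_pos ρ τ
  have l2 := lowSym_pos ρ ζ
  have p1 := psi_nonneg hN τ
  have p2 := psi_nonneg hN ζ
  rw [abs_mul, abs_of_nonneg f0]
  calc _ ≤ (2 ^ q * (phi ρ N τ + phi ρ N ζ)) * (4 * (lowSym ρ τ * lowSym ρ ζ)) := by gcongr
    _ = 4 * 2 ^ q * ((phi ρ N τ * lowSym ρ τ) * lowSym ρ ζ +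
        lowSym ρ τ * (phi ρ N ζ * lowSym ρ ζ)) := by ring
    _ ≤ _ := by
        rw [phi_mul_lowSym, phi_mul_lowSym]
        gcongr
        · exact lowSym_le_lam ρ ζ
        · exact lowSym_le_lam ρ τ

/-- The elevation term gains a derivative under `M²`. -/
theorem abs_smoothed_kernel_le {ϰ c ρ : ℝ} (h : 0 < ϰ) (hc : 1 ≤ c) (hϰ : ϰ ≤ c ^ 2) {a : ℝ}
    (ha : |a| ≤ 1) (τ ζ : ℝ) :
    |a * bsym ϰ (τ + ζ) * msym (τ + ζ) ^ 2 * etaSym ϰ ρ τ * msym ζ| ≤ 6 * c * lam ρ τ := by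
  have h1 := bsym_mul_etaSym_le (ρ := ρ) h hc hϰ τ ζ
  have e1 := etaSym_pos h ρ τ
  have b1 := bsym_pos h (τ + ζ)
  have m1 := msym_pos ζ
  have j0 := jap_pos (τ + ζ)
  have j1 := jap_pos τ
  have j2 := jap_pos ζ
  have la1 := lam_pos ρ τ
  have e : a * bsym ϰ (τ + ζ) * msym (τ + ζ) ^ 2 * etaSym ϰ ρ τ * msym ζ =
      a * (bsym ϰ (τ + ζ) * etaSym ϰ ρ τ * (msym (τ + ζ) ^ 2 * msym ζ)) := by ring
  rw [e]
  refine (abs_mul_le_of_abs_le_one ha).trans ?_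
  rw [abs_of_nonneg (by positivity)]
  have h2 : jap ζ / jap τ ≤ 2 * jap (τ + ζ) := by
    rw [div_le_iff₀ j1]
    linarith [jap_right_le_mul τ ζ]
  have h3 := msym_sq_mul_jap_le (τ + ζ)
  have h4 : msym (τ + ζ) ^ 2 ≤ 1 := pow_le_one₀ (msym_nonneg _) (msym_le_one _)
  have h5 : msym (τ + ζ) ^ 2 * msym ζ ≤ msym (τ + ζ) ^ 2 :=
    mul_le_of_le_one_right (sq_nonneg _) (msym_le_one ζ)
  calc _ ≤ ((1 + c * (2 * jap (τ + ζ))) * lam ρ τ) * msym (τ + ζ) ^ 2 := by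
        refine mul_le_mul (h1.trans ?_) h5 (by positivity) (by positivity)
        gcongr
        · exact (lowSym_pos ρ τ).le
        · exact lowSym_le_lam ρ τ
    _ = (msym (τ + ζ) ^ 2 + 2 * c * (msym (τ + ζ) ^ 2 * jap (τ + ζ))) * lam ρ τ := by ring
    _ ≤ (1 + 2 * c * 2) * lam ρ τ := by gcongr
    _ ≤ _ := by gcongr; linarith

/-- For differences of elevations measured weakly: the factor ⟨k⟩^{-r} has been moved out of the
first argument, leaving b⁻¹. Then b(τ + ζ)/b(τ) ≤ 2c⟨ζ⟩, and the velocity symbol has a spare ⟨ζ⟩⁻¹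
to absorb this. -/
theorem abs_elevation_kernel_le {ϰ c ρ : ℝ} (h : 0 < ϰ) (hc : 1 ≤ c) (hϰ : ϰ ≤ c ^ 2) {a : ℝ}
    (ha : |a| ≤ 1) (τ ζ : ℝ) :
    |a * bsym ϰ (τ + ζ) * (bsym ϰ τ)⁻¹ * velSym ρ ζ| ≤ 4 * c * lam ρ ζ := by
  have h1 := bsym_add_le h hc hϰ τ ζ
  have b1 := bsym_pos h (τ + ζ)
  have b2 := bsym_pos h τ
  have j1 := jap_pos τ
  have j2 := jap_pos ζ
  have v1 := velSym_pos ρ ζ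
  have la1 := lam_pos ρ ζ
  rw [mul_assoc, mul_assoc]
  refine (abs_mul_le_of_abs_le_one ha).trans ?_
  rw [abs_of_nonneg (by positivity)]
  have h2 : 1 + c * (jap ζ / jap τ) ≤ 2 * c * jap ζ := by
    have h3 : jap ζ / jap τ ≤ jap ζ := div_le_self j2.le (one_le_jap τ)
    nlinarith [one_le_jap ζ]
  calc _ ≤ (bsym ϰ τ * (2 * c * jap ζ)) * ((bsym ϰ τ)⁻¹ * (2 * (lam ρ ζ * (jap ζ)⁻¹))) := by
        gcongr
        · exact h1.trans (by gcongr)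
        · exact velSym_le ρ ζ
    _ = _ := by field_simp; ring

/-- The velocity in the second argument is measured weakly and keeps only M, just enough for its
share of the half derivative; the share of the other velocity is taken from its weight ⟨τ⟩^{-r}. -/
theorem abs_transport_kernel_le {ρ : ℝ} {a : ℝ} (ha : |a| ≤ 1) (τ ζ : ℝ) :
    |1 / 2 * a * (freq (τ + ζ) * msym (τ + ζ)) * velSym ρ τ * msym ζ| ≤ 2 * lam ρ τ := by
  have h1 := abs_freq_mul_msym_add_le τ ζ
  have h2 := sqrt_jap_mul_velSym_le ρ τ
  have h3 := msym_mul_sqrt_jap_le ζ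
  have v1 := velSym_pos ρ τ
  have v2 := msym_pos ζ
  have l1 := lowSym_pos ρ τ
  have h4 : |1 / 2 * a| ≤ 1 / 2 := by
    rw [abs_mul, abs_of_pos (by norm_num : (0 : ℝ) < 1 / 2)]; linarith
  have h5 : √(jap τ) * velSym ρ τ ≤ lam ρ τ := by
    calc √(jap τ) * velSym ρ τ ≤ √(jap τ) * lowSym ρ τ := by gcongr; exact velSym_le_low ρ τ
      _ = lam ρ τ := by unfold lowSym; have := (sqrt_jap_pos τ).ne'; field_simp
  have la1 := lam_pos ρ τ
  rw [abs_mul, abs_mul, abs_mul, abs_of_pos v1, abs_of_pos v2]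
  calc _ ≤ 1 / 2 * (2 * (√(jap τ) * √(jap ζ))) * velSym ρ τ * msym ζ := by gcongr
    _ = (√(jap τ) * velSym ρ τ) * (msym ζ * √(jap ζ)) := by ring
    _ ≤ lam ρ τ * 2 := by gcongr
    _ = _ := by ring

/-- The coefficient is the linear part of ∂ₜη, that is -∂ₓv. The outer and inner factors M are
merely bounded by 1; the symbol kM⟨k⟩^{-r} is at most ⟨k⟩^{-ρ}. -/
theorem abs_rate_kernel_le {ρ : ℝ} {a : ℝ} (ha : |a| ≤ 1) (τ ζ : ℝ) :
    |msym (τ + ζ) * (a * (freq τ * msym τ) * lowSym ρ τ) * msym ζ| ≤ lam ρ τ := by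
  have h1 := abs_freq_mul_msym_le τ
  have e : msym (τ + ζ) * (a * (freq τ * msym τ) * lowSym ρ τ) * msym ζ =
    (msym (τ + ζ) * a * msym ζ) * (freq τ * msym τ * lowSym ρ τ) := by ring
  rw [e]
  refine (abs_mul_le_of_abs_le_one ?_).trans ?_
  · rw [abs_mul, abs_mul, abs_of_pos (msym_pos _), abs_of_pos (msym_pos _)]
    exact mul_le_one₀ (mul_le_one₀ (msym_le_one _) (abs_nonneg _) ha) (msym_nonneg _)
      (msym_le_one _)
  · have l1 := lowSym_pos ρ τ
    rw [abs_mul, abs_mul, abs_of_pos (msym_pos _), abs_of_pos l1]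
    calc _ ≤ √(jap τ) * lowSym ρ τ := by gcongr; exact h1
      _ = lam ρ τ := by unfold lowSym; have := (sqrt_jap_pos τ).ne'; field_simp

/-- The algebra property of H^ρ at the level of kernels: ⟨τ + ζ⟩^ρ is dominated by the sum of the
two weights, each of which cancels one of the two decaying factors and leaves the other. -/
theorem abs_product_kernel_le {ϰ ρ : ℝ} (h : 0 < ϰ) (hρ : 0 ≤ ρ) {a : ℝ} (ha : |a| ≤ 1)
    (τ ζ : ℝ) : |a * (lam ρ (τ + ζ))⁻¹ * etaSym ϰ ρ τ * velSym ρ ζ| ≤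
      2 ^ ρ * (lam ρ τ + lam ρ ζ) := by
  have e1 := etaSym_pos h ρ τ
  have v1 := velSym_pos ρ ζ
  have la1 := lam_pos ρ τ
  have la2 := lam_pos ρ ζ
  have la0 := lam_pos ρ (τ + ζ)
  rw [mul_assoc, mul_assoc]
  refine (abs_mul_le_of_abs_le_one ha).trans ?_
  rw [abs_of_nonneg (by positivity)]
  calc _ ≤ (2 ^ ρ * ((lam ρ τ)⁻¹ + (lam ρ ζ)⁻¹)) * (lam ρ τ * lam ρ ζ) := by
        gcongr
        · exact inv_lam_add_le hρ τ ζ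
        · exact etaSym_le_lam h ρ τ
        · exact velSym_le_lam ρ ζ
    _ = _ := by field_simp; ring

theorem abs_square_kernel_le {ρ : ℝ} (hρ : 0 ≤ ρ) {a : ℝ} (ha : |a| ≤ 1)
    (τ ζ : ℝ) : |a * (lam ρ (τ + ζ))⁻¹ * velSym ρ τ * velSym ρ ζ| ≤
      2 ^ ρ * (lam ρ τ + lam ρ ζ) := by
  have e1 := velSym_pos ρ τ
  have v1 := velSym_pos ρ ζ
  have la1 := lam_pos ρ τ
  have la2 := lam_pos ρ ζ
  have la0 := lam_pos ρ (τ + ζ)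
  rw [mul_assoc, mul_assoc]
  refine (abs_mul_le_of_abs_le_one ha).trans ?_
  rw [abs_of_nonneg (by positivity)]
  calc _ ≤ (2 ^ ρ * ((lam ρ τ)⁻¹ + (lam ρ ζ)⁻¹)) * (lam ρ τ * lam ρ ζ) := by
        gcongr
        · exact inv_lam_add_le hρ τ ζ
        · exact velSym_le_lam ρ τ
        · exact velSym_le_lam ρ ζ
    _ = _ := by field_simp; ring

/-- The sharp cutoff to the frequencies with `⟨k⟩ ≤ n`. -/
def cut (n ξ : ℝ) : ℝ := if jap ξ ≤ n then 1 else 0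

theorem isCutoff_cut (n : ℝ) : IsCutoff (cut n) where
  measurable := Measurable.ite (measurableSet_le measurable_jap measurable_const)
    measurable_const measurable_const
  abs_le_one ξ := by unfold cut; split_ifs <;> simp
  even ξ := by unfold cut; rw [jap_neg]

theorem cut_cases {n τ ζ : ℝ} (hn : 1 ≤ n) :
    (1 - cut n τ * cut n ζ = 0) ∨ (1 - cut n τ * cut n ζ = 1 ∧
      ((√(jap τ))⁻¹ ≤ (√n)⁻¹ ∨ (√(jap ζ))⁻¹ ≤ (√n)⁻¹)) := by
  have key : ∀ {x : ℝ}, ¬ jap x ≤ n → (√(jap x))⁻¹ ≤ (√n)⁻¹ := by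
    intro x hx
    have : 0 < √n := Real.sqrt_pos.mpr (by linarith)
    gcongr
    linarith
  unfold cut
  split_ifs with h1 h2 h2
  · left; norm_num
  · right; exact ⟨by norm_num, Or.inr (key h2)⟩
  · right; exact ⟨by norm_num, Or.inl (key h1)⟩
  · right; exact ⟨by norm_num, Or.inl (key h1)⟩

/-- The smallness n^{-1/2} comes from the spare factor ⟨τ⟩^{-1/2} if τ is high, and from ⟨ζ⟩^{-ρ} ≤
⟨ζ⟩^{-1/2} if ζ is high. The other factor ⟨·⟩^{-ρ} is kept for Young's inequality. -/
theorem lam_mul_lam_mul_le {ρ n τ ζ : ℝ} (hρ : 1 / 2 ≤ ρ)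
    (h : (√(jap τ))⁻¹ ≤ (√n)⁻¹ ∨ (√(jap ζ))⁻¹ ≤ (√n)⁻¹) :
    lam ρ τ * lam ρ ζ * (√(jap τ))⁻¹ ≤ (√n)⁻¹ * (lam ρ τ + lam ρ ζ) := by
  have la1 := lam_pos ρ τ
  have la2 := lam_pos ρ ζ
  have s1 := inv_pos.mpr (sqrt_jap_pos τ)
  have s2 : (√(jap τ))⁻¹ ≤ 1 := inv_le_one_of_one_le₀ (one_le_sqrt_jap τ)
  have u1 := lam_le_one (by linarith : 0 ≤ ρ) τ
  have n0 : 0 ≤ (√n)⁻¹ := by positivity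
  rcases h with h | h
  · calc _ ≤ 1 * lam ρ ζ * (√n)⁻¹ := by gcongr
      _ ≤ _ := by nlinarith
  · have := (lam_le_inv_sqrt hρ ζ).trans h
    calc _ ≤ lam ρ τ * (√n)⁻¹ * 1 := by gcongr
      _ ≤ _ := by nlinarith

/-- Interactions with at least one high frequency are small. -/
theorem abs_elevation_error_le {ϰ c ρ n : ℝ} (h : 0 < ϰ) (hc : 1 ≤ c) (hϰ : ϰ ≤ c ^ 2)
    (hρ : 1 / 2 ≤ ρ) (hn : 1 ≤ n) {a : ℝ} (ha : |a| ≤ 1) (τ ζ : ℝ) :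
    |a * bsym ϰ (τ + ζ) * etaSym ϰ ρ τ * velSym ρ ζ * (1 - cut n τ * cut n ζ)| ≤
      8 * c * (√n)⁻¹ * (lam ρ τ + lam ρ ζ) := by
  have la1 := lam_pos ρ τ
  have la2 := lam_pos ρ ζ
  have n0 : 0 ≤ (√n)⁻¹ := by positivity
  rcases cut_cases (τ := τ) (ζ := ζ) hn with h0 | ⟨h0, hcut⟩
  · rw [h0, mul_zero, abs_zero]; positivity
  have h1 := bsym_mul_etaSym_le (ρ := ρ) h hc hϰ τ ζ
  have e1 := etaSym_pos h ρ τ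
  have b1 := bsym_pos h (τ + ζ)
  have v1 := velSym_pos ρ ζ
  have j1 := jap_pos τ
  have j2 := jap_pos ζ
  have s1 := inv_pos.mpr (sqrt_jap_pos τ)
  have l1 := lowSym_pos ρ τ
  rw [h0, mul_one, mul_assoc, mul_assoc]
  refine (abs_mul_le_of_abs_le_one ha).trans ?_
  rw [← mul_assoc, abs_of_nonneg (by positivity)]
  have h2 := velSym_le ρ ζ
  have i1 : (jap τ)⁻¹ ≤ 1 := inv_le_one_of_one_le₀ (one_le_jap τ)
  have i2 : (jap ζ)⁻¹ ≤ 1 := inv_le_one_of_one_le₀ (one_le_jap ζ)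
  have h3 : (1 + c * (jap ζ / jap τ)) * (jap ζ)⁻¹ ≤ 2 * c := by
    have : (1 + c * (jap ζ / jap τ)) * (jap ζ)⁻¹ = (jap ζ)⁻¹ + c * (jap τ)⁻¹ := by field_simp
    rw [this]
    nlinarith
  calc _ ≤ ((1 + c * (jap ζ / jap τ)) * lowSym ρ τ) * (2 * (lam ρ ζ * (jap ζ)⁻¹)) := by gcongr
    _ = ((1 + c * (jap ζ / jap τ)) * (jap ζ)⁻¹) * (2 * (lam ρ τ * lam ρ ζ * (√(jap τ))⁻¹)) := by
        unfold lowSym; ring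
    _ ≤ (2 * c) * (2 * ((√n)⁻¹ * (lam ρ τ + lam ρ ζ))) := by
        have := lam_mul_lam_mul_le hρ hcut
        gcongr
    _ ≤ _ := by
        have : 0 ≤ c * ((√n)⁻¹ * (lam ρ τ + lam ρ ζ)) := by positivity
        linarith

theorem abs_velocity_error_le {ρ n : ℝ} (hρ : 1 / 2 ≤ ρ) (hn : 1 ≤ n) {a : ℝ} (ha : |a| ≤ 1)
    (τ ζ : ℝ) :
    |1 / 2 * a * (freq (τ + ζ) * msym (τ + ζ)) * velSym ρ τ * velSym ρ ζ *
      (1 - cut n τ * cut n ζ)| ≤ 4 * (√n)⁻¹ * (lam ρ τ + lam ρ ζ) := by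
  have la1 := lam_pos ρ τ
  have la2 := lam_pos ρ ζ
  have n0 : 0 ≤ (√n)⁻¹ := by positivity
  rcases cut_cases (τ := τ) (ζ := ζ) hn with h0 | ⟨h0, hcut⟩
  · rw [h0, mul_zero, abs_zero]; positivity
  rw [h0, mul_one]
  have l1 := lowSym_pos ρ τ
  calc _ ≤ 4 * (lowSym ρ τ * lowSym ρ ζ) := abs_velocity_kernel_le ha τ ζ
    _ ≤ 4 * (lowSym ρ τ * lam ρ ζ) := by gcongr; exact lowSym_le_lam ρ ζ
    _ = 4 * (lam ρ τ * lam ρ ζ * (√(jap τ))⁻¹) := by unfold lowSym; ring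
    _ ≤ 4 * ((√n)⁻¹ * (lam ρ τ + lam ρ ζ)) := by
        have := lam_mul_lam_mul_le hρ hcut
        gcongr
    _ = _ := by ring

end Kernels

end WhithamBoussinesq
end

noncomputable section
open MeasureTheory
open scoped SchwartzMap ENNReal

namespace WhithamBoussinesq

/-! ### The symmetrized energy -/

section EnergyIdentity

variable {H : Type*} [NormedAddCommGroup H] [InnerProductSpace ℂ H]

/-- Conservation for x' = -iAy, y' = -iAx with A self-adjoint: the two inner products are i times
complex conjugates of each other, up to sign. -/
theorem re_inner_I_smul_add {A : H →L[ℂ] H} (hA : ∀ x y, inner ℂ (A x) y = inner ℂ x (A y))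
    (x y : H) : (inner ℂ x (-(Complex.I • A y))).re + (inner ℂ y (-(Complex.I • A x))).re = 0 := by
  have h : inner ℂ y (A x) = (starRingEnd ℂ) (inner ℂ x (A y)) := by
    rw [inner_conj_symm, hA]
  rw [inner_neg_right, inner_neg_right, inner_smul_right, inner_smul_right, h]
  simp only [Complex.neg_re, Complex.mul_re, Complex.I_re, Complex.I_im, Complex.conj_im,
    Complex.conj_re]
  ring

theorem hasDerivAt_norm_sq' {f : ℝ → H} {f' : H} {t : ℝ} (hf : HasDerivAt f f' t) :
    HasDerivAt (fun t ↦ ‖f t‖ ^ 2) (2 * (inner ℂ (f t) f').re) t := by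
  have h := Complex.reCLM.hasFDerivAt.comp_hasDerivAt t (HasDerivAt.inner ℂ hf hf)
  refine (h.congr_deriv ?_).congr_of_eventuallyEq (Filter.Eventually.of_forall fun s ↦ ?_)
  · have : (inner ℂ f' (f t)).re = (inner ℂ (f t) f').re := by
      rw [← inner_conj_symm, Complex.conj_re]
    simp only [Complex.reCLM_apply, Complex.add_re, this]
    ring
  · simp only [Function.comp_apply, Complex.reCLM_apply]
    rw [inner_self_eq_norm_sq_to_K]
    norm_cast

/-- The symmetrized energy. -/
def energy (c : ℝ) (M S : H →L[ℂ] H) (f g : H) : ℝ :=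
  ‖f‖ ^ 2 + ‖g‖ ^ 2 + c * (‖M f‖ ^ 2 + ‖M g‖ ^ 2) + (inner ℂ (S (M g)) (M g)).re

/-- The energy identity for a linear system with the symmetrizer `S`. -/
theorem hasDerivAt_energy {A M : H →L[ℂ] H} (hA : ∀ x y, inner ℂ (A x) y = inner ℂ x (A y))
    (hM : ∀ x y, inner ℂ (M x) y = inner ℂ x (M y)) (hAM : ∀ x, M (A x) = A (M x))
    {S : ℝ → H →L[ℂ] H} {S' : H →L[ℂ] H} {f g : ℝ → H} {F G : H} {t : ℝ} (c : ℝ)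
    (hS : HasDerivAt S S' t) (hSt : ∀ x y, inner ℂ (S t x) y = inner ℂ x (S t y))
    (hf : HasDerivAt f (-(Complex.I • A (g t)) - Complex.I • A (M (S t (M (g t)))) + F) t)
    (hg : HasDerivAt g (-(Complex.I • A (f t)) + G) t) :
    HasDerivAt (fun t ↦ energy c M (S t) (f t) (g t))
      (2 * (inner ℂ (f t) F).re + 2 * (inner ℂ (g t) G).re
        + 2 * c * ((inner ℂ (f t) (-(Complex.I • M (M (A (M (S t (M (g t))))))))).re
          + (inner ℂ (M (f t)) (M F)).re + (inner ℂ (M (g t)) (M G)).re)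
        + (inner ℂ (M (S' (M (g t)))) (g t)).re + 2 * (inner ℂ (S t (M (g t))) (M G)).re) t := by
  have hMf := (M.restrictScalars ℝ).hasFDerivAt.comp_hasDerivAt t hf
  have hMg := (M.restrictScalars ℝ).hasFDerivAt.comp_hasDerivAt t hg
  have d1 := hasDerivAt_norm_sq' hf
  have d2 := hasDerivAt_norm_sq' hg
  have d3 := hasDerivAt_norm_sq' hMf
  have d4 := hasDerivAt_norm_sq' hMg
  have hSR : HasDerivAt (fun t ↦ (S t).restrictScalars ℝ) (S'.restrictScalars ℝ) t :=
    (ContinuousLinearMap.restrictScalarsL ℂ H H ℝ ℝ).hasFDerivAt.comp_hasDerivAt t hS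
  have hSg := hSR.clm_apply hMg
  have d5 := Complex.reCLM.hasFDerivAt.comp_hasDerivAt t (HasDerivAt.inner ℂ hSg hMg)
  have d := ((d1.add d2).add ((d3.add d4).const_mul c)).add d5
  refine (d.congr_deriv ?_).congr_of_eventuallyEq (Filter.Eventually.of_forall fun s ↦ ?_)
  swap
  · simp [energy]
  simp only [ContinuousLinearMap.coe_restrictScalars', Function.comp_apply, Complex.reCLM_apply,
    Complex.add_re, inner_add_left, inner_add_right, map_add]
  set y := S t (M (g t)) with hy
  have hBA : ∀ x z, inner ℂ ((A ∘L M) x) z = inner ℂ x ((A ∘L M) z) := by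
    intro x z
    rw [ContinuousLinearMap.comp_apply, ContinuousLinearMap.comp_apply, hA, hM, hAM]
  -- Three cancellations: s1 in ‖f‖² + ‖g‖², s2 in its image under M, which commutes with A, and s3
  -- between -iAMSMg in the equation for f and the derivative of ⟨SMg, Mg⟩ along g' = -iAf. For s3
  -- the self-adjoint operator is AM.
  have s1 := re_inner_I_smul_add hA (f t) (g t)
  have s2 := re_inner_I_smul_add hA (M (f t)) (M (g t))
  have s3 := re_inner_I_smul_add hBA (f t) y
  have e1 : (inner ℂ (M (f t)) (-(Complex.I • M (A (M y))))).re =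
      (inner ℂ (f t) (-(Complex.I • M (M (A (M y)))))).re := by
    rw [hM, map_neg, map_smul]
  have e2 : ∀ z, (inner ℂ (S t z) (M (g t))).re = (inner ℂ y z).re := by
    intro z
    rw [hSt, ← inner_conj_symm, Complex.conj_re, ← hy]
  have e3 : (inner ℂ (S' (M (g t))) (M (g t))).re = (inner ℂ (M (S' (M (g t)))) (g t)).re := by
    rw [hM]
  simp only [sub_eq_add_neg, map_add, map_neg, map_smul, inner_add_right,
    Complex.add_re] at s1 s2 s3 e1 ⊢
  simp only [ContinuousLinearMap.comp_apply, hAM, ← map_smul, ← map_neg] at s1 s2 s3 e1 ⊢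
  simp only [e2, e3]
  linear_combination 2 * s1 + 2 * c * s2 + 2 * s3 + 2 * c * e1

/-- The symmetrizer term may be negative, but it is at most c‖Mg‖² in size and so is absorbed by the
term with c. -/
theorem energy_ge {c : ℝ} {M S : H →L[ℂ] H} {f g : H} (hc : 0 ≤ c)
    (hS : ‖S (M g)‖ ≤ c * ‖M g‖) : ‖f‖ ^ 2 + ‖g‖ ^ 2 ≤ energy c M S f g := by
  have h1 : |(inner ℂ (S (M g)) (M g)).re| ≤ ‖S (M g)‖ * ‖M g‖ :=
    (Complex.abs_re_le_norm _).trans (norm_inner_le_norm _ _)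
  have h2 := neg_le_of_abs_le h1
  have h3 : ‖S (M g)‖ * ‖M g‖ ≤ c * ‖M g‖ * ‖M g‖ := by gcongr
  unfold energy
  nlinarith [mul_nonneg hc (sq_nonneg ‖M f‖)]

theorem energy_le {c : ℝ} {M S : H →L[ℂ] H} {f g : H} (hc : 0 ≤ c)
    (hM : ∀ x, ‖M x‖ ≤ ‖x‖) (hS : ‖S (M g)‖ ≤ c * ‖M g‖) :
    energy c M S f g ≤ (1 + 2 * c) * (‖f‖ ^ 2 + ‖g‖ ^ 2) := by
  have h1 : |(inner ℂ (S (M g)) (M g)).re| ≤ ‖S (M g)‖ * ‖M g‖ :=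
    (Complex.abs_re_le_norm _).trans (norm_inner_le_norm _ _)
  have h2 := le_of_abs_le h1
  have h3 : ‖S (M g)‖ * ‖M g‖ ≤ c * ‖M g‖ * ‖M g‖ := by gcongr
  have h4 : ‖M f‖ ^ 2 ≤ ‖f‖ ^ 2 := by gcongr; exact hM f
  have h5 : ‖M g‖ ^ 2 ≤ ‖g‖ ^ 2 := by gcongr; exact hM g
  unfold energy
  nlinarith [mul_le_mul_of_nonneg_left h4 hc, mul_le_mul_of_nonneg_left h5 hc,
    mul_nonneg hc (sq_nonneg ‖f‖)]

end EnergyIdentity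

/-! ### Grönwall's inequality -/

section Gronwall

/-- The function e^{-Dt}E(t) - et is nonincreasing. Differentiability is assumed in the open
interval only, as for solutions here. -/
theorem gronwall_Icc {E E' : ℝ → ℝ} {D e T : ℝ} (he : 0 ≤ e) (hD : 0 ≤ D)
    (hc : ContinuousOn E (Set.Icc 0 T)) (hd : ∀ t ∈ Set.Ioo 0 T, HasDerivAt E (E' t) t)
    (hb : ∀ t ∈ Set.Ioo 0 T, E' t ≤ D * E t + e) {t : ℝ} (ht : t ∈ Set.Icc 0 T) :
    E t ≤ Real.exp (D * t) * (E 0 + e * t) := by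
  have hanti : AntitoneOn (fun t ↦ Real.exp (-(D * t)) * E t - e * t) (Set.Icc 0 T) := by
    refine antitoneOn_of_hasDerivWithinAt_nonpos (convex_Icc 0 T) ?_
      (f' := fun t ↦ (Real.exp (-(D * t)) * (-D)) * E t + Real.exp (-(D * t)) * E' t - e)
      (fun x hx ↦ ?_) (fun x hx ↦ ?_)
    · fun_prop
    · rw [interior_Icc] at hx
      have h1 : HasDerivAt (fun t ↦ Real.exp (-(D * t))) (Real.exp (-(D * x)) * (-D)) x := by
        have : HasDerivAt (fun t ↦ -(D * t)) (-D) x := by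
          simpa only [mul_one] using! ((hasDerivAt_id x).const_mul D).neg
        exact this.exp
      have h2 : HasDerivAt (fun t ↦ e * t) e x := by simpa using (hasDerivAt_id x).const_mul e
      exact ((h1.mul (hd x hx)).sub h2).hasDerivWithinAt
    · rw [interior_Icc] at hx
      have h1 := hb x hx
      have h2 : Real.exp (-(D * x)) ≤ 1 := Real.exp_le_one_iff.mpr (by
        have := mul_nonneg hD hx.1.le; linarith)
      have h3 := Real.exp_pos (-(D * x))
      nlinarith
  have h := hanti (Set.left_mem_Icc.mpr (ht.1.trans ht.2)) ht ht.1
  simp only [mul_zero, neg_zero, Real.exp_zero, one_mul, sub_zero] at h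
  have h3 := Real.exp_pos (D * t)
  have h4 : Real.exp (D * t) * Real.exp (-(D * t)) = 1 := by rw [← Real.exp_add]; simp
  calc E t = Real.exp (D * t) * (Real.exp (-(D * t)) * E t) := by rw [← mul_assoc, h4, one_mul]
    _ ≤ _ := by gcongr; linarith

end Gronwall

/-! ### Ordinary differential equations with locally Lipschitz fields -/

section CutoffODE

variable {X : Type*} [NormedAddCommGroup X]

/-- Maps that are Lipschitz on bounded sets. -/
def LipOnBalls {Y : Type*} [NormedAddCommGroup Y] (F : X → Y) : Prop :=
  ∀ a : ℝ, ∃ L : ℝ, 0 ≤ L ∧ ∀ x y, ‖x‖ ≤ a → ‖y‖ ≤ a → ‖F x - F y‖ ≤ L * ‖x - y‖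

theorem LipOnBalls.exists_bound {Y : Type*} [NormedAddCommGroup Y] {F : X → Y}
    (hF : LipOnBalls F) (a : ℝ) : ∃ L : ℝ, 0 ≤ L ∧ ∀ x, ‖x‖ ≤ a → ‖F x‖ ≤ L := by
  by_cases ha : 0 ≤ a
  · obtain ⟨L, hL, h⟩ := hF a
    refine ⟨‖F 0‖ + L * a, by positivity, fun x hx ↦ ?_⟩
    have := h x 0 hx (by simpa using ha)
    calc ‖F x‖ = ‖F 0 + (F x - F 0)‖ := by congr 1; abel
      _ ≤ ‖F 0‖ + ‖F x - F 0‖ := norm_add_le _ _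
      _ ≤ ‖F 0‖ + L * a := by
          gcongr
          refine this.trans ?_
          gcongr
          simpa using hx
  · exact ⟨0, le_rfl, fun x hx ↦ absurd ((norm_nonneg x).trans hx) ha⟩

theorem LipOnBalls.smul [NormedSpace ℝ X] {θ : X → ℝ} {F : X → X} (hθ : LipOnBalls θ) (hF : LipOnBalls F) :
    LipOnBalls (fun x ↦ θ x • F x) := by
  intro a
  obtain ⟨L, hL, h⟩ := hθ a
  obtain ⟨L', hL', h'⟩ := hF a
  obtain ⟨B, hB, b⟩ := hθ.exists_bound a
  obtain ⟨B', hB', b'⟩ := hF.exists_bound a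
  refine ⟨B * L' + L * B', by positivity, fun x y hx hy ↦ ?_⟩
  calc ‖θ x • F x - θ y • F y‖ = ‖θ x • (F x - F y) + (θ x - θ y) • F y‖ := by
        congr 1; rw [smul_sub, sub_smul]; abel
    _ ≤ ‖θ x‖ * ‖F x - F y‖ + ‖θ x - θ y‖ * ‖F y‖ := by
        rw [← norm_smul, ← norm_smul]; exact norm_add_le _ _
    _ ≤ B * (L' * ‖x - y‖) + (L * ‖x - y‖) * B' := by
        gcongr
        · exact b x hx
        · exact h' x y hx hy
        · exact h x y hx hy
        · exact b' y hy
    _ = _ := by ring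

/-- A locally Lipschitz field with bounded support has global solutions. -/
theorem exists_solution_of_lipOnBalls [NormedSpace ℝ X] [CompleteSpace X] {G : X → X} (hG : LipOnBalls G) {a : ℝ}
    (ha : ∀ x, a ≤ ‖x‖ → G x = 0) (x₀ : X) {T : ℝ} (hT : 0 ≤ T) :
    ∃ u : ℝ → X, u 0 = x₀ ∧ ContinuousOn u (Set.Icc 0 T) ∧
      ∀ t ∈ Set.Ioo 0 T, HasDerivAt u (G (u t)) t := by
  obtain ⟨L, hL, hb⟩ := hG.exists_bound a
  have hb' : ∀ x, ‖G x‖ ≤ L := by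
    intro x
    rcases le_total ‖x‖ a with h | h
    · exact hb x h
    · rw [ha x h, norm_zero]; exact hL
  -- The field is globally bounded by L, so a solution cannot leave the ball of radius LT about x₀
  -- within time T. A Lipschitz constant on that ball gives Picard–Lindelöf on the whole interval at
  -- once.
  obtain ⟨K, hK, hl⟩ := hG (‖x₀‖ + L * T)
  have hPL : IsPicardLindelof (fun _ ↦ G) (tmin := 0) (tmax := T) ⟨0, le_rfl, hT⟩ x₀
      ⟨L * T, by positivity⟩ 0 ⟨L, hL⟩ ⟨K, hK⟩ := by
    refine IsPicardLindelof.of_time_independent (fun x _ ↦ hb' x) ?_ ?_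
    · refine LipschitzOnWith.of_dist_le_mul fun x hx y hy ↦ ?_
      rw [dist_eq_norm, dist_eq_norm]
      have key : ∀ z ∈ Metric.closedBall x₀ (L * T), ‖z‖ ≤ ‖x₀‖ + L * T := by
        intro z hz
        rw [mem_closedBall_iff_norm] at hz
        have := norm_le_norm_add_norm_sub' z x₀
        linarith
      exact hl x y (key x hx) (key y hy)
    · simp only [sub_zero, sub_self, max_eq_left hT]
      exact le_of_eq (by rw [NNReal.coe_zero, sub_zero]; rfl)
  obtain ⟨u, hu0, hu⟩ := hPL.exists_eq_forall_mem_Icc_hasDerivWithinAt₀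
  refine ⟨u, hu0, fun t ht ↦ (hu t ht).continuousWithinAt, fun t ht ↦ ?_⟩
  exact (hu t (Set.Ioo_subset_Icc_self ht)).hasDerivAt (Icc_mem_nhds ht.1 ht.2)

end CutoffODE

end WhithamBoussinesq
end

noncomputable section
open MeasureTheory
open scoped SchwartzMap ENNReal

namespace WhithamBoussinesq

/-! ### Bounds for the operators of the truncated system -/

section Operators

/-- Parameters: `ρ = s - 1`, a bound `c²` for the surface tension and an integer `q ≥ ρ + 2`. -/
structure Params (ϰ c ρ : ℝ) (q : ℕ) : Prop where
  pos : 0 < ϰ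
  one_le : 1 ≤ c
  le_sq : ϰ ≤ c ^ 2
  half_lt : 1 / 2 < ρ
  le_q : ρ + 2 ≤ q

/-- The symbol `kbM` of the dispersion relation, truncated to `⟨k⟩ ≤ n`. -/
def omSym (ϰ n ξ : ℝ) : ℝ := cut n ξ * (freq ξ * bsym ϰ ξ) * msym ξ

/-- The outer symbol in the elevation equation. -/
def elevOut (ϰ ρ n ξ : ℝ) : ℝ := cut n ξ * (bsym ϰ ξ * highSym ρ ξ) * thsym ξ

/-- The outer symbol in the velocity equation. -/
def velOut (ρ n ξ : ℝ) : ℝ := cut n ξ * (1 / 2 * freq ξ * highSym ρ ξ) * msym ξ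

theorem continuous_highSym (ρ : ℝ) : Continuous (highSym ρ) := by
  have : highSym ρ = fun ξ ↦ √(jap ξ) * jap ξ ^ ρ := by ext ξ; rw [highSym, inv_lam]
  rw [this]
  exact continuous_jap.sqrt.mul (continuous_jap.rpow_const fun ξ ↦ Or.inl (jap_pos ξ).ne')

theorem bddSymbol_cut_mul (n : ℝ) {A : ℝ → ℝ} (hA : Continuous A) :
    BddSymbol (fun ξ ↦ cut n ξ * A ξ) := by
  refine ⟨(isCutoff_cut n).measurable.mul hA.measurable, ?_⟩
  obtain ⟨C, hC⟩ := (isCompact_Icc (a := -n) (b := n)).exists_bound_of_continuousOn hA.continuousOn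
  have h0 : 0 ≤ max C 0 := le_max_right _ _
  refine ⟨max C 0, fun ξ ↦ ?_⟩
  change |cut n ξ * A ξ| ≤ _
  unfold cut
  split_ifs with h
  · rw [one_mul]
    refine (hC ξ ?_).trans (le_max_left _ _)
    have h1 := (abs_freq_le_jap ξ).trans h
    have h2 : |ξ| ≤ |2 * Real.pi * ξ| := by
      rw [abs_mul, abs_of_pos (by positivity : 0 < 2 * Real.pi)]
      nlinarith [abs_nonneg ξ, Real.pi_gt_three]
    exact abs_le.mp (h2.trans h1)
  · simp

theorem bddSymbol_of_nonneg_le_one {φ : ℝ → ℝ} (hm : Measurable φ) (h0 : ∀ x, 0 ≤ φ x)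
    (h1 : ∀ x, φ x ≤ 1) : BddSymbol φ :=
  ⟨hm, 1, fun x ↦ by rw [abs_of_nonneg (h0 x)]; exact h1 x⟩

theorem bddSymbol_msym : BddSymbol msym :=
  bddSymbol_of_nonneg_le_one measurable_msym msym_nonneg msym_le_one

theorem bddSymbol_thsym : BddSymbol thsym := ⟨measurable_thsym, 1, abs_thsym_le_one⟩

theorem bddSymbol_cut (n : ℝ) : BddSymbol (cut n) :=
  ⟨(isCutoff_cut n).measurable, 1, (isCutoff_cut n).abs_le_one⟩

theorem bddSymbol_psi {N : ℝ} (hN : 1 ≤ N) : BddSymbol (psi N) :=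
  bddSymbol_of_nonneg_le_one (measurable_psi N) (psi_nonneg hN) (psi_le_one N)

theorem bddSymbol_lowSym {ρ : ℝ} (hρ : 0 ≤ ρ) : BddSymbol (lowSym ρ) :=
  bddSymbol_of_nonneg_le_one (measurable_lowSym ρ) (fun x ↦ (lowSym_pos ρ x).le) (lowSym_le_one hρ)

theorem continuous_bsym (ϰ : ℝ) : Continuous (bsym ϰ) := by unfold bsym; fun_prop

theorem continuous_freq : Continuous freq := by unfold freq; fun_prop

theorem bddSymbol_omSym (ϰ n : ℝ) : BddSymbol (omSym ϰ n) :=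
  (bddSymbol_cut_mul n (continuous_freq.mul (continuous_bsym ϰ))).mul bddSymbol_msym

theorem bddSymbol_elevOut (ϰ ρ n : ℝ) : BddSymbol (elevOut ϰ ρ n) :=
  (bddSymbol_cut_mul n ((continuous_bsym ϰ).mul (continuous_highSym ρ))).mul bddSymbol_thsym

theorem bddSymbol_velOut (ρ n : ℝ) : BddSymbol (velOut ρ n) :=
  (bddSymbol_cut_mul n ((continuous_const.mul continuous_freq).mul (continuous_highSym ρ))).mul
    bddSymbol_msym

/-- This only makes the operators well defined: the constant contains the supremum of A, which may
grow with the truncation. Bounds uniform in the truncation are proved separately from the kernel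
inequalities. -/
theorem admissible_tri {ρ : ℝ} (hρ : 1 / 2 < ρ) {A B C : ℝ → ℝ} (hA : BddSymbol A)
    (hB : Measurable B) (hB' : ∀ x, |B x| ≤ lam ρ x) (hC : BddSymbol C) :
    Admissible (tri A B C) := by
  obtain ⟨a, ha⟩ := hA.2
  obtain ⟨b, hb⟩ := hC.2
  have a0 : 0 ≤ a := (abs_nonneg _).trans (ha 0)
  have b0 : 0 ≤ b := (abs_nonneg _).trans (hb 0)
  refine admissible_of_le (memLp_lam hρ) (measurable_lam ρ) (measurable_tri hA.1 hB hC.1)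
    (C := a * b) (by positivity) fun τ ζ ↦ ?_
  have l1 := lam_pos ρ τ
  have l2 := lam_pos ρ ζ
  rw [tri, abs_mul, abs_mul, abs_of_pos l1, abs_of_pos l2]
  calc _ ≤ a * lam ρ τ * b := by
        gcongr
        exacts [ha _, hB' _, hb _]
    _ ≤ _ := by nlinarith [mul_nonneg (mul_nonneg a0 b0) l2.le]

variable {ϰ c ρ : ℝ} {q : ℕ}

theorem Params.nonneg (hp : Params ϰ c ρ q) : 0 ≤ ρ := by linarith [hp.half_lt]

theorem abs_etaSym_le (hp : Params ϰ c ρ q) (x : ℝ) : |etaSym ϰ ρ x| ≤ lam ρ x := by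
  rw [abs_of_pos (etaSym_pos hp.pos ρ x)]; exact etaSym_le_lam hp.pos ρ x

theorem abs_velSym_le (ρ x : ℝ) : |velSym ρ x| ≤ lam ρ x := by
  rw [abs_of_pos (velSym_pos ρ x)]; exact velSym_le_lam ρ x

theorem bddSymbol_velSym (hρ : 0 ≤ ρ) : BddSymbol (velSym ρ) :=
  bddSymbol_of_nonneg_le_one (measurable_velSym ρ) (fun x ↦ (velSym_pos ρ x).le)
    (fun x ↦ (velSym_le_lam ρ x).trans (lam_le_one hρ x))

/-- Multiplication by the elevation with profile `P`. -/
def sOp (ϰ ρ : ℝ) : L2C →L[ℂ] L2C →L[ℂ] L2C := bil (tri (fun _ ↦ 1) (etaSym ϰ ρ) (fun _ ↦ 1))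

/-- The operator `M`. -/
abbrev mOp : L2C →L[ℂ] L2C := mulOp msym

/-- The nonlinear term in the elevation equation. -/
def nonlinP (ϰ ρ n : ℝ) : L2C →L[ℂ] L2C →L[ℂ] L2C :=
  bil (tri (elevOut ϰ ρ n) (etaSym ϰ ρ) (velSym ρ))

/-- The nonlinear term in the velocity equation. -/
def nonlinQ (ρ n : ℝ) : L2C →L[ℂ] L2C →L[ℂ] L2C :=
  bil (tri (velOut ρ n) (velSym ρ) (velSym ρ))

theorem admissible_sOp (hp : Params ϰ c ρ q) :
    Admissible (tri (fun _ ↦ 1) (etaSym ϰ ρ) (fun _ ↦ 1)) :=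
  admissible_tri hp.half_lt bddSymbol_one (measurable_etaSym ϰ ρ) (abs_etaSym_le hp) bddSymbol_one

theorem admissible_nonlinP (hp : Params ϰ c ρ q) (n : ℝ) :
    Admissible (tri (elevOut ϰ ρ n) (etaSym ϰ ρ) (velSym ρ)) :=
  admissible_tri hp.half_lt (bddSymbol_elevOut ϰ ρ n) (measurable_etaSym ϰ ρ) (abs_etaSym_le hp)
    (bddSymbol_velSym hp.nonneg)

theorem admissible_nonlinQ (hp : Params ϰ c ρ q) (n : ℝ) :
    Admissible (tri (velOut ρ n) (velSym ρ) (velSym ρ)) :=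
  admissible_tri hp.half_lt (bddSymbol_velOut ρ n) (measurable_velSym ρ) (abs_velSym_le ρ)
    (bddSymbol_velSym hp.nonneg)

theorem weightNorm_nonneg (w : ℝ → ℝ) : 0 ≤ weightNorm w := ENNReal.toReal_nonneg

theorem norm_bil_tri_le (hρ : 1 / 2 < ρ) {A B C : ℝ → ℝ} (hA : Measurable A) (hB : Measurable B)
    (hC : Measurable C) {a : ℝ} (ha : 0 ≤ a)
    (h : ∀ τ ζ, |tri A B C τ ζ| ≤ a * (lam ρ τ + lam ρ ζ)) (f g : L2C) :
    ‖bil (tri A B C) f g‖ ≤ 2 * a * weightNorm (lam ρ) * ‖f‖ * ‖g‖ :=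
  norm_bil_le (memLp_lam hρ) (measurable_lam ρ) (measurable_tri hA hB hC) ha
    (fun τ ζ ↦ by rw [abs_of_pos (lam_pos ρ τ), abs_of_pos (lam_pos ρ ζ)]; exact h τ ζ) f g

theorem norm_sOp_le (hp : Params ϰ c ρ q) (P g : L2C) :
    ‖sOp ϰ ρ P g‖ ≤ 2 * weightNorm (lam ρ) * ‖P‖ * ‖g‖ := by
  have h := norm_bil_tri_le hp.half_lt measurable_const (measurable_etaSym ϰ ρ) measurable_const
    zero_le_one (A := fun _ ↦ 1) (C := fun _ ↦ 1) (fun τ ζ ↦ by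
      have := abs_etaSym_le hp τ
      have l2 := lam_pos ρ ζ
      simp only [tri, one_mul, mul_one]
      linarith) P g
  simpa [sOp] using h

theorem norm_mOp_le (f : L2C) : ‖mOp f‖ ≤ ‖f‖ := by
  simpa using norm_mulOp_le bddSymbol_msym (C := 1)
    (fun x ↦ by rw [abs_of_nonneg (msym_nonneg x)]; exact msym_le_one x) f

theorem abs_cut_mul_le (n ξ : ℝ) {a : ℝ} (ha : |a| ≤ 1) : |cut n ξ * a| ≤ 1 := by
  rw [abs_mul]
  exact mul_le_one₀ ((isCutoff_cut n).abs_le_one ξ) (abs_nonneg _) ha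

theorem omSym_mul_msym (ϰ n ξ : ℝ) :
    omSym ϰ n ξ * msym ξ = cut n ξ * thsym ξ * bsym ϰ ξ := by
  rw [← freq_mul_msym_sq, omSym, freq]; ring

/-- `A M (η M g)` as a bilinear map. -/
theorem omOp_mOp_sOp (hp : Params ϰ c ρ q) (n : ℝ) {φ : ℝ → ℝ} (hφ : BddSymbol φ) (P g : L2C) :
    mulOp (omSym ϰ n) (mOp (sOp ϰ ρ P (mOp (mulOp φ g)))) =
      bil (tri (fun x ↦ cut n x * thsym x * bsym ϰ x) (etaSym ϰ ρ) (fun x ↦ msym x * φ x)) P g := by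
  have hA := bddSymbol_omSym ϰ n
  rw [mulOp_mulOp hA bddSymbol_msym, mulOp_mulOp bddSymbol_msym hφ, sOp,
    bil_tri_mulOp_right (admissible_sOp hp) (bddSymbol_msym.mul hφ),
    mulOp_bil_tri _ (hA.mul bddSymbol_msym)]
  · simp only [omSym_mul_msym, mul_one]
  · exact admissible_tri hp.half_lt bddSymbol_one (measurable_etaSym ϰ ρ) (abs_etaSym_le hp)
      ((bddSymbol_msym.mul hφ).mul bddSymbol_one)

theorem measurable_outB (ϰ n : ℝ) : Measurable (fun x ↦ cut n x * thsym x * bsym ϰ x) :=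
  ((isCutoff_cut n).measurable.mul measurable_thsym).mul (measurable_bsym ϰ)

theorem bddSymbol_outB (ϰ n : ℝ) : BddSymbol (fun x ↦ cut n x * thsym x * bsym ϰ x) := by
  have := (bddSymbol_omSym ϰ n).mul bddSymbol_msym
  simpa only [omSym_mul_msym] using this

/-- The price of the coercivity terms in the energy: differentiating c‖Mf‖² brings in M²AMSM. The
symbol of AM has order one, and M² compensates for it. -/
theorem norm_smoothed_le (hp : Params ϰ c ρ q) (n : ℝ) (P g : L2C) :
    ‖mOp (mOp (mulOp (omSym ϰ n) (mOp (sOp ϰ ρ P (mOp g)))))‖ ≤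
      12 * c * weightNorm (lam ρ) * ‖P‖ * ‖g‖ := by
  have h1 := omOp_mOp_sOp hp n bddSymbol_one P g
  rw [mulOp_one] at h1
  have hadm : Admissible (tri (fun x ↦ cut n x * thsym x * bsym ϰ x) (etaSym ϰ ρ)
      (fun x ↦ msym x * 1)) :=
    admissible_tri hp.half_lt (bddSymbol_outB ϰ n) (measurable_etaSym ϰ ρ) (abs_etaSym_le hp)
      (bddSymbol_msym.mul bddSymbol_one)
  rw [h1, mulOp_mulOp bddSymbol_msym bddSymbol_msym, mulOp_bil_tri hadm
    (bddSymbol_msym.mul bddSymbol_msym)]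
  have hc0 : 0 ≤ c := zero_le_one.trans hp.one_le
  refine (norm_bil_tri_le hp.half_lt (a := 6 * c)
    ((measurable_msym.mul measurable_msym).mul (measurable_outB ϰ n))
    (measurable_etaSym ϰ ρ) (measurable_msym.mul_const 1) (by positivity)
    (fun τ ζ ↦ ?_) P g).trans (le_of_eq (by ring))
  have h := abs_smoothed_kernel_le (ρ := ρ) hp.pos hp.one_le hp.le_sq
    (abs_cut_mul_le n (τ + ζ) (abs_thsym_le_one (τ + ζ))) τ ζ
  have e : tri (fun x ↦ msym x * msym x * (cut n x * thsym x * bsym ϰ x)) (etaSym ϰ ρ)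
      (fun x ↦ msym x * 1) τ ζ = cut n (τ + ζ) * thsym (τ + ζ) * bsym ϰ (τ + ζ) *
        msym (τ + ζ) ^ 2 * etaSym ϰ ρ τ * msym ζ := by simp only [tri]; ring
  refine (congrArg abs e).trans_le (h.trans ?_)
  have l2 := lam_pos ρ ζ
  gcongr
  linarith

/-- This controls the symmetrizer whose elevation is replaced by the linear part of its time
derivative: the factor b in ω cancels the b⁻¹ in the elevation symbol. -/
theorem norm_rate_linear_le (hp : Params ϰ c ρ q) (n : ℝ) (Q g : L2C) :
    ‖mOp (sOp ϰ ρ (mulOp (omSym ϰ n) Q) (mOp g))‖ ≤ 2 * weightNorm (lam ρ) * ‖Q‖ * ‖g‖ := by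
  have hA := bddSymbol_omSym ϰ n
  have e0 : (fun x ↦ omSym ϰ n x * etaSym ϰ ρ x) =
      fun x ↦ cut n x * (freq x * msym x) * lowSym ρ x := by
    ext x
    have := (bsym_pos hp.pos x).ne'
    unfold omSym etaSym
    field_simp
  have had1 := admissible_tri hp.half_lt bddSymbol_one (measurable_etaSym ϰ ρ)
    (abs_etaSym_le hp) (bddSymbol_msym.mul bddSymbol_one)
  have had2 := had1.mul_left hA
  rw [sOp, bil_tri_mulOp_right (admissible_sOp hp) bddSymbol_msym,
    bil_tri_mulOp_left had1 hA, mulOp_bil_tri _ bddSymbol_msym, e0]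
  swap
  · convert had2 using 3
    simp only [tri]; ring
  refine (norm_bil_tri_le hp.half_lt (a := 1) (measurable_msym.mul_const 1)
    (((isCutoff_cut n).measurable.mul (measurable_freq.mul measurable_msym)).mul
      (measurable_lowSym ρ)) (measurable_msym.mul_const 1) zero_le_one
    (fun τ ζ ↦ ?_) Q g).trans (le_of_eq (by ring))
  have h := abs_rate_kernel_le (ρ := ρ) ((isCutoff_cut n).abs_le_one τ) τ ζ
  simp only [tri, mul_one, one_mul, Pi.mul_apply]
  have l2 := lam_pos ρ ζ
  linarith

/-- The nonlinear part of ∂ₜη is tanh D(ηv), which lies in H^ρ by the algebra property;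
multiplication by an element of H^ρ is then bounded on L². These two uses of Young's inequality give
the square of the weight norm. -/
theorem norm_rate_nonlinear_le (hp : Params ϰ c ρ q) (n : ℝ) (P Q g : L2C) :
    ‖sOp ϰ ρ (nonlinP ϰ ρ n P Q) g‖ ≤
      4 * 2 ^ ρ * weightNorm (lam ρ) ^ 2 * ‖P‖ * ‖Q‖ * ‖g‖ := by
  set σ : ℝ → ℝ := fun x ↦ (bsym ϰ x)⁻¹ * (√(jap x))⁻¹ with hσ
  have hσb : BddSymbol σ := by
    refine bddSymbol_of_nonneg_le_one ((measurable_bsym ϰ).inv.mul measurable_jap.sqrt.inv)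
      (fun x ↦ ?_) (fun x ↦ ?_)
    · have := bsym_pos hp.pos x; positivity
    · exact mul_le_one₀ (inv_le_one_of_one_le₀ (one_le_bsym hp.pos x)) (by positivity)
        (inv_le_one_of_one_le₀ (one_le_sqrt_jap x))
  have hl : Admissible (tri (fun _ ↦ 1) (lam ρ) (fun _ ↦ 1)) :=
    admissible_tri hp.half_lt bddSymbol_one (measurable_lam ρ)
      (fun x ↦ (abs_of_pos (lam_pos ρ x)).le) bddSymbol_one
  have e1 : sOp ϰ ρ (nonlinP ϰ ρ n P Q) g =
      bil (tri (fun _ ↦ 1) (lam ρ) (fun _ ↦ 1)) (mulOp σ (nonlinP ϰ ρ n P Q)) g := by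
    rw [bil_tri_mulOp_left hl hσb, sOp]
    congr 4; ext x; simp only [hσ, etaSym, lowSym]; ring
  have e2 : (fun x ↦ σ x * elevOut ϰ ρ n x) = fun x ↦ cut n x * thsym x * (lam ρ x)⁻¹ := by
    ext x
    have h1 := (bsym_pos hp.pos x).ne'
    have h2 := (sqrt_jap_pos x).ne'
    simp only [hσ, elevOut, highSym]
    field_simp
  have h1 : ‖mulOp σ (nonlinP ϰ ρ n P Q)‖ ≤ 2 * 2 ^ ρ * weightNorm (lam ρ) * ‖P‖ * ‖Q‖ := by
    rw [nonlinP, mulOp_bil_tri (admissible_nonlinP hp n) hσb, e2]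
    refine norm_bil_tri_le hp.half_lt (((isCutoff_cut n).measurable.mul measurable_thsym).mul
      (measurable_lam ρ).inv) (measurable_etaSym ϰ ρ) (measurable_velSym ρ) (by positivity)
      (fun τ ζ ↦ ?_) P Q
    exact abs_product_kernel_le hp.pos hp.nonneg
      (abs_cut_mul_le n (τ + ζ) (abs_thsym_le_one (τ + ζ))) τ ζ
  have h2 := norm_bil_tri_le hp.half_lt measurable_const (measurable_lam ρ) measurable_const
    zero_le_one (A := fun _ ↦ 1) (C := fun _ ↦ 1) (fun τ ζ ↦ by
      have l1 := lam_pos ρ τ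
      have l2 := lam_pos ρ ζ
      simp only [tri, one_mul, mul_one, abs_of_pos l1]
      linarith) (mulOp σ (nonlinP ϰ ρ n P Q)) g
  have hw := weightNorm_nonneg (lam ρ)
  rw [e1]
  calc _ ≤ 2 * 1 * weightNorm (lam ρ) * (2 * 2 ^ ρ * weightNorm (lam ρ) * ‖P‖ * ‖Q‖) * ‖g‖ := by
        refine h2.trans ?_; gcongr
    _ = _ := by ring

/-- The derivative losing term is isolated: once AMSM applied to the weighted Q is subtracted, the
kernel contains the increment φ(τ + ζ) - φ(ζ) of the weight, whose gain offsets the order of b. The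
constant is independent of n and N. -/
theorem norm_commutator_le (hp : Params ϰ c ρ q) (n : ℝ) {N : ℝ} (hN : 1 ≤ N) (P Q : L2C) :
    ‖mulOp (psi N) (nonlinP ϰ ρ n P Q) -
      mulOp (omSym ϰ n) (mOp (sOp ϰ ρ P (mOp (mulOp (psi N) Q))))‖ ≤
      2 * c * ((q + 1) * 2 ^ q) * weightNorm (lam ρ) *
        (‖mulOp (psi N) P‖ * ‖Q‖ + ‖P‖ * ‖mulOp (psi N) Q‖) := by
  have hψ := bddSymbol_psi hN
  have hc0 : 0 ≤ c := zero_le_one.trans hp.one_le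
  have had1 : Admissible (tri (fun x ↦ psi N x * elevOut ϰ ρ n x) (etaSym ϰ ρ) (velSym ρ)) :=
    admissible_tri hp.half_lt (hψ.mul (bddSymbol_elevOut ϰ ρ n)) (measurable_etaSym ϰ ρ)
      (abs_etaSym_le hp) (bddSymbol_velSym hp.nonneg)
  have had2 : Admissible (tri (fun x ↦ cut n x * thsym x * bsym ϰ x) (etaSym ϰ ρ)
      (fun x ↦ msym x * psi N x)) :=
    admissible_tri hp.half_lt (bddSymbol_outB ϰ n) (measurable_etaSym ϰ ρ) (abs_etaSym_le hp)
      (bddSymbol_msym.mul hψ)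
  set L : ℝ → ℝ → ℝ := fun τ ζ ↦ cut n (τ + ζ) * thsym (τ + ζ) * (bsym ϰ (τ + ζ) *
    etaSym ϰ ρ τ * ((phi ρ N (τ + ζ) - phi ρ N ζ) * velSym ρ ζ)) with hL
  -- The weighted nonlinearity carries φ(τ + ζ) times the velocity symbol at ζ; the principal term
  -- carries M(ζ)ψ(ζ), which is φ(ζ) times the same symbol.
  have hLe : ∀ τ ζ, L τ ζ = tri (fun x ↦ psi N x * elevOut ϰ ρ n x) (etaSym ϰ ρ) (velSym ρ) τ ζ -
      tri (fun x ↦ cut n x * thsym x * bsym ϰ x) (etaSym ϰ ρ) (fun x ↦ msym x * psi N x) τ ζ := by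
    intro τ ζ
    have e1 : phi ρ N ζ * velSym ρ ζ = msym ζ * psi N ζ := by
      rw [velSym, mul_left_comm, phi_mul_lowSym]
    have e2 : phi ρ N (τ + ζ) = psi N (τ + ζ) * highSym ρ (τ + ζ) := rfl
    simp only [hL, tri, sub_mul, e1, e2, elevOut]
    ring
  have hLm : Measurable (Function.uncurry L) := by
    have : Function.uncurry L = fun p ↦ Function.uncurry (tri (fun x ↦ psi N x * elevOut ϰ ρ n x)
        (etaSym ϰ ρ) (velSym ρ)) p - Function.uncurry (tri (fun x ↦ cut n x * thsym x * bsym ϰ x)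
        (etaSym ϰ ρ) (fun x ↦ msym x * psi N x)) p := by
      ext ⟨τ, ζ⟩; exact hLe τ ζ
    rw [this]
    exact had1.1.sub had2.1
  have hLb : ∀ τ ζ, |L τ ζ| ≤ 2 * c * ((q + 1) * 2 ^ q) *
      (|psi N τ| * |lam ρ ζ| + |lam ρ τ| * |psi N ζ|) := by
    intro τ ζ
    rw [abs_of_nonneg (psi_nonneg hN τ), abs_of_nonneg (psi_nonneg hN ζ),
      abs_of_pos (lam_pos ρ τ), abs_of_pos (lam_pos ρ ζ)]
    exact abs_commutator_kernel_le hp.pos hp.one_le hp.le_sq hp.nonneg hp.le_q hN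
      (abs_cut_mul_le n (τ + ζ) (abs_thsym_le_one (τ + ζ))) τ ζ
  have hLa : Admissible L := admissible_of_le_symbol (memLp_lam hp.half_lt) (measurable_lam ρ)
    hψ hψ hLm (by positivity) hLb
  rw [nonlinP, mulOp_bil_tri (admissible_nonlinP hp n) hψ, omOp_mOp_sOp hp n hψ,
    bil_sub_bil had1 had2 hLa hLe]
  exact norm_bil_le_symbol (memLp_lam hp.half_lt) (measurable_lam ρ) hψ hψ hLm (by positivity)
    hLb P Q

/-- No commutator is needed: the half derivative is absorbed by the two factors M, and the weight at
the sum is dominated by the weights at the two frequencies. -/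
theorem norm_weighted_nonlinQ_le (hp : Params ϰ c ρ q) (n : ℝ) {N : ℝ} (hN : 1 ≤ N) (Q : L2C) :
    ‖mulOp (psi N) (nonlinQ ρ n Q Q)‖ ≤
      8 * 2 ^ q * weightNorm (lam ρ) * ‖Q‖ * ‖mulOp (psi N) Q‖ := by
  have hψ := bddSymbol_psi hN
  rw [nonlinQ, mulOp_bil_tri (admissible_nonlinQ hp n) hψ]
  have := norm_bil_le_symbol (memLp_lam hp.half_lt) (measurable_lam ρ) hψ hψ
    (K := tri (fun x ↦ psi N x * velOut ρ n x) (velSym ρ) (velSym ρ)) (C := 4 * 2 ^ q)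
    (measurable_tri (hψ.mul (bddSymbol_velOut ρ n)).1 (measurable_velSym ρ) (measurable_velSym ρ))
    (by positivity) (fun τ ζ ↦ ?_) Q Q
  · linarith
  · rw [abs_of_nonneg (psi_nonneg hN τ), abs_of_nonneg (psi_nonneg hN ζ),
      abs_of_pos (lam_pos ρ τ), abs_of_pos (lam_pos ρ ζ)]
    have h := abs_weighted_velocity_kernel_le hp.nonneg hp.le_q hN
      ((isCutoff_cut n).abs_le_one (τ + ζ)) τ ζ
    have e : tri (fun x ↦ psi N x * velOut ρ n x) (velSym ρ) (velSym ρ) τ ζ =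
        phi ρ N (τ + ζ) * (1 / 2 * cut n (τ + ζ) * (freq (τ + ζ) * msym (τ + ζ)) * velSym ρ τ *
          velSym ρ ζ) := by
      have e2 : phi ρ N (τ + ζ) = psi N (τ + ζ) * highSym ρ (τ + ζ) := rfl
      simp only [tri, velOut, e2]
      ring
    rw [e]
    exact h

end Operators

end WhithamBoussinesq
end

noncomputable section
open MeasureTheory
open scoped SchwartzMap ENNReal

namespace WhithamBoussinesq

/-! ### Estimates in the weak norm with weight ⟨k⟩^{-r} -/

section Differences

variable {ϰ c ρ : ℝ} {q : ℕ}

/-- The outer symbol in the velocity equation, without the weight. -/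
def velOutLow (n ξ : ℝ) : ℝ := 1 / 2 * cut n ξ * (freq ξ * msym ξ)

theorem lowSym_mul_elevOut (ϰ ρ n x : ℝ) :
    lowSym ρ x * elevOut ϰ ρ n x = cut n x * thsym x * bsym ϰ x := by
  have h := lowSym_mul_highSym ρ x
  unfold elevOut
  linear_combination cut n x * thsym x * bsym ϰ x * h

theorem lowSym_mul_velOut (ρ n x : ℝ) : lowSym ρ x * velOut ρ n x = velOutLow n x := by
  have h := lowSym_mul_highSym ρ x
  unfold velOut velOutLow
  linear_combination 1 / 2 * cut n x * (freq x * msym x) * h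

theorem measurable_velOutLow (n : ℝ) : Measurable (velOutLow n) :=
  (measurable_const.mul (isCutoff_cut n).measurable).mul (measurable_freq.mul measurable_msym)

theorem bddSymbol_velOutLow (n : ℝ) : BddSymbol (velOutLow n) := by
  have h := (bddSymbol_lowSym (ρ := 1) zero_le_one).mul (bddSymbol_velOut 1 n)
  simpa only [lowSym_mul_velOut] using h

theorem low_nonlinP (hp : Params ϰ c ρ q) (n : ℝ) (P Q : L2C) :
    mulOp (lowSym ρ) (nonlinP ϰ ρ n P Q) =
      bil (tri (fun x ↦ cut n x * thsym x * bsym ϰ x) (etaSym ϰ ρ) (velSym ρ)) P Q := by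
  rw [nonlinP, mulOp_bil_tri (admissible_nonlinP hp n) (bddSymbol_lowSym hp.nonneg)]
  simp only [lowSym_mul_elevOut]

theorem low_nonlinQ (hp : Params ϰ c ρ q) (n : ℝ) (P Q : L2C) :
    mulOp (lowSym ρ) (nonlinQ ρ n P Q) = bil (tri (velOutLow n) (velSym ρ) (velSym ρ)) P Q := by
  rw [nonlinQ, mulOp_bil_tri (admissible_nonlinQ hp n) (bddSymbol_lowSym hp.nonneg)]
  simp only [lowSym_mul_velOut]

/-- In the weak norm the principal term is exact, with no commutator: the weight ⟨k⟩^{-r} cancels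
the outer ⟨k⟩^r, and the velocity symbol is M times that same weight. -/
theorem low_nonlinP_eq (hp : Params ϰ c ρ q) (n : ℝ) (P Q : L2C) :
    mulOp (lowSym ρ) (nonlinP ϰ ρ n P Q) =
      mulOp (omSym ϰ n) (mOp (sOp ϰ ρ P (mOp (mulOp (lowSym ρ) Q)))) := by
  rw [low_nonlinP hp, omOp_mOp_sOp hp n (bddSymbol_lowSym hp.nonneg)]
  rfl

/-- For the part of a difference where the elevations differ: the first argument needs only the weak
norm if the second is bounded in the strong one. -/
theorem norm_low_nonlinP_le (hp : Params ϰ c ρ q) (n : ℝ) (P Q : L2C) :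
    ‖mulOp (lowSym ρ) (nonlinP ϰ ρ n P Q)‖ ≤
      8 * c * weightNorm (lam ρ) * ‖mulOp (lowSym ρ) P‖ * ‖Q‖ := by
  have hc0 : 0 ≤ c := zero_le_one.trans hp.one_le
  have hm : Measurable fun x ↦ (bsym ϰ x)⁻¹ := (measurable_bsym ϰ).inv
  have hK : ∀ τ ζ, |tri (fun x ↦ cut n x * thsym x * bsym ϰ x) (fun x ↦ (bsym ϰ x)⁻¹)
      (velSym ρ) τ ζ| ≤ 4 * c * (lam ρ τ + lam ρ ζ) := by
    intro τ ζ
    have h := abs_elevation_kernel_le (ρ := ρ) hp.pos hp.one_le hp.le_sq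
      (abs_cut_mul_le n (τ + ζ) (abs_thsym_le_one (τ + ζ))) τ ζ
    have l1 := lam_pos ρ τ
    refine h.trans ?_
    gcongr
    linarith
  have had : Admissible (tri (fun x ↦ cut n x * thsym x * bsym ϰ x) (fun x ↦ (bsym ϰ x)⁻¹)
      (velSym ρ)) :=
    admissible_of_le (memLp_lam hp.half_lt) (measurable_lam ρ)
      (measurable_tri (measurable_outB ϰ n) hm (measurable_velSym ρ)) (C := 4 * c) (by positivity)
      fun τ ζ ↦ by
        rw [abs_of_pos (lam_pos ρ τ), abs_of_pos (lam_pos ρ ζ)]; exact hK τ ζ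
  have e : (fun x ↦ lowSym ρ x * (bsym ϰ x)⁻¹) = etaSym ϰ ρ := by
    ext x; rw [etaSym]; ring
  rw [low_nonlinP hp, ← e, ← bil_tri_mulOp_left had (bddSymbol_lowSym hp.nonneg)]
  refine (norm_bil_tri_le hp.half_lt (measurable_outB ϰ n) hm (measurable_velSym ρ)
    (a := 4 * c) (by positivity) hK _ _).trans (le_of_eq (by ring))

theorem norm_low_nonlinQ_le_right (hp : Params ϰ c ρ q) (n : ℝ) (P Q : L2C) :
    ‖mulOp (lowSym ρ) (nonlinQ ρ n P Q)‖ ≤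
      4 * weightNorm (lam ρ) * ‖P‖ * ‖mulOp (lowSym ρ) Q‖ := by
  have had : Admissible (tri (velOutLow n) (velSym ρ) msym) :=
    admissible_tri hp.half_lt (bddSymbol_velOutLow n) (measurable_velSym ρ) (abs_velSym_le ρ)
      bddSymbol_msym
  have e : (fun x ↦ lowSym ρ x * msym x) = velSym ρ := by
    ext x; rw [velSym]; ring
  have h1 : bil (tri (velOutLow n) (velSym ρ) (velSym ρ)) P Q =
      bil (tri (velOutLow n) (velSym ρ) msym) P (mulOp (lowSym ρ) Q) := by
    rw [bil_tri_mulOp_right had (bddSymbol_lowSym hp.nonneg), e]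
  rw [low_nonlinQ hp, h1]
  refine (norm_bil_tri_le hp.half_lt (measurable_velOutLow n) (measurable_velSym ρ)
    measurable_msym (a := 2) (by positivity) (fun τ ζ ↦ ?_) _ _).trans (le_of_eq (by ring))
  have h := abs_transport_kernel_le (ρ := ρ) ((isCutoff_cut n).abs_le_one (τ + ζ)) τ ζ
  have l1 := lam_pos ρ ζ
  exact h.trans (by linarith)

theorem norm_low_nonlinQ_le_left (hp : Params ϰ c ρ q) (n : ℝ) (P Q : L2C) :
    ‖mulOp (lowSym ρ) (nonlinQ ρ n P Q)‖ ≤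
      4 * weightNorm (lam ρ) * ‖mulOp (lowSym ρ) P‖ * ‖Q‖ := by
  have hK : ∀ τ ζ, |tri (velOutLow n) msym (velSym ρ) τ ζ| ≤ 2 * (lam ρ τ + lam ρ ζ) := by
    intro τ ζ
    have h := abs_transport_kernel_le (ρ := ρ) ((isCutoff_cut n).abs_le_one (ζ + τ)) ζ τ
    have l1 := lam_pos ρ τ
    have e : tri (velOutLow n) msym (velSym ρ) τ ζ =
        1 / 2 * cut n (ζ + τ) * (freq (ζ + τ) * msym (ζ + τ)) * velSym ρ ζ * msym τ := by
      rw [tri, velOutLow, add_comm τ ζ]; ring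
    rw [e]
    exact h.trans (by linarith)
  have hm := measurable_tri (measurable_velOutLow n) measurable_msym (measurable_velSym ρ)
  have had : Admissible (tri (velOutLow n) msym (velSym ρ)) :=
    admissible_of_le (memLp_lam hp.half_lt) (measurable_lam ρ) hm (C := 2) (by positivity)
      fun τ ζ ↦ by
        rw [abs_of_pos (lam_pos ρ τ), abs_of_pos (lam_pos ρ ζ)]; exact hK τ ζ
  have e : (fun x ↦ lowSym ρ x * msym x) = velSym ρ := by
    ext x; rw [velSym]; ring
  have h1 : bil (tri (velOutLow n) (velSym ρ) (velSym ρ)) P Q =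
      bil (tri (velOutLow n) msym (velSym ρ)) (mulOp (lowSym ρ) P) Q := by
    rw [bil_tri_mulOp_left had (bddSymbol_lowSym hp.nonneg), e]
  rw [low_nonlinQ hp, h1]
  exact (norm_bil_tri_le hp.half_lt (measurable_velOutLow n) measurable_msym (measurable_velSym ρ)
    (a := 2) (by positivity) hK _ _).trans (le_of_eq (by ring))

/-- Truncating both arguments multiplies the kernel by cut(τ)cut(ζ), so the error involves only
interactions with a high frequency. -/
theorem norm_bil_sub_cut_le (hρ : 1 / 2 < ρ) {K : ℝ → ℝ → ℝ} (had : Admissible K) {n a : ℝ}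
    (ha : 0 ≤ a)
    (hK : ∀ τ ζ, |K τ ζ * (1 - cut n τ * cut n ζ)| ≤ a * (lam ρ τ + lam ρ ζ)) (f g : L2C) :
    ‖bil K f g - bil K (mulOp (cut n) f) (mulOp (cut n) g)‖ ≤
      2 * a * weightNorm (lam ρ) * ‖f‖ * ‖g‖ := by
  have hcb := bddSymbol_cut n
  have had1 := had.mul_right hcb
  have had2 := had1.mul_left hcb
  set L : ℝ → ℝ → ℝ := fun τ ζ ↦ K τ ζ * (1 - cut n τ * cut n ζ) with hL
  have e : ∀ τ ζ, L τ ζ = K τ ζ - cut n τ * (cut n ζ * K τ ζ) := by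
    intro τ ζ; simp only [hL]; ring
  have hm : Measurable (Function.uncurry L) := by
    have : Function.uncurry L = fun p ↦ Function.uncurry K p -
        Function.uncurry (fun τ ζ ↦ cut n τ * (cut n ζ * K τ ζ)) p := by
      ext ⟨τ, ζ⟩; exact e τ ζ
    rw [this]
    exact had.1.sub had2.1
  have hb : ∀ τ ζ, |L τ ζ| ≤ a * (|lam ρ τ| + |lam ρ ζ|) := by
    intro τ ζ
    rw [abs_of_pos (lam_pos ρ τ), abs_of_pos (lam_pos ρ ζ)]; exact hK τ ζ
  have hLa := admissible_of_le (memLp_lam hρ) (measurable_lam ρ) hm ha hb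
  rw [bil_mulOp_right had hcb, bil_mulOp_left had1 hcb, bil_sub_bil had had2 hLa e]
  exact norm_bil_le (memLp_lam hρ) (measurable_lam ρ) hm ha hb f g

theorem norm_low_nonlinP_sub_cut_le (hp : Params ϰ c ρ q) {n : ℝ} (hn : 1 ≤ n) (P Q : L2C) :
    ‖mulOp (lowSym ρ) (nonlinP ϰ ρ n P Q) -
      mulOp (lowSym ρ) (nonlinP ϰ ρ n (mulOp (cut n) P) (mulOp (cut n) Q))‖ ≤
      16 * c * weightNorm (lam ρ) * (√n)⁻¹ * ‖P‖ * ‖Q‖ := by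
  have hc0 : 0 ≤ c := zero_le_one.trans hp.one_le
  have had := admissible_tri hp.half_lt (bddSymbol_outB ϰ n) (measurable_etaSym ϰ ρ)
    (abs_etaSym_le hp) (bddSymbol_velSym hp.nonneg)
  rw [low_nonlinP hp, low_nonlinP hp]
  refine (norm_bil_sub_cut_le hp.half_lt had (a := 8 * c * (√n)⁻¹) (by positivity)
    (fun τ ζ ↦ ?_) P Q).trans (le_of_eq (by ring))
  exact abs_elevation_error_le hp.pos hp.one_le hp.le_sq hp.half_lt.le hn
    (abs_cut_mul_le n (τ + ζ) (abs_thsym_le_one (τ + ζ))) τ ζ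

theorem norm_low_nonlinQ_sub_cut_le (hp : Params ϰ c ρ q) {n : ℝ} (hn : 1 ≤ n) (P Q : L2C) :
    ‖mulOp (lowSym ρ) (nonlinQ ρ n P Q) -
      mulOp (lowSym ρ) (nonlinQ ρ n (mulOp (cut n) P) (mulOp (cut n) Q))‖ ≤
      8 * weightNorm (lam ρ) * (√n)⁻¹ * ‖P‖ * ‖Q‖ := by
  have had := admissible_tri hp.half_lt (bddSymbol_velOutLow n) (measurable_velSym ρ)
    (abs_velSym_le ρ) (bddSymbol_velSym hp.nonneg)
  rw [low_nonlinQ hp, low_nonlinQ hp]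
  refine (norm_bil_sub_cut_le hp.half_lt had (a := 4 * (√n)⁻¹) (by positivity)
    (fun τ ζ ↦ ?_) P Q).trans (le_of_eq (by ring))
  exact abs_velocity_error_le hp.half_lt.le hn ((isCutoff_cut n).abs_le_one (τ + ζ)) τ ζ

end Differences

/-! ### The energy estimate for an abstract symmetrizable system -/

section AbstractEstimate

variable {H : Type*} [NormedAddCommGroup H] [InnerProductSpace ℂ H]

theorem re_inner_le (x y : H) : (inner ℂ x y).re ≤ ‖x‖ * ‖y‖ :=
  (Complex.re_le_norm _).trans (norm_inner_le_norm _ _)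

/-- The quantities u₁, …, u₇ are the seven real parts in `hasDerivAt_energy`, in that order, with x
= ‖f‖ and y = ‖g‖. -/
theorem energy_rate_le {a c ε x y E u₁ u₂ u₃ u₄ u₅ u₆ u₇ : ℝ} (hc : 0 ≤ c) (ha : 0 ≤ a)
    (hE : x ^ 2 + y ^ 2 ≤ E) (h₁ : u₁ ≤ x * (a * (x + y) + ε)) (h₂ : u₂ ≤ y * (a * (x + y) + ε))
    (h₃ : u₃ ≤ x * (a * y)) (h₄ : u₄ ≤ x * (a * (x + y) + ε)) (h₅ : u₅ ≤ y * (a * (x + y) + ε))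
    (h₆ : u₆ ≤ a * y * y) (h₇ : u₇ ≤ c * y * (a * (x + y) + ε)) :
    2 * u₁ + 2 * u₂ + 2 * c * (u₃ + u₄ + u₅) + u₆ + 2 * u₇ ≤
      ((5 + 9 * c) * a + (1 + 2 * c)) * E + (2 + 4 * c) * ε ^ 2 := by
  have tot : 2 * (x * (a * (x + y) + ε)) + 2 * (y * (a * (x + y) + ε)) ≤
      4 * a * (x ^ 2 + y ^ 2) + 2 * ε ^ 2 + (x ^ 2 + y ^ 2) := by
    linarith [mul_nonneg ha (sq_nonneg (x - y)), sq_nonneg (ε - x), sq_nonneg (ε - y)]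
  have r3 : 2 * (x * (a * y)) ≤ a * (x ^ 2 + y ^ 2) := by
    linarith [mul_nonneg ha (sq_nonneg (x - y))]
  have r4 : a * y * y ≤ a * (x ^ 2 + y ^ 2) := by linarith [mul_nonneg ha (sq_nonneg x)]
  have r5 : 2 * (y * (a * (x + y) + ε)) ≤
      4 * a * (x ^ 2 + y ^ 2) + 2 * ε ^ 2 + (x ^ 2 + y ^ 2) := by
    linarith [mul_nonneg ha (sq_nonneg (x - y)), mul_nonneg ha (sq_nonneg x),
      mul_nonneg ha (sq_nonneg y), sq_nonneg (ε - y), sq_nonneg ε, sq_nonneg x]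
  have w1 := mul_le_mul_of_nonneg_left tot hc
  have w2 := mul_le_mul_of_nonneg_left r3 hc
  have w3 := mul_le_mul_of_nonneg_left r5 hc
  have w4 := mul_le_mul_of_nonneg_left (add_le_add (add_le_add h₃ h₄) h₅) hc
  have w5 : ((5 + 9 * c) * a + (1 + 2 * c)) * (x ^ 2 + y ^ 2) ≤
      ((5 + 9 * c) * a + (1 + 2 * c)) * E := by gcongr
  linarith

/-- The energy estimate for a linear system with a symmetrizer. -/
theorem energy_estimate {A M : H →L[ℂ] H} (hA : ∀ x y, inner ℂ (A x) y = inner ℂ x (A y))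
    (hM : ∀ x y, inner ℂ (M x) y = inner ℂ x (M y)) (hAM : ∀ x, M (A x) = A (M x))
    (hM1 : ∀ x, ‖M x‖ ≤ ‖x‖) {S S' : ℝ → H →L[ℂ] H} {f g F G : ℝ → H} {c a ε T : ℝ}
    (hc : 0 ≤ c) (ha : 0 ≤ a) (hScont : ContinuousOn S (Set.Icc 0 T))
    (hfcont : ContinuousOn f (Set.Icc 0 T)) (hgcont : ContinuousOn g (Set.Icc 0 T))
    (hS : ∀ t ∈ Set.Ioo 0 T, HasDerivAt S (S' t) t)
    (hSb : ∀ t ∈ Set.Icc 0 T, ∀ x, ‖S t x‖ ≤ c * ‖x‖)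
    (hSt : ∀ t ∈ Set.Ioo 0 T, ∀ x y, inner ℂ (S t x) y = inner ℂ x (S t y))
    (hf : ∀ t ∈ Set.Ioo 0 T,
      HasDerivAt f (-(Complex.I • A (g t)) - Complex.I • A (M (S t (M (g t)))) + F t) t)
    (hg : ∀ t ∈ Set.Ioo 0 T, HasDerivAt g (-(Complex.I • A (f t)) + G t) t)
    (hF : ∀ t ∈ Set.Ioo 0 T, ‖F t‖ ≤ a * (‖f t‖ + ‖g t‖) + ε)
    (hG : ∀ t ∈ Set.Ioo 0 T, ‖G t‖ ≤ a * (‖f t‖ + ‖g t‖) + ε)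
    (hMS : ∀ t ∈ Set.Ioo 0 T, ‖M (M (A (M (S t (M (g t))))))‖ ≤ a * ‖g t‖)
    (hS' : ∀ t ∈ Set.Ioo 0 T, ‖M (S' t (M (g t)))‖ ≤ a * ‖g t‖) {t : ℝ} (ht : t ∈ Set.Icc 0 T) :
    ‖f t‖ ^ 2 + ‖g t‖ ^ 2 ≤ Real.exp (((5 + 9 * c) * a + (1 + 2 * c)) * t) *
      ((1 + 2 * c) * (‖f 0‖ ^ 2 + ‖g 0‖ ^ 2) + (2 + 4 * c) * ε ^ 2 * t) := by
  have h0 : (0 : ℝ) ∈ Set.Icc 0 T := Set.left_mem_Icc.mpr (ht.1.trans ht.2)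
  have hE : ∀ s ∈ Set.Icc 0 T, ‖f s‖ ^ 2 + ‖g s‖ ^ 2 ≤ energy c M (S s) (f s) (g s) :=
    fun s hs ↦ energy_ge hc (hSb s hs _)
  have hcont : ContinuousOn (fun t ↦ energy c M (S t) (f t) (g t)) (Set.Icc 0 T) := by
    have hMf := M.continuous.comp_continuousOn hfcont
    have hMg := M.continuous.comp_continuousOn hgcont
    have hin := Complex.continuous_re.comp_continuousOn ((hScont.clm_apply hMg).inner hMg)
    exact (((hfcont.norm.pow 2).add (hgcont.norm.pow 2)).add
      (((hMf.norm.pow 2).add (hMg.norm.pow 2)).const_mul c)).add hin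
  have key := gronwall_Icc (D := (5 + 9 * c) * a + (1 + 2 * c)) (e := (2 + 4 * c) * ε ^ 2)
    (by positivity) (by positivity) hcont
    (fun s hs ↦ hasDerivAt_energy hA hM hAM c (hS s hs) (hSt s hs) (hf s hs) (hg s hs))
    (fun s hs ↦ ?_) ht
  · refine (hE t ht).trans (key.trans ?_)
    gcongr
    exact energy_le hc hM1 (hSb 0 h0 _)
  · have hs' := Set.Ioo_subset_Icc_self hs
    have k1 := re_inner_le (f s) (F s)
    have k2 := re_inner_le (g s) (G s)
    have k3 := re_inner_le (f s) (-(Complex.I • M (M (A (M (S s (M (g s))))))))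
    rw [norm_neg, norm_smul, Complex.norm_I, one_mul] at k3
    have k4 := re_inner_le (M (f s)) (M (F s))
    have k5 := re_inner_le (M (g s)) (M (G s))
    have k6 := re_inner_le (M (S' s (M (g s)))) (g s)
    have k7 := re_inner_le (S s (M (g s))) (M (G s))
    have x0 := norm_nonneg (f s)
    have y0 := norm_nonneg (g s)
    set x := ‖f s‖
    set y := ‖g s‖
    have q1 : x * ‖F s‖ ≤ x * (a * (x + y) + ε) := by gcongr; exact hF s hs
    have q2 : y * ‖G s‖ ≤ y * (a * (x + y) + ε) := by gcongr; exact hG s hs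
    have q3 : x * ‖M (M (A (M (S s (M (g s))))))‖ ≤ x * (a * y) := by gcongr; exact hMS s hs
    have q4 : ‖M (f s)‖ * ‖M (F s)‖ ≤ x * (a * (x + y) + ε) := by
      gcongr
      · exact hM1 _
      · exact (hM1 _).trans (hF s hs)
    have q5 : ‖M (g s)‖ * ‖M (G s)‖ ≤ y * (a * (x + y) + ε) := by
      gcongr
      · exact hM1 _
      · exact (hM1 _).trans (hG s hs)
    have q6 : ‖M (S' s (M (g s)))‖ * y ≤ a * y * y := by gcongr; exact hS' s hs
    have q7 : ‖S s (M (g s))‖ * ‖M (G s)‖ ≤ c * y * (a * (x + y) + ε) := by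
      gcongr
      · refine (hSb s hs' _).trans ?_
        gcongr
        exact hM1 _
      · exact (hM1 _).trans (hG s hs)
    exact energy_rate_le hc ha (hE s hs') (k1.trans q1) (k2.trans q2) (k3.trans q3) (k4.trans q4)
      (k5.trans q5) (k6.trans q6) (k7.trans q7)

end AbstractEstimate

end WhithamBoussinesq
end

noncomputable section
open MeasureTheory
open scoped SchwartzMap ENNReal

namespace WhithamBoussinesq

/-! ### The weighted a priori estimate and the weak comparison -/

section Fields

variable {ϰ c ρ : ℝ} {q : ℕ}

/-- The first component of the truncated vector field. -/
def fieldP (ϰ ρ n : ℝ) (P Q : L2C) : L2C :=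
  -(Complex.I • (mulOp (omSym ϰ n) Q + nonlinP ϰ ρ n P Q))

/-- The second component of the truncated vector field. -/
def fieldQ (ϰ ρ n : ℝ) (P Q : L2C) : L2C :=
  -(Complex.I • (mulOp (omSym ϰ n) P + nonlinQ ρ n Q Q))

/-- The constant in the energy. -/
def symConst (ρ B : ℝ) : ℝ := 2 * weightNorm (lam ρ) * B

/-- The bound for the lower order terms. -/
def lowerRate (c ρ : ℝ) (q : ℕ) (B : ℝ) : ℝ :=
  weightNorm (lam ρ) * B * (2 * c * ((q + 1) * 2 ^ q) + 8 * 2 ^ q + 20 * c + 10) +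
    4 * 2 ^ ρ * weightNorm (lam ρ) ^ 2 * B ^ 2

/-- The growth rate of the energy. -/
def growth (c ρ : ℝ) (q : ℕ) (B : ℝ) : ℝ :=
  (5 + 9 * symConst ρ B) * lowerRate c ρ q B + (1 + 2 * symConst ρ B)

theorem symConst_nonneg (ρ : ℝ) {B : ℝ} (hB : 0 ≤ B) : 0 ≤ symConst ρ B := by
  have := weightNorm_nonneg (lam ρ)
  unfold symConst; positivity

theorem lowerRate_nonneg {c : ℝ} (hc : 0 ≤ c) (ρ : ℝ) (q : ℕ) {B : ℝ} (hB : 0 ≤ B) :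
    0 ≤ lowerRate c ρ q B := by
  have := weightNorm_nonneg (lam ρ)
  unfold lowerRate; positivity

theorem growth_pos {c : ℝ} (hc : 0 ≤ c) (ρ : ℝ) (q : ℕ) {B : ℝ} (hB : 0 ≤ B) :
    0 < growth c ρ q B := by
  have h1 := symConst_nonneg ρ hB
  have h2 := lowerRate_nonneg hc ρ q hB
  unfold growth; positivity

theorem sOp_symm (hp : Params ϰ c ρ q) {P : L2C} (hP : reflect P = P) (x y : L2C) :
    inner ℂ (sOp ϰ ρ P x) y = inner ℂ x (sOp ϰ ρ P y) := by
  have e : tri (fun _ ↦ 1) (etaSym ϰ ρ) (fun _ ↦ 1) = fun τ _ ↦ etaSym ϰ ρ τ := by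
    ext τ ζ; simp [tri]
  have had := admissible_sOp hp
  rw [e] at had
  rw [sOp, e]
  refine (inner_bil_symm had (fun x ↦ ?_) hP y x).symm
  simp only [etaSym, lowSym, bsym_neg, lam_neg, jap_neg]

theorem norm_rate_le (hp : Params ϰ c ρ q) (n : ℝ) {B : ℝ} {P Q : L2C} (hP : ‖P‖ ≤ B)
    (hQ : ‖Q‖ ≤ B) (g : L2C) :
    ‖mOp (sOp ϰ ρ (fieldP ϰ ρ n P Q) (mOp g))‖ ≤
      (2 * weightNorm (lam ρ) * B + 4 * 2 ^ ρ * weightNorm (lam ρ) ^ 2 * B ^ 2) * ‖g‖ := by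
  have hw := weightNorm_nonneg (lam ρ)
  have hB : 0 ≤ B := (norm_nonneg P).trans hP
  have e : mOp (sOp ϰ ρ (fieldP ϰ ρ n P Q) (mOp g)) =
      -(Complex.I • (mOp (sOp ϰ ρ (mulOp (omSym ϰ n) Q) (mOp g)) +
        mOp (sOp ϰ ρ (nonlinP ϰ ρ n P Q) (mOp g)))) := by
    simp only [fieldP, map_neg, map_smul, map_add, neg_apply, smul_apply,
      add_apply]
  rw [e, norm_neg, norm_smul, Complex.norm_I, one_mul]
  calc _ ≤ 2 * weightNorm (lam ρ) * ‖Q‖ * ‖g‖ +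
        4 * 2 ^ ρ * weightNorm (lam ρ) ^ 2 * ‖P‖ * ‖Q‖ * ‖mOp g‖ := by
        refine (norm_add_le _ _).trans (add_le_add (norm_rate_linear_le hp n Q g) ?_)
        exact (norm_mOp_le _).trans (norm_rate_nonlinear_le hp n P Q _)
    _ ≤ 2 * weightNorm (lam ρ) * B * ‖g‖ +
        4 * 2 ^ ρ * weightNorm (lam ρ) ^ 2 * B * B * ‖g‖ := by
        gcongr
        exact norm_mOp_le g
    _ = _ := by ring

theorem hasDerivAt_clm_apply {E F : Type*} [NormedAddCommGroup E] [NormedSpace ℂ E]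
    [NormedAddCommGroup F] [NormedSpace ℂ F] (L : E →L[ℂ] F) {f : ℝ → E} {f' : E} {t : ℝ}
    (hf : HasDerivAt f f' t) : HasDerivAt (fun t ↦ L (f t)) (L f') t :=
  (L.restrictScalars ℝ).hasFDerivAt.comp_hasDerivAt t hf

theorem rate_le_lowerRate {c ρ B : ℝ} (hc : 0 ≤ c) (hB : 0 ≤ B) (q : ℕ) :
    2 * weightNorm (lam ρ) * B + 4 * 2 ^ ρ * weightNorm (lam ρ) ^ 2 * B ^ 2 ≤
      lowerRate c ρ q B := by
  have h : 0 ≤ weightNorm (lam ρ) * B := mul_nonneg (weightNorm_nonneg _) hB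
  have h' : 0 ≤ weightNorm (lam ρ) * B * (2 * c * ((q + 1) * 2 ^ q) + 8 * 2 ^ q + 20 * c + 8) := by
    positivity
  unfold lowerRate
  linarith

theorem mul_le_lowerRate {c ρ B x : ℝ} (hB : 0 ≤ B) (q : ℕ)
    (hx : x ≤ 2 * c * ((q + 1) * 2 ^ q) + 8 * 2 ^ q + 20 * c + 10) :
    x * weightNorm (lam ρ) * B ≤ lowerRate c ρ q B := by
  have h : 0 ≤ weightNorm (lam ρ) * B := mul_nonneg (weightNorm_nonneg _) hB
  have h1 := mul_le_mul_of_nonneg_left hx h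
  have : 0 ≤ 4 * 2 ^ ρ * weightNorm (lam ρ) ^ 2 * B ^ 2 := by positivity
  unfold lowerRate
  linarith

/-- The weighted energy estimate for the truncated system. -/
theorem weighted_estimate (hp : Params ϰ c ρ q) {n N B T : ℝ} (hN : 1 ≤ N) (hB : 0 ≤ B)
    {P Q : ℝ → L2C} (hPc : ContinuousOn P (Set.Icc 0 T)) (hQc : ContinuousOn Q (Set.Icc 0 T))
    (hP : ∀ t ∈ Set.Ioo 0 T, HasDerivAt P (fieldP ϰ ρ n (P t) (Q t)) t)
    (hQ : ∀ t ∈ Set.Ioo 0 T, HasDerivAt Q (fieldQ ϰ ρ n (P t) (Q t)) t)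
    (hR : ∀ t ∈ Set.Icc 0 T, reflect (P t) = P t)
    (hPB : ∀ t ∈ Set.Icc 0 T, ‖P t‖ ≤ B) (hQB : ∀ t ∈ Set.Icc 0 T, ‖Q t‖ ≤ B)
    {t : ℝ} (ht : t ∈ Set.Icc 0 T) :
    ‖mulOp (psi N) (P t)‖ ^ 2 + ‖mulOp (psi N) (Q t)‖ ^ 2 ≤ Real.exp (growth c ρ q B * t) *
      ((1 + 2 * symConst ρ B) * (‖mulOp (psi N) (P 0)‖ ^ 2 + ‖mulOp (psi N) (Q 0)‖ ^ 2)) := by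
  have hw := weightNorm_nonneg (lam ρ)
  have hc0 : 0 ≤ c := zero_le_one.trans hp.one_le
  have hψ := bddSymbol_psi hN
  have hom := bddSymbol_omSym ϰ n
  have hsub : Set.Ioo 0 T ⊆ Set.Icc 0 T := Set.Ioo_subset_Icc_self
  -- Applied to f = ψP and g = ψQ. The principal part of the weighted elevation nonlinearity is the
  -- symmetrizer term, the commutator is F, and the whole velocity nonlinearity is G.
  have key := energy_estimate (A := mulOp (omSym ϰ n)) (M := mOp)
    (fun x y ↦ inner_mulOp_left hom x y) (fun x y ↦ inner_mulOp_left bddSymbol_msym x y)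
    (fun x ↦ mulOp_comm bddSymbol_msym hom x) norm_mOp_le (S := fun t ↦ sOp ϰ ρ (P t))
    (S' := fun t ↦ sOp ϰ ρ (fieldP ϰ ρ n (P t) (Q t)))
    (f := fun t ↦ mulOp (psi N) (P t)) (g := fun t ↦ mulOp (psi N) (Q t))
    (F := fun t ↦ -(Complex.I • (mulOp (psi N) (nonlinP ϰ ρ n (P t) (Q t)) -
      mulOp (omSym ϰ n) (mOp (sOp ϰ ρ (P t) (mOp (mulOp (psi N) (Q t))))))))
    (G := fun t ↦ -(Complex.I • mulOp (psi N) (nonlinQ ρ n (Q t) (Q t))))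
    (c := symConst ρ B) (a := lowerRate c ρ q B) (ε := 0) (T := T) (symConst_nonneg ρ hB)
    (lowerRate_nonneg hc0 ρ q hB)
    ((sOp ϰ ρ).continuous.comp_continuousOn hPc)
    ((mulOp (psi N)).continuous.comp_continuousOn hPc)
    ((mulOp (psi N)).continuous.comp_continuousOn hQc)
    (fun s hs ↦ hasDerivAt_clm_apply (sOp ϰ ρ) (hP s hs))
    (fun s hs x ↦ ?_) (fun s hs x y ↦ sOp_symm hp (hR s (hsub hs)) x y)
    (fun s hs ↦ ?_) (fun s hs ↦ ?_) (fun s hs ↦ ?_) (fun s hs ↦ ?_) (fun s hs ↦ ?_)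
    (fun s hs ↦ ?_) ht
  · simpa [growth] using key
  · refine (norm_sOp_le hp _ _).trans ?_
    unfold symConst
    gcongr
    exact hPB s hs
  · refine (hasDerivAt_clm_apply (mulOp (psi N)) (hP s hs)).congr_deriv ?_
    simp only [fieldP, map_neg, map_smul, map_add, mulOp_comm hψ hom]
    module
  · refine (hasDerivAt_clm_apply (mulOp (psi N)) (hQ s hs)).congr_deriv ?_
    simp only [fieldQ, map_neg, map_smul, map_add, mulOp_comm hψ hom]
    module
  · have b1 := hPB s (hsub hs)
    have b2 := hQB s (hsub hs)
    rw [norm_neg, norm_smul, Complex.norm_I, one_mul, add_zero]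
    have hl := mul_le_lowerRate (c := c) (ρ := ρ) hB q (x := 2 * c * ((q + 1) * 2 ^ q)) (by
      have : (0 : ℝ) ≤ 8 * 2 ^ q + 20 * c + 10 := by positivity
      linarith)
    calc _ ≤ 2 * c * ((q + 1) * 2 ^ q) * weightNorm (lam ρ) *
          (‖mulOp (psi N) (P s)‖ * B + B * ‖mulOp (psi N) (Q s)‖) := by
          refine (norm_commutator_le hp n hN (P s) (Q s)).trans ?_
          gcongr
      _ = 2 * c * ((q + 1) * 2 ^ q) * weightNorm (lam ρ) * B *
          (‖mulOp (psi N) (P s)‖ + ‖mulOp (psi N) (Q s)‖) := by ring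
      _ ≤ _ := by gcongr
  · have b2 := hQB s (hsub hs)
    rw [norm_neg, norm_smul, Complex.norm_I, one_mul, add_zero]
    have hl := mul_le_lowerRate (c := c) (ρ := ρ) hB q (x := 8 * 2 ^ q) (by
      have : (0 : ℝ) ≤ 2 * c * ((q + 1) * 2 ^ q) + 20 * c + 10 := by positivity
      linarith)
    calc _ ≤ 8 * 2 ^ q * weightNorm (lam ρ) * B * (0 + ‖mulOp (psi N) (Q s)‖) := by
          refine (norm_weighted_nonlinQ_le hp n hN (Q s)).trans ?_
          rw [zero_add]
          gcongr
      _ ≤ _ := by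
          gcongr
          exacts [lowerRate_nonneg hc0 ρ q hB, norm_nonneg _]
  · have b1 := hPB s (hsub hs)
    have hl := mul_le_lowerRate (c := c) (ρ := ρ) hB q (x := 12 * c) (by
      have : (0 : ℝ) ≤ 2 * c * ((q + 1) * 2 ^ q) + 8 * 2 ^ q + 8 * c + 10 := by positivity
      linarith)
    refine (norm_smoothed_le hp n _ _).trans (le_trans ?_ (mul_le_mul_of_nonneg_right hl
      (norm_nonneg _)))
    gcongr
  · refine (norm_rate_le hp n (hPB s (hsub hs)) (hQB s (hsub hs)) _).trans ?_
    gcongr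
    exact rate_le_lowerRate hc0 hB q

/-- `(P, Q)` solves the system at frequencies `⟨k⟩ ≤ n`. -/
structure IsTruncSol (ϰ ρ n T : ℝ) (P Q : ℝ → L2C) : Prop where
  contP : ContinuousOn (fun t ↦ mulOp (cut n) (P t)) (Set.Icc 0 T)
  contQ : ContinuousOn (fun t ↦ mulOp (cut n) (Q t)) (Set.Icc 0 T)
  derivP : ∀ t ∈ Set.Ioo 0 T,
    HasDerivAt (fun t ↦ mulOp (cut n) (P t)) (fieldP ϰ ρ n (P t) (Q t)) t
  derivQ : ∀ t ∈ Set.Ioo 0 T,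
    HasDerivAt (fun t ↦ mulOp (cut n) (Q t)) (fieldQ ϰ ρ n (P t) (Q t)) t

theorem norm_cut_le (n : ℝ) (f : L2C) : ‖mulOp (cut n) f‖ ≤ ‖f‖ := by
  simpa using norm_mulOp_le (bddSymbol_cut n) (isCutoff_cut n).abs_le_one f

theorem cut_mul_cut {n m : ℝ} (h : n ≤ m) (x : ℝ) : cut n x * cut m x = cut n x := by
  unfold cut
  split_ifs with h1 h2
  · simp
  · exact absurd (h1.trans h) h2
  · simp
  · simp

theorem om_cut (ϰ n : ℝ) (f : L2C) :
    mulOp (omSym ϰ n) (mulOp (cut n) f) = mulOp (omSym ϰ n) f := by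
  rw [mulOp_mulOp (bddSymbol_omSym ϰ n) (bddSymbol_cut n)]
  congr 2
  ext x
  have := cut_mul_cut (le_refl n) x
  unfold omSym
  linear_combination freq x * bsym ϰ x * msym x * this

/-- The error made by truncating the arguments of the truncated field. -/
def truncError (c ρ B n : ℝ) : ℝ := 32 * c * weightNorm (lam ρ) * (√n)⁻¹ * B ^ 2

/-- Comparison of two solutions of the truncated system in a weak norm. -/
theorem comparison (hp : Params ϰ c ρ q) {n B T : ℝ} (hn : 1 ≤ n) (hB : 0 ≤ B)
    {P₁ Q₁ P₂ Q₂ : ℝ → L2C} (h₁ : IsTruncSol ϰ ρ n T P₁ Q₁) (h₂ : IsTruncSol ϰ ρ n T P₂ Q₂)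
    (hR : ∀ t ∈ Set.Icc 0 T, reflect (P₁ t) = P₁ t)
    (hP₁ : ∀ t ∈ Set.Icc 0 T, ‖P₁ t‖ ≤ B) (hQ₁ : ∀ t ∈ Set.Icc 0 T, ‖Q₁ t‖ ≤ B)
    (hP₂ : ∀ t ∈ Set.Icc 0 T, ‖P₂ t‖ ≤ B) (hQ₂ : ∀ t ∈ Set.Icc 0 T, ‖Q₂ t‖ ≤ B)
    {t : ℝ} (ht : t ∈ Set.Icc 0 T) :
    ‖mulOp (lowSym ρ) (mulOp (cut n) (P₁ t) - mulOp (cut n) (P₂ t))‖ ^ 2 +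
      ‖mulOp (lowSym ρ) (mulOp (cut n) (Q₁ t) - mulOp (cut n) (Q₂ t))‖ ^ 2 ≤
      Real.exp (growth c ρ q B * t) * ((1 + 2 * symConst ρ B) *
        (‖mulOp (lowSym ρ) (mulOp (cut n) (P₁ 0) - mulOp (cut n) (P₂ 0))‖ ^ 2 +
          ‖mulOp (lowSym ρ) (mulOp (cut n) (Q₁ 0) - mulOp (cut n) (Q₂ 0))‖ ^ 2) +
        (2 + 4 * symConst ρ B) * truncError c ρ B n ^ 2 * t) := by
  have hw := weightNorm_nonneg (lam ρ)
  have hc1 := hp.one_le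
  have hc0 : 0 ≤ c := zero_le_one.trans hp.one_le
  have hl := bddSymbol_lowSym hp.nonneg
  have hom := bddSymbol_omSym ϰ n
  have hn0 : 0 ≤ (√n)⁻¹ := by positivity
  have hsub : Set.Ioo 0 T ⊆ Set.Icc 0 T := Set.Ioo_subset_Icc_self
  -- Uses η₁v₁ - η₂v₂ = η₁(v₁ - v₂) + (η₁ - η₂)v₂: the first product is the symmetrizer term, with
  -- η₁ as coefficient, and the second belongs to F. Only the projections to ⟨k⟩ ≤ n are known to be
  -- differentiable, so all arguments are first projected, and the errors made by this are the
  -- source of ε.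
  have key := energy_estimate (A := mulOp (omSym ϰ n)) (M := mOp)
    (fun x y ↦ inner_mulOp_left hom x y) (fun x y ↦ inner_mulOp_left bddSymbol_msym x y)
    (fun x ↦ mulOp_comm bddSymbol_msym hom x) norm_mOp_le
    (S := fun t ↦ sOp ϰ ρ (mulOp (cut n) (P₁ t)))
    (S' := fun t ↦ sOp ϰ ρ (fieldP ϰ ρ n (P₁ t) (Q₁ t)))
    (f := fun t ↦ mulOp (lowSym ρ) (mulOp (cut n) (P₁ t) - mulOp (cut n) (P₂ t)))
    (g := fun t ↦ mulOp (lowSym ρ) (mulOp (cut n) (Q₁ t) - mulOp (cut n) (Q₂ t)))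
    (F := fun t ↦ -(Complex.I • (mulOp (lowSym ρ) (nonlinP ϰ ρ n
          (mulOp (cut n) (P₁ t) - mulOp (cut n) (P₂ t)) (mulOp (cut n) (Q₂ t))) +
        (mulOp (lowSym ρ) (nonlinP ϰ ρ n (P₁ t) (Q₁ t)) - mulOp (lowSym ρ) (nonlinP ϰ ρ n
          (mulOp (cut n) (P₁ t)) (mulOp (cut n) (Q₁ t)))) -
        (mulOp (lowSym ρ) (nonlinP ϰ ρ n (P₂ t) (Q₂ t)) - mulOp (lowSym ρ) (nonlinP ϰ ρ n
          (mulOp (cut n) (P₂ t)) (mulOp (cut n) (Q₂ t)))))))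
    (G := fun t ↦ -(Complex.I • (mulOp (lowSym ρ) (nonlinQ ρ n (mulOp (cut n) (Q₁ t))
          (mulOp (cut n) (Q₁ t) - mulOp (cut n) (Q₂ t))) +
        mulOp (lowSym ρ) (nonlinQ ρ n (mulOp (cut n) (Q₁ t) - mulOp (cut n) (Q₂ t))
          (mulOp (cut n) (Q₂ t))) +
        (mulOp (lowSym ρ) (nonlinQ ρ n (Q₁ t) (Q₁ t)) - mulOp (lowSym ρ) (nonlinQ ρ n
          (mulOp (cut n) (Q₁ t)) (mulOp (cut n) (Q₁ t)))) -
        (mulOp (lowSym ρ) (nonlinQ ρ n (Q₂ t) (Q₂ t)) - mulOp (lowSym ρ) (nonlinQ ρ n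
          (mulOp (cut n) (Q₂ t)) (mulOp (cut n) (Q₂ t)))))))
    (c := symConst ρ B) (a := lowerRate c ρ q B) (ε := truncError c ρ B n) (T := T)
    (symConst_nonneg ρ hB) (lowerRate_nonneg hc0 ρ q hB)
    ((sOp ϰ ρ).continuous.comp_continuousOn h₁.contP)
    ((mulOp (lowSym ρ)).continuous.comp_continuousOn (h₁.contP.sub h₂.contP))
    ((mulOp (lowSym ρ)).continuous.comp_continuousOn (h₁.contQ.sub h₂.contQ))
    (fun s hs ↦ hasDerivAt_clm_apply (sOp ϰ ρ) (h₁.derivP s hs))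
    (fun s hs x ↦ ?_) (fun s hs x y ↦ sOp_symm hp ?_ x y)
    (fun s hs ↦ ?_) (fun s hs ↦ ?_) (fun s hs ↦ ?_) (fun s hs ↦ ?_) (fun s hs ↦ ?_)
    (fun s hs ↦ ?_) ht
  · exact key
  · refine (norm_sOp_le hp _ _).trans ?_
    unfold symConst
    gcongr
    exact (norm_cut_le n _).trans (hP₁ s hs)
  · rw [reflect_mulOp (bddSymbol_cut n) (isCutoff_cut n).even, hR s (hsub hs)]
  · refine (hasDerivAt_clm_apply (mulOp (lowSym ρ))
      ((h₁.derivP s hs).sub (h₂.derivP s hs))).congr_deriv ?_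
    rw [← low_nonlinP_eq hp]
    simp only [fieldP, map_neg, map_smul, map_add, map_sub, mulOp_comm hom hl, om_cut,
      sub_apply]
    module
  · refine (hasDerivAt_clm_apply (mulOp (lowSym ρ))
      ((h₁.derivQ s hs).sub (h₂.derivQ s hs))).congr_deriv ?_
    simp only [fieldQ, map_neg, map_smul, map_add, map_sub, mulOp_comm hom hl, om_cut, sub_apply]
    module
  · have a1 := norm_low_nonlinP_le hp n (mulOp (cut n) (P₁ s) - mulOp (cut n) (P₂ s))
      (mulOp (cut n) (Q₂ s))
    have a2 := norm_low_nonlinP_sub_cut_le hp hn (P₁ s) (Q₁ s)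
    have a3 := norm_low_nonlinP_sub_cut_le hp hn (P₂ s) (Q₂ s)
    have e2 : 16 * c * weightNorm (lam ρ) * (√n)⁻¹ * ‖P₁ s‖ * ‖Q₁ s‖ ≤
        16 * c * weightNorm (lam ρ) * (√n)⁻¹ * B * B := by
      gcongr
      exacts [hP₁ s (hsub hs), hQ₁ s (hsub hs)]
    have e3 : 16 * c * weightNorm (lam ρ) * (√n)⁻¹ * ‖P₂ s‖ * ‖Q₂ s‖ ≤
        16 * c * weightNorm (lam ρ) * (√n)⁻¹ * B * B := by
      gcongr
      exacts [hP₂ s (hsub hs), hQ₂ s (hsub hs)]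
    have hr := mul_le_lowerRate (c := c) (ρ := ρ) hB q (x := 8 * c) (by
      have : (0 : ℝ) ≤ 2 * c * ((q + 1) * 2 ^ q) + 8 * 2 ^ q + 12 * c + 10 := by positivity
      linarith)
    set x := ‖mulOp (lowSym ρ) (mulOp (cut n) (P₁ s) - mulOp (cut n) (P₂ s))‖ with hx
    set y := ‖mulOp (lowSym ρ) (mulOp (cut n) (Q₁ s) - mulOp (cut n) (Q₂ s))‖ with hy
    have x0 : 0 ≤ x := norm_nonneg _
    have y0 : 0 ≤ y := norm_nonneg _
    have e1 : 8 * c * weightNorm (lam ρ) * x * ‖mulOp (cut n) (Q₂ s)‖ ≤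
        lowerRate c ρ q B * (x + y) := by
      calc _ ≤ 8 * c * weightNorm (lam ρ) * x * B := by
            gcongr; exact (norm_cut_le n _).trans (hQ₂ s (hsub hs))
        _ = 8 * c * weightNorm (lam ρ) * B * x := by ring
        _ ≤ lowerRate c ρ q B * x := by gcongr
        _ ≤ _ := by
          have := mul_nonneg (lowerRate_nonneg hc0 ρ q hB) y0
          linarith
    rw [norm_neg, norm_smul, Complex.norm_I, one_mul]
    refine (norm_sub_le _ _).trans ((add_le_add (norm_add_le _ _) le_rfl).trans ?_)
    unfold truncError
    linarith
  · have a1 := norm_low_nonlinQ_le_right hp n (mulOp (cut n) (Q₁ s))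
      (mulOp (cut n) (Q₁ s) - mulOp (cut n) (Q₂ s))
    have a1' := norm_low_nonlinQ_le_left hp n (mulOp (cut n) (Q₁ s) - mulOp (cut n) (Q₂ s))
      (mulOp (cut n) (Q₂ s))
    have a2 := norm_low_nonlinQ_sub_cut_le hp hn (Q₁ s) (Q₁ s)
    have a3 := norm_low_nonlinQ_sub_cut_le hp hn (Q₂ s) (Q₂ s)
    have e2 : 8 * weightNorm (lam ρ) * (√n)⁻¹ * ‖Q₁ s‖ * ‖Q₁ s‖ ≤
        16 * c * weightNorm (lam ρ) * (√n)⁻¹ * B * B := by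
      gcongr
      · linarith
      exacts [hQ₁ s (hsub hs), hQ₁ s (hsub hs)]
    have e3 : 8 * weightNorm (lam ρ) * (√n)⁻¹ * ‖Q₂ s‖ * ‖Q₂ s‖ ≤
        16 * c * weightNorm (lam ρ) * (√n)⁻¹ * B * B := by
      gcongr
      · linarith
      exacts [hQ₂ s (hsub hs), hQ₂ s (hsub hs)]
    have hr := mul_le_lowerRate (c := c) (ρ := ρ) hB q (x := 8) (by
      have : (0 : ℝ) ≤ 2 * c * ((q + 1) * 2 ^ q) + 8 * 2 ^ q + 20 * c + 2 := by positivity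
      linarith)
    set x := ‖mulOp (lowSym ρ) (mulOp (cut n) (P₁ s) - mulOp (cut n) (P₂ s))‖ with hx
    set y := ‖mulOp (lowSym ρ) (mulOp (cut n) (Q₁ s) - mulOp (cut n) (Q₂ s))‖ with hy
    have x0 : 0 ≤ x := norm_nonneg _
    have y0 : 0 ≤ y := norm_nonneg _
    have f1 : 4 * weightNorm (lam ρ) * ‖mulOp (cut n) (Q₁ s)‖ * y ≤
        4 * weightNorm (lam ρ) * B * y := by
      gcongr; exact (norm_cut_le n _).trans (hQ₁ s (hsub hs))
    have f2 : 4 * weightNorm (lam ρ) * y * ‖mulOp (cut n) (Q₂ s)‖ ≤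
        4 * weightNorm (lam ρ) * y * B := by
      gcongr; exact (norm_cut_le n _).trans (hQ₂ s (hsub hs))
    have f3 := mul_le_mul_of_nonneg_right hr y0
    have f4 := mul_nonneg (lowerRate_nonneg hc0 ρ q hB) x0
    rw [norm_neg, norm_smul, Complex.norm_I, one_mul]
    refine (norm_sub_le _ _).trans ((add_le_add ((norm_add_le _ _).trans
      (add_le_add (norm_add_le _ _) le_rfl)) le_rfl).trans ?_)
    unfold truncError
    linarith
  · have hr := mul_le_lowerRate (c := c) (ρ := ρ) hB q (x := 12 * c) (by
      have : (0 : ℝ) ≤ 2 * c * ((q + 1) * 2 ^ q) + 8 * 2 ^ q + 8 * c + 10 := by positivity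
      linarith)
    refine (norm_smoothed_le hp n _ _).trans (le_trans ?_ (mul_le_mul_of_nonneg_right hr
      (norm_nonneg _)))
    gcongr
    exact (norm_cut_le n _).trans (hP₁ s (hsub hs))
  · refine (norm_rate_le hp n (hP₁ s (hsub hs)) (hQ₁ s (hsub hs)) _).trans ?_
    gcongr
    exact rate_le_lowerRate hc0 hB q

end Fields

end WhithamBoussinesq
end

noncomputable section
open MeasureTheory
open scoped SchwartzMap ENNReal

namespace WhithamBoussinesq

/-! ### Preservation of reality -/

section Reality

theorem reflect_reflect (f : L2C) : reflect (reflect f) = f := by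
  refine Lp.ext ?_
  have h1 := coeFn_reflect (reflect f)
  have h2 := (Measure.measurePreserving_neg (volume : Measure ℝ)).quasiMeasurePreserving.ae_eq_comp
    (coeFn_reflect f)
  filter_upwards [h1, h2] with x h1 h2
  rw [h1]
  simp only [Function.comp_apply] at h2
  rw [h2]
  simp

/-- The projection to the Fourier transforms of real valued functions. -/
def realProj : L2C →L[ℝ] L2C := (1 / 2 : ℝ) • (ContinuousLinearMap.id ℝ L2C + reflect)

theorem realProj_apply (f : L2C) : realProj f = (1 / 2 : ℝ) • (f + reflect f) := rfl

theorem reflect_realProj (f : L2C) : reflect (realProj f) = realProj f := by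
  rw [realProj_apply, map_smul, map_add, reflect_reflect, add_comm]

theorem realProj_of_reflect {f : L2C} (h : reflect f = f) : realProj f = f := by
  rw [realProj_apply, h, ← two_smul ℝ f, smul_smul]; norm_num

/-- The derivative of ‖reflect f - f‖² vanishes. -/
theorem reflect_eq_of_hasDerivAt {f f' : ℝ → L2C} {T : ℝ} (hc : ContinuousOn f (Set.Icc 0 T))
    (hd : ∀ t ∈ Set.Ioo 0 T, HasDerivAt f (f' t) t)
    (hr : ∀ t ∈ Set.Ioo 0 T, reflect (f' t) = f' t) (h0 : reflect (f 0) = f 0) :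
    ∀ t ∈ Set.Icc 0 T, reflect (f t) = f t := by
  intro t ht
  have hcont : ContinuousOn (fun t ↦ ‖reflect (f t) - f t‖ ^ 2) (Set.Icc 0 T) :=
    ((reflect.continuous.comp_continuousOn hc).sub hc).norm.pow 2
  have h := gronwall_Icc (D := 0) (e := 0) (E' := fun _ ↦ 0) le_rfl le_rfl hcont
    (fun s hs ↦ ?_) (fun s hs ↦ by simp) ht
  · rw [h0] at h
    simp only [zero_mul, Real.exp_zero, sub_self, norm_zero, ne_eq, OfNat.ofNat_ne_zero,
      not_false_eq_true, zero_pow, add_zero, mul_zero] at h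
    have h2 : ‖reflect (f t) - f t‖ = 0 := by
      have := sq_nonneg ‖reflect (f t) - f t‖
      exact pow_eq_zero_iff two_ne_zero |>.mp (le_antisymm h this)
    exact sub_eq_zero.mp (norm_eq_zero.mp h2)
  · have h1 : HasDerivAt (fun t ↦ reflect (f t)) (reflect (f' s)) s :=
      reflect.hasFDerivAt.comp_hasDerivAt s (hd s hs)
    have h2 := hasDerivAt_norm_sq' (h1.sub (hd s hs))
    rw [hr s hs] at h2
    simpa using h2

variable {ϰ c ρ : ℝ} {q : ℕ}

theorem thsym_neg (x : ℝ) : thsym (-x) = -thsym x := by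
  simp [thsym, Real.tanh_neg]

theorem freq_neg (x : ℝ) : freq (-x) = -freq x := by simp [freq]

theorem lowSym_neg (ρ x : ℝ) : lowSym ρ (-x) = lowSym ρ x := by
  simp only [lowSym, lam_neg, jap_neg]

theorem highSym_neg (ρ x : ℝ) : highSym ρ (-x) = highSym ρ x := by
  simp only [highSym, lam_neg, jap_neg]

theorem etaSym_neg (ϰ ρ x : ℝ) : etaSym ϰ ρ (-x) = etaSym ϰ ρ x := by
  simp only [etaSym, bsym_neg, lowSym_neg]

theorem velSym_neg (ρ x : ℝ) : velSym ρ (-x) = velSym ρ x := by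
  simp only [velSym, msym_neg, lowSym_neg]

theorem tri_odd {A B C : ℝ → ℝ} (hA : ∀ x, A (-x) = -A x) (hB : ∀ x, B (-x) = B x)
    (hC : ∀ x, C (-x) = C x) (τ ζ : ℝ) : tri A B C (-τ) (-ζ) = -tri A B C τ ζ := by
  rw [tri, tri, ← neg_add, hA, hB, hC]; ring

theorem reflect_neg_I_smul {f : L2C} (h : reflect f = -f) :
    reflect (-(Complex.I • f)) = -(Complex.I • f) := by
  rw [map_neg, reflect_I_smul, h]; simp

theorem reflect_fieldP (hp : Params ϰ c ρ q) (n : ℝ) {P Q : L2C} (hP : reflect P = P)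
    (hQ : reflect Q = Q) : reflect (fieldP ϰ ρ n P Q) = fieldP ϰ ρ n P Q := by
  refine reflect_neg_I_smul ?_
  rw [map_add, reflect_mulOp_odd (bddSymbol_omSym ϰ n) (fun x ↦ ?_), nonlinP,
    reflect_bil_odd (admissible_nonlinP hp n)
      (tri_odd (fun x ↦ ?_) (etaSym_neg ϰ ρ) (velSym_neg ρ)), hP, hQ]
  · abel
  · simp only [elevOut, (isCutoff_cut n).even, bsym_neg, highSym_neg, thsym_neg]; ring
  · simp only [omSym, (isCutoff_cut n).even, bsym_neg, freq_neg, msym_neg]; ring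

theorem reflect_fieldQ (hp : Params ϰ c ρ q) (n : ℝ) {P Q : L2C} (hP : reflect P = P)
    (hQ : reflect Q = Q) : reflect (fieldQ ϰ ρ n P Q) = fieldQ ϰ ρ n P Q := by
  refine reflect_neg_I_smul ?_
  rw [map_add, reflect_mulOp_odd (bddSymbol_omSym ϰ n) (fun x ↦ ?_), nonlinQ,
    reflect_bil_odd (admissible_nonlinQ hp n)
      (tri_odd (fun x ↦ ?_) (velSym_neg ρ) (velSym_neg ρ)), hP, hQ]
  · abel
  · simp only [velOut, (isCutoff_cut n).even, freq_neg, highSym_neg, msym_neg]; ring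
  · simp only [omSym, (isCutoff_cut n).even, bsym_neg, freq_neg, msym_neg]; ring

end Reality

/-! ### Locally Lipschitz maps, the ball cutoff and a continuity argument -/

section LocallyLipschitz

variable {X Y Z W : Type*} [NormedAddCommGroup X] [NormedAddCommGroup Y] [NormedAddCommGroup Z]
  [NormedAddCommGroup W]

theorem LipOnBalls.add {F G : X → Y} (hF : LipOnBalls F) (hG : LipOnBalls G) :
    LipOnBalls (fun x ↦ F x + G x) := by
  intro a
  obtain ⟨L, hL, h⟩ := hF a
  obtain ⟨L', hL', h'⟩ := hG a
  refine ⟨L + L', by positivity, fun x y hx hy ↦ ?_⟩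
  calc ‖F x + G x - (F y + G y)‖ = ‖(F x - F y) + (G x - G y)‖ := by congr 1; abel
    _ ≤ L * ‖x - y‖ + L' * ‖x - y‖ := (norm_add_le _ _).trans (add_le_add (h x y hx hy) (h' x y hx hy))
    _ = _ := by ring

theorem LipOnBalls.prodMk {F : X → Y} {G : X → Z} (hF : LipOnBalls F) (hG : LipOnBalls G) :
    LipOnBalls (fun x ↦ (F x, G x)) := by
  intro a
  obtain ⟨L, hL, h⟩ := hF a
  obtain ⟨L', hL', h'⟩ := hG a
  refine ⟨max L L', le_max_of_le_left hL, fun x y hx hy ↦ ?_⟩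
  rw [Prod.mk_sub_mk, Prod.norm_mk]
  refine max_le ((h x y hx hy).trans ?_) ((h' x y hx hy).trans ?_)
  · gcongr; exact le_max_left _ _
  · gcongr; exact le_max_right _ _

theorem LipOnBalls.clm_comp [NormedSpace ℝ Y] [NormedSpace ℝ Z] {F : X → Y} (hF : LipOnBalls F)
    (L : Y →L[ℝ] Z) : LipOnBalls (fun x ↦ L (F x)) := by
  intro a
  obtain ⟨K, hK, h⟩ := hF a
  refine ⟨‖L‖ * K, by positivity, fun x y hx hy ↦ ?_⟩
  rw [← map_sub, mul_assoc]
  exact (L.le_opNorm _).trans (by gcongr; exact h x y hx hy)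

theorem lipOnBalls_bilinear [NormedSpace ℂ X] [NormedSpace ℂ Y] [NormedSpace ℂ Z] [NormedSpace ℂ W]
    (b : Y →L[ℂ] Z →L[ℂ] W) (L : X →L[ℂ] Y) (L' : X →L[ℂ] Z) :
    LipOnBalls (fun x ↦ b (L x) (L' x)) := by
  intro a
  refine ⟨‖b‖ * ‖L‖ * ‖L'‖ * |a| + ‖b‖ * ‖L‖ * ‖L'‖ * |a|, by positivity, fun x y hx hy ↦ ?_⟩
  have hx' := hx.trans (le_abs_self a)
  have hy' := hy.trans (le_abs_self a)
  have key : ∀ u v, ‖b (L u) (L' v)‖ ≤ ‖b‖ * ‖L‖ * ‖L'‖ * (‖u‖ * ‖v‖) := by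
    intro u v
    calc _ ≤ ‖b‖ * ‖L u‖ * ‖L' v‖ := b.le_opNorm₂ _ _
      _ ≤ ‖b‖ * (‖L‖ * ‖u‖) * (‖L'‖ * ‖v‖) := by gcongr <;> exact ContinuousLinearMap.le_opNorm _ _
      _ = _ := by ring
  have e : b (L x) (L' x) - b (L y) (L' y) = b (L (x - y)) (L' x) + b (L y) (L' (x - y)) := by
    simp only [map_sub, sub_apply]; abel
  rw [e]
  calc _ ≤ ‖b‖ * ‖L‖ * ‖L'‖ * (‖x - y‖ * |a|) + ‖b‖ * ‖L‖ * ‖L'‖ * (|a| * ‖x - y‖) := by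
        refine (norm_add_le _ _).trans (add_le_add ((key _ _).trans ?_) ((key _ _).trans ?_))
        · gcongr
        · gcongr
    _ = _ := by ring

theorem lipOnBalls_clm [NormedSpace ℝ X] [NormedSpace ℝ Y] (L : X →L[ℝ] Y) :
    LipOnBalls (fun x ↦ L x) := fun _ ↦ ⟨‖L‖, norm_nonneg _, fun x y _ _ ↦ by
  rw [← map_sub]; exact L.le_opNorm _⟩

/-- A cutoff that is `1` on the ball of radius `B` and `0` outside the ball of radius `2B`. -/
def ballCutoff (B : ℝ) (x : X) : ℝ := max 0 (min 1 (2 - ‖x‖ / B))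

theorem ballCutoff_eq_one {B : ℝ} (hB : 0 < B) {x : X} (hx : ‖x‖ ≤ B) : ballCutoff B x = 1 := by
  have : ‖x‖ / B ≤ 1 := (div_le_one hB).mpr hx
  rw [ballCutoff, min_eq_left (by linarith)]; simp

theorem ballCutoff_eq_zero {B : ℝ} (hB : 0 < B) {x : X} (hx : 2 * B ≤ ‖x‖) :
    ballCutoff B x = 0 := by
  have : 2 ≤ ‖x‖ / B := (le_div_iff₀ hB).mpr hx
  rw [ballCutoff, max_eq_left]
  exact (min_le_right _ _).trans (by linarith)

theorem lipOnBalls_ballCutoff {B : ℝ} (hB : 0 < B) : LipOnBalls (ballCutoff B : X → ℝ) := by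
  refine fun _ ↦ ⟨B⁻¹, by positivity, fun x y _ _ ↦ ?_⟩
  unfold ballCutoff
  rw [Real.norm_eq_abs]
  calc |max 0 (min 1 (2 - ‖x‖ / B)) - max 0 (min 1 (2 - ‖y‖ / B))|
      ≤ |min 1 (2 - ‖x‖ / B) - min 1 (2 - ‖y‖ / B)| := by
        have := abs_max_sub_max_le_max 0 (min 1 (2 - ‖x‖ / B)) 0 (min 1 (2 - ‖y‖ / B))
        simpa using this
    _ ≤ |(2 - ‖x‖ / B) - (2 - ‖y‖ / B)| := by
        have := abs_min_sub_min_le_max 1 (2 - ‖x‖ / B) 1 (2 - ‖y‖ / B)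
        simpa using this
    _ = B⁻¹ * |‖y‖ - ‖x‖| := by
        have e : 2 - ‖x‖ / B - (2 - ‖y‖ / B) = B⁻¹ * (‖y‖ - ‖x‖) := by field_simp; ring
        rw [e, abs_mul, abs_of_pos (inv_pos.mpr hB)]
    _ ≤ _ := by
        gcongr
        rw [abs_sub_comm]
        exact abs_norm_sub_norm_le x y

/-- Otherwise there is a first time τ with f ≥ b. Up to that time f ≤ b, so the step gives f(τ) < b.
-/
theorem forall_lt_of_bootstrap {f : ℝ → ℝ} {T b : ℝ} (hc : ContinuousOn f (Set.Icc 0 T))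
    (h0 : f 0 < b)
    (step : ∀ τ ∈ Set.Icc 0 T, (∀ t ∈ Set.Icc 0 τ, f t ≤ b) → f τ < b) :
    ∀ t ∈ Set.Icc 0 T, f t < b := by
  by_contra! hcon
  obtain ⟨t₁, ht₁, hf₁⟩ := hcon
  have hcl : IsClosed {t ∈ Set.Icc 0 T | b ≤ f t} :=
    hc.preimage_isClosed_of_isClosed isClosed_Icc isClosed_Ici
  have hcomp : IsCompact {t ∈ Set.Icc 0 T | b ≤ f t} :=
    isCompact_Icc.of_isClosed_subset hcl fun t ht ↦ ht.1
  obtain ⟨τ, ⟨hτ, hbτ⟩, hmin⟩ := hcomp.exists_isLeast ⟨t₁, ht₁, hf₁⟩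
  have hsub : Set.Icc 0 τ ⊆ Set.Icc 0 T := Set.Icc_subset_Icc_right hτ.2
  obtain ⟨s, hs, hfs⟩ := intermediate_value_Icc hτ.1 (hc.mono hsub) ⟨h0.le, hbτ⟩
  have hsτ : s = τ := le_antisymm hs.2 (hmin ⟨hsub hs, hfs.ge⟩)
  refine (step τ hτ fun t ht ↦ ?_).not_ge hbτ
  by_contra! hlt
  have : t = τ := le_antisymm ht.2 (hmin ⟨hsub ht, hlt.le⟩)
  rw [this, ← hsτ, hfs] at hlt
  exact lt_irrefl _ hlt

end LocallyLipschitz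

/-! ### Solutions of the truncated systems -/

section Galerkin

variable {ϰ c ρ : ℝ} {q : ℕ}

theorem LipOnBalls.neg_I_smul {X : Type*} [NormedAddCommGroup X] {F : X → L2C}
    (hF : LipOnBalls F) : LipOnBalls fun x ↦ -(Complex.I • F x) :=
  hF.clm_comp (-(Complex.I • ContinuousLinearMap.id ℝ L2C))

theorem lipOnBalls_fieldP (ϰ ρ n : ℝ) :
    LipOnBalls (fun x : L2C × L2C ↦ fieldP ϰ ρ n x.1 x.2) := by
  refine LipOnBalls.neg_I_smul (LipOnBalls.add ?_ ?_)
  · exact lipOnBalls_clm (((mulOp (omSym ϰ n)).restrictScalars ℝ).comp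
      (ContinuousLinearMap.snd ℝ L2C L2C))
  · exact lipOnBalls_bilinear (nonlinP ϰ ρ n) (ContinuousLinearMap.fst ℂ L2C L2C)
      (ContinuousLinearMap.snd ℂ L2C L2C)

theorem lipOnBalls_fieldQ (ϰ ρ n : ℝ) :
    LipOnBalls (fun x : L2C × L2C ↦ fieldQ ϰ ρ n x.1 x.2) := by
  refine LipOnBalls.neg_I_smul (LipOnBalls.add ?_ ?_)
  · exact lipOnBalls_clm (((mulOp (omSym ϰ n)).restrictScalars ℝ).comp
      (ContinuousLinearMap.fst ℝ L2C L2C))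
  · exact lipOnBalls_bilinear (nonlinQ ρ n) (ContinuousLinearMap.snd ℂ L2C L2C)
      (ContinuousLinearMap.snd ℂ L2C L2C)

/-- For N = 1 the weight is trivial, so the weighted estimate contains the a priori bound for the
norm. -/
theorem mulOp_psi_one (f : L2C) : mulOp (psi 1) f = f := by
  have : psi 1 = fun _ ↦ 1 := by
    ext x; rw [psi, div_one]; exact min_eq_left (one_le_jap x)
  rw [this, mulOp_one]

/-- Solutions of the truncated system, with a bound. -/
structure IsGalerkin (ϰ ρ n T B : ℝ) (P Q : ℝ → L2C) : Prop where
  contP : ContinuousOn P (Set.Icc 0 T)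
  contQ : ContinuousOn Q (Set.Icc 0 T)
  derivP : ∀ t ∈ Set.Ioo 0 T, HasDerivAt P (fieldP ϰ ρ n (P t) (Q t)) t
  derivQ : ∀ t ∈ Set.Ioo 0 T, HasDerivAt Q (fieldQ ϰ ρ n (P t) (Q t)) t
  realP : ∀ t ∈ Set.Icc 0 T, reflect (P t) = P t
  realQ : ∀ t ∈ Set.Icc 0 T, reflect (Q t) = Q t
  bound : ∀ t ∈ Set.Icc 0 T, ‖P t‖ ^ 2 + ‖Q t‖ ^ 2 ≤ B ^ 2

theorem le_of_sq_add_sq_le {a b B : ℝ} (hB : 0 ≤ B) (h : a ^ 2 + b ^ 2 ≤ B ^ 2) : a ≤ B ∧ b ≤ B :=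
  ⟨abs_le_of_sq_le_sq' (by nlinarith [sq_nonneg b]) hB |>.2,
    abs_le_of_sq_le_sq' (by nlinarith [sq_nonneg a]) hB |>.2⟩

/-- The field is multiplied by a cutoff in the norm and projected to real functions, which gives a
global solution. The a priori estimate and continuity in time keep it in the ball where both
modifications are inactive. The time T and the radius B do not depend on n. -/
theorem exists_galerkin (hp : Params ϰ c ρ q) (n : ℝ) {B T : ℝ} (hB : 0 < B) (hT : 0 ≤ T)
    {P₀ Q₀ : L2C} (hP₀ : reflect P₀ = P₀) (hQ₀ : reflect Q₀ = Q₀)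
    (h0 : Real.exp (growth c ρ q B * T) *
      ((1 + 2 * symConst ρ B) * (‖P₀‖ ^ 2 + ‖Q₀‖ ^ 2)) < B ^ 2) :
    ∃ P Q : ℝ → L2C, P 0 = P₀ ∧ Q 0 = Q₀ ∧ IsGalerkin ϰ ρ n T B P Q := by
  have hg := growth_pos (zero_le_one.trans hp.one_le) ρ q hB.le
  have hs := symConst_nonneg ρ hB.le
  obtain ⟨u, hu0, huc, hud⟩ := exists_solution_of_lipOnBalls
    (LipOnBalls.smul (lipOnBalls_ballCutoff hB) (((lipOnBalls_fieldP ϰ ρ n).clm_comp realProj).prodMk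
      ((lipOnBalls_fieldQ ϰ ρ n).clm_comp realProj))) (a := 2 * B)
    (fun x hx ↦ by simp only [ballCutoff_eq_zero hB hx, zero_smul]) (P₀, Q₀) hT
  have hc1 : ContinuousOn (fun t ↦ (u t).1) (Set.Icc 0 T) := continuous_fst.comp_continuousOn huc
  have hc2 : ContinuousOn (fun t ↦ (u t).2) (Set.Icc 0 T) := continuous_snd.comp_continuousOn huc
  have hd1 : ∀ t ∈ Set.Ioo 0 T, HasDerivAt (fun t ↦ (u t).1)
      (ballCutoff B (u t) • realProj (fieldP ϰ ρ n (u t).1 (u t).2)) t := fun t ht ↦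
    (ContinuousLinearMap.fst ℝ L2C L2C).hasFDerivAt.comp_hasDerivAt t (hud t ht)
  have hd2 : ∀ t ∈ Set.Ioo 0 T, HasDerivAt (fun t ↦ (u t).2)
      (ballCutoff B (u t) • realProj (fieldQ ϰ ρ n (u t).1 (u t).2)) t := fun t ht ↦
    (ContinuousLinearMap.snd ℝ L2C L2C).hasFDerivAt.comp_hasDerivAt t (hud t ht)
  have hr1 := reflect_eq_of_hasDerivAt hc1 hd1
    (fun t _ ↦ by rw [map_smul, reflect_realProj]) (by simp [hu0, hP₀])
  have hr2 := reflect_eq_of_hasDerivAt hc2 hd2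
    (fun t _ ↦ by rw [map_smul, reflect_realProj]) (by simp [hu0, hQ₀])
  have hsub : Set.Ioo 0 T ⊆ Set.Icc 0 T := Set.Ioo_subset_Icc_self
  -- While the bound holds, the cutoff equals 1 and the projection fixes the field, so the truncated
  -- system is solved.
  have real : ∀ t ∈ Set.Ioo 0 T, ‖(u t).1‖ ^ 2 + ‖(u t).2‖ ^ 2 ≤ B ^ 2 →
      HasDerivAt (fun t ↦ (u t).1) (fieldP ϰ ρ n (u t).1 (u t).2) t ∧
      HasDerivAt (fun t ↦ (u t).2) (fieldQ ϰ ρ n (u t).1 (u t).2) t := by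
    intro t ht hb
    have hb' := le_of_sq_add_sq_le hB.le hb
    have h1 : ballCutoff B (u t) = 1 := ballCutoff_eq_one hB (max_le hb'.1 hb'.2)
    have d1 := hd1 t ht
    have d2 := hd2 t ht
    rw [h1, one_smul, realProj_of_reflect
      (reflect_fieldP hp n (hr1 t (hsub ht)) (hr2 t (hsub ht)))] at d1
    rw [h1, one_smul, realProj_of_reflect
      (reflect_fieldQ hp n (hr1 t (hsub ht)) (hr2 t (hsub ht)))] at d2
    exact ⟨d1, d2⟩
  have e0 : ‖(u 0).1‖ ^ 2 + ‖(u 0).2‖ ^ 2 = ‖P₀‖ ^ 2 + ‖Q₀‖ ^ 2 := by rw [hu0]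
  have hN0 : 0 ≤ ‖P₀‖ ^ 2 + ‖Q₀‖ ^ 2 := by positivity
  have hlt : ∀ t ∈ Set.Icc 0 T, ‖(u t).1‖ ^ 2 + ‖(u t).2‖ ^ 2 < B ^ 2 := by
    refine forall_lt_of_bootstrap ((hc1.norm.pow 2).add (hc2.norm.pow 2)) ?_ fun τ hτ hb ↦ ?_
    · rw [e0]
      refine lt_of_le_of_lt ?_ h0
      have h1 : 1 ≤ Real.exp (growth c ρ q B * T) := Real.one_le_exp (by positivity)
      have h2 : ‖P₀‖ ^ 2 + ‖Q₀‖ ^ 2 ≤ (1 + 2 * symConst ρ B) * (‖P₀‖ ^ 2 + ‖Q₀‖ ^ 2) :=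
        le_mul_of_one_le_left hN0 (by linarith)
      exact h2.trans (le_mul_of_one_le_left (hN0.trans h2) h1)
    · have hτs : Set.Icc 0 τ ⊆ Set.Icc 0 T := Set.Icc_subset_Icc_right hτ.2
      have hτo : Set.Ioo 0 τ ⊆ Set.Ioo 0 T := Set.Ioo_subset_Ioo_right hτ.2
      have key := weighted_estimate hp (n := n) (N := 1) (B := B) (T := τ) le_rfl hB.le
        (hc1.mono hτs) (hc2.mono hτs)
        (fun t ht ↦ (real t (hτo ht) (hb t (Set.Ioo_subset_Icc_self ht))).1)
        (fun t ht ↦ (real t (hτo ht) (hb t (Set.Ioo_subset_Icc_self ht))).2)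
        (fun t ht ↦ hr1 t (hτs ht))
        (fun t ht ↦ (le_of_sq_add_sq_le hB.le (hb t ht)).1)
        (fun t ht ↦ (le_of_sq_add_sq_le hB.le (hb t ht)).2)
        (Set.right_mem_Icc.mpr hτ.1)
      simp only [mulOp_psi_one] at key
      rw [e0] at key
      refine (key.trans ?_).trans_lt h0
      have := hτ.2
      gcongr
  exact ⟨fun t ↦ (u t).1, fun t ↦ (u t).2, by simp [hu0], by simp [hu0],
    ⟨hc1, hc2, fun t ht ↦ (real t ht (hlt t (hsub ht)).le).1,
      fun t ht ↦ (real t ht (hlt t (hsub ht)).le).2, hr1, hr2, fun t ht ↦ (hlt t ht).le⟩⟩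

theorem IsGalerkin.tail (hp : Params ϰ c ρ q) {n T B N : ℝ} {P Q : ℝ → L2C} (hB : 0 ≤ B)
    (h : IsGalerkin ϰ ρ n T B P Q) (hN : 1 ≤ N) {t : ℝ} (ht : t ∈ Set.Icc 0 T) :
    ‖mulOp (psi N) (P t)‖ ^ 2 + ‖mulOp (psi N) (Q t)‖ ^ 2 ≤ Real.exp (growth c ρ q B * T) *
      ((1 + 2 * symConst ρ B) * (‖mulOp (psi N) (P 0)‖ ^ 2 + ‖mulOp (psi N) (Q 0)‖ ^ 2)) := by
  refine (weighted_estimate hp hN hB h.contP h.contQ h.derivP h.derivQ h.realP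
    (fun t ht ↦ (le_of_sq_add_sq_le hB (h.bound t ht)).1)
    (fun t ht ↦ (le_of_sq_add_sq_le hB (h.bound t ht)).2) ht).trans ?_
  have hg := growth_pos (zero_le_one.trans hp.one_le) ρ q hB
  have hs := symConst_nonneg ρ hB
  have := ht.2
  gcongr

/-- Truncation acts only on the outer symbols, so projecting the level m field to level n ≤ m gives
the level n field with the same arguments. This makes approximations of different levels comparable.
-/
theorem cut_fieldP (hp : Params ϰ c ρ q) {n m : ℝ} (h : n ≤ m) (P Q : L2C) :
    mulOp (cut n) (fieldP ϰ ρ m P Q) = fieldP ϰ ρ n P Q := by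
  have e1 : (fun x ↦ cut n x * omSym ϰ m x) = omSym ϰ n := by
    ext x
    have := cut_mul_cut h x
    unfold omSym
    linear_combination freq x * bsym ϰ x * msym x * this
  have e2 : (fun x ↦ cut n x * elevOut ϰ ρ m x) = elevOut ϰ ρ n := by
    ext x
    have := cut_mul_cut h x
    unfold elevOut
    linear_combination bsym ϰ x * highSym ρ x * thsym x * this
  rw [fieldP, fieldP, map_neg, map_smul, map_add, mulOp_mulOp (bddSymbol_cut n)
    (bddSymbol_omSym ϰ m), nonlinP, mulOp_bil_tri (admissible_nonlinP hp m) (bddSymbol_cut n),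
    e1, e2, nonlinP]

theorem cut_fieldQ (hp : Params ϰ c ρ q) {n m : ℝ} (h : n ≤ m) (P Q : L2C) :
    mulOp (cut n) (fieldQ ϰ ρ m P Q) = fieldQ ϰ ρ n P Q := by
  have e1 : (fun x ↦ cut n x * omSym ϰ m x) = omSym ϰ n := by
    ext x
    have := cut_mul_cut h x
    unfold omSym
    linear_combination freq x * bsym ϰ x * msym x * this
  have e2 : (fun x ↦ cut n x * velOut ρ m x) = velOut ρ n := by
    ext x
    have := cut_mul_cut h x
    unfold velOut
    linear_combination 1 / 2 * freq x * highSym ρ x * msym x * this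
  rw [fieldQ, fieldQ, map_neg, map_smul, map_add, mulOp_mulOp (bddSymbol_cut n)
    (bddSymbol_omSym ϰ m), nonlinQ, mulOp_bil_tri (admissible_nonlinQ hp m) (bddSymbol_cut n),
    e1, e2, nonlinQ]

theorem IsGalerkin.isTruncSol (hp : Params ϰ c ρ q) {n m T B : ℝ} {P Q : ℝ → L2C}
    (h : IsGalerkin ϰ ρ m T B P Q) (hnm : n ≤ m) : IsTruncSol ϰ ρ n T P Q where
  contP := (mulOp (cut n)).continuous.comp_continuousOn h.contP
  contQ := (mulOp (cut n)).continuous.comp_continuousOn h.contQ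
  derivP t ht := by
    rw [← cut_fieldP hp hnm]; exact hasDerivAt_clm_apply _ (h.derivP t ht)
  derivQ t ht := by
    rw [← cut_fieldQ hp hnm]; exact hasDerivAt_clm_apply _ (h.derivQ t ht)

end Galerkin

end WhithamBoussinesq
end

noncomputable section
open MeasureTheory Filter Topology
open scoped SchwartzMap ENNReal

namespace WhithamBoussinesq

/-! ### Convergence of cutoffs; low and high frequencies -/

section Approximation

theorem tendsto_norm_mulOp_zero {φ : ℕ → ℝ → ℝ} (hb : ∀ n, BddSymbol (φ n))
    (h1 : ∀ n x, |φ n x| ≤ 1) (h0 : ∀ x, Tendsto (fun n ↦ φ n x) atTop (𝓝 0)) (f : L2C) :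
    Tendsto (fun n ↦ ‖mulOp (φ n) f‖) atTop (𝓝 0) := by
  have hint : Integrable (fun x ↦ ‖f x‖ ^ 2) volume := (Lp.memLp f).norm.integrable_sq
  have key : Tendsto (fun n ↦ ∫ x, inner ℂ (mulOp (φ n) f x) (mulOp (φ n) f x)) atTop
      (𝓝 (∫ _ : ℝ, (0 : ℂ))) := by
    refine tendsto_integral_of_dominated_convergence (fun x ↦ ‖f x‖ ^ 2)
      (fun n ↦ (L2.integrable_inner _ _).1) hint (fun n ↦ ?_) ?_
    · filter_upwards [coeFn_mulOp (hb n) f] with x hx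
      rw [hx]
      refine (norm_inner_le_norm _ _).trans ?_
      rw [← sq, norm_mul, Complex.norm_real, Real.norm_eq_abs]
      gcongr
      exact mul_le_of_le_one_left (norm_nonneg _) (h1 n x)
    · filter_upwards [ae_all_iff.mpr fun n ↦ coeFn_mulOp (hb n) f] with x hx
      have h2 : Tendsto (fun n ↦ (φ n x : ℂ) * f x) atTop (𝓝 0) := by
        have := (Complex.continuous_ofReal.tendsto 0).comp (h0 x)
        simpa using this.mul_const (f x)
      have h3 := h2.inner (𝕜 := ℂ) h2
      simpa [hx] using h3
  rw [integral_zero] at key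
  have h4 : Tendsto (fun n ↦ ‖mulOp (φ n) f‖ ^ 2) atTop (𝓝 0) := by
    have h5 := (Complex.continuous_re.tendsto 0).comp key
    refine h5.congr fun n ↦ ?_
    rw [Function.comp_apply, ← L2.inner_def, inner_self_eq_norm_sq_to_K]
    norm_cast
  have h6 := (Real.continuous_sqrt.tendsto 0).comp h4
  simpa [Function.comp_def, Real.sqrt_sq (norm_nonneg _)] using h6

theorem tendsto_norm_psi (f : L2C) :
    Tendsto (fun n : ℕ ↦ ‖mulOp (psi (n + 1)) f‖) atTop (𝓝 0) := by
  have hn : ∀ n : ℕ, (1 : ℝ) ≤ n + 1 := fun n ↦ by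
    have : (0 : ℝ) ≤ n := n.cast_nonneg
    linarith
  refine tendsto_norm_mulOp_zero (fun n ↦ bddSymbol_psi (hn n)) (fun n x ↦ ?_) (fun x ↦ ?_) f
  · rw [abs_of_nonneg (psi_nonneg (hn n) x)]; exact psi_le_one _ x
  · have h : Tendsto (fun n : ℕ ↦ jap x / ((n : ℝ) + 1)) atTop (𝓝 0) := by
      have := (tendsto_one_div_add_atTop_nhds_zero_nat (𝕜 := ℝ)).const_mul (jap x)
      simpa [div_eq_mul_inv] using this
    exact squeeze_zero (fun n ↦ psi_nonneg (hn n) x) (fun n ↦ min_le_right _ _) h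

theorem bddSymbol_one_sub_cut (n : ℝ) : BddSymbol (fun x ↦ 1 - cut n x) := by
  refine bddSymbol_of_nonneg_le_one (measurable_const.sub (isCutoff_cut n).measurable)
    (fun x ↦ ?_) (fun x ↦ ?_) <;> (unfold cut; split_ifs <;> norm_num)

theorem mulOp_one_sub_cut (n : ℝ) (f : L2C) :
    mulOp (fun x ↦ 1 - cut n x) f = f - mulOp (cut n) f := by
  refine Lp.ext ?_
  filter_upwards [coeFn_mulOp (bddSymbol_one_sub_cut n) f, coeFn_mulOp (bddSymbol_cut n) f,
    Lp.coeFn_sub f (mulOp (cut n) f)] with x h1 h2 h3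
  rw [h1, h3, Pi.sub_apply, h2]
  push_cast; ring

theorem tendsto_cut (f : L2C) :
    Tendsto (fun n : ℕ ↦ mulOp (cut n) f) atTop (𝓝 f) := by
  have h := tendsto_norm_mulOp_zero (fun n : ℕ ↦ bddSymbol_one_sub_cut n) (fun n x ↦ ?_)
    (fun x ↦ ?_) f
  · rw [tendsto_iff_norm_sub_tendsto_zero]
    refine h.congr fun n ↦ ?_
    rw [mulOp_one_sub_cut, norm_sub_rev]
  · unfold cut; split_ifs <;> norm_num
  · refine tendsto_const_nhds.congr' ?_
    filter_upwards [eventually_ge_atTop ⌈jap x⌉₊] with n hn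
    have : jap x ≤ n := (Nat.le_ceil _).trans (by exact_mod_cast hn)
    simp [cut, this]

theorem norm_low_sub_cut_le {ρ n : ℝ} (hρ : 0 ≤ ρ) (hn : 1 ≤ n) (f : L2C) :
    ‖mulOp (lowSym ρ) (f - mulOp (cut n) f)‖ ≤ (√n)⁻¹ * ‖f‖ := by
  have hb := (bddSymbol_lowSym hρ).mul (bddSymbol_one_sub_cut n)
  rw [← mulOp_one_sub_cut, mulOp_mulOp (bddSymbol_lowSym hρ) (bddSymbol_one_sub_cut n)]
  refine norm_mulOp_le hb (fun x ↦ ?_) f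
  have hl := lowSym_pos ρ x
  have hn0 : 0 < √n := Real.sqrt_pos.mpr (by linarith)
  unfold cut
  split_ifs with h
  · simp
  · rw [sub_zero, mul_one, abs_of_pos hl]
    calc lowSym ρ x ≤ 1 * (√(jap x))⁻¹ := by
          unfold lowSym; gcongr; exact lam_le_one hρ x
      _ ≤ _ := by
          rw [one_mul]; gcongr; linarith

/-- On ⟨k⟩ > N the weight ψ is 1; on ⟨k⟩ ≤ N the weight ⟨k⟩^r is bounded by N^r, so the weak norm
controls the strong one. -/
theorem exists_norm_le_psi_add_low {ρ N : ℝ} (hρ : 0 ≤ ρ) (hN : 1 ≤ N) :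
    ∃ C : ℝ, 0 ≤ C ∧ ∀ f : L2C, ‖f‖ ≤ ‖mulOp (psi N) f‖ + C * ‖mulOp (lowSym ρ) f‖ := by
  refine ⟨√N * N ^ ρ, by positivity, fun f ↦ ?_⟩
  have h1 : ‖mulOp (fun x ↦ 1 - cut N x) f‖ ≤ 1 * ‖mulOp (psi N) f‖ := by
    refine norm_mulOp_le_norm_mulOp (bddSymbol_one_sub_cut N) (bddSymbol_psi hN) (fun x ↦ ?_) f
    rw [abs_of_nonneg (psi_nonneg hN x)]
    unfold cut
    split_ifs with h
    · simpa using psi_nonneg hN x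
    · have : 1 ≤ jap x / N := (one_le_div (by linarith)).mpr (by linarith)
      simp [psi, min_eq_left this]
  have h2 : ‖mulOp (cut N) f‖ ≤ √N * N ^ ρ * ‖mulOp (lowSym ρ) f‖ := by
    refine norm_mulOp_le_norm_mulOp (bddSymbol_cut N) (bddSymbol_lowSym hρ) (fun x ↦ ?_) f
    rw [abs_of_pos (lowSym_pos ρ x)]
    have hl := lowSym_pos ρ x
    unfold cut
    split_ifs with h
    · have h3 : highSym ρ x ≤ √N * N ^ ρ := by
        have := jap_pos x
        rw [highSym, inv_lam]; gcongr
      rw [abs_one, ← lowSym_mul_highSym ρ x, mul_comm]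
      gcongr
    · rw [abs_zero]; positivity
  calc ‖f‖ = ‖mulOp (fun x ↦ 1 - cut N x) f + mulOp (cut N) f‖ := by
        rw [mulOp_one_sub_cut, sub_add_cancel]
    _ ≤ _ := by
        refine (norm_add_le _ _).trans (add_le_add ?_ h2)
        simpa using h1

end Approximation

/-! ### Closeness of solutions in the weak and the strong norm -/

section Stability

variable {ϰ c ρ : ℝ} {q : ℕ}

/-- Both components are bounded by `B` on `[0, T]`. -/
def BoundedBy (T B : ℝ) (P Q : ℝ → L2C) : Prop := ∀ t ∈ Set.Icc 0 T, ‖P t‖ ≤ B ∧ ‖Q t‖ ≤ B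

/-- High frequencies are controlled by those of the data. -/
def TailBound (T K : ℝ) (P Q : ℝ → L2C) : Prop :=
  ∀ N : ℝ, 1 ≤ N → ∀ t ∈ Set.Icc 0 T, ‖mulOp (psi N) (P t)‖ ^ 2 + ‖mulOp (psi N) (Q t)‖ ^ 2 ≤
    K * (‖mulOp (psi N) (P 0)‖ ^ 2 + ‖mulOp (psi N) (Q 0)‖ ^ 2)

theorem norm_low_le (hρ : 0 ≤ ρ) (f : L2C) : ‖mulOp (lowSym ρ) f‖ ≤ ‖f‖ := by
  simpa using norm_mulOp_le (bddSymbol_lowSym hρ) (C := 1)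
    (fun x ↦ by rw [abs_of_pos (lowSym_pos ρ x)]; exact lowSym_le_one hρ x) f

/-- Solutions of the truncated system with close data are close in a weak norm. -/
theorem exists_low_close (hp : Params ϰ c ρ q) {B T : ℝ} (hB : 0 ≤ B) {ε : ℝ}
    (hε : 0 < ε) : ∃ δ : ℝ, 0 < δ ∧ ∃ n₀ : ℝ, 1 ≤ n₀ ∧ ∀ n : ℝ, n₀ ≤ n → ∀ P₁ Q₁ P₂ Q₂ : ℝ → L2C,
      IsTruncSol ϰ ρ n T P₁ Q₁ → IsTruncSol ϰ ρ n T P₂ Q₂ →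
      (∀ t ∈ Set.Icc 0 T, reflect (P₁ t) = P₁ t) → BoundedBy T B P₁ Q₁ → BoundedBy T B P₂ Q₂ →
      ‖P₁ 0 - P₂ 0‖ < δ → ‖Q₁ 0 - Q₂ 0‖ < δ → ∀ t ∈ Set.Icc 0 T,
        ‖mulOp (lowSym ρ) (P₁ t - P₂ t)‖ ≤ ε ∧ ‖mulOp (lowSym ρ) (Q₁ t - Q₂ t)‖ ≤ ε := by
  have hg := growth_pos (zero_le_one.trans hp.one_le) ρ q hB
  have hs := symConst_nonneg ρ hB
  -- The right-hand side of the comparison estimate at time T, with a the distance of the data and x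
  -- = n^{-1/2}. It is continuous and vanishes at the origin.
  set w : ℝ → ℝ → ℝ := fun a x ↦ Real.exp (growth c ρ q B * T) * ((1 + 2 * symConst ρ B) *
    (a ^ 2 + a ^ 2) + (2 + 4 * symConst ρ B) *
      (32 * c * weightNorm (lam ρ) * x * B ^ 2) ^ 2 * T) with hw
  have h1 : Tendsto (fun p : ℝ × ℝ ↦ w p.1 p.2) (𝓝 (0, 0)) (𝓝 0) := by
    have hc : Continuous fun p : ℝ × ℝ ↦ w p.1 p.2 := by simp only [hw]; fun_prop
    have := hc.tendsto (0, 0)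
    simpa [hw] using this
  have h2 : Tendsto (fun p : ℝ × ℝ ↦ p.2 * (2 * B)) (𝓝 (0, 0)) (𝓝 0) := by
    have hc : Continuous fun p : ℝ × ℝ ↦ p.2 * (2 * B) := by fun_prop
    have := hc.tendsto (0, 0)
    simpa using this
  have h3 := (h1.eventually_lt_const (u := (ε / 2) ^ 2) (by positivity)).and
    (h2.eventually_lt_const (u := ε / 2) (by positivity))
  obtain ⟨r, hr, hball⟩ := Metric.eventually_nhds_iff.mp h3
  -- The threshold r⁻² + 1 ensures n^{-1/2} < r.
  refine ⟨r / 2, by positivity, (r⁻¹) ^ 2 + 1, by nlinarith [sq_nonneg r⁻¹], ?_⟩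
  intro n hn P₁ Q₁ P₂ Q₂ s₁ s₂ hR b₁ b₂ hP hQ t ht
  have hn1 : 1 ≤ n := by nlinarith [sq_nonneg r⁻¹]
  have hx : (√n)⁻¹ < r := by
    have h4 : r⁻¹ < √n := Real.lt_sqrt_of_sq_lt (by linarith)
    exact inv_lt_of_inv_lt₀ hr h4
  have hx0 : 0 ≤ (√n)⁻¹ := by positivity
  obtain ⟨k1, k2⟩ := hball (y := (r / 2, (√n)⁻¹)) (by
    rw [Prod.dist_eq, max_lt_iff]
    simp only [Real.dist_eq, sub_zero]
    rw [abs_of_nonneg hx0, abs_of_pos (by positivity)]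
    exact ⟨by linarith, hx⟩)
  have key := comparison hp hn1 hB s₁ s₂ hR (fun t ht ↦ (b₁ t ht).1) (fun t ht ↦ (b₁ t ht).2)
    (fun t ht ↦ (b₂ t ht).1) (fun t ht ↦ (b₂ t ht).2) ht
  have init : ∀ f g : L2C, ‖f - g‖ < r / 2 →
      ‖mulOp (lowSym ρ) (mulOp (cut n) f - mulOp (cut n) g)‖ ≤ r / 2 := by
    intro f g h
    rw [← map_sub]
    exact ((norm_low_le hp.nonneg _).trans (norm_cut_le n _)).trans h.le
  have i1 := init _ _ hP
  have i2 := init _ _ hQ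
  have hle : ‖mulOp (lowSym ρ) (mulOp (cut n) (P₁ t) - mulOp (cut n) (P₂ t))‖ ^ 2 +
      ‖mulOp (lowSym ρ) (mulOp (cut n) (Q₁ t) - mulOp (cut n) (Q₂ t))‖ ^ 2 ≤ (ε / 2) ^ 2 := by
    refine (key.trans ?_).trans k1.le
    have ht2 := ht.2
    have ht1 := ht.1
    simp only [hw, truncError]
    gcongr
  have hle' := le_of_sq_add_sq_le (by positivity) hle
  have fin : ∀ f g : L2C, ‖f‖ ≤ B → ‖g‖ ≤ B →
      ‖mulOp (lowSym ρ) (mulOp (cut n) f - mulOp (cut n) g)‖ ≤ ε / 2 →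
      ‖mulOp (lowSym ρ) (f - g)‖ ≤ ε := by
    intro f g hf hg h
    have h5 := norm_low_sub_cut_le hp.nonneg hn1 (f - g)
    have h6 : ‖f - g‖ ≤ 2 * B := (norm_sub_le _ _).trans (by linarith)
    have h7 : (√n)⁻¹ * ‖f - g‖ ≤ (√n)⁻¹ * (2 * B) := by gcongr
    rw [map_sub] at h5
    rw [← map_sub (mulOp (cut n))] at h
    have h8 : ‖mulOp (lowSym ρ) (f - g)‖ ≤
        ‖mulOp (lowSym ρ) (f - g) - mulOp (lowSym ρ) (mulOp (cut n) (f - g))‖ +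
          ‖mulOp (lowSym ρ) (mulOp (cut n) (f - g))‖ := by
      simpa using norm_add_le (mulOp (lowSym ρ) (f - g) -
        mulOp (lowSym ρ) (mulOp (cut n) (f - g))) (mulOp (lowSym ρ) (mulOp (cut n) (f - g)))
    simp only at k2
    linarith
  exact ⟨fin _ _ (b₁ t ht).1 (b₂ t ht).1 hle'.1, fin _ _ (b₁ t ht).2 (b₂ t ht).2 hle'.2⟩

/-- Solutions of the truncated system with data close to given data are close to each other. -/
theorem exists_close (hp : Params ϰ c ρ q) {B T K : ℝ} (hB : 0 ≤ B) (hK : 0 ≤ K)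
    (P₀ Q₀ : L2C) {ε : ℝ} (hε : 0 < ε) :
    ∃ δ : ℝ, 0 < δ ∧ ∃ n₀ : ℝ, 1 ≤ n₀ ∧ ∀ n : ℝ, n₀ ≤ n → ∀ P₁ Q₁ P₂ Q₂ : ℝ → L2C,
      IsTruncSol ϰ ρ n T P₁ Q₁ → IsTruncSol ϰ ρ n T P₂ Q₂ →
      (∀ t ∈ Set.Icc 0 T, reflect (P₁ t) = P₁ t) → BoundedBy T B P₁ Q₁ → BoundedBy T B P₂ Q₂ →
      TailBound T K P₁ Q₁ → TailBound T K P₂ Q₂ →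
      ‖P₁ 0 - P₀‖ < δ → ‖Q₁ 0 - Q₀‖ < δ → ‖P₂ 0 - P₀‖ < δ → ‖Q₂ 0 - Q₀‖ < δ →
      ∀ t ∈ Set.Icc 0 T, ‖P₁ t - P₂ t‖ ≤ ε ∧ ‖Q₁ t - Q₂ t‖ ≤ ε := by
  have h1 : Tendsto (fun p : ℝ × ℝ ↦ K * ((p.1 + p.2) ^ 2 + (p.1 + p.2) ^ 2)) (𝓝 (0, 0))
      (𝓝 0) := by
    have hc : Continuous fun p : ℝ × ℝ ↦ K * ((p.1 + p.2) ^ 2 + (p.1 + p.2) ^ 2) := by fun_prop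
    have := hc.tendsto (0, 0)
    simpa using this
  obtain ⟨r, hr, hball⟩ := Metric.eventually_nhds_iff.mp
    (h1.eventually_lt_const (u := (ε / 4) ^ 2) (by positivity))
  -- N is chosen from the tails of P₀ and Q₀ alone. Nearby data then also have small tails, and the
  -- tail bound carries this to all times; only then are δ and the level n chosen from the weak
  -- estimate, whose accuracy depends on N.
  obtain ⟨m, hm1, hm2⟩ := (((tendsto_norm_psi P₀).eventually_lt_const (u := r / 2)
    (by positivity)).and ((tendsto_norm_psi Q₀).eventually_lt_const (u := r / 2)
    (by positivity))).exists
  have hN : (1 : ℝ) ≤ m + 1 := by have : (0 : ℝ) ≤ m := m.cast_nonneg; linarith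
  set N : ℝ := m + 1
  obtain ⟨C, hC, hCf⟩ := exists_norm_le_psi_add_low hp.nonneg hN
  obtain ⟨δ, hδ, n₀, hn₀, hlow⟩ := exists_low_close hp hB (T := T) (ε := ε / 2 / (C + 1))
    (by positivity)
  refine ⟨min (δ / 2) (r / 2), by positivity, n₀, hn₀, ?_⟩
  intro n hn P₁ Q₁ P₂ Q₂ s₁ s₂ hR b₁ b₂ t₁ t₂ hP₁ hQ₁ hP₂ hQ₂ t ht
  rw [lt_min_iff] at hP₁ hQ₁ hP₂ hQ₂
  have tri_ineq : ∀ {f g h : L2C}, ‖f - h‖ < δ / 2 → ‖g - h‖ < δ / 2 → ‖f - g‖ < δ := by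
    intro f g h h1 h2
    have : f - g = (f - h) - (g - h) := by abel
    rw [this]
    exact (norm_sub_le _ _).trans_lt (by linarith)
  have hl := hlow n hn P₁ Q₁ P₂ Q₂ s₁ s₂ hR b₁ b₂ (tri_ineq hP₁.1 hP₂.1) (tri_ineq hQ₁.1 hQ₂.1) t ht
  have psi_le : ∀ f : L2C, ‖mulOp (psi N) f‖ ≤ ‖f‖ := by
    intro f
    simpa using norm_mulOp_le (bddSymbol_psi hN) (C := 1)
      (fun x ↦ by rw [abs_of_nonneg (psi_nonneg hN x)]; exact psi_le_one N x) f
  have init : ∀ {f h : L2C}, ‖f - h‖ < r / 2 → ‖mulOp (psi N) h‖ < r / 2 →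
      ‖mulOp (psi N) f‖ ≤ r / 2 + r / 2 := by
    intro f h h1 h2
    have h3 : mulOp (psi N) f = mulOp (psi N) (f - h) + mulOp (psi N) h := by
      rw [map_sub, sub_add_cancel]
    rw [h3]
    have := psi_le (f - h)
    exact (norm_add_le _ _).trans (by linarith)
  have tail : ∀ {P Q : ℝ → L2C}, TailBound T K P Q → ‖P 0 - P₀‖ < r / 2 → ‖Q 0 - Q₀‖ < r / 2 →
      ‖mulOp (psi N) (P t)‖ ≤ ε / 4 ∧ ‖mulOp (psi N) (Q t)‖ ≤ ε / 4 := by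
    intro P Q hPQ hP hQ
    refine le_of_sq_add_sq_le (by positivity) ((hPQ N hN t ht).trans ?_)
    have h4 := hball (y := (r / 2, r / 2)) (by
      rw [Prod.dist_eq, max_lt_iff]
      simp only [Real.dist_eq, sub_zero]
      rw [abs_of_pos (by positivity)]
      constructor <;> linarith)
    refine le_trans ?_ h4.le
    have i1 := init hP hm1
    have i2 := init hQ hm2
    gcongr
  have T1 := tail t₁ hP₁.2 hQ₁.2
  have T2 := tail t₂ hP₂.2 hQ₂.2
  have fin : ∀ {f g : L2C}, ‖mulOp (psi N) f‖ ≤ ε / 4 → ‖mulOp (psi N) g‖ ≤ ε / 4 →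
      ‖mulOp (lowSym ρ) (f - g)‖ ≤ ε / 2 / (C + 1) → ‖f - g‖ ≤ ε := by
    intro f g h1 h2 h3
    have h4 := hCf (f - g)
    have h5 : ‖mulOp (psi N) (f - g)‖ ≤ ε / 4 + ε / 4 := by
      rw [map_sub]; exact (norm_sub_le _ _).trans (add_le_add h1 h2)
    have h6 : C * ‖mulOp (lowSym ρ) (f - g)‖ ≤ ε / 2 := by
      calc _ ≤ (C + 1) * (ε / 2 / (C + 1)) := by gcongr; linarith
        _ = ε / 2 := by field_simp
    linarith
  exact ⟨fin T1.1 T2.1 hl.1, fin T1.2 T2.2 hl.2⟩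

end Stability

end WhithamBoussinesq
end

noncomputable section
open MeasureTheory Filter Topology
open scoped SchwartzMap ENNReal

namespace WhithamBoussinesq

/-! ### The untruncated equations in H^{s-1} × H^{s-3/2} -/

section WeakField

variable {ϰ c ρ : ℝ} {q : ℕ}

/-- The symbol that takes `P` to the elevation measured in `H^{s-1}`. -/
def weakSymP (ϰ ξ : ℝ) : ℝ := (√(jap ξ))⁻¹ * (bsym ϰ ξ)⁻¹

/-- The symbol that takes `Q` to the velocity measured in `H^{s-3/2}`. -/
def weakSymQ (ξ : ℝ) : ℝ := (jap ξ)⁻¹ * msym ξ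

theorem bddSymbol_weakSymP (h : 0 < ϰ) : BddSymbol (weakSymP ϰ) :=
  bddSymbol_of_nonneg_le_one (measurable_jap.sqrt.inv.mul (measurable_bsym ϰ).inv)
    (fun x ↦ by have := bsym_pos h x; unfold weakSymP; positivity)
    (fun x ↦ mul_le_one₀ (inv_le_one_of_one_le₀ (one_le_sqrt_jap x))
      (inv_nonneg.mpr (bsym_pos h x).le) (inv_le_one_of_one_le₀ (one_le_bsym h x)))

theorem bddSymbol_weakSymQ : BddSymbol weakSymQ :=
  bddSymbol_of_nonneg_le_one (measurable_jap.inv.mul measurable_msym)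
    (fun x ↦ mul_nonneg (inv_nonneg.mpr (jap_pos x).le) (msym_nonneg x))
    (fun x ↦ mul_le_one₀ (inv_le_one_of_one_le₀ (one_le_jap x)) (msym_nonneg x) (msym_le_one x))

/-- The linear part of the weak form of the elevation equation. -/
def weakLinP (ξ : ℝ) : ℝ := (√(jap ξ))⁻¹ * (freq ξ * msym ξ)

/-- The linear part of the weak form of the velocity equation. -/
def weakLinQ (ϰ ξ : ℝ) : ℝ := thsym ξ * ((jap ξ)⁻¹ * bsym ϰ ξ)

theorem bddSymbol_weakLinP : BddSymbol weakLinP := by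
  refine ⟨measurable_jap.sqrt.inv.mul (measurable_freq.mul measurable_msym), 1, fun x ↦ ?_⟩
  have h := abs_freq_mul_msym_le x
  have hs := sqrt_jap_pos x
  rw [weakLinP, abs_mul, abs_of_pos (inv_pos.mpr hs), abs_mul, abs_of_nonneg (msym_nonneg x),
    inv_mul_le_iff₀ hs, mul_one]
  exact h

theorem bsym_le_jap {ϰ c : ℝ} (hc : 1 ≤ c) (hϰ : ϰ ≤ c ^ 2) (x : ℝ) : bsym ϰ x ≤ c * jap x := by
  have h0 : 0 ≤ c * jap x := by have := jap_pos x; positivity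
  refine Real.sqrt_le_iff.mpr ⟨h0, ?_⟩
  rw [mul_pow c, jap_sq]
  nlinarith [sq_nonneg (2 * Real.pi * x), mul_le_mul_of_nonneg_right hϰ (sq_nonneg (2 * Real.pi * x))]

theorem bddSymbol_weakLinQ (hp : Params ϰ c ρ q) : BddSymbol (weakLinQ ϰ) := by
  refine bddSymbol_thsym.mul ⟨measurable_jap.inv.mul (measurable_bsym ϰ), c, fun x ↦ ?_⟩
  have h := bsym_le_jap hp.one_le hp.le_sq x
  have hj := jap_pos x
  have hb := bsym_pos hp.pos x
  rw [abs_of_pos (by positivity), inv_mul_le_iff₀ hj, mul_comm]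
  exact h

/-- The outer symbol in the weak form of the elevation equation. -/
def weakOutP (ρ ξ : ℝ) : ℝ := thsym ξ * (lam ρ ξ)⁻¹

/-- The outer symbol in the weak form of the velocity equation. -/
def weakOutQ (ρ ξ : ℝ) : ℝ := 1 / 2 * (√(jap ξ))⁻¹ * thsym ξ * (lam ρ ξ)⁻¹

theorem measurable_weakOutP (ρ : ℝ) : Measurable (weakOutP ρ) :=
  measurable_thsym.mul (measurable_lam ρ).inv

theorem measurable_weakOutQ (ρ : ℝ) : Measurable (weakOutQ ρ) :=
  ((measurable_const.mul measurable_jap.sqrt.inv).mul measurable_thsym).mul (measurable_lam ρ).inv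

theorem abs_half_weak_le (x : ℝ) : |1 / 2 * (√(jap x))⁻¹ * thsym x| ≤ 1 := by
  have h1 := abs_thsym_le_one x
  have h2 : (√(jap x))⁻¹ ≤ 1 := inv_le_one_of_one_le₀ (one_le_sqrt_jap x)
  have h3 := inv_pos.mpr (sqrt_jap_pos x)
  rw [abs_mul, abs_of_pos (by positivity)]
  exact mul_le_one₀ (by linarith) (abs_nonneg _) h1

theorem admissible_weakP (hp : Params ϰ c ρ q) :
    Admissible (tri (weakOutP ρ) (etaSym ϰ ρ) (velSym ρ)) :=
  admissible_of_le (memLp_lam hp.half_lt) (measurable_lam ρ)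
    (measurable_tri (measurable_weakOutP ρ) (measurable_etaSym ϰ ρ) (measurable_velSym ρ))
    (C := 2 ^ ρ) (by positivity) fun τ ζ ↦ by
      rw [abs_of_pos (lam_pos ρ τ), abs_of_pos (lam_pos ρ ζ)]
      exact abs_product_kernel_le hp.pos hp.nonneg (abs_thsym_le_one (τ + ζ)) τ ζ

theorem admissible_weakQ (hp : Params ϰ c ρ q) :
    Admissible (tri (weakOutQ ρ) (velSym ρ) (velSym ρ)) :=
  admissible_of_le (memLp_lam hp.half_lt) (measurable_lam ρ)
    (measurable_tri (measurable_weakOutQ ρ) (measurable_velSym ρ) (measurable_velSym ρ))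
    (C := 2 ^ ρ) (by positivity) fun τ ζ ↦ by
      rw [abs_of_pos (lam_pos ρ τ), abs_of_pos (lam_pos ρ ζ)]
      exact abs_square_kernel_le hp.nonneg (abs_half_weak_le (τ + ζ)) τ ζ

/-- The right-hand side of the elevation equation in `H^{s-1}`. -/
def weakP (ϰ ρ : ℝ) (P Q : L2C) : L2C :=
  -(Complex.I • (mulOp weakLinP Q + bil (tri (weakOutP ρ) (etaSym ϰ ρ) (velSym ρ)) P Q))

/-- The right-hand side of the velocity equation in `H^{s-3/2}`. -/
def weakQ (ϰ ρ : ℝ) (P Q : L2C) : L2C :=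
  -(Complex.I • (mulOp (weakLinQ ϰ) P + bil (tri (weakOutQ ρ) (velSym ρ) (velSym ρ)) Q Q))

theorem lipOnBalls_weakP (ϰ ρ : ℝ) : LipOnBalls (fun x : L2C × L2C ↦ weakP ϰ ρ x.1 x.2) := by
  refine LipOnBalls.neg_I_smul (LipOnBalls.add ?_ ?_)
  · exact lipOnBalls_clm (((mulOp weakLinP).restrictScalars ℝ).comp
      (ContinuousLinearMap.snd ℝ L2C L2C))
  · exact lipOnBalls_bilinear _ (ContinuousLinearMap.fst ℂ L2C L2C)
      (ContinuousLinearMap.snd ℂ L2C L2C)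

theorem lipOnBalls_weakQ (ϰ ρ : ℝ) : LipOnBalls (fun x : L2C × L2C ↦ weakQ ϰ ρ x.1 x.2) := by
  refine LipOnBalls.neg_I_smul (LipOnBalls.add ?_ ?_)
  · exact lipOnBalls_clm (((mulOp (weakLinQ ϰ)).restrictScalars ℝ).comp
      (ContinuousLinearMap.fst ℝ L2C L2C))
  · exact lipOnBalls_bilinear _ (ContinuousLinearMap.snd ℂ L2C L2C)
      (ContinuousLinearMap.snd ℂ L2C L2C)

theorem LipOnBalls.continuous {X Y : Type*} [NormedAddCommGroup X] [NormedAddCommGroup Y]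
    {F : X → Y} (hF : LipOnBalls F) : Continuous F := by
  refine continuous_iff_continuousAt.mpr fun x ↦ ?_
  obtain ⟨L, hL, h⟩ := hF (‖x‖ + 1)
  have hon : LipschitzOnWith ⟨L, hL⟩ F (Metric.ball x 1) := by
    refine LipschitzOnWith.of_dist_le_mul fun y hy z hz ↦ ?_
    rw [dist_eq_norm, dist_eq_norm]
    have key : ∀ z ∈ Metric.ball x 1, ‖z‖ ≤ ‖x‖ + 1 := by
      intro z hz
      rw [mem_ball_iff_norm] at hz
      have := norm_le_norm_add_norm_sub' z x
      linarith
    exact h y z (key y hy) (key z hz)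
  exact hon.continuousOn.continuousAt (Metric.ball_mem_nhds x one_pos)

/-- The full right-hand side makes sense in L² after application of the symbol that lowers the
order; on ⟨k⟩ ≤ n it is the truncated field under that symbol. -/
theorem cut_weakP (hp : Params ϰ c ρ q) (n : ℝ) (P Q : L2C) :
    mulOp (cut n) (weakP ϰ ρ P Q) = mulOp (weakSymP ϰ) (fieldP ϰ ρ n P Q) := by
  have hw := bddSymbol_weakSymP hp.pos
  have e1 : (fun x ↦ weakSymP ϰ x * omSym ϰ n x) = fun x ↦ cut n x * weakLinP x := by
    ext x
    have := (bsym_pos hp.pos x).ne'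
    unfold weakSymP omSym weakLinP
    field_simp
  have e2 : (fun x ↦ weakSymP ϰ x * elevOut ϰ ρ n x) = fun x ↦ cut n x * weakOutP ρ x := by
    ext x
    have h1 := (bsym_pos hp.pos x).ne'
    have h2 := (sqrt_jap_pos x).ne'
    unfold weakSymP elevOut weakOutP highSym
    field_simp
  rw [fieldP, weakP, map_neg, map_smul, map_add, map_neg, map_smul, map_add,
    mulOp_mulOp (bddSymbol_cut n) bddSymbol_weakLinP, mulOp_mulOp hw (bddSymbol_omSym ϰ n), nonlinP,
    mulOp_bil_tri (admissible_nonlinP hp n) hw, mulOp_bil_tri (admissible_weakP hp)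
    (bddSymbol_cut n), e1, e2]

theorem cut_weakQ (hp : Params ϰ c ρ q) (n : ℝ) (P Q : L2C) :
    mulOp (cut n) (weakQ ϰ ρ P Q) = mulOp weakSymQ (fieldQ ϰ ρ n P Q) := by
  have e1 : (fun x ↦ weakSymQ x * omSym ϰ n x) = fun x ↦ cut n x * weakLinQ ϰ x := by
    ext x
    have h := freq_mul_msym_sq x
    unfold weakSymQ omSym weakLinQ freq
    linear_combination cut n x * (jap x)⁻¹ * bsym ϰ x * h
  have e2 : (fun x ↦ weakSymQ x * velOut ρ n x) = fun x ↦ cut n x * weakOutQ ρ x := by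
    ext x
    have h := freq_mul_msym_sq x
    have h1 : (jap x)⁻¹ * √(jap x) = (√(jap x))⁻¹ := by
      rw [inv_mul_eq_iff_eq_mul₀ (jap_pos x).ne', ← div_eq_mul_inv, Real.div_sqrt]
    unfold weakSymQ velOut weakOutQ highSym freq
    linear_combination cut n x * (1 / 2) * (jap x)⁻¹ * √(jap x) * (lam ρ x)⁻¹ * h +
      cut n x * (1 / 2) * thsym x * (lam ρ x)⁻¹ * h1
  rw [fieldQ, weakQ, map_neg, map_smul, map_add, map_neg, map_smul, map_add,
    mulOp_mulOp (bddSymbol_cut n) (bddSymbol_weakLinQ hp),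
    mulOp_mulOp bddSymbol_weakSymQ (bddSymbol_omSym ϰ n), nonlinQ,
    mulOp_bil_tri (admissible_nonlinQ hp n) bddSymbol_weakSymQ, mulOp_bil_tri (admissible_weakQ hp)
    (bddSymbol_cut n), e1, e2]

end WeakField

/-! ### Existence and uniqueness on the Fourier side -/

section FourierSolutions

variable {ϰ c ρ : ℝ} {q : ℕ}

/-- Solutions in the variables `P`, `Q` on the Fourier side. -/
structure IsFourierSol (ϰ ρ T : ℝ) (P Q : ℝ → L2C) : Prop where
  contP : ContinuousOn P (Set.Icc 0 T)
  contQ : ContinuousOn Q (Set.Icc 0 T)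
  derivP : ∀ t ∈ Set.Ioo 0 T, HasDerivAt (fun t ↦ mulOp (weakSymP ϰ) (P t)) (weakP ϰ ρ (P t) (Q t)) t
  derivQ : ∀ t ∈ Set.Ioo 0 T, HasDerivAt (fun t ↦ mulOp weakSymQ (Q t)) (weakQ ϰ ρ (P t) (Q t)) t
  realP : ∀ t ∈ Set.Icc 0 T, reflect (P t) = P t
  realQ : ∀ t ∈ Set.Icc 0 T, reflect (Q t) = Q t

/-- The order lowering symbols decay at infinity, so they are bounded below only on ⟨k⟩ ≤ n.
Dividing there recovers the truncated equations from the weak ones. -/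
theorem exists_inverse_cut {φ : ℝ → ℝ} (hφ : BddSymbol φ) (n : ℝ) (h : ∀ x, 0 < φ x) {a : ℝ}
    (ha : 0 ≤ a) (hb : ∀ x, jap x ≤ n → (φ x)⁻¹ ≤ a) :
    ∃ L : L2C →L[ℂ] L2C, (∀ f, L (mulOp φ f) = mulOp (cut n) f) ∧
      ∀ f, L (mulOp (cut n) f) = L f := by
  have hχ : BddSymbol (fun x ↦ cut n x * (φ x)⁻¹) := by
    refine ⟨(isCutoff_cut n).measurable.mul hφ.1.inv, a, fun x ↦ ?_⟩
    have := h x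
    change |cut n x * (φ x)⁻¹| ≤ a
    unfold cut
    split_ifs with hx
    · rw [one_mul, abs_of_pos (by positivity)]; exact hb x hx
    · simpa using ha
  refine ⟨mulOp (fun x ↦ cut n x * (φ x)⁻¹), fun f ↦ ?_, fun f ↦ ?_⟩
  · rw [mulOp_mulOp hχ hφ]
    congr 2; ext x
    have := (h x).ne'
    field_simp
  · rw [mulOp_mulOp hχ (bddSymbol_cut n)]
    congr 2; ext x
    have := cut_mul_cut (le_refl n) x
    linear_combination (φ x)⁻¹ * this

theorem exists_inverse_weakSymP (hp : Params ϰ c ρ q) (n : ℝ) :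
    ∃ L : L2C →L[ℂ] L2C, (∀ f, L (mulOp (weakSymP ϰ) f) = mulOp (cut n) f) ∧
      ∀ f, L (mulOp (cut n) f) = L f := by
  refine exists_inverse_cut (bddSymbol_weakSymP hp.pos) n (fun x ↦ ?_)
    (a := √|n| * (c * |n|)) ?_ fun x hx ↦ ?_
  · exact mul_pos (inv_pos.mpr (sqrt_jap_pos x)) (inv_pos.mpr (bsym_pos hp.pos x))
  · have := hp.one_le; positivity
  · have h1 := hx.trans (le_abs_self n)
    have h2 := bsym_le_jap hp.one_le hp.le_sq x
    have h3 := hp.one_le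
    have h4 := bsym_pos hp.pos x
    rw [weakSymP, mul_inv, inv_inv, inv_inv]
    gcongr
    exact h2.trans (by gcongr)

theorem exists_inverse_weakSymQ (n : ℝ) :
    ∃ L : L2C →L[ℂ] L2C, (∀ f, L (mulOp weakSymQ f) = mulOp (cut n) f) ∧
      ∀ f, L (mulOp (cut n) f) = L f := by
  refine exists_inverse_cut bddSymbol_weakSymQ n (fun x ↦ ?_)
    (a := |n| * (2 * |n|)) (by positivity) fun x hx ↦ ?_
  · exact mul_pos (inv_pos.mpr (jap_pos x)) (msym_pos x)
  · have h1 := hx.trans (le_abs_self n)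
    have h2 := one_le_msym_sq_mul_jap x
    have h3 := msym_pos x
    have h4 := msym_le_one x
    have h5 := jap_pos x
    rw [weakSymQ, mul_inv, inv_inv]
    have h6 : (msym x)⁻¹ ≤ 2 * jap x := by
      rw [inv_le_iff_one_le_mul₀ h3]
      nlinarith [mul_pos h3 h5]
    calc _ ≤ jap x * (2 * jap x) := by gcongr
      _ ≤ _ := by gcongr

theorem IsFourierSol.isTruncSol (hp : Params ϰ c ρ q) {T : ℝ} {P Q : ℝ → L2C}
    (h : IsFourierSol ϰ ρ T P Q) (n : ℝ) : IsTruncSol ϰ ρ n T P Q where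
  contP := (mulOp (cut n)).continuous.comp_continuousOn h.contP
  contQ := (mulOp (cut n)).continuous.comp_continuousOn h.contQ
  derivP t ht := by
    obtain ⟨L, h1, h2⟩ := exists_inverse_weakSymP hp n
    have hd := hasDerivAt_clm_apply L (h.derivP t ht)
    rw [← h2, cut_weakP hp, h1, cut_fieldP hp le_rfl] at hd
    simp only [h1] at hd
    exact hd
  derivQ t ht := by
    obtain ⟨L, h1, h2⟩ := exists_inverse_weakSymQ n
    have hd := hasDerivAt_clm_apply L (h.derivQ t ht)
    rw [← h2, cut_weakQ hp, h1, cut_fieldQ hp le_rfl] at hd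
    simp only [h1] at hd
    exact hd

/-- A curve is differentiable if its truncations are, with a common continuous derivative. -/
theorem hasDerivAt_of_cut {f g : ℝ → L2C} {a b t : ℝ} (ht : t ∈ Set.Ioo a b)
    (hg : ContinuousAt g t)
    (hd : ∀ n : ℕ, ∀ s ∈ Set.Ioo a b,
      HasDerivAt (fun s ↦ mulOp (cut n) (f s)) (mulOp (cut n) (g s)) s) :
    HasDerivAt f (g t) t := by
  rw [hasDerivAt_iff_isLittleO, Asymptotics.isLittleO_iff]
  intro ε hε
  obtain ⟨δ, hδ, hball⟩ := Metric.continuousAt_iff.mp hg ε hε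
  have hmem : Metric.ball t δ ∩ Set.Ioo a b ∈ 𝓝 t :=
    inter_mem (Metric.ball_mem_nhds t hδ) (isOpen_Ioo.mem_nhds ht)
  filter_upwards [hmem] with s hs
  have hconv : Convex ℝ (Metric.ball t δ ∩ Set.Ioo a b) :=
    (convex_ball t δ).inter (convex_Ioo a b)
  -- The mean value inequality for the truncations, with a bound independent of n because
  -- projections do not increase norms; letting n → ∞ gives differentiability.
  have key : ∀ n : ℕ, ‖mulOp (cut n) (f s - f t - (s - t) • g t)‖ ≤ ε * ‖s - t‖ := by
    intro n
    have hd' : ∀ r ∈ Metric.ball t δ ∩ Set.Ioo a b,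
        HasDerivWithinAt (fun r ↦ mulOp (cut n) (f r) - r • mulOp (cut n) (g t))
          (mulOp (cut n) (g r) - (1 : ℝ) • mulOp (cut n) (g t))
          (Metric.ball t δ ∩ Set.Ioo a b) r := fun r hr ↦
      ((hd n r hr.2).sub ((hasDerivAt_id r).smul_const _)).hasDerivWithinAt
    have hmv := hconv.norm_image_sub_le_of_norm_hasDerivWithin_le (C := ε) hd' (fun r hr ↦ ?_)
      ⟨Metric.mem_ball_self hδ, ht⟩ hs
    · have e : mulOp (cut n) (f s - f t - (s - t) • g t) =
          mulOp (cut n) (f s) - s • mulOp (cut n) (g t) -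
            (mulOp (cut n) (f t) - t • mulOp (cut n) (g t)) := by
        have e' : mulOp (cut n) ((s - t) • g t) = (s - t) • mulOp (cut n) (g t) :=
          ((mulOp (cut n)).restrictScalars ℝ).map_smul _ _
        rw [map_sub, map_sub, e', sub_smul]
        abel
      rw [e]
      exact hmv
    · rw [one_smul, ← map_sub]
      refine (norm_cut_le n _).trans ?_
      rw [← dist_eq_norm]
      exact (hball hr.1).le
  exact le_of_tendsto (tendsto_cut _).norm (Eventually.of_forall key)

theorem isFourierSol_of_isTruncSol (hp : Params ϰ c ρ q) {T : ℝ} {P Q : ℝ → L2C}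
    (hPc : ContinuousOn P (Set.Icc 0 T)) (hQc : ContinuousOn Q (Set.Icc 0 T))
    (hPr : ∀ t ∈ Set.Icc 0 T, reflect (P t) = P t) (hQr : ∀ t ∈ Set.Icc 0 T, reflect (Q t) = Q t)
    (h : ∀ n : ℕ, IsTruncSol ϰ ρ n T P Q) : IsFourierSol ϰ ρ T P Q := by
  have hat : ∀ t ∈ Set.Ioo 0 T, ContinuousAt (fun t ↦ (P t, Q t)) t := fun t ht ↦
    (hPc.prodMk hQc).continuousAt (Icc_mem_nhds ht.1 ht.2)
  refine ⟨hPc, hQc, fun t ht ↦ ?_, fun t ht ↦ ?_, hPr, hQr⟩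
  · have hc : ContinuousAt (fun t ↦ weakP ϰ ρ (P t) (Q t)) t :=
      ContinuousAt.comp (g := fun x : L2C × L2C ↦ weakP ϰ ρ x.1 x.2) (f := fun t ↦ (P t, Q t))
        (lipOnBalls_weakP ϰ ρ).continuous.continuousAt (hat t ht)
    refine hasDerivAt_of_cut (g := fun t ↦ weakP ϰ ρ (P t) (Q t)) ht hc fun n s hs ↦ ?_
    have hd := hasDerivAt_clm_apply (mulOp (weakSymP ϰ)) ((h n).derivP s hs)
    rw [← cut_weakP hp] at hd
    simp only [mulOp_comm (bddSymbol_weakSymP hp.pos) (bddSymbol_cut n)] at hd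
    exact hd
  · have hc : ContinuousAt (fun t ↦ weakQ ϰ ρ (P t) (Q t)) t :=
      ContinuousAt.comp (g := fun x : L2C × L2C ↦ weakQ ϰ ρ x.1 x.2) (f := fun t ↦ (P t, Q t))
        (lipOnBalls_weakQ ϰ ρ).continuous.continuousAt (hat t ht)
    refine hasDerivAt_of_cut (g := fun t ↦ weakQ ϰ ρ (P t) (Q t)) ht hc fun n s hs ↦ ?_
    have hd := hasDerivAt_clm_apply (mulOp weakSymQ) ((h n).derivQ s hs)
    rw [← cut_weakQ hp] at hd
    simp only [mulOp_comm bddSymbol_weakSymQ (bddSymbol_cut n)] at hd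
    exact hd

theorem low_injective {ρ : ℝ} (hρ : 0 ≤ ρ) {f : L2C} (h : mulOp (lowSym ρ) f = 0) : f = 0 := by
  refine Lp.ext ?_
  have h1 := coeFn_mulOp (bddSymbol_lowSym hρ) f
  rw [h] at h1
  filter_upwards [h1, Lp.coeFn_zero ℂ 2 (volume : Measure ℝ)] with x h1 h2
  rw [h2] at h1 ⊢
  have h3 : (lowSym ρ x : ℂ) ≠ 0 := by exact_mod_cast (lowSym_pos ρ x).ne'
  exact (mul_eq_zero.mp h1.symm).resolve_left h3

theorem exists_boundedBy {T : ℝ} {P Q : ℝ → L2C} (hP : ContinuousOn P (Set.Icc 0 T))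
    (hQ : ContinuousOn Q (Set.Icc 0 T)) : ∃ B : ℝ, 0 ≤ B ∧ ∀ B', B ≤ B' → BoundedBy T B' P Q := by
  obtain ⟨B₁, h₁⟩ := isCompact_Icc.exists_bound_of_continuousOn hP
  obtain ⟨B₂, h₂⟩ := isCompact_Icc.exists_bound_of_continuousOn hQ
  exact ⟨max 0 (max B₁ B₂), le_max_left _ _, fun B' hB' t ht ↦
    ⟨(h₁ t ht).trans ((le_max_left _ _).trans ((le_max_right _ _).trans hB')),
      (h₂ t ht).trans ((le_max_right _ _).trans ((le_max_right _ _).trans hB'))⟩⟩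

/-- Both solutions are bounded on the compact interval and solve the truncated equations at every
level n. Their weak distance is therefore below any ε; no tail bound is needed. -/
theorem IsFourierSol.unique (hp : Params ϰ c ρ q) {T : ℝ} {P₁ Q₁ P₂ Q₂ : ℝ → L2C}
    (h₁ : IsFourierSol ϰ ρ T P₁ Q₁) (h₂ : IsFourierSol ϰ ρ T P₂ Q₂) (hP : P₁ 0 = P₂ 0)
    (hQ : Q₁ 0 = Q₂ 0) : ∀ t ∈ Set.Icc 0 T, P₁ t = P₂ t ∧ Q₁ t = Q₂ t := by
  obtain ⟨B₁, hB₁, b₁⟩ := exists_boundedBy h₁.contP h₁.contQ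
  obtain ⟨B₂, hB₂, b₂⟩ := exists_boundedBy h₂.contP h₂.contQ
  intro t ht
  have key : ∀ ε : ℝ, 0 < ε → ‖mulOp (lowSym ρ) (P₁ t - P₂ t)‖ ≤ ε ∧
      ‖mulOp (lowSym ρ) (Q₁ t - Q₂ t)‖ ≤ ε := by
    intro ε hε
    obtain ⟨δ, hδ, n, hn, h⟩ := exists_low_close hp (B := max B₁ B₂) (T := T)
      (le_max_of_le_left hB₁) hε
    exact h n le_rfl P₁ Q₁ P₂ Q₂ (h₁.isTruncSol hp n) (h₂.isTruncSol hp n) h₁.realP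
      (b₁ _ (le_max_left _ _)) (b₂ _ (le_max_right _ _)) (by simpa [hP] using hδ)
      (by simpa [hQ] using hδ) t ht
  have z : ∀ {x : L2C}, (∀ ε : ℝ, 0 < ε → ‖mulOp (lowSym ρ) x‖ ≤ ε) → x = 0 := fun hx ↦
    low_injective hp.nonneg (norm_le_zero_iff.mp (le_of_forall_pos_le_add fun ε hε ↦ by
      simpa using hx ε hε))
  exact ⟨sub_eq_zero.mp (z fun ε hε ↦ (key ε hε).1), sub_eq_zero.mp (z fun ε hε ↦ (key ε hε).2)⟩

/-- Existence on the Fourier side. -/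
theorem exists_isFourierSol (hp : Params ϰ c ρ q) {B T : ℝ} (hB : 0 < B) (hT : 0 ≤ T)
    {P₀ Q₀ : L2C} (hP₀ : reflect P₀ = P₀) (hQ₀ : reflect Q₀ = Q₀)
    (h0 : Real.exp (growth c ρ q B * T) *
      ((1 + 2 * symConst ρ B) * (‖P₀‖ ^ 2 + ‖Q₀‖ ^ 2)) < B ^ 2) :
    ∃ P Q : ℝ → L2C, P 0 = P₀ ∧ Q 0 = Q₀ ∧ IsFourierSol ϰ ρ T P Q ∧ BoundedBy T B P Q ∧
      TailBound T (Real.exp (growth c ρ q B * T) * (1 + 2 * symConst ρ B)) P Q := by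
  have hs := symConst_nonneg ρ hB.le
  set K := Real.exp (growth c ρ q B * T) * (1 + 2 * symConst ρ B) with hKdef
  have hK : 0 ≤ K := by positivity
  choose P Q hP0 hQ0 hG using fun k : ℕ ↦ exists_galerkin hp (k : ℝ) hB hT hP₀ hQ₀ h0
  have hbd : ∀ k, BoundedBy T B (P k) (Q k) := fun k t ht ↦
    le_of_sq_add_sq_le hB.le ((hG k).bound t ht)
  have htail : ∀ k, TailBound T K (P k) (Q k) := fun k N hN t ht ↦ by
    have := (hG k).tail hp hB.le hN ht
    rwa [← mul_assoc] at this
  -- All approximations have the same data and, from index n on, solve the level n equations; their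
  -- uniform bounds and tail bounds make them a Cauchy sequence in the strong norm.
  have hclose : ∀ ε : ℝ, 0 < ε → ∃ m : ℕ, ∀ k ≥ m, ∀ l ≥ m, ∀ t ∈ Set.Icc 0 T,
      ‖P k t - P l t‖ ≤ ε ∧ ‖Q k t - Q l t‖ ≤ ε := by
    intro ε hε
    obtain ⟨δ, hδ, n, hn, h⟩ := exists_close hp (T := T) hB.le hK P₀ Q₀ hε
    obtain ⟨m, hm⟩ := exists_nat_ge n
    refine ⟨m, fun k hk l hl ↦ h n le_rfl _ _ _ _
      ((hG k).isTruncSol hp (hm.trans (by exact_mod_cast hk)))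
      ((hG l).isTruncSol hp (hm.trans (by exact_mod_cast hl))) (hG k).realP (hbd k) (hbd l)
      (htail k) (htail l) ?_ ?_ ?_ ?_⟩
    · simpa [hP0] using hδ
    · simpa [hQ0] using hδ
    · simpa [hP0] using hδ
    · simpa [hQ0] using hδ
  have hcauchy : ∀ {f : ℕ → ℝ → L2C}, (∀ ε : ℝ, 0 < ε → ∃ m : ℕ, ∀ k ≥ m, ∀ l ≥ m,
      ∀ t ∈ Set.Icc 0 T, ‖f k t - f l t‖ ≤ ε) →
      ∃ g : ℝ → L2C, TendstoUniformlyOn f g atTop (Set.Icc 0 T) := by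
    intro f hf
    have hu : UniformCauchySeqOn f atTop (Set.Icc 0 T) := by
      rw [Metric.uniformCauchySeqOn_iff]
      intro ε hε
      obtain ⟨m, hm⟩ := hf (ε / 2) (by positivity)
      refine ⟨m, fun k hk l hl t ht ↦ ?_⟩
      rw [dist_eq_norm]
      exact (hm k hk l hl t ht).trans_lt (by linarith)
    -- The implication lets a limit be chosen for all t at once; values outside [0, T] are
    -- arbitrary.
    have hlim : ∀ t, ∃ y, t ∈ Set.Icc 0 T → Tendsto (fun k ↦ f k t) atTop (𝓝 y) := by
      intro t
      by_cases ht : t ∈ Set.Icc 0 T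
      · obtain ⟨y, hy⟩ := cauchySeq_tendsto_of_complete (hu.cauchySeq ht)
        exact ⟨y, fun _ ↦ hy⟩
      · exact ⟨0, fun h ↦ absurd h ht⟩
    choose g hg using hlim
    exact ⟨g, hu.tendstoUniformlyOn_of_tendsto hg⟩
  obtain ⟨p, hp'⟩ := hcauchy fun ε hε ↦
    (hclose ε hε).imp fun m hm k hk l hl t ht ↦ (hm k hk l hl t ht).1
  obtain ⟨r, hr'⟩ := hcauchy fun ε hε ↦
    (hclose ε hε).imp fun m hm k hk l hl t ht ↦ (hm k hk l hl t ht).2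
  have hpt : ∀ t ∈ Set.Icc 0 T, Tendsto (fun k ↦ P k t) atTop (𝓝 (p t)) := fun t ht ↦
    hp'.tendsto_at ht
  have hqt : ∀ t ∈ Set.Icc 0 T, Tendsto (fun k ↦ Q k t) atTop (𝓝 (r t)) := fun t ht ↦
    hr'.tendsto_at ht
  have h0T : (0 : ℝ) ∈ Set.Icc 0 T := ⟨le_rfl, hT⟩
  have hpc : ContinuousOn p (Set.Icc 0 T) :=
    hp'.continuousOn (Frequently.of_forall fun k ↦ (hG k).contP)
  have hrc : ContinuousOn r (Set.Icc 0 T) :=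
    hr'.continuousOn (Frequently.of_forall fun k ↦ (hG k).contQ)
  have hp0 : p 0 = P₀ := tendsto_nhds_unique (hpt 0 h0T) (by simp [hP0])
  have hr0 : r 0 = Q₀ := tendsto_nhds_unique (hqt 0 h0T) (by simp [hQ0])
  have hbl : BoundedBy T B p r := fun t ht ↦
    ⟨le_of_tendsto (hpt t ht).norm (Eventually.of_forall fun k ↦ (hbd k t ht).1),
      le_of_tendsto (hqt t ht).norm (Eventually.of_forall fun k ↦ (hbd k t ht).2)⟩
  have hunif : ∀ {F : L2C × L2C → L2C}, LipOnBalls F →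
      TendstoUniformlyOn (fun k t ↦ F (P k t, Q k t)) (fun t ↦ F (p t, r t)) atTop
        (Set.Ioo 0 T) := by
    intro F hF
    obtain ⟨L, hL, hLip⟩ := hF B
    rw [Metric.tendstoUniformlyOn_iff]
    intro ε hε
    have hε' : 0 < ε / (L + 1) := by positivity
    filter_upwards [Metric.tendstoUniformlyOn_iff.mp hp' _ hε',
      Metric.tendstoUniformlyOn_iff.mp hr' _ hε'] with k h1 h2 t ht
    have ht' := Set.Ioo_subset_Icc_self ht
    have h3 := hLip (p t, r t) (P k t, Q k t) (max_le (hbl t ht').1 (hbl t ht').2)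
      (max_le (hbd k t ht').1 (hbd k t ht').2)
    rw [dist_eq_norm]
    refine h3.trans_lt ?_
    have h4 : ‖(p t, r t) - (P k t, Q k t)‖ < ε / (L + 1) := by
      rw [Prod.mk_sub_mk, Prod.norm_mk, max_lt_iff, ← dist_eq_norm, ← dist_eq_norm]
      exact ⟨h1 t ht', h2 t ht'⟩
    calc _ ≤ (L + 1) * ‖(p t, r t) - (P k t, Q k t)‖ := by gcongr; linarith
      _ < (L + 1) * (ε / (L + 1)) := by gcongr
      _ = ε := by field_simp
  refine ⟨p, r, hp0, hr0, isFourierSol_of_isTruncSol hp hpc hrc ?_ ?_ fun n ↦ ?_, hbl, ?_⟩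
  · exact fun t ht ↦ tendsto_nhds_unique ((reflect.continuous.tendsto _).comp (hpt t ht))
      ((hpt t ht).congr fun k ↦ ((hG k).realP t ht).symm)
  · exact fun t ht ↦ tendsto_nhds_unique ((reflect.continuous.tendsto _).comp (hqt t ht))
      ((hqt t ht).congr fun k ↦ ((hG k).realQ t ht).symm)
  · have hts : ∀ᶠ k : ℕ in atTop, IsTruncSol ϰ ρ n T (P k) (Q k) := by
      filter_upwards [eventually_ge_atTop n] with k hk
      exact (hG k).isTruncSol hp (by exact_mod_cast hk)
    refine ⟨(mulOp (cut n)).continuous.comp_continuousOn hpc,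
      (mulOp (cut n)).continuous.comp_continuousOn hrc, fun t ht ↦ ?_, fun t ht ↦ ?_⟩
    · refine hasDerivAt_of_tendstoUniformlyOn isOpen_Ioo (hunif (lipOnBalls_fieldP ϰ ρ n))
        (f := fun k t ↦ mulOp (cut n) (P k t)) (hts.mono fun k hk s hs ↦ hk.derivP s hs)
        (fun s hs ↦ ?_) ht
      exact ((mulOp (cut n)).continuous.tendsto _).comp (hpt s (Set.Ioo_subset_Icc_self hs))
    · refine hasDerivAt_of_tendstoUniformlyOn isOpen_Ioo (hunif (lipOnBalls_fieldQ ϰ ρ n))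
        (f := fun k t ↦ mulOp (cut n) (Q k t)) (hts.mono fun k hk s hs ↦ hk.derivQ s hs)
        (fun s hs ↦ ?_) ht
      exact ((mulOp (cut n)).continuous.tendsto _).comp (hqt s (Set.Ioo_subset_Icc_self hs))
  · intro N hN t ht
    have h1 := ((((mulOp (psi N)).continuous.tendsto _).comp (hpt t ht)).norm.pow 2).add
      ((((mulOp (psi N)).continuous.tendsto _).comp (hqt t ht)).norm.pow 2)
    refine le_of_tendsto h1 (Eventually.of_forall fun k ↦ ?_)
    have := htail k N hN t ht
    rw [hP0, hQ0] at this
    rw [hp0, hr0]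
    exact this

end FourierSolutions

end WhithamBoussinesq
end

noncomputable section
open MeasureTheory Filter Topology
open scoped SchwartzMap ENNReal FourierTransform

namespace WhithamBoussinesq

/-! ### The Fourier transform of real L² functions -/

section RealFourier

/-- Complex conjugation on `L²`. -/
def conjL2 : L2C →L[ℝ] L2C :=
  Complex.conjCLE.toContinuousLinearMap.compLpL 2 (volume : Measure ℝ)

theorem coeFn_conjL2 (f : L2C) : conjL2 f =ᵐ[volume] fun x ↦ (starRingEnd ℂ) (f x) :=
  Complex.conjCLE.toContinuousLinearMap.coeFn_compLpL (p := 2) (μ := (volume : Measure ℝ)) f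

theorem fourier_conj_apply (f : ℝ → ℂ) (ξ : ℝ) :
    𝓕 (fun x ↦ (starRingEnd ℂ) (f x)) ξ = (starRingEnd ℂ) (𝓕 f (-ξ)) := by
  rw [Real.fourier_eq', Real.fourier_eq', ← integral_conj]
  congr 1
  ext x
  simp only [smul_eq_mul, map_mul, ← Complex.exp_conj, Complex.conj_ofReal, Complex.conj_I]
  congr 2
  simp

/-- Both sides are continuous in f, and for Schwartz functions the identity is read off from the
integral. -/
theorem fourier_conjL2 (f : L2C) : 𝓕 (conjL2 f) = reflect (𝓕 f) := by
  refine DenseRange.induction_on (p := fun f : L2C ↦ 𝓕 (conjL2 f) = reflect (𝓕 f))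
    (SchwartzMap.denseRange_toLpCLM (F := ℂ) (E := ℝ) (p := 2) (μ := volume)
      ENNReal.ofNat_ne_top) f ?_ fun g ↦ ?_
  · exact isClosed_eq ((Lp.fourierTransformₗᵢ ℝ ℂ).continuous.comp conjL2.continuous)
      (reflect.continuous.comp (Lp.fourierTransformₗᵢ ℝ ℂ).continuous)
  · have e : conjL2 (g.toLp 2) =
        (SchwartzMap.postcompCLM Complex.conjCLE.toContinuousLinearMap g).toLp 2 := by
      refine Lp.ext ?_
      filter_upwards [coeFn_conjL2 (g.toLp 2), g.coeFn_toLp 2 volume,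
        (SchwartzMap.postcompCLM Complex.conjCLE.toContinuousLinearMap g).coeFn_toLp 2 volume]
        with x h1 h2 h3
      rw [h1, h2, h3]
      rfl
    rw [SchwartzMap.toLpCLM_apply, e, SchwartzMap.toLp_fourier_eq, SchwartzMap.toLp_fourier_eq]
    refine Lp.ext ?_
    have h2 := (Measure.measurePreserving_neg (volume : Measure ℝ)).quasiMeasurePreserving.ae_eq_comp
      ((𝓕 g).coeFn_toLp 2 volume)
    filter_upwards [coeFn_reflect ((𝓕 g).toLp 2), h2, (𝓕 (SchwartzMap.postcompCLM
      Complex.conjCLE.toContinuousLinearMap g)).coeFn_toLp 2 volume] with x h1 h2 h3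
    simp only [Function.comp_apply] at h2
    rw [h1, h2, h3, SchwartzMap.fourier_coe, SchwartzMap.fourier_coe, ← fourier_conj_apply]
    rfl

/-- The inclusion of the real valued `L²` functions. -/
def ofRealL2 : Lp ℝ 2 (volume : Measure ℝ) →L[ℝ] L2C :=
  Complex.ofRealCLM.compLpL 2 (volume : Measure ℝ)

theorem coeFn_ofRealL2 (f : Lp ℝ 2 (volume : Measure ℝ)) :
    ofRealL2 f =ᵐ[volume] fun x ↦ (f x : ℂ) :=
  Complex.ofRealCLM.coeFn_compLpL (p := 2) (μ := (volume : Measure ℝ)) f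

theorem toDist_two (f : Lp ℝ 2 (volume : Measure ℝ)) : toDist 2 f = distC 2 (ofRealL2 f) := rfl

/-- The Fourier transform of a real valued `L²` function. -/
def l2hat (f : Lp ℝ 2 (volume : Measure ℝ)) : L2C := 𝓕 (ofRealL2 f)

theorem reflect_l2hat (f : Lp ℝ 2 (volume : Measure ℝ)) : reflect (l2hat f) = l2hat f := by
  rw [l2hat, ← fourier_conjL2]
  congr 1
  refine Lp.ext ?_
  filter_upwards [coeFn_conjL2 (ofRealL2 f), coeFn_ofRealL2 f] with x h1 h2
  rw [h1, h2, Complex.conj_ofReal]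

theorem exists_l2hat_eq {F : L2C} (h : reflect F = F) :
    ∃ f : Lp ℝ 2 (volume : Measure ℝ), l2hat f = F := by
  have e : 𝓕 (𝓕⁻ F) = F := FourierTransform.fourier_fourierInv_eq F
  have hc : conjL2 (𝓕⁻ F) = 𝓕⁻ F := by
    refine (Lp.fourierTransformₗᵢ ℝ ℂ).injective ?_
    change 𝓕 (conjL2 (𝓕⁻ F)) = 𝓕 (𝓕⁻ F)
    rw [fourier_conjL2, e, h]
  refine ⟨Complex.reCLM.compLpL 2 (volume : Measure ℝ) (𝓕⁻ F), ?_⟩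
  rw [l2hat]
  conv_rhs => rw [← e]
  congr 1
  refine Lp.ext ?_
  have h1 := coeFn_conjL2 (𝓕⁻ F)
  rw [hc] at h1
  filter_upwards [h1, coeFn_ofRealL2 (Complex.reCLM.compLpL 2 (volume : Measure ℝ) (𝓕⁻ F)),
    Complex.reCLM.coeFn_compLpL (p := 2) (μ := (volume : Measure ℝ)) (𝓕⁻ F)] with x h1 h2 h3
  rw [h2, h3]
  exact Complex.conj_eq_iff_re.mp h1.symm

end RealFourier

/-! ### Sobolev spaces and Fourier multipliers on the Fourier side -/

section Multipliers

theorem distC_apply (p : ℝ≥0∞) [Fact (1 ≤ p)] (f : Lp ℂ p (volume : Measure ℝ)) (u : 𝓢(ℝ, ℂ)) :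
    distC p f u = ∫ x, u x • f x := Lp.toTemperedDistribution_apply f u

theorem fourier_distC (f : L2C) : 𝓕 (distC 2 f) = distC 2 (𝓕 f) :=
  Lp.fourier_toTemperedDistribution_eq f

theorem fourier_dist_injective {u v : 𝓢'(ℝ, ℂ)} (h : (𝓕 u : 𝓢'(ℝ, ℂ)) = 𝓕 v) : u = v := by
  have e : ∀ w : 𝓢'(ℝ, ℂ), 𝓕⁻ (𝓕 w : 𝓢'(ℝ, ℂ)) = w := FourierTransform.fourierInv_fourier_eq
  rw [← e u, h, e]

theorem fourier_multD (φ : ℝ → ℝ) (u : 𝓢'(ℝ, ℂ)) :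
    𝓕 (multD φ u) = TemperedDistribution.smulLeftCLM ℂ
      (fun ξ : ℝ ↦ ((φ (2 * Real.pi * ξ) : ℝ) : ℂ)) (𝓕 u) := by
  rw [multD, TemperedDistribution.fourierMultiplierCLM_apply,
    FourierTransform.fourier_fourierInv_eq]

theorem smulLeftCLM_distC {g : ℝ → ℂ} (hg : g.HasTemperateGrowth) {f F : L2C}
    (h : ∀ᵐ x, F x = g x * f x) :
    TemperedDistribution.smulLeftCLM ℂ g (distC 2 f) = distC 2 F := by
  ext u
  rw [TemperedDistribution.smulLeftCLM_apply_apply, distC_apply, distC_apply]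
  refine integral_congr_ae ?_
  filter_upwards [h] with x hx
  rw [SchwartzMap.smulLeftCLM_apply_apply hg, hx]
  simp only [smul_eq_mul]
  ring

theorem fourier_multD_distC {φ : ℝ → ℝ} (hφ : φ.HasTemperateGrowth) {f F : L2C}
    (h : ∀ᵐ ξ, F ξ = ((φ (2 * Real.pi * ξ) : ℝ) : ℂ) * f ξ) {u : 𝓢'(ℝ, ℂ)}
    (hu : 𝓕 u = distC 2 f) : 𝓕 (multD φ u) = distC 2 F := by
  rw [fourier_multD, hu]
  exact smulLeftCLM_distC (hasTemperateGrowth_symbol hφ) h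

theorem bessel_neg_bessel (σ : ℝ) (f : 𝓢'(ℝ, ℂ)) : bessel (-σ) (bessel σ f) = f := by
  simp only [bessel, multD]
  rw [TemperedDistribution.fourierMultiplierCLM_fourierMultiplierCLM_apply
    (hasTemperateGrowth_symbol (hasTemperateGrowth_bessel _))
    (hasTemperateGrowth_symbol (hasTemperateGrowth_bessel _))]
  have : ((fun ξ : ℝ ↦ (((1 + (2 * Real.pi * ξ) ^ 2) ^ (σ / 2) : ℝ) : ℂ)) *
      (fun ξ : ℝ ↦ (((1 + (2 * Real.pi * ξ) ^ 2) ^ (-σ / 2) : ℝ) : ℂ))) = fun _ ↦ 1 := by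
    ext ξ
    rw [Pi.mul_apply]
    norm_cast
    rw [← Real.rpow_add (by positivity)]
    ring_nf
    simp
  rw [this]
  simp

theorem besselSym_eq (σ ξ : ℝ) : (1 + (2 * Real.pi * ξ) ^ 2) ^ (-σ / 2) = lam σ ξ := by
  rw [lam, jap, Real.sqrt_eq_rpow, ← Real.rpow_mul (by positivity)]
  congr 1; ring

theorem bddSymbol_lam {σ : ℝ} (hσ : 0 ≤ σ) : BddSymbol (lam σ) :=
  bddSymbol_of_nonneg_le_one (measurable_lam σ) (fun x ↦ (lam_pos σ x).le) (lam_le_one hσ)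

theorem fourier_bessel_neg {σ : ℝ} (hσ : 0 ≤ σ) (f : L2C) :
    𝓕 (bessel (-σ) (distC 2 f)) = distC 2 (mulOp (lam σ) (𝓕 f)) := by
  refine fourier_multD_distC (hasTemperateGrowth_bessel (-σ)) ?_ (fourier_distC f)
  filter_upwards [coeFn_mulOp (bddSymbol_lam hσ) (𝓕 f)] with ξ h
  rw [h, besselSym_eq]

/-- The isometry `f ↦ 𝓕 (J^σ f)` of `H^σ` into `L²`. -/
def sobolevHat (σ : ℝ) : Sobolev σ →ₗᵢ[ℝ] L2C where
  toLinearMap := ((Lp.fourierTransformₗᵢ ℝ ℂ).toLinearEquiv.toLinearMap.restrictScalars ℝ) ∘ₗ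
    Sobolev.besselL2 σ
  norm_map' f := (Lp.fourierTransformₗᵢ ℝ ℂ).norm_map (Sobolev.besselL2 σ f)

theorem sobolevHat_apply (σ : ℝ) (f : Sobolev σ) : sobolevHat σ f = 𝓕 (Sobolev.besselL2 σ f) := rfl

theorem lam_sobolevHat {σ : ℝ} (hσ : 0 ≤ σ) (f : Sobolev σ) :
    mulOp (lam σ) (sobolevHat σ f) = l2hat (Sobolev.toL2 σ f) := by
  refine distC_injective 2 ?_
  rw [sobolevHat_apply, ← fourier_bessel_neg hσ, Sobolev.distC_besselL2, bessel_neg_bessel,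
    toDist_two, fourier_distC]
  rfl

theorem mulOp_injective {φ : ℝ → ℝ} (hφ : BddSymbol φ) (h0 : ∀ x, 0 < φ x) {f g : L2C}
    (h : mulOp φ f = mulOp φ g) : f = g := by
  refine Lp.ext ?_
  have h1 := coeFn_mulOp hφ f
  rw [h] at h1
  filter_upwards [h1, coeFn_mulOp hφ g] with x h1 h2
  rw [h2] at h1
  have h3 : (φ x : ℂ) ≠ 0 := by exact_mod_cast (h0 x).ne'
  exact (mul_left_cancel₀ h3 h1).symm

theorem reflect_sobolevHat {σ : ℝ} (hσ : 0 ≤ σ) (f : Sobolev σ) :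
    reflect (sobolevHat σ f) = sobolevHat σ f := by
  refine mulOp_injective (bddSymbol_lam hσ) (lam_pos σ) ?_
  rw [← reflect_mulOp (bddSymbol_lam hσ) (lam_neg σ), lam_sobolevHat hσ, reflect_l2hat]

/-- The range of the isometry consists of the functions fixed by the reflection: ⟨k⟩^{-σ}F is again
fixed, hence the transform of a real L² function. -/
theorem exists_sobolevHat_eq {σ : ℝ} (hσ : 0 ≤ σ) {F : L2C} (hF : reflect F = F) :
    ∃ f : Sobolev σ, sobolevHat σ f = F := by
  obtain ⟨g, hg⟩ := exists_l2hat_eq (F := mulOp (lam σ) F)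
    (by rw [reflect_mulOp (bddSymbol_lam hσ) (lam_neg σ), hF])
  have e : 𝓕 (𝓕⁻ F) = F := FourierTransform.fourier_fourierInv_eq F
  have h1 : toDist 2 g = bessel (-σ) (distC 2 (𝓕⁻ F)) := by
    refine fourier_dist_injective ?_
    rw [fourier_bessel_neg hσ, e, ← hg, toDist_two, fourier_distC]
    rfl
  have h2 : bessel σ (toDist 2 g) = distC 2 (𝓕⁻ F) := by
    have := bessel_neg_bessel (-σ) (distC 2 (𝓕⁻ F))
    rwa [neg_neg, ← h1] at this
  have hmem : g ∈ sobolevSubmodule σ := ⟨𝓕⁻ F, h2.symm⟩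
  let f : Sobolev σ := ⟨g, hmem⟩
  have h3 : Sobolev.besselL2 σ f = 𝓕⁻ F := by
    refine distC_injective 2 ?_
    rw [Sobolev.distC_besselL2]
    exact h2
  exact ⟨f, by rw [sobolevHat_apply, h3, e]⟩

/-- A bounded left inverse defined on all of L², by projecting to real functions first; this allows
curves to be lifted and differentiated without membership conditions. -/
theorem exists_sobolev_lift {σ : ℝ} (hσ : 0 ≤ σ) : ∃ L : L2C →L[ℝ] Sobolev σ,
    (∀ F, reflect F = F → sobolevHat σ (L F) = F) ∧ ∀ f, L (sobolevHat σ f) = f := by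
  have hmem : ∀ F, realProj F ∈ LinearMap.range (sobolevHat σ).toLinearMap := fun F ↦
    exists_sobolevHat_eq hσ (reflect_realProj F)
  let L : L2C →L[ℝ] Sobolev σ :=
    (sobolevHat σ).equivRange.symm.toContinuousLinearEquiv.toContinuousLinearMap ∘L
      (realProj.codRestrict (LinearMap.range (sobolevHat σ).toLinearMap) hmem)
  have key : ∀ F, sobolevHat σ (L F) = realProj F := by
    intro F
    have := (sobolevHat σ).equivRange.apply_symm_apply ⟨realProj F, hmem F⟩
    exact congrArg Subtype.val this
  refine ⟨L, fun F hF ↦ by rw [key, realProj_of_reflect hF], fun f ↦ ?_⟩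
  refine (sobolevHat σ).injective ?_
  rw [key, realProj_of_reflect (reflect_sobolevHat hσ f)]

end Multipliers

end WhithamBoussinesq
end

noncomputable section
open MeasureTheory Filter Topology
open scoped SchwartzMap ENNReal FourierTransform

namespace WhithamBoussinesq

/-! ### Products and convolutions -/

section Products

theorem integral_fourierInv_mul {f g : ℝ → ℂ} (hf : Integrable f) (hg : Integrable g) :
    ∫ x, 𝓕⁻ f x * g x = ∫ x, f x * 𝓕⁻ g x := by
  have hL : Continuous fun p : ℝ × ℝ ↦ (-innerₗ ℝ) p.1 p.2 := continuous_inner.neg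
  have h := VectorFourier.integral_fourierIntegral_smul_eq_flip (L := -innerₗ ℝ)
    (μ := volume) (ν := volume) Real.continuous_fourierChar hL hf hg
  have e : (-innerₗ ℝ : ℝ →ₗ[ℝ] ℝ →ₗ[ℝ] ℝ).flip = -innerₗ ℝ := by
    ext; simp
  rw [e] at h
  exact h

theorem continuous_fourierInv {f : ℝ → ℂ} (hf : Integrable f) : Continuous (𝓕⁻ f) := by
  have hL : Continuous fun p : ℝ × ℝ ↦ (-innerₗ ℝ) p.1 p.2 := continuous_inner.neg
  exact VectorFourier.fourierIntegral_continuous (L := -innerₗ ℝ) (μ := volume)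
    Real.continuous_fourierChar hL hf

theorem norm_fourierInv_le (f : ℝ → ℂ) (x : ℝ) : ‖𝓕⁻ f x‖ ≤ ∫ y, ‖f y‖ :=
  VectorFourier.norm_fourierIntegral_le_integral_norm Real.fourierChar volume (-innerₗ ℝ) f x

/-- The inverse Fourier transform on `L²` is given by the integral on `L¹ ∩ L²`. -/
theorem coeFn_fourierInv {F : L2C} (hF : Integrable F volume) :
    (𝓕⁻ F : L2C) =ᵐ[volume] 𝓕⁻ (F : ℝ → ℂ) := by
  -- Two locally integrable functions agree if they agree against smooth functions of compact
  -- support; for these the L² transform and the integral are both moved onto the test function.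
  refine ae_eq_of_integral_contDiff_smul_eq ((Lp.memLp _).locallyIntegrable one_le_two)
    (continuous_fourierInv hF).locallyIntegrable fun g g_smooth g_cpt ↦ ?_
  have hg₁ : HasCompactSupport (Complex.ofRealCLM ∘ g) := g_cpt.comp_left rfl
  have hg₂ : ContDiff ℝ (⊤ : ℕ∞) (Complex.ofRealCLM ∘ g) := by fun_prop
  set ψ : 𝓢(ℝ, ℂ) := hg₁.toSchwartzMap hg₂
  have hψ : ∀ x, ψ x = (g x : ℂ) := fun x ↦ rfl
  have h1 : distC 2 (𝓕⁻ F) ψ = distC 2 F (𝓕⁻ ψ) := by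
    have := Lp.fourierInv_toTemperedDistribution_eq F
    exact (DFunLike.congr_fun this ψ).symm
  rw [distC_apply, distC_apply] at h1
  have h2 : ∫ x, (𝓕⁻ ψ : 𝓢(ℝ, ℂ)) x * F x = ∫ x, ψ x * 𝓕⁻ (F : ℝ → ℂ) x := by
    rw [SchwartzMap.fourierInv_coe]
    exact integral_fourierInv_mul ψ.integrable hF
  simp only [smul_eq_mul] at h1
  rw [h2] at h1
  simpa only [hψ, Complex.real_smul] using h1

theorem coeFn_ofRealL2_eq_fourierInv {f : Lp ℝ 2 (volume : Measure ℝ)}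
    (hf : Integrable (l2hat f) volume) :
    ∀ᵐ x, (f x : ℂ) = 𝓕⁻ (l2hat f : ℝ → ℂ) x := by
  have e : 𝓕⁻ (l2hat f) = ofRealL2 f := FourierTransform.fourierInv_fourier_eq (ofRealL2 f)
  have h := coeFn_fourierInv hf
  rw [e] at h
  filter_upwards [h, coeFn_ofRealL2 f] with x h1 h2
  rw [← h2, h1]

theorem fourierInv_modulated (φ : 𝓢(ℝ, ℂ)) (τ ζ : ℝ) :
    𝓕⁻ (fun x : ℝ ↦ (Real.fourierChar (x * τ) : ℂ) * 𝓕 (φ : ℝ → ℂ) x) ζ = φ (τ + ζ) := by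
  have h : 𝓕⁻ (𝓕 (φ : ℝ → ℂ)) (τ + ζ) = φ (τ + ζ) := by
    have h1 : 𝓕⁻ (𝓕 φ : 𝓢(ℝ, ℂ)) = φ := FourierTransform.fourierInv_fourier_eq φ
    have h2 := DFunLike.congr_fun h1 (τ + ζ)
    rw [SchwartzMap.fourierInv_coe, SchwartzMap.fourier_coe] at h2
    exact h2
  rw [← h, Real.fourierInv_eq, Real.fourierInv_eq]
  congr 1
  ext x
  simp only [Circle.smul_def, smul_eq_mul, RCLike.inner_apply, conj_trivial]
  rw [← mul_assoc, ← Circle.coe_mul, ← AddChar.map_add_eq_mul]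
  congr 3
  ring

/-- Duality puts 𝓕⁻ on a modulated 𝓕φ, and modulation becomes translation of φ by τ. -/
theorem fourierInv_mul_fourierInv (φ : 𝓢(ℝ, ℂ)) {G : ℝ → ℂ} (hG : Integrable G) (τ : ℝ) :
    𝓕⁻ (fun x ↦ 𝓕 (φ : ℝ → ℂ) x * 𝓕⁻ G x) τ = ∫ ζ, G ζ * φ (τ + ζ) := by
  have hφ : Integrable (𝓕 (φ : ℝ → ℂ)) := by
    rw [← SchwartzMap.fourier_coe]; exact (𝓕 φ).integrable
  have hc : Continuous fun x : ℝ ↦ (Real.fourierChar (x * τ) : ℂ) := by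
    have := Real.continuous_fourierChar
    fun_prop
  have hi : Integrable fun x : ℝ ↦ (Real.fourierChar (x * τ) : ℂ) * 𝓕 (φ : ℝ → ℂ) x :=
    hφ.bdd_mul (c := 1) hc.aestronglyMeasurable (Eventually.of_forall fun x ↦ (Circle.norm_coe _).le)
  have key := integral_fourierInv_mul hG hi
  simp only [fourierInv_modulated] at key
  rw [← key, Real.fourierInv_eq]
  congr 1
  ext x
  simp only [Circle.smul_def, smul_eq_mul, RCLike.inner_apply, conj_trivial]
  rw [mul_comm τ x]
  ring

theorem integral_mul_integral_comp_add {F G φ : ℝ → ℂ} (hF : Integrable F) (hG : Integrable G)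
    (hφ : Continuous φ) {C : ℝ} (hC : ∀ x, ‖φ x‖ ≤ C) :
    ∫ τ, F τ * ∫ ζ, G ζ * φ (τ + ζ) = ∫ ξ, φ ξ * ∫ ζ, F (ξ - ζ) * G ζ := by
  have h1 : Integrable (fun p : ℝ × ℝ ↦ F p.1 * (G p.2 * φ (p.1 + p.2)))
      ((volume : Measure ℝ).prod volume) := by
    have h := (hF.mul_prod hG).bdd_mul (f := fun p : ℝ × ℝ ↦ φ (p.1 + p.2)) (c := C)
      (by fun_prop) (Eventually.of_forall fun p ↦ hC _)
    refine h.congr (Eventually.of_forall fun p ↦ ?_)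
    simp only; ring
  have h2 : Integrable (fun p : ℝ × ℝ ↦ φ p.1 * (F (p.1 - p.2) * G p.2))
      ((volume : Measure ℝ).prod volume) := by
    have h := (hG.convolution_integrand (ContinuousLinearMap.mul ℂ ℂ) hF (μ := volume)).bdd_mul
      (f := fun p : ℝ × ℝ ↦ φ p.1) (c := C) (by fun_prop) (Eventually.of_forall fun p ↦ hC _)
    refine h.congr (Eventually.of_forall fun p ↦ ?_)
    simp only [ContinuousLinearMap.mul_apply']; ring
  calc ∫ τ, F τ * ∫ ζ, G ζ * φ (τ + ζ) = ∫ τ, ∫ ζ, F τ * (G ζ * φ (τ + ζ)) := by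
        simp only [integral_const_mul]
    _ = ∫ ζ, ∫ τ, F τ * (G ζ * φ (τ + ζ)) := integral_integral_swap h1
    _ = ∫ ζ, ∫ ξ, φ ξ * (F (ξ - ζ) * G ζ) := by
        congr 1
        ext ζ
        rw [← integral_sub_right_eq_self _ ζ]
        congr 1
        ext ξ
        rw [sub_add_cancel]; ring
    _ = ∫ ξ, ∫ ζ, φ ξ * (F (ξ - ζ) * G ζ) := (integral_integral_swap h2).symm
    _ = _ := by simp only [integral_const_mul]

/-- The Fourier transform of a product is the convolution of the Fourier transforms. -/
theorem fourier_mulL2 {f g : Lp ℝ 2 (volume : Measure ℝ)} {H : L2C}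
    (hf : Integrable (l2hat f) volume) (hg : Integrable (l2hat g) volume)
    (hH : ∀ᵐ ξ, H ξ = ∫ ζ, l2hat f (ξ - ζ) * l2hat g ζ) :
    𝓕 (toDist 1 (mulL2 f g)) = distC 2 H := by
  ext φ
  have h0 : (𝓕 (toDist 1 (mulL2 f g)) : 𝓢'(ℝ, ℂ)) φ =
      distC 1 (Complex.ofRealCLM.compLpL 1 (volume : Measure ℝ) (mulL2 f g)) (𝓕 φ) := rfl
  rw [h0, distC_apply, distC_apply]
  have hφ : Integrable (𝓕 (φ : ℝ → ℂ)) := by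
    rw [← SchwartzMap.fourier_coe]; exact (𝓕 φ).integrable
  have hi : Integrable fun x ↦ 𝓕 (φ : ℝ → ℂ) x * 𝓕⁻ (l2hat g : ℝ → ℂ) x :=
    hφ.mul_bdd (c := ∫ y, ‖l2hat g y‖) (continuous_fourierInv hg).aestronglyMeasurable
      (Eventually.of_forall (norm_fourierInv_le _))
  have hC : ∃ C : ℝ, ∀ x, ‖φ x‖ ≤ C :=
    ⟨_, fun x ↦ SchwartzMap.norm_le_seminorm ℂ φ x⟩
  obtain ⟨C, hC⟩ := hC
  calc ∫ x, (𝓕 φ : 𝓢(ℝ, ℂ)) x •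
        (Complex.ofRealCLM.compLpL 1 (volume : Measure ℝ) (mulL2 f g)) x
      = ∫ x, 𝓕⁻ (l2hat f : ℝ → ℂ) x * (𝓕 (φ : ℝ → ℂ) x * 𝓕⁻ (l2hat g : ℝ → ℂ) x) := by
        refine integral_congr_ae ?_
        filter_upwards [Complex.ofRealCLM.coeFn_compLpL (p := 1) (μ := (volume : Measure ℝ))
          (mulL2 f g), Lp.coeFn_lpSMul (r := 1) f g, coeFn_ofRealL2_eq_fourierInv hf,
          coeFn_ofRealL2_eq_fourierInv hg] with x h1 h2 h3 h4
        have h5 : (mulL2 f g : ℝ → ℝ) x = f x * g x := h2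
        rw [h1, h5, SchwartzMap.fourier_coe, ← h3, ← h4]
        simp only [Complex.ofRealCLM_apply, Complex.ofReal_mul, smul_eq_mul]
        ring
    _ = ∫ τ, l2hat f τ * ∫ ζ, l2hat g ζ * φ (τ + ζ) := by
        rw [integral_fourierInv_mul hf hi]
        simp only [fourierInv_mul_fourierInv φ hg]
    _ = ∫ ξ, φ ξ * ∫ ζ, l2hat f (ξ - ζ) * l2hat g ζ :=
        integral_mul_integral_comp_add hf hg φ.continuous hC
    _ = ∫ ξ, φ ξ • H ξ := by
        refine integral_congr_ae ?_
        filter_upwards [hH] with ξ h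
        rw [h, smul_eq_mul]

end Products

end WhithamBoussinesq
end

noncomputable section
open MeasureTheory Filter Topology
open scoped SchwartzMap ENNReal FourierTransform

namespace WhithamBoussinesq

/-! ### The two equations in terms of P and Q -/

section Equations

variable {ϰ c ρ : ℝ} {q : ℕ}

theorem distC_smul (a : ℂ) (f : L2C) : distC 2 (a • f) = a • distC 2 f :=
  (Lp.toTemperedDistributionCLM ℂ (volume : Measure ℝ) 2).map_smul a f

theorem fourier_rhs {a b : 𝓢'(ℝ, ℂ)} {A B : L2C} (ha : 𝓕 a = distC 2 (Complex.I • A))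
    (hb : 𝓕 b = distC 2 B) :
    𝓕 (-a - Complex.I • b) = distC 2 (-(Complex.I • (A + B))) := by
  have h : (𝓕 (-a - Complex.I • b) : 𝓢'(ℝ, ℂ)) = -𝓕 a - Complex.I • 𝓕 b := by ext φ; rfl
  rw [h, ha, hb, ← distC_smul, ← map_neg, ← map_sub]
  congr 1
  module

theorem fourier_I_smul {a : 𝓢'(ℝ, ℂ)} {A : L2C} (ha : 𝓕 a = distC 2 A) :
    𝓕 (Complex.I • a) = distC 2 (Complex.I • A) := by
  have h : (𝓕 (Complex.I • a) : 𝓢'(ℝ, ℂ)) = Complex.I • 𝓕 a := by ext φ; rfl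
  rw [h, ha, distC_smul]

theorem derivCLM_eq_lineDeriv (u : 𝓢'(ℝ, ℂ)) :
    TemperedDistribution.derivCLM ℂ u = LineDeriv.lineDerivOp (1 : ℝ) u := by
  ext φ
  rw [TemperedDistribution.derivCLM_apply_apply, TemperedDistribution.lineDerivOp_apply_apply]
  congr 2

theorem fourier_derivCLM {u : 𝓢'(ℝ, ℂ)} {f F : L2C} (hu : 𝓕 u = distC 2 f)
    (h : ∀ᵐ ξ, F ξ = (freq ξ : ℂ) * f ξ) :
    𝓕 (TemperedDistribution.derivCLM ℂ u) = distC 2 (Complex.I • F) := by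
  have h2π : (2 * Real.pi : ℂ) ≠ 0 := by
    exact_mod_cast (by positivity : (2 * Real.pi : ℝ) ≠ 0)
  have hg : (fun ξ : ℝ ↦ ((inner ℝ ξ (1 : ℝ) : ℝ) : ℂ)).HasTemperateGrowth := by fun_prop
  rw [derivCLM_eq_lineDeriv, TemperedDistribution.fourier_lineDerivOp_eq, hu,
    smulLeftCLM_distC hg (F := (2 * Real.pi : ℂ)⁻¹ • F), ← distC_smul, smul_smul]
  · congr 2
    field_simp
  · filter_upwards [h, Lp.coeFn_smul (2 * Real.pi : ℂ)⁻¹ F] with ξ h1 h2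
    rw [h2, Pi.smul_apply, h1, smul_eq_mul, freq]
    simp only [RCLike.inner_apply, conj_trivial, one_mul]
    push_cast
    field_simp

theorem integrable_mulOp (hρ : 1 / 2 < ρ) {φ : ℝ → ℝ} (hφ : BddSymbol φ)
    (h : ∀ x, |φ x| ≤ lam ρ x) (f : L2C) : Integrable (mulOp φ f) volume := by
  have h1 : MemLp (fun x ↦ (φ x : ℂ)) 2 (volume : Measure ℝ) := by
    refine (memLp_lam hρ).mono (Complex.measurable_ofReal.comp hφ.1).aestronglyMeasurable
      (Eventually.of_forall fun x ↦ ?_)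
    rw [Complex.norm_real, Real.norm_eq_abs, Real.norm_eq_abs, abs_of_pos (lam_pos ρ x)]
    exact h x
  exact (h1.integrable_mul (Lp.memLp f)).congr (coeFn_mulOp hφ f).symm

theorem bddSymbol_etaSym (hp : Params ϰ c ρ q) : BddSymbol (etaSym ϰ ρ) :=
  bddSymbol_of_nonneg_le_one (measurable_etaSym ϰ ρ) (fun x ↦ (etaSym_pos hp.pos ρ x).le)
    (fun x ↦ (etaSym_le_lam hp.pos ρ x).trans (lam_le_one hp.nonneg x))

theorem admissible_product (hρ : 1 / 2 < ρ) {A B : ℝ → ℝ} (hA : BddSymbol A)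
    (hA' : ∀ x, |A x| ≤ lam ρ x) (hB : BddSymbol B) : Admissible (tri (fun _ ↦ 1) A B) :=
  admissible_tri hρ bddSymbol_one hA.1 hA' hB

/-- Both symbols are dominated by ⟨k⟩^{-ρ}, so both transforms are integrable and the convolution
formula for products applies. -/
theorem fourier_product (hρ : 1 / 2 < ρ) {A B : ℝ → ℝ} (hA : BddSymbol A)
    (hA' : ∀ x, |A x| ≤ lam ρ x) (hB : BddSymbol B) (hB' : ∀ x, |B x| ≤ lam ρ x)
    {f g : Lp ℝ 2 (volume : Measure ℝ)} {P Q : L2C} (hf : l2hat f = mulOp A P)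
    (hg : l2hat g = mulOp B Q) :
    𝓕 (toDist 1 (mulL2 f g)) = distC 2 (bil (tri (fun _ ↦ 1) A B) P Q) := by
  refine fourier_mulL2 (by rw [hf]; exact integrable_mulOp hρ hA hA' P)
    (by rw [hg]; exact integrable_mulOp hρ hB hB' Q) ?_
  have e : bilFun (fun _ _ ↦ 1) (l2hat f) (l2hat g) =
      bilFun (fun _ _ ↦ 1) (fun x ↦ (A x : ℂ) * P x) (fun x ↦ (B x : ℂ) * Q x) := by
    rw [hf, hg]
    exact bilFun_congr_ae (coeFn_mulOp hA P) (coeFn_mulOp hB Q)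
  filter_upwards [coeFn_bil (admissible_product hρ hA hA' hB) P Q] with ξ h
  have e' := congrFun e ξ
  simp only [bilFun, Complex.ofReal_one, one_mul] at e'
  rw [h, e']
  simp only [bilFun, tri]
  congr 1
  ext ζ
  push_cast
  ring

theorem bddSymbol_freq_velSym (hρ : 0 ≤ ρ) : BddSymbol (fun x ↦ freq x * velSym ρ x) := by
  have h := (bddSymbol_lam hρ).mul bddSymbol_weakLinP
  refine ⟨measurable_freq.mul (measurable_velSym ρ), ?_⟩
  obtain ⟨C, hC⟩ := h.2
  refine ⟨C, fun x ↦ ?_⟩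
  have e : freq x * velSym ρ x = lam ρ x * weakLinP x := by
    unfold velSym lowSym weakLinP; ring
  change |freq x * velSym ρ x| ≤ C
  rw [e]
  exact hC x

theorem lam_mul_weakOutP (ρ x : ℝ) : lam ρ x * weakOutP ρ x = thsym x * 1 := by
  have := (lam_pos ρ x).ne'
  unfold weakOutP
  field_simp

theorem lam_weakP (hp : Params ϰ c ρ q) (P Q : L2C) :
    mulOp (lam ρ) (weakP ϰ ρ P Q) = -(Complex.I • (mulOp (fun x ↦ freq x * velSym ρ x) Q +
      mulOp thsym (bil (tri (fun _ ↦ 1) (etaSym ϰ ρ) (velSym ρ)) P Q))) := by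
  have e1 : (fun x ↦ lam ρ x * weakLinP x) = fun x ↦ freq x * velSym ρ x := by
    ext x; unfold velSym lowSym weakLinP; ring
  rw [weakP, map_neg, map_smul, map_add, mulOp_mulOp (bddSymbol_lam hp.nonneg) bddSymbol_weakLinP,
    mulOp_bil_tri (admissible_weakP hp) (bddSymbol_lam hp.nonneg), e1,
    mulOp_bil_tri (admissible_product hp.half_lt (bddSymbol_etaSym hp) (abs_etaSym_le hp)
      (bddSymbol_velSym hp.nonneg)) bddSymbol_thsym]
  simp only [lam_mul_weakOutP]

theorem fourier_tanhD {u : 𝓢'(ℝ, ℂ)} {f : L2C} (hu : 𝓕 u = distC 2 f) :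
    𝓕 (tanhD u) = distC 2 (mulOp thsym f) :=
  fourier_multD_distC hasTemperateGrowth_tanh (coeFn_mulOp bddSymbol_thsym f) hu

theorem fourier_toDist (f : Lp ℝ 2 (volume : Measure ℝ)) : 𝓕 (toDist 2 f) = distC 2 (l2hat f) :=
  fourier_distC _

/-- The elevation equation on the Fourier side. -/
theorem rhsElevation_iff (hp : Params ϰ c ρ q) {η v : Lp ℝ 2 (volume : Measure ℝ)} {P Q : L2C}
    (hη : l2hat η = mulOp (etaSym ϰ ρ) P) (hv : l2hat v = mulOp (velSym ρ) Q) (g : Sobolev ρ) :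
    toDist 2 (Sobolev.toL2 ρ g) = rhsElevation η v ↔ sobolevHat ρ g = weakP ϰ ρ P Q := by
  have h1 : 𝓕 (rhsElevation η v) = distC 2 (mulOp (lam ρ) (weakP ϰ ρ P Q)) := by
    rw [lam_weakP hp]
    refine fourier_rhs (fourier_derivCLM (fourier_toDist v) ?_) (fourier_tanhD
      (fourier_product hp.half_lt (bddSymbol_etaSym hp) (abs_etaSym_le hp)
        (bddSymbol_velSym hp.nonneg) (abs_velSym_le ρ) hη hv))
    rw [hv]
    filter_upwards [coeFn_mulOp (bddSymbol_freq_velSym hp.nonneg) Q,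
      coeFn_mulOp (bddSymbol_velSym hp.nonneg) Q] with ξ h1 h2
    rw [h1, h2]
    push_cast; ring
  have h2 : 𝓕 (toDist 2 (Sobolev.toL2 ρ g)) = distC 2 (mulOp (lam ρ) (sobolevHat ρ g)) := by
    rw [fourier_toDist, lam_sobolevHat hp.nonneg]
  constructor
  · intro h
    rw [h, h1] at h2
    exact (mulOp_injective (bddSymbol_lam hp.nonneg) (lam_pos ρ) (distC_injective 2 h2)).symm
  · intro h
    exact fourier_dist_injective (by rw [h1, h2, h])

theorem lam_add (a b x : ℝ) : lam (a + b) x = lam a x * lam b x := by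
  rw [lam, lam, lam, ← Real.rpow_add (jap_pos x)]; congr 1; ring

theorem lam_half (x : ℝ) : lam (1 / 2) x = (√(jap x))⁻¹ := by
  rw [lam, Real.rpow_neg (jap_pos x).le, Real.sqrt_eq_rpow]

theorem lam_sub_half (ρ x : ℝ) : lam (ρ - 1 / 2) x = lam ρ x * √(jap x) := by
  have h := lam_add (ρ - 1 / 2) (1 / 2) x
  have h1 := (sqrt_jap_pos x).ne'
  rw [sub_add_cancel, lam_half] at h
  rw [h]; field_simp

theorem bddSymbol_bsym_lowSym (hp : Params ϰ c ρ q) :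
    BddSymbol (fun x ↦ bsym ϰ x * lowSym ρ x) := by
  refine ⟨(measurable_bsym ϰ).mul (measurable_lowSym ρ), c, fun x ↦ ?_⟩
  have h1 := bsym_le_jap hp.one_le hp.le_sq x
  have h2 := bsym_pos hp.pos x
  have h3 := lowSym_pos ρ x
  have h4 : lowSym ρ x ≤ (jap x)⁻¹ := by
    have e : (jap x)⁻¹ = (√(jap x))⁻¹ * (√(jap x))⁻¹ := by
      rw [← mul_inv, Real.mul_self_sqrt (jap_pos x).le]
    rw [e, lowSym]
    gcongr
    exact lam_le_inv_sqrt hp.half_lt.le x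
  have hc := hp.one_le
  have hj := jap_pos x
  change |bsym ϰ x * lowSym ρ x| ≤ c
  rw [abs_of_pos (by positivity)]
  calc _ ≤ c * jap x * (jap x)⁻¹ := mul_le_mul h1 h4 h3.le (by positivity)
    _ = c := by field_simp

theorem lam_weakQ (hp : Params ϰ c ρ q) (P Q : L2C) :
    mulOp (lam (ρ - 1 / 2)) (weakQ ϰ ρ P Q) =
      -(Complex.I • (mulOp thsym (mulOp (fun x ↦ bsym ϰ x * lowSym ρ x) P) +
        mulOp thsym ((1 / 2 : ℝ) • bil (tri (fun _ ↦ 1) (velSym ρ) (velSym ρ)) Q Q))) := by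
  have hl : BddSymbol (lam (ρ - 1 / 2)) := bddSymbol_lam (by linarith [hp.half_lt])
  have e1 : (fun x ↦ lam (ρ - 1 / 2) x * weakLinQ ϰ x) =
      fun x ↦ thsym x * (bsym ϰ x * lowSym ρ x) := by
    ext x
    have h2 := Real.mul_self_sqrt (jap_pos x).le
    have h3 := (sqrt_jap_pos x).ne'
    have h4 := (jap_pos x).ne'
    rw [lam_sub_half]
    unfold weakLinQ lowSym
    field_simp
    linear_combination lam ρ x * thsym x * bsym ϰ x * h2
  have e2 : (fun x ↦ lam (ρ - 1 / 2) x * weakOutQ ρ x) = fun x ↦ 1 / 2 * (thsym x * 1) := by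
    ext x
    have h3 := (sqrt_jap_pos x).ne'
    have h4 := (lam_pos ρ x).ne'
    rw [lam_sub_half]
    unfold weakOutQ
    field_simp
  have had := admissible_product hp.half_lt (bddSymbol_velSym hp.nonneg) (abs_velSym_le ρ)
    (bddSymbol_velSym hp.nonneg)
  have hhalf : BddSymbol (fun _ ↦ (1 / 2 : ℝ)) := ⟨measurable_const, 1 / 2, by norm_num⟩
  have had' := admissible_tri hp.half_lt (bddSymbol_thsym.mul bddSymbol_one)
    (measurable_velSym ρ) (abs_velSym_le ρ) (bddSymbol_velSym hp.nonneg)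
  have e3 : mulOp thsym ((1 / 2 : ℝ) • bil (tri (fun _ ↦ 1) (velSym ρ) (velSym ρ)) Q Q) =
      mulOp (fun _ ↦ 1 / 2) (mulOp thsym (bil (tri (fun _ ↦ 1) (velSym ρ) (velSym ρ)) Q Q)) := by
    refine Lp.ext ?_
    set X := bil (tri (fun _ ↦ 1) (velSym ρ) (velSym ρ)) Q Q
    filter_upwards [coeFn_mulOp bddSymbol_thsym ((1 / 2 : ℝ) • X), Lp.coeFn_smul (1 / 2 : ℝ) X,
      coeFn_mulOp hhalf (mulOp thsym X), coeFn_mulOp bddSymbol_thsym X] with x h1 h2 h3 h4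
    rw [h1, h2, h3, h4, Pi.smul_apply, Complex.real_smul]
    ring
  rw [e3, weakQ, map_neg, map_smul, map_add, mulOp_mulOp hl (bddSymbol_weakLinQ hp),
    mulOp_mulOp bddSymbol_thsym (bddSymbol_bsym_lowSym hp),
    mulOp_bil_tri (admissible_weakQ hp) hl, e1, e2, mulOp_bil_tri had bddSymbol_thsym,
    mulOp_bil_tri had' hhalf]

/-- The velocity equation on the Fourier side. -/
theorem rhsVelocity_iff (hp : Params ϰ c ρ q) {η v : Lp ℝ 2 (volume : Measure ℝ)} {P Q : L2C}
    (hη : l2hat η = mulOp (etaSym ϰ ρ) P) (hv : l2hat v = mulOp (velSym ρ) Q)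
    (g : Sobolev (ρ - 1 / 2)) :
    toDist 2 (Sobolev.toL2 (ρ - 1 / 2) g) = rhsVelocity ϰ η v ↔
      sobolevHat (ρ - 1 / 2) g = weakQ ϰ ρ P Q := by
  have hσ : 0 ≤ ρ - 1 / 2 := by linarith [hp.half_lt]
  have h1 : 𝓕 (rhsVelocity ϰ η v) = distC 2 (mulOp (lam (ρ - 1 / 2)) (weakQ ϰ ρ P Q)) := by
    rw [lam_weakQ hp]
    refine fourier_rhs (fourier_I_smul (fourier_tanhD (fourier_multD_distC (by fun_prop) ?_
      (fourier_toDist η)))) (fourier_tanhD ?_)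
    · rw [hη]
      filter_upwards [coeFn_mulOp (bddSymbol_bsym_lowSym hp) P,
        coeFn_mulOp (bddSymbol_etaSym hp) P] with ξ h1 h2
      have e : bsym ϰ ξ * lowSym ρ ξ = (1 + ϰ * (2 * Real.pi * ξ) ^ 2) * etaSym ϰ ρ ξ := by
        have h3 := (bsym_pos hp.pos ξ).ne'
        have h4 : bsym ϰ ξ ^ 2 = 1 + ϰ * (2 * Real.pi * ξ) ^ 2 :=
          Real.sq_sqrt (by have := hp.pos; positivity)
        rw [← h4, etaSym]
        field_simp
      rw [h1, h2, e]
      push_cast; ring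
    · have h2 := fourier_product hp.half_lt (bddSymbol_velSym hp.nonneg) (abs_velSym_le ρ)
        (bddSymbol_velSym hp.nonneg) (abs_velSym_le ρ) hv hv
      have h3 : (𝓕 (toDist 1 ((1 / 2 : ℝ) • mulL2 v v)) : 𝓢'(ℝ, ℂ)) =
          (1 / 2 : ℝ) • 𝓕 (toDist 1 (mulL2 v v)) := by
        rw [map_smul]; ext φ; rfl
      rw [h3, h2, map_smul]
  have h2 : 𝓕 (toDist 2 (Sobolev.toL2 (ρ - 1 / 2) g)) =
      distC 2 (mulOp (lam (ρ - 1 / 2)) (sobolevHat (ρ - 1 / 2) g)) := by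
    rw [fourier_toDist, lam_sobolevHat hσ]
  constructor
  · intro h
    rw [h, h1] at h2
    exact (mulOp_injective (bddSymbol_lam hσ) (lam_pos _) (distC_injective 2 h2)).symm
  · intro h
    exact fourier_dist_injective (by rw [h1, h2, h])

end Equations

end WhithamBoussinesq
end

noncomputable section
open MeasureTheory Filter Topology
open scoped SchwartzMap ENNReal FourierTransform

namespace WhithamBoussinesq

/-! ### The correspondence between data and unknowns -/

section Unknowns

variable {ϰ c s : ℝ} {q : ℕ}

/-- The symbol that takes `⟨D⟩^{s+1/2}η` to the unknown `P`. -/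
def dataSymP (ϰ ξ : ℝ) : ℝ := bsym ϰ ξ * (jap ξ)⁻¹

/-- The symbol that takes `⟨D⟩^s v` to the unknown `Q`. -/
def dataSymQ (ξ : ℝ) : ℝ := (√(jap ξ) * msym ξ)⁻¹

theorem abs_dataSymP_le (hϰ : 0 < ϰ) (hc : 1 ≤ c) (h : ϰ ≤ c ^ 2) (x : ℝ) :
    |dataSymP ϰ x| ≤ c := by
  have h1 := bsym_le_jap hc h x
  have h2 := bsym_pos hϰ x
  have h3 := jap_pos x
  rw [dataSymP, abs_of_pos (by positivity), ← div_eq_mul_inv, div_le_iff₀ h3]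
  exact h1

theorem bddSymbol_dataSymP (hϰ : 0 < ϰ) (hc : 1 ≤ c) (h : ϰ ≤ c ^ 2) : BddSymbol (dataSymP ϰ) :=
  ⟨(measurable_bsym ϰ).mul measurable_jap.inv, c, abs_dataSymP_le hϰ hc h⟩

theorem bddSymbol_inv_dataSymP (hϰ : 0 < ϰ) (hc : 1 ≤ c) (h : ϰ ≤ c ^ 2) :
    BddSymbol (fun x ↦ (dataSymP ϰ x)⁻¹) := by
  refine ⟨((measurable_bsym ϰ).mul measurable_jap.inv).inv, c * (√ϰ)⁻¹, fun x ↦ ?_⟩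
  have h1 := sqrt_mul_jap_le_bsym hϰ hc h x
  have h2 := bsym_pos hϰ x
  have h3 := jap_pos x
  have h4 := Real.sqrt_pos.mpr hϰ
  change |(dataSymP ϰ x)⁻¹| ≤ _
  rw [dataSymP, abs_of_pos (by positivity), mul_inv, inv_inv, ← div_eq_inv_mul, ← div_eq_mul_inv,
    div_le_div_iff₀ h2 h4]
  linarith

theorem dataSymQ_pos (x : ℝ) : 0 < dataSymQ x :=
  inv_pos.mpr (mul_pos (sqrt_jap_pos x) (msym_pos x))

theorem abs_dataSymQ_le (x : ℝ) : |dataSymQ x| ≤ 2 := by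
  have h0 : 0 < √(jap x) * msym x := mul_pos (sqrt_jap_pos x) (msym_pos x)
  have h1 := one_le_msym_sq_mul_jap x
  have h2 := Real.sq_sqrt (jap_pos x).le
  rw [abs_of_pos (dataSymQ_pos x), dataSymQ, inv_le_comm₀ h0 two_pos]
  refine le_of_sq_le_sq ?_ h0.le
  rw [mul_pow, h2]
  nlinarith

theorem measurable_dataSymQ : Measurable dataSymQ := (measurable_jap.sqrt.mul measurable_msym).inv

theorem bddSymbol_dataSymQ : BddSymbol dataSymQ := ⟨measurable_dataSymQ, 2, abs_dataSymQ_le⟩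

theorem bddSymbol_inv_dataSymQ : BddSymbol (fun x ↦ (dataSymQ x)⁻¹) := by
  refine ⟨measurable_dataSymQ.inv, 2, fun x ↦ ?_⟩
  change |(dataSymQ x)⁻¹| ≤ 2
  rw [abs_of_pos (inv_pos.mpr (dataSymQ_pos x)), dataSymQ, inv_inv, mul_comm]
  exact msym_mul_sqrt_jap_le x

theorem dataSymP_neg (ϰ x : ℝ) : dataSymP ϰ (-x) = dataSymP ϰ x := by
  rw [dataSymP, dataSymP, bsym_neg, jap_neg]

theorem dataSymQ_neg (x : ℝ) : dataSymQ (-x) = dataSymQ x := by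
  rw [dataSymQ, dataSymQ, msym_neg, jap_neg]

/-- The unknown `P` that belongs to the elevation. -/
def hatP (ϰ s : ℝ) : Sobolev (s + 1 / 2) →L[ℝ] L2C :=
  ((mulOp (dataSymP ϰ)).restrictScalars ℝ) ∘L (sobolevHat (s + 1 / 2)).toContinuousLinearMap

/-- The unknown `Q` that belongs to the velocity. -/
def hatQ (s : ℝ) : Sobolev s →L[ℝ] L2C :=
  ((mulOp dataSymQ).restrictScalars ℝ) ∘L (sobolevHat s).toContinuousLinearMap

theorem hatP_apply (ϰ s : ℝ) (η : Sobolev (s + 1 / 2)) :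
    hatP ϰ s η = mulOp (dataSymP ϰ) (sobolevHat (s + 1 / 2) η) := rfl

theorem hatQ_apply (s : ℝ) (v : Sobolev s) : hatQ s v = mulOp dataSymQ (sobolevHat s v) := rfl

theorem norm_hatP_le (hp : Params ϰ c (s - 1) q) (η : Sobolev (s + 1 / 2)) :
    ‖hatP ϰ s η‖ ≤ c * ‖η‖ := by
  rw [hatP_apply, ← (sobolevHat (s + 1 / 2)).norm_map η]
  exact norm_mulOp_le (bddSymbol_dataSymP hp.pos hp.one_le hp.le_sq)
    (abs_dataSymP_le hp.pos hp.one_le hp.le_sq) _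

theorem norm_hatQ_le (v : Sobolev s) : ‖hatQ s v‖ ≤ 2 * ‖v‖ := by
  rw [hatQ_apply, ← (sobolevHat s).norm_map v]
  exact norm_mulOp_le bddSymbol_dataSymQ abs_dataSymQ_le _

theorem exists_scaled_lift {σ : ℝ} (hσ : 0 ≤ σ) {φ : ℝ → ℝ} (hφ : BddSymbol φ)
    (hψ : BddSymbol (fun x ↦ (φ x)⁻¹)) (h0 : ∀ x, 0 < φ x) (he : ∀ x, φ (-x) = φ x) :
    ∃ L : L2C →L[ℝ] Sobolev σ, (∀ F, reflect F = F → mulOp φ (sobolevHat σ (L F)) = F) ∧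
      ∀ f, L (mulOp φ (sobolevHat σ f)) = f := by
  obtain ⟨L, h1, h2⟩ := exists_sobolev_lift hσ
  refine ⟨L ∘L (mulOp (fun x ↦ (φ x)⁻¹)).restrictScalars ℝ, fun F hF ↦ ?_, fun f ↦ ?_⟩
  · change mulOp φ (sobolevHat σ (L (mulOp (fun x ↦ (φ x)⁻¹) F))) = F
    rw [h1 _ (by rw [reflect_mulOp hψ (fun x ↦ by rw [he]), hF]), mulOp_mulOp hφ hψ]
    simp only [fun x ↦ mul_inv_cancel₀ (h0 x).ne', mulOp_one]
  · change L (mulOp (fun x ↦ (φ x)⁻¹) (mulOp φ (sobolevHat σ f))) = f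
    rw [mulOp_mulOp hψ hφ]
    simp only [fun x ↦ inv_mul_cancel₀ (h0 x).ne', mulOp_one, h2]

theorem exists_lift_hatP (hp : Params ϰ c (s - 1) q) : ∃ L : L2C →L[ℝ] Sobolev (s + 1 / 2),
    (∀ F, reflect F = F → hatP ϰ s (L F) = F) ∧ ∀ η, L (hatP ϰ s η) = η :=
  exists_scaled_lift (by linarith [hp.half_lt]) (bddSymbol_dataSymP hp.pos hp.one_le hp.le_sq)
    (bddSymbol_inv_dataSymP hp.pos hp.one_le hp.le_sq)
    (fun x ↦ mul_pos (bsym_pos hp.pos x) (inv_pos.mpr (jap_pos x))) (dataSymP_neg ϰ)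

theorem exists_lift_hatQ (hs : 0 ≤ s) : ∃ L : L2C →L[ℝ] Sobolev s,
    (∀ F, reflect F = F → hatQ s (L F) = F) ∧ ∀ v, L (hatQ s v) = v :=
  exists_scaled_lift hs bddSymbol_dataSymQ bddSymbol_inv_dataSymQ dataSymQ_pos dataSymQ_neg

theorem reflect_hatP (hp : Params ϰ c (s - 1) q) (η : Sobolev (s + 1 / 2)) :
    reflect (hatP ϰ s η) = hatP ϰ s η := by
  rw [hatP_apply, reflect_mulOp (bddSymbol_dataSymP hp.pos hp.one_le hp.le_sq) (dataSymP_neg ϰ),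
    reflect_sobolevHat (by linarith [hp.half_lt])]

theorem reflect_hatQ (hs : 0 ≤ s) (v : Sobolev s) : reflect (hatQ s v) = hatQ s v := by
  rw [hatQ_apply, reflect_mulOp bddSymbol_dataSymQ dataSymQ_neg, reflect_sobolevHat hs]

theorem lam_one (x : ℝ) : lam 1 x = (jap x)⁻¹ := by rw [lam, Real.rpow_neg_one]

theorem l2hat_elevation (hp : Params ϰ c (s - 1) q) (η : Sobolev (s + 1 / 2)) :
    l2hat (Sobolev.toL2 _ η) = mulOp (etaSym ϰ (s - 1)) (hatP ϰ s η) := by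
  rw [hatP_apply, mulOp_mulOp (bddSymbol_etaSym hp)
    (bddSymbol_dataSymP hp.pos hp.one_le hp.le_sq), ← lam_sobolevHat (by linarith [hp.half_lt])]
  congr 2
  ext x
  have h1 := (bsym_pos hp.pos x).ne'
  rw [show s + 1 / 2 = s - 1 + 1 + 1 / 2 by ring, lam_add, lam_add, lam_one, lam_half]
  unfold etaSym lowSym dataSymP
  field_simp

theorem l2hat_velocity (hp : Params ϰ c (s - 1) q) (v : Sobolev s) :
    l2hat (Sobolev.toL2 _ v) = mulOp (velSym (s - 1)) (hatQ s v) := by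
  rw [hatQ_apply, mulOp_mulOp (bddSymbol_velSym hp.nonneg) bddSymbol_dataSymQ,
    ← lam_sobolevHat (by linarith [hp.half_lt])]
  congr 2
  ext x
  have h1 := (msym_pos x).ne'
  have h2 := (sqrt_jap_pos x).ne'
  have h3 := (jap_pos x).ne'
  have h4 := Real.mul_self_sqrt (jap_pos x).le
  have h5 := lam_add (s - 1) 1 x
  rw [sub_add_cancel, lam_one] at h5
  rw [h5]
  unfold velSym lowSym dataSymQ
  field_simp
  linear_combination lam (s - 1) x * h4

theorem l2hat_injective {f g : Lp ℝ 2 (volume : Measure ℝ)} (h : l2hat f = l2hat g) : f = g :=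
  toDist_injective 2 (fourier_dist_injective (by rw [fourier_toDist, fourier_toDist, h]))

theorem toL2_eq_iff {σ : ℝ} (hσ : 0 ≤ σ) {φ ψ : ℝ → ℝ} (hφ : BddSymbol φ) {P : L2C}
    {f : Lp ℝ 2 (volume : Measure ℝ)} (hf : l2hat f = mulOp ψ P)
    (hψ : ∀ x, ψ x = lam σ x * φ x) (g : Sobolev σ) :
    Sobolev.toL2 σ g = f ↔ sobolevHat σ g = mulOp φ P := by
  have h : l2hat f = mulOp (lam σ) (mulOp φ P) := by
    rw [hf, mulOp_mulOp (bddSymbol_lam hσ) hφ]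
    congr 2
    exact funext hψ
  constructor
  · intro e
    refine mulOp_injective (bddSymbol_lam hσ) (lam_pos σ) ?_
    rw [lam_sobolevHat hσ, e, h]
  · intro e
    refine l2hat_injective ?_
    rw [← lam_sobolevHat hσ, e, h]

theorem toL2_eq_elevation_iff (hp : Params ϰ c (s - 1) q) (η : Sobolev (s + 1 / 2))
    (g : Sobolev (s - 1)) : Sobolev.toL2 _ g = Sobolev.toL2 _ η ↔
      sobolevHat (s - 1) g = mulOp (weakSymP ϰ) (hatP ϰ s η) :=
  toL2_eq_iff hp.nonneg (bddSymbol_weakSymP hp.pos) (l2hat_elevation hp η)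
    (fun x ↦ by unfold etaSym lowSym weakSymP; ring) g

theorem toL2_eq_velocity_iff (hp : Params ϰ c (s - 1) q) (v : Sobolev s)
    (g : Sobolev (s - 3 / 2)) : Sobolev.toL2 _ g = Sobolev.toL2 _ v ↔
      sobolevHat (s - 3 / 2) g = mulOp weakSymQ (hatQ s v) := by
  refine toL2_eq_iff (by linarith [hp.half_lt]) bddSymbol_weakSymQ (l2hat_velocity hp v)
    (fun x ↦ ?_) g
  have h2 := (sqrt_jap_pos x).ne'
  have h3 := (jap_pos x).ne'
  have h4 := Real.mul_self_sqrt (jap_pos x).le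
  rw [show s - 3 / 2 = s - 1 - 1 / 2 by ring, lam_sub_half]
  unfold velSym lowSym weakSymQ
  field_simp
  linear_combination -(msym x * lam (s - 1) x) * h4

/-- The orders s - 3/2 and (s - 1) - 1/2 are equal but not by definition, so the index of the
Sobolev space is kept as a variable. -/
theorem rhsVelocity_iff_of_eq {ρ σ : ℝ} (hσ : σ = ρ - 1 / 2) (hp : Params ϰ c ρ q)
    {η v : Lp ℝ 2 (volume : Measure ℝ)} {P Q : L2C}
    (hη : l2hat η = mulOp (etaSym ϰ ρ) P) (hv : l2hat v = mulOp (velSym ρ) Q) (g : Sobolev σ) :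
    toDist 2 (Sobolev.toL2 σ g) = rhsVelocity ϰ η v ↔ sobolevHat σ g = weakQ ϰ ρ P Q := by
  subst hσ
  exact rhsVelocity_iff hp hη hv g

theorem reflect_weakP {ρ : ℝ} (hp : Params ϰ c ρ q) {P Q : L2C} (hP : reflect P = P)
    (hQ : reflect Q = Q) : reflect (weakP ϰ ρ P Q) = weakP ϰ ρ P Q := by
  refine reflect_neg_I_smul ?_
  rw [map_add, reflect_mulOp_odd bddSymbol_weakLinP (fun x ↦ ?_),
    reflect_bil_odd (admissible_weakP hp)
      (tri_odd (fun x ↦ ?_) (etaSym_neg ϰ ρ) (velSym_neg ρ)), hP, hQ]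
  · abel
  · simp only [weakOutP, thsym_neg, lam_neg]; ring
  · simp only [weakLinP, freq_neg, jap_neg, msym_neg]; ring

theorem reflect_weakQ {ρ : ℝ} (hp : Params ϰ c ρ q) {P Q : L2C} (hP : reflect P = P)
    (hQ : reflect Q = Q) : reflect (weakQ ϰ ρ P Q) = weakQ ϰ ρ P Q := by
  refine reflect_neg_I_smul ?_
  rw [map_add, reflect_mulOp_odd (bddSymbol_weakLinQ hp) (fun x ↦ ?_),
    reflect_bil_odd (admissible_weakQ hp)
      (tri_odd (fun x ↦ ?_) (velSym_neg ρ) (velSym_neg ρ)), hP, hQ]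
  · abel
  · simp only [weakOutQ, thsym_neg, lam_neg, jap_neg]; ring
  · simp only [weakLinQ, thsym_neg, jap_neg, bsym_neg]; ring

end Unknowns

/-! ### Translation of solutions to and from the Fourier side -/

section Solutions

variable {ϰ c s : ℝ} {q : ℕ}

theorem IsSolution.isFourierSol (hp : Params ϰ c (s - 1) q) {T : ℝ} {u₀ : Data s}
    {u : ℝ → Data s} (h : IsSolution ϰ s T u₀ u) :
    IsFourierSol ϰ (s - 1) T (fun t ↦ hatP ϰ s (u t).1) (fun t ↦ hatQ s (u t).2) := by
  have hs : 0 ≤ s := by linarith [hp.half_lt]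
  obtain ⟨w, hw, he⟩ := h.equations
  have hd : ∀ t ∈ Set.Ioo 0 T, HasDerivAt w (deriv w t) t := fun t ht ↦
    ((hw.differentiableOn one_ne_zero).differentiableAt (isOpen_Ioo.mem_nhds ht)).hasDerivAt
  refine ⟨(hatP ϰ s).continuous.comp_continuousOn (continuous_fst.comp_continuousOn h.continuousOn),
    (hatQ s).continuous.comp_continuousOn (continuous_snd.comp_continuousOn h.continuousOn),
    fun t ht ↦ ?_, fun t ht ↦ ?_, fun t _ ↦ reflect_hatP hp _, fun t _ ↦ reflect_hatQ hs _⟩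
  · have h1 := (sobolevHat (s - 1)).toContinuousLinearMap.hasFDerivAt.comp_hasDerivAt t
      (hasFDerivAt_fst.comp_hasDerivAt t (hd t ht))
    have h2 := (rhsElevation_iff hp (l2hat_elevation hp (u t).1) (l2hat_velocity hp (u t).2)
      (deriv w t).1).mp (he t ht).2.2.1
    rw [← h2]
    refine h1.congr_of_eventuallyEq ?_
    filter_upwards [isOpen_Ioo.mem_nhds ht] with r hr
    exact ((toL2_eq_elevation_iff hp (u r).1 (w r).1).mp (he r hr).1).symm
  · have h1 := (sobolevHat (s - 3 / 2)).toContinuousLinearMap.hasFDerivAt.comp_hasDerivAt t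
      (hasFDerivAt_snd.comp_hasDerivAt t (hd t ht))
    have h2 := (rhsVelocity_iff_of_eq (by ring) hp (l2hat_elevation hp (u t).1)
      (l2hat_velocity hp (u t).2) (deriv w t).2).mp (he t ht).2.2.2
    rw [← h2]
    refine h1.congr_of_eventuallyEq ?_
    filter_upwards [isOpen_Ioo.mem_nhds ht] with r hr
    exact ((toL2_eq_velocity_iff hp (u r).2 (w r).2).mp (he r hr).2.1).symm

theorem IsFourierSol.isSolution (hp : Params ϰ c (s - 1) q) {T : ℝ} {u : ℝ → Data s}
    (h : IsFourierSol ϰ (s - 1) T (fun t ↦ hatP ϰ s (u t).1) (fun t ↦ hatQ s (u t).2)) :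
    IsSolution ϰ s T (u 0) u := by
  have hs : 0 ≤ s := by linarith [hp.half_lt]
  have hs' : 0 ≤ s - 3 / 2 := by linarith [hp.half_lt]
  obtain ⟨L₁, -, e₁⟩ := exists_lift_hatP hp
  obtain ⟨L₂, -, e₂⟩ := exists_lift_hatQ hs
  obtain ⟨L₃, e₃, -⟩ := exists_sobolev_lift hp.nonneg
  obtain ⟨L₄, e₄, -⟩ := exists_sobolev_lift hs'
  set P : ℝ → L2C := fun t ↦ hatP ϰ s (u t).1 with hPdef
  set Q : ℝ → L2C := fun t ↦ hatQ s (u t).2 with hQdef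
  have hcont : ContinuousOn (fun t ↦ (P t, Q t)) (Set.Icc 0 T) := h.contP.prodMk h.contQ
  have hder : ∀ t ∈ Set.Ioo 0 T,
      HasDerivAt (fun t ↦ (L₃ (mulOp (weakSymP ϰ) (P t)), L₄ (mulOp weakSymQ (Q t))))
        (L₃ (weakP ϰ (s - 1) (P t) (Q t)), L₄ (weakQ ϰ (s - 1) (P t) (Q t))) t := fun t ht ↦
    (L₃.hasFDerivAt.comp_hasDerivAt t (h.derivP t ht)).prodMk
      (L₄.hasFDerivAt.comp_hasDerivAt t (h.derivQ t ht))
  have hIoo : Set.Ioo 0 T ⊆ Set.Icc 0 T := Set.Ioo_subset_Icc_self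
  refine ⟨?_, rfl, fun t ↦ (L₃ (mulOp (weakSymP ϰ) (P t)), L₄ (mulOp weakSymQ (Q t))), ?_,
    fun t ht ↦ ⟨?_, ?_, ?_, ?_⟩⟩
  · have := (L₁.continuous.comp_continuousOn h.contP).prodMk (L₂.continuous.comp_continuousOn h.contQ)
    refine this.congr fun t _ ↦ ?_
    exact Prod.ext (e₁ _).symm (e₂ _).symm
  -- The derivative is the weak field evaluated along (P, Q), and this field is continuous on L² ×
  -- L²; this gives the class C¹.
  · rw [contDiffOn_one_iff_derivWithin isOpen_Ioo.uniqueDiffOn]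
    refine ⟨fun t ht ↦ (hder t ht).differentiableAt.differentiableWithinAt, ?_⟩
    have h3 := L₃.continuous.comp (lipOnBalls_weakP ϰ (s - 1)).continuous
    have h4 := L₄.continuous.comp (lipOnBalls_weakQ ϰ (s - 1)).continuous
    refine ((h3.prodMk h4).comp_continuousOn (hcont.mono hIoo)).congr fun t ht ↦ ?_
    rw [derivWithin_of_isOpen isOpen_Ioo ht, (hder t ht).deriv]
    rfl
  · refine (toL2_eq_elevation_iff hp _ _).mpr (e₃ _ ?_)
    rw [reflect_mulOp (bddSymbol_weakSymP hp.pos) (fun x ↦ by simp [weakSymP, jap_neg, bsym_neg]),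
      h.realP t (hIoo ht)]
  · refine (toL2_eq_velocity_iff hp _ _).mpr (e₄ _ ?_)
    rw [reflect_mulOp bddSymbol_weakSymQ (fun x ↦ by simp [weakSymQ, jap_neg, msym_neg]),
      h.realQ t (hIoo ht)]
  · rw [(hder t ht).deriv]
    refine (rhsElevation_iff hp (l2hat_elevation hp (u t).1) (l2hat_velocity hp (u t).2) _).mpr ?_
    exact e₃ _ (reflect_weakP hp (h.realP t (hIoo ht)) (h.realQ t (hIoo ht)))
  · rw [(hder t ht).deriv]
    refine (rhsVelocity_iff_of_eq (by ring) hp (l2hat_elevation hp (u t).1)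
      (l2hat_velocity hp (u t).2) _).mpr ?_
    exact e₄ _ (reflect_weakQ hp (h.realP t (hIoo ht)) (h.realQ t (hIoo ht)))

theorem IsFourierSol.congr {ρ T : ℝ} {P Q P' Q' : ℝ → L2C} (h : IsFourierSol ϰ ρ T P Q)
    (hP : Set.EqOn P' P (Set.Icc 0 T)) (hQ : Set.EqOn Q' Q (Set.Icc 0 T)) :
    IsFourierSol ϰ ρ T P' Q' := by
  have hIoo : Set.Ioo 0 T ⊆ Set.Icc 0 T := Set.Ioo_subset_Icc_self
  refine ⟨h.contP.congr hP, h.contQ.congr hQ, fun t ht ↦ ?_, fun t ht ↦ ?_,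
    fun t ht ↦ by rw [hP ht, h.realP t ht], fun t ht ↦ by rw [hQ ht, h.realQ t ht]⟩
  · rw [hP (hIoo ht), hQ (hIoo ht)]
    refine (h.derivP t ht).congr_of_eventuallyEq ?_
    filter_upwards [isOpen_Ioo.mem_nhds ht] with r hr
    rw [hP (hIoo hr)]
  · rw [hP (hIoo ht), hQ (hIoo ht)]
    refine (h.derivQ t ht).congr_of_eventuallyEq ?_
    filter_upwards [isOpen_Ioo.mem_nhds ht] with r hr
    rw [hQ (hIoo hr)]

theorem IsSolution.eqOn (hp : Params ϰ c (s - 1) q) {T τ : ℝ} (hτ : τ ≤ T) {u₀ : Data s}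
    {u w : ℝ → Data s} (hu : IsSolution ϰ s T u₀ u) (hw : IsSolution ϰ s τ u₀ w) :
    Set.EqOn w u (Set.Icc 0 τ) := by
  have hs : 0 ≤ s := by linarith [hp.half_lt]
  obtain ⟨L₁, -, e₁⟩ := exists_lift_hatP hp
  obtain ⟨L₂, -, e₂⟩ := exists_lift_hatQ hs
  have h1 := hu.isFourierSol hp
  have h2 : IsFourierSol ϰ (s - 1) τ (fun t ↦ hatP ϰ s (u t).1) (fun t ↦ hatQ s (u t).2) :=
    ⟨h1.contP.mono (Set.Icc_subset_Icc_right hτ), h1.contQ.mono (Set.Icc_subset_Icc_right hτ),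
      fun t ht ↦ h1.derivP t ⟨ht.1, ht.2.trans_le hτ⟩,
      fun t ht ↦ h1.derivQ t ⟨ht.1, ht.2.trans_le hτ⟩,
      fun t ht ↦ h1.realP t ⟨ht.1, ht.2.trans hτ⟩, fun t ht ↦ h1.realQ t ⟨ht.1, ht.2.trans hτ⟩⟩
  intro t ht
  obtain ⟨hP, hQ⟩ := (hw.isFourierSol hp).unique hp h2 (by simp only [hw.initial, hu.initial])
    (by simp only [hw.initial, hu.initial]) t ht
  refine Prod.ext ?_ ?_
  · rw [← e₁ (w t).1, ← e₁ (u t).1]; exact congrArg L₁ hP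
  · rw [← e₂ (w t).2, ← e₂ (u t).2]; exact congrArg L₂ hQ

theorem exists_isSolution (hp : Params ϰ c (s - 1) q) {B T : ℝ} (hB : 0 < B) (hT : 0 ≤ T)
    (u₀ : Data s) (h0 : Real.exp (growth c (s - 1) q B * T) * ((1 + 2 * symConst (s - 1) B) *
      (‖hatP ϰ s u₀.1‖ ^ 2 + ‖hatQ s u₀.2‖ ^ 2)) < B ^ 2) :
    ∃ u : ℝ → Data s, IsUniqueSolution ϰ s T u₀ u ∧
      BoundedBy T B (fun t ↦ hatP ϰ s (u t).1) (fun t ↦ hatQ s (u t).2) ∧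
      TailBound T (Real.exp (growth c (s - 1) q B * T) * (1 + 2 * symConst (s - 1) B))
        (fun t ↦ hatP ϰ s (u t).1) (fun t ↦ hatQ s (u t).2) := by
  have hs : 0 ≤ s := by linarith [hp.half_lt]
  obtain ⟨L₁, f₁, e₁⟩ := exists_lift_hatP hp
  obtain ⟨L₂, f₂, e₂⟩ := exists_lift_hatQ hs
  obtain ⟨P, Q, hP0, hQ0, hsol, hbd, htail⟩ := exists_isFourierSol hp hB hT
    (reflect_hatP hp u₀.1) (reflect_hatQ hs u₀.2) h0
  have hP : Set.EqOn (fun t ↦ hatP ϰ s (L₁ (P t))) P (Set.Icc 0 T) := fun t ht ↦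
    f₁ _ (hsol.realP t ht)
  have hQ : Set.EqOn (fun t ↦ hatQ s (L₂ (Q t))) Q (Set.Icc 0 T) := fun t ht ↦
    f₂ _ (hsol.realQ t ht)
  have h00 : (0 : ℝ) ∈ Set.Icc 0 T := ⟨le_rfl, hT⟩
  have hi : (L₁ (P 0), L₂ (Q 0)) = u₀ := Prod.ext (by rw [hP0]; exact e₁ _) (by rw [hQ0]; exact e₂ _)
  have hu : IsSolution ϰ s T u₀ (fun t ↦ (L₁ (P t), L₂ (Q t))) := by
    have := IsFourierSol.isSolution hp (u := fun t ↦ (L₁ (P t), L₂ (Q t))) (hsol.congr hP hQ)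
    rwa [hi] at this
  refine ⟨fun t ↦ (L₁ (P t), L₂ (Q t)), ⟨hu, fun τ _ hτ w hw ↦ hu.eqOn hp hτ hw⟩, fun t ht ↦ ?_,
    fun N hN t ht ↦ ?_⟩
  · have h1 := hP ht
    have h2 := hQ ht
    simp only at h1 h2 ⊢
    rw [h1, h2]
    exact hbd t ht
  · have h1 := hP ht
    have h2 := hQ ht
    have h3 := hP h00
    have h4 := hQ h00
    simp only at h1 h2 h3 h4 ⊢
    rw [h1, h2, h3, h4]
    exact htail N hN t ht

end Solutions

end WhithamBoussinesq
end

noncomputable section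
open MeasureTheory Filter Topology
open scoped SchwartzMap ENNReal FourierTransform

namespace WhithamBoussinesq

/-! ### The time of existence and continuous dependence -/

section Lifespan

theorem norm_fst_le_dataNorm {s : ℝ} (u : Data s) : ‖u.1‖ ≤ dataNorm u :=
  Real.le_sqrt_of_sq_le (le_add_of_nonneg_right (sq_nonneg _))

theorem norm_snd_le_dataNorm {s : ℝ} (u : Data s) : ‖u.2‖ ≤ dataNorm u :=
  Real.le_sqrt_of_sq_le (le_add_of_nonneg_left (sq_nonneg _))

theorem dataNorm_le_add {s : ℝ} (u : Data s) : dataNorm u ≤ ‖u.1‖ + ‖u.2‖ := by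
  refine Real.sqrt_le_iff.mpr ⟨by positivity, ?_⟩
  nlinarith [norm_nonneg u.1, norm_nonneg u.2]

/-- The bound for the squared norm of the unknowns that belong to data of size `R + 1`. -/
def initialBound (ϰ R : ℝ) : ℝ := (ϰ + 3) ^ 2 * (R + 1) ^ 2

/-- The radius of the ball in which the solutions stay. -/
def radius (ρ ϰ R : ℝ) : ℝ := 1 + 3 * (1 + 4 * weightNorm (lam ρ)) * initialBound ϰ R

/-- The time of existence. -/
def lifespan (ρ : ℝ) (q : ℕ) (ϰ R : ℝ) : ℝ := (growth (1 + ϰ) ρ q (radius ρ ϰ R))⁻¹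

theorem one_le_radius (ρ ϰ R : ℝ) : 1 ≤ radius ρ ϰ R := by
  have := weightNorm_nonneg (lam ρ)
  unfold radius initialBound
  linarith [show 0 ≤ 3 * (1 + 4 * weightNorm (lam ρ)) * ((ϰ + 3) ^ 2 * (R + 1) ^ 2) by positivity]

theorem radius_mono (ρ : ℝ) {ϰ₁ ϰ₂ R₁ R₂ : ℝ} (h₀ : 0 ≤ ϰ₁) (h : ϰ₁ ≤ ϰ₂) (hR₀ : 0 ≤ R₁)
    (hR : R₁ ≤ R₂) : radius ρ ϰ₁ R₁ ≤ radius ρ ϰ₂ R₂ := by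
  have := weightNorm_nonneg (lam ρ)
  unfold radius initialBound
  gcongr

theorem growth_mono (ρ : ℝ) (q : ℕ) {c₁ c₂ B₁ B₂ : ℝ} (h₀ : 0 ≤ c₁) (h : c₁ ≤ c₂) (hB₀ : 0 ≤ B₁)
    (hB : B₁ ≤ B₂) : growth c₁ ρ q B₁ ≤ growth c₂ ρ q B₂ := by
  have hw := weightNorm_nonneg (lam ρ)
  have h1 : symConst ρ B₁ ≤ symConst ρ B₂ := by unfold symConst; gcongr
  have h2 : lowerRate c₁ ρ q B₁ ≤ lowerRate c₂ ρ q B₂ := by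
    have hc₂ := h₀.trans h
    have hB₂ := hB₀.trans hB
    unfold lowerRate; gcongr
  have h3 := symConst_nonneg ρ (hB₀.trans hB)
  have h4 := lowerRate_nonneg h₀ ρ q hB₀
  unfold growth
  gcongr

theorem lifespan_pos (ρ : ℝ) (q : ℕ) {ϰ : ℝ} (h : 0 < ϰ) (R : ℝ) : 0 < lifespan ρ q ϰ R :=
  inv_pos.mpr (growth_pos (by linarith) ρ q (zero_le_one.trans (one_le_radius ρ ϰ R)))

theorem lifespan_anti (ρ : ℝ) (q : ℕ) {ϰ₁ ϰ₂ R₁ R₂ : ℝ} (h₀ : 0 < ϰ₁) (h : ϰ₁ ≤ ϰ₂) (hR₀ : 0 ≤ R₁)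
    (hR : R₁ ≤ R₂) : lifespan ρ q ϰ₂ R₂ ≤ lifespan ρ q ϰ₁ R₁ := by
  have hB := zero_le_one.trans (one_le_radius ρ ϰ₁ R₁)
  exact inv_anti₀ (growth_pos (by linarith) ρ q hB)
    (growth_mono ρ q (by linarith) (by linarith) hB (radius_mono ρ h₀.le h hR₀ hR))

variable {ϰ s : ℝ} {q : ℕ}

/-- On the lifespan the exponential is e ≤ 3, and with W the weight norm 1 + 4WB ≤ (1 + 4W)B as B ≥
1. Hence the left side is at most 3(1 + 4W)B times the bound for the data, which by the choice of B
is (B - 1)B. The constant (ϰ + 3)² dominates (1 + ϰ)² + 2², from the norms of the maps to P and Q.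
-/
theorem energy_lt_radius_sq (hp : Params ϰ (1 + ϰ) (s - 1) q) {R : ℝ} (hR : 0 ≤ R) (u : Data s)
    (h1 : ‖u.1‖ ≤ R + 1) (h2 : ‖u.2‖ ≤ R + 1) :
    Real.exp (growth (1 + ϰ) (s - 1) q (radius (s - 1) ϰ R) * lifespan (s - 1) q ϰ R) *
      ((1 + 2 * symConst (s - 1) (radius (s - 1) ϰ R)) *
        (‖hatP ϰ s u.1‖ ^ 2 + ‖hatQ s u.2‖ ^ 2)) < radius (s - 1) ϰ R ^ 2 := by
  have hϰ := hp.pos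
  have hB := one_le_radius (s - 1) ϰ R
  have hBdef : radius (s - 1) ϰ R =
    1 + 3 * (1 + 4 * weightNorm (lam (s - 1))) * initialBound ϰ R := rfl
  have hw := weightNorm_nonneg (lam (s - 1))
  set B := radius (s - 1) ϰ R
  set W := weightNorm (lam (s - 1))
  have hg : growth (1 + ϰ) (s - 1) q B * lifespan (s - 1) q ϰ R = 1 :=
    mul_inv_cancel₀ (growth_pos (by linarith) (s - 1) q (zero_le_one.trans hB)).ne'
  have hN : ‖hatP ϰ s u.1‖ ^ 2 + ‖hatQ s u.2‖ ^ 2 ≤ initialBound ϰ R := by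
    have hP : ‖hatP ϰ s u.1‖ ≤ (1 + ϰ) * (R + 1) := (norm_hatP_le hp u.1).trans (by gcongr)
    have hQ : ‖hatQ s u.2‖ ≤ 2 * (R + 1) := (norm_hatQ_le u.2).trans (by gcongr)
    calc _ ≤ ((1 + ϰ) * (R + 1)) ^ 2 + (2 * (R + 1)) ^ 2 := by gcongr
      _ ≤ initialBound ϰ R := by
        unfold initialBound
        nlinarith [show 0 ≤ (1 + ϰ) * (R + 1) ^ 2 by positivity]
  have he : Real.exp 1 ≤ 3 := by linarith [Real.exp_one_lt_d9]
  have hS : 1 + 2 * symConst (s - 1) B ≤ (1 + 4 * W) * B := by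
    change 1 + 2 * (2 * W * B) ≤ _
    linarith
  have hS0 := symConst_nonneg (s - 1) (zero_le_one.trans hB)
  rw [hg]
  calc _ ≤ 3 * (((1 + 4 * W) * B) * initialBound ϰ R) := by gcongr
    _ = (B - 1) * B := by rw [hBdef]; ring
    _ < B ^ 2 := by nlinarith

/-- The constant comes from inverting b⟨k⟩⁻¹ and may blow up as ϰ → 0. It serves only the
qualitative continuous dependence and does not enter the lifespan. -/
theorem exists_dataNorm_sub_le (hp : Params ϰ (1 + ϰ) (s - 1) q) : ∃ C : ℝ, 0 < C ∧
    ∀ u v : Data s, dataNorm (u - v) ≤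
      C * (‖hatP ϰ s u.1 - hatP ϰ s v.1‖ + ‖hatQ s u.2 - hatQ s v.2‖) := by
  obtain ⟨L₁, -, e₁⟩ := exists_lift_hatP hp
  obtain ⟨L₂, -, e₂⟩ := exists_lift_hatQ (s := s) (by linarith [hp.half_lt])
  refine ⟨‖L₁‖ + ‖L₂‖ + 1, by positivity, fun u v ↦ (dataNorm_le_add _).trans ?_⟩
  have h1 : ‖(u - v).1‖ ≤ ‖L₁‖ * ‖hatP ϰ s u.1 - hatP ϰ s v.1‖ := by
    have := L₁.le_opNorm (hatP ϰ s (u - v).1)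
    rwa [e₁, Prod.fst_sub, map_sub] at this
  have h2 : ‖(u - v).2‖ ≤ ‖L₂‖ * ‖hatQ s u.2 - hatQ s v.2‖ := by
    have := L₂.le_opNorm (hatQ s (u - v).2)
    rwa [e₂, Prod.snd_sub, map_sub] at this
  nlinarith [norm_nonneg (hatP ϰ s u.1 - hatP ϰ s v.1), norm_nonneg (hatQ s u.2 - hatQ s v.2),
    norm_nonneg L₁, norm_nonneg L₂,
    mul_nonneg (norm_nonneg L₁) (norm_nonneg (hatQ s u.2 - hatQ s v.2)),
    mul_nonneg (norm_nonneg L₂) (norm_nonneg (hatP ϰ s u.1 - hatP ϰ s v.1))]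

/-- Existence, uniqueness and continuous dependence on the data, on the lifespan. -/
theorem wellPosed (hp : Params ϰ (1 + ϰ) (s - 1) q) (u₀ : Data s) :
    ∃ u : ℝ → Data s, IsUniqueSolution ϰ s (lifespan (s - 1) q ϰ (dataNorm u₀)) u₀ u ∧
      ∀ ε : ℝ, 0 < ε → ∃ δ : ℝ, 0 < δ ∧ ∀ u₀' : Data s, dataNorm (u₀' - u₀) < δ →
        ∃ u' : ℝ → Data s, IsUniqueSolution ϰ s (lifespan (s - 1) q ϰ (dataNorm u₀)) u₀' u' ∧
          ∀ t ∈ Set.Icc 0 (lifespan (s - 1) q ϰ (dataNorm u₀)), dataNorm (u' t - u t) ≤ ε := by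
  set R := dataNorm u₀ with hRdef
  have hR : 0 ≤ R := Real.sqrt_nonneg _
  have hB := zero_lt_one.trans_le (one_le_radius (s - 1) ϰ R)
  have hT := (lifespan_pos (s - 1) q hp.pos R).le
  have hex := fun (u : Data s) (h1 : ‖u.1‖ ≤ R + 1) (h2 : ‖u.2‖ ≤ R + 1) ↦
    exists_isSolution hp hB hT u (energy_lt_radius_sq hp hR u h1 h2)
  have hn1 := norm_fst_le_dataNorm u₀
  have hn2 := norm_snd_le_dataNorm u₀
  obtain ⟨u, hu, hub, hut⟩ := hex u₀ (by linarith) (by linarith)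
  refine ⟨u, hu, fun ε hε ↦ ?_⟩
  set T := lifespan (s - 1) q ϰ R
  set B := radius (s - 1) ϰ R
  set K := Real.exp (growth (1 + ϰ) (s - 1) q B * T) * (1 + 2 * symConst (s - 1) B)
  have hK : 0 ≤ K := by have := symConst_nonneg (s - 1) hB.le; positivity
  obtain ⟨C, hC, hCle⟩ := exists_dataNorm_sub_le hp
  have hε' : 0 < ε / (2 * C) := by positivity
  obtain ⟨δ, hδ, n, -, key⟩ := exists_close hp (T := T) hB.le hK (hatP ϰ s u₀.1) (hatQ s u₀.2) hε'
  have hϰ := hp.pos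
  -- A distance below 1 keeps the perturbed data below size R + 1, so the same T and B serve; ϰ + 3
  -- exceeds both factors 1 + ϰ and 2 by which distances grow in passing to P and Q.
  refine ⟨min 1 (δ / (ϰ + 3)), by positivity, fun u₀' h' ↦ ?_⟩
  have hd1 := norm_fst_le_dataNorm (u₀' - u₀)
  have hd2 := norm_snd_le_dataNorm (u₀' - u₀)
  have hle1 := h'.trans_le (min_le_left _ _)
  have hle2 := h'.trans_le (min_le_right _ _)
  rw [lt_div_iff₀ (by linarith)] at hle2
  rw [Prod.fst_sub] at hd1
  rw [Prod.snd_sub] at hd2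
  have hn0 : 0 ≤ dataNorm (u₀' - u₀) := Real.sqrt_nonneg _
  obtain ⟨u', hu', hub', hut'⟩ := hex u₀'
    (by linarith [norm_le_norm_add_norm_sub' u₀'.1 u₀.1])
    (by linarith [norm_le_norm_add_norm_sub' u₀'.2 u₀.2])
  have hP : ‖hatP ϰ s u₀'.1 - hatP ϰ s u₀.1‖ < δ := by
    rw [← map_sub]
    refine (norm_hatP_le hp _).trans_lt ?_
    nlinarith
  have hQ : ‖hatQ s u₀'.2 - hatQ s u₀.2‖ < δ := by
    rw [← map_sub]
    refine (norm_hatQ_le _).trans_lt ?_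
    nlinarith
  refine ⟨u', hu', fun t ht ↦ ?_⟩
  have hf := hu.1.isFourierSol hp
  have hf' := hu'.1.isFourierSol hp
  obtain ⟨k1, k2⟩ := key n le_rfl _ _ _ _ (hf'.isTruncSol hp n) (hf.isTruncSol hp n) hf'.realP
    hub' hub hut' hut (by simpa only [hu'.1.initial] using hP)
    (by simpa only [hu'.1.initial] using hQ) (by simpa only [hu.1.initial, sub_self, norm_zero] using hδ)
    (by simpa only [hu.1.initial, sub_self, norm_zero] using hδ) t ht
  calc dataNorm (u' t - u t) ≤ C * (ε / (2 * C) + ε / (2 * C)) :=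
        (hCle _ _).trans (by gcongr)
    _ = ε := by field_simp; ring

end Lifespan

end WhithamBoussinesq
end

open WhithamBoussinesq

theorem mainTheorem2 (s : ℝ) (hs : 3 / 2 < s) :
    ∃ T : ℝ → ℝ → ℝ,
      (∀ ϰ R : ℝ, 0 < ϰ → 0 ≤ R → 0 < T ϰ R) ∧
      (∀ ϰ₁ ϰ₂ R₁ R₂ : ℝ, 0 < ϰ₁ → ϰ₁ ≤ ϰ₂ → 0 ≤ R₁ → R₁ ≤ R₂ → T ϰ₂ R₂ ≤ T ϰ₁ R₁) ∧
      ∀ ϰ : ℝ, 0 < ϰ → ∀ u₀ : Data s, NonCavitation u₀.1 →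
        ∃ u : ℝ → Data s, IsUniqueSolution ϰ s (T ϰ (dataNorm u₀)) u₀ u ∧
          ∀ ε : ℝ, 0 < ε → ∃ δ : ℝ, 0 < δ ∧
            ∀ u₀' : Data s, NonCavitation u₀'.1 → dataNorm (u₀' - u₀) < δ →
              ∃ u' : ℝ → Data s, IsUniqueSolution ϰ s (T ϰ (dataNorm u₀)) u₀' u' ∧
                ∀ t ∈ Set.Icc 0 (T ϰ (dataNorm u₀)), dataNorm (u' t - u t) ≤ ε := by
  -- The exponent q = ⌈s + 1⌉ satisfies q ≥ ρ + 2, and c = 1 + ϰ satisfies c ≥ 1 and ϰ ≤ c² while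
  -- increasing with ϰ, as monotonicity of the lifespan requires.
  refine ⟨lifespan (s - 1) ⌈s + 1⌉₊, fun ϰ R h _ ↦ lifespan_pos _ _ h R,
    fun _ _ _ _ h h' hR hR' ↦ lifespan_anti _ _ h h' hR hR', fun ϰ hϰ u₀ _ ↦ ?_⟩
  have hq := Nat.le_ceil (s + 1)
  have hp : Params ϰ (1 + ϰ) (s - 1) ⌈s + 1⌉₊ :=
    ⟨hϰ, by linarith, by nlinarith, by linarith, by linarith⟩
  obtain ⟨u, hu, hdep⟩ := wellPosed hp u₀
  refine ⟨u, hu, fun ε hε ↦ ?_⟩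
  obtain ⟨δ, hδ, h⟩ := hdep ε hε
  exact ⟨δ, hδ, fun u₀' _ h' ↦ h u₀' h'⟩
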